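/- **Theorem 4.4.** *Geometry.* Let $(\gamma)$ be a curve of length $L$, parametrized by arc length $\mu\mapsto(L_1(\mu),L_2(\mu))$, $0\le\mu\le L$, which runs from $P_0=(a,0)$ to $P_{N+1}=(0,b)$ through the open first quadrant, with $L_1$ non-increasing and $L_2$ non-decreasing. Let $0=\mu_0<\dots<\mu_{N+1}=L$ be the parameters of its vertices $P_0,\dots,P_{N+1}$, $P_r=(s_r,t_r)$. Each closed arc $P_jP_{j+1}$ is $C^2$ and is either flat (a segment parallel to a coordinate axis) or oblique (no tangent at a point of the open arc is parallel to an axis). Let $G$ be the closed domain bounded by the axes and $(\gamma)$, $G_R$ the set of points of $G$ on none of the lines $s=s_r$, $t=t_r$, and $(n_1,n_2)=(L_2',-L_1')$ the outward unit normal. The components of $\operatorname{int}G\cap G_R$ are called cells: they are the interiors of the curvilinear triangles under the oblique arcs, and open rectangles. *Data.* Let $f(s,t,x,p,q,u)\in\mathbb R^n$ and $\Phi(s,t,x,p,q,u)\in\mathbb R$ be $C^2$, $u$ (values in $\mathbb R^m$) be $C^1$ and $x$ (values in $\mathbb R^n$) be $C^2$ for $(s,t)$ in a neighbourhood of $G$,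 with $x_{st}=f(s,t,x,x_s,x_t,u)$ on $\operatorname{int}G\cup(\gamma)$ and $x(s,0)=x_1(s)$, $x(0,t)=x_2(t)$. Let $\Phi_1(s,t,x,\eta)$, for $(s,t)\in(\gamma)$, be $C^2$ in $(\mu,x,\eta)$ along each arc up to its end points, and let $\Phi_0(P_r,\cdot)$ be $C^1$. Put $H=\Phi+\psi_jf^j$ and $$g_i(s,t,\psi,\psi_s,\psi_t)=\frac{\partial H}{\partial x^i}-\frac{D}{Ds}\frac{\partial H}{\partial p^i}-\frac{D}{Dt}\frac{\partial H}{\partial q^i},$$ with total derivatives $D/Ds$, $D/Dt$, along $x,x_s,x_t,u$. On the open arcs let $$F_{1,i}=n_1\Phi_{p^i}+n_2\Phi_{q^i}+\Phi_{1,x^i}-\frac{D}{D\mu}\Phi_{1,\eta^i},$$ with $\eta=x_\mu=-n_2x_s+n_1x_t$, and at the vertices let $F_{0,i}(P_r)=\Phi_{0,x^i}(P_r,x(P_r))-V_r(\Phi_{1,\eta^i})$, where $V_r(\varphi)=\varphi(\mu_r^+)-\varphi(\mu_r^-)$. Let $\rho_1(s,t,\tau)$, $(s,\tau)\in G$, $0\le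 t\le\tau$, and $\rho_2(s,t,\sigma)$, $(\sigma,t)\in G$, $0\le s\le\sigma$, be the matrix solutions of $$\frac{\partial\rho^i_{1,j}}{\partial t}=-\frac{\partial f^k}{\partial p^j}(s,t,\dots)\,\rho^i_{1,k},\quad \rho_1(s,\tau,\tau)=I;\qquad \frac{\partial\rho^i_{2,j}}{\partial s}=-\frac{\partial f^k}{\partial q^j}(s,t,\dots)\,\rho^i_{2,k},\quad \rho_2(\sigma,t,\sigma)=I$$ (the values of the Riemann function on characteristics). *Side conditions.* For a vertex $P_k$ put $$A_{k,j}(t)=\int_{\{\mu>\mu_k:\,L_1(\mu)=s_k\}}F_{1,i}\,\rho^i_{1,j}(s_k,t,L_2(\mu))\,d\mu+\sum_{r>k,\ s_r=s_k}F_{0,i}(P_r)\,\rho^i_{1,j}(s_k,t,t_r),$$ $$B_{k,j}(s)=\int_{\{\mu<\mu_k:\,L_2(\mu)=t_k\}}F_{1,i}\,\rho^i_{2,j}(s,t_k,L_1(\mu))\,d\mu+\sum_{r<k,\ t_r=t_k}F_{0,i}(P_r)\,\rho^i_{2,j}(s,t_k,s_r).$$ 1. On every open flat arc, $\psi$ has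 boundary values (limits from $\operatorname{int}G\cap G_R$), differentiable along the arc, with $$(n_1^2-n_2^2)\frac{\partial\psi_j}{\partial\mu}+n_1\frac{\partial H}{\partial p^j}+n_2\frac{\partial H}{\partial q^j}+\frac{\partial\Phi_1}{\partial x^j}-\frac{D}{D\mu}\frac{\partial\Phi_1}{\partial\eta^j}=0.$$ At every point $P$ of an open oblique arc, as $(s,t)\to P$ within $\operatorname{int}G\cap G_R$, $$\psi_j\to0,\qquad n_2(P)\frac{\partial\psi_j}{\partial s}\to-F_{1,j}(P),\qquad n_1(P)\frac{\partial\psi_j}{\partial t}\to-F_{1,j}(P).$$ 2. As $(s,t)\to P_k$ within $\operatorname{int}G$: $\psi\to B_k(s_k)+A_k(t_k)+F_0(P_k)$ from $\{s<s_k,\,t<t_k\}$, $\psi\to A_k(t_k)$ from $\{s<s_k,\,t>t_k\}$, and $\psi\to B_k(s_k)$ from $\{s>s_k,\,t<t_k\}$ (no condition where the set is empty near $P_k$). 3. If $P_r$ is the last vertex on the line $t=t_r$, then at all $(s,t_r)\in\operatorname{int}G$ with $s\ne s_k$ for all $k$ the one-sided limits exist and $$\psi_j(s,t_r^-)-\psi_j(s,t_r^+)=B_{r,j}(s)+F_{0,i}(P_r)\,\rho^i_{2,j}(s,t_r,s_r).$$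 If $P_r$ is the first vertex on the line $s=s_r$, then at all $(s_r,t)\in\operatorname{int}G$ with $t\ne t_k$ for all $k$ the one-sided limits exist and $$\psi_j(s_r^-,t)-\psi_j(s_r^+,t)=A_{r,j}(t)+F_{0,i}(P_r)\,\rho^i_{1,j}(s_r,t,t_r).$$ *Solutions.* A solution is a function $\psi:\operatorname{int}G\cap G_R\to\mathbb R^n$ which has first partial derivatives and mixed second partial derivatives with $\psi_{st}=\psi_{ts}=g(s,t,\psi,\psi_s,\psi_t)$, which satisfies 1–3, and for which $\psi$, $n_2(B_s)\psi_s$ and $n_1(A_t)\psi_t$ extend continuously to the closure of each cell; here $B_s$ and $A_t$ are the points of $(\gamma)$ above and to the right of $(s,t)$. (If no oblique arc has a tangent parallel to an axis at one of its end points, the last requirement says that $\psi$ is $C^1$ up to the boundary of every cell.) *Claim.* Assume that $g$ is Lipschitz continuous in $(\psi,\psi_s,\psi_t)$, uniformly in $(s,t)\in\operatorname{int}G\cap G_R$. Then matrix functions $\rho_1,\rho_2$ as above exist, and for any such $\rho_1,\rho_2$ the Hamiltonian equations with the side conditions 1–3 have exactly one solution $\psi$. -/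

import Mathlib

open Set Filter Topology MeasureTheory

noncomputable section

/-- `n`-dimensional Euclidean space. -/
abbrev Euc (n : ℕ) : Type := EuclideanSpace ℝ (Fin n)

/-- Partial derivative with respect to the first plane coordinate `s`. -/
def dS {F : Type*} [NormedAddCommGroup F] [NormedSpace ℝ F] (φ : ℝ × ℝ → F) (z : ℝ × ℝ) : F :=
  deriv (fun s => φ (s, z.2)) z.1

/-- Partial derivative with respect to the second plane coordinate `t`. -/
def dT {F : Type*} [NormedAddCommGroup F] [NormedSpace ℝ F] (φ : ℝ × ℝ → F) (z : ℝ × ℝ) : F :=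
  deriv (fun t => φ (z.1, t)) z.2

/-! ### The curvilinear boundary -/

/-- A curve `μ ↦ (L₁ μ, L₂ μ)`, `0 ≤ μ ≤ node (N + 1)`, with the marked parameter values
`node 0, …, node (N + 1)` of its vertices `P₀, …, P_{N+1}`.  Arc `j` (`j ≤ N`) is the part of the
curve between the vertices `j` and `j + 1`. -/
structure VertexCurve where
  N : ℕ
  node : ℕ → ℝ
  L₁ : ℝ → ℝ
  L₂ : ℝ → ℝ

namespace VertexCurve

variable (c : VertexCurve)

/-- Total length. -/
def len : ℝ := c.node (c.N + 1)

def point (μ : ℝ) : ℝ × ℝ := (c.L₁ μ, c.L₂ μ)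

/-- Coordinates of the vertices. -/
def vs (r : ℕ) : ℝ := c.L₁ (c.node r)

def vt (r : ℕ) : ℝ := c.L₂ (c.node r)

def vertex (r : ℕ) : ℝ × ℝ := (c.vs r, c.vt r)

/-- The unit normal pointing out of the domain: the curve is parametrized by arc length and runs
counterclockwise, so that its unit tangent is `(-n₂, n₁)`. -/
def n₁ (μ : ℝ) : ℝ := deriv c.L₂ μ

def n₂ (μ : ℝ) : ℝ := -deriv c.L₁ μ

/-- Parameters of the relative interior of arc `j`. -/
def arc (j : ℕ) : Set ℝ := Ioo (c.node j) (c.node (j + 1))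

def closedArc (j : ℕ) : Set ℝ := Icc (c.node j) (c.node (j + 1))

/-- Arc `j` is a segment parallel to the `s`-axis. -/
def IsHorizontal (j : ℕ) : Prop := ∀ μ ∈ c.closedArc j, c.L₂ μ = c.vt j

/-- Arc `j` is a segment parallel to the `t`-axis. -/
def IsVertical (j : ℕ) : Prop := ∀ μ ∈ c.closedArc j, c.L₁ μ = c.vs j

def IsFlat (j : ℕ) : Prop := c.IsHorizontal j ∨ c.IsVertical j

/-- Arc `j` is oblique: inside the arc (vertices not included) no tangent is parallel to a
coordinate axis.  At its two end points the tangent may be parallel to an axis. -/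
def IsOblique (j : ℕ) : Prop := ∀ μ ∈ c.arc j, 0 < c.n₁ μ ∧ 0 < c.n₂ μ

/-- The standing geometric assumptions: a continuous, piecewise `C²`, non-increasing curve,
parametrized by arc length, which joins a point `(a, 0)` to a point `(0, b)` through the open first
quadrant, and each of whose arcs between consecutive vertices is flat or oblique. -/
structure Admissible : Prop where
  node_zero : c.node 0 = 0
  node_lt : ∀ j ≤ c.N, c.node j < c.node (j + 1)
  smooth₁ : ∀ j ≤ c.N, ContDiffOn ℝ 2 c.L₁ (c.closedArc j)
  smooth₂ : ∀ j ≤ c.N, ContDiffOn ℝ 2 c.L₂ (c.closedArc j)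
  unit_speed : ∀ j ≤ c.N, ∀ μ ∈ c.arc j, deriv c.L₁ μ ^ 2 + deriv c.L₂ μ ^ 2 = 1
  antitone₁ : AntitoneOn c.L₁ (Icc 0 c.len)
  monotone₂ : MonotoneOn c.L₂ (Icc 0 c.len)
  start : c.L₂ 0 = 0
  finish : c.L₁ c.len = 0
  pos : ∀ μ ∈ Ioo 0 c.len, 0 < c.L₁ μ ∧ 0 < c.L₂ μ
  arc_kind : ∀ j ≤ c.N, c.IsFlat j ∨ c.IsOblique j

/-- The curve as a set of points. -/
def gamma : Set (ℝ × ℝ) := c.point '' Icc 0 c.len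

/-- The closed domain bounded by the two coordinate axes and the curve. -/
def G : Set (ℝ × ℝ) := {z | ∃ μ ∈ Icc 0 c.len, z.1 ∈ Icc 0 (c.L₁ μ) ∧ z.2 ∈ Icc 0 (c.L₂ μ)}

/-- The regular part of the domain: the lines through the vertices and parallel to the axes are
removed. -/
def GR : Set (ℝ × ℝ) := {z ∈ c.G | ∀ r ≤ c.N + 1, z.1 ≠ c.vs r ∧ z.2 ≠ c.vt r}

def intGR : Set (ℝ × ℝ) := interior c.G ∩ c.GR

/-- The open cells into which the lines through the vertices cut the domain.  For `j = k` this is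
the interior of the curvilinear triangle under arc `j` (empty when that arc is flat), for `j < k` it
is an open rectangle (empty when arc `j` is horizontal or arc `k` is vertical), for `j > k` it is
empty. -/
def cell (j k : ℕ) : Set (ℝ × ℝ) :=
  {z ∈ interior c.G | z.1 ∈ Ioo (c.vs (k + 1)) (c.vs k) ∧ z.2 ∈ Ioo (c.vt j) (c.vt (j + 1))}

/-- The parts of the interior of the domain in three of the open quadrants around vertex `k`. -/
def W3 (k : ℕ) : Set (ℝ × ℝ) := {z ∈ interior c.G | z.1 < c.vs k ∧ z.2 < c.vt k}

def W2 (k : ℕ) : Set (ℝ × ℝ) := {z ∈ interior c.G | z.1 < c.vs k ∧ c.vt k < z.2}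

def W4 (k : ℕ) : Set (ℝ × ℝ) := {z ∈ interior c.G | c.vs k < z.1 ∧ z.2 < c.vt k}

/-- Parameters of the maximal segment of the curve that starts at vertex `k`, is parallel to the
`t`-axis and consists of points subsequent to the vertex. -/
def Lt (k : ℕ) : Set ℝ := {μ | c.node k < μ ∧ μ ≤ c.len ∧ c.L₁ μ = c.vs k}

/-- Parameters of the maximal segment of the curve that ends at vertex `k`, is parallel to the
`s`-axis and consists of points preceding the vertex. -/
def Ls (k : ℕ) : Set ℝ := {μ | 0 ≤ μ ∧ μ < c.node k ∧ c.L₂ μ = c.vt k}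

open Classical in
/-- The vertices other than vertex `k` on its segment `Lt`. -/
def Tset (k : ℕ) : Finset ℕ := (Finset.range (c.N + 2)).filter fun r => k < r ∧ c.vs r = c.vs k

open Classical in
/-- The vertices other than vertex `k` on its segment `Ls`. -/
def Sset (k : ℕ) : Finset ℕ := (Finset.range (c.N + 2)).filter fun r => r < k ∧ c.vt r = c.vt k

/-- Regularity of `ψ` on a cell up to its boundary.  Over the cell `(j, k)` the vertical line
through `z` meets the curve at the point `B_s` of arc `k`, the horizontal one at the point `A_t` of
arc `j`; the functions `ψ`, `n₂(B_s) ψ_s` and `n₁(A_t) ψ_t` extend continuously to the closed cell.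
Where the tangents of the two arcs are not parallel to an axis at the end points of the arcs, or
the arcs are flat, this says that `ψ` is `C¹` up to the boundary of the cell.  (Along an arc that
becomes parallel to an axis at a vertex `ψ_s` or `ψ_t` is unbounded in general.) -/
def RegularOnCell {n : ℕ} (j k : ℕ) (ψ : ℝ × ℝ → Euc n) : Prop :=
  ∃ v p q : ℝ × ℝ → Euc n,
    ContinuousOn v (closure (c.cell j k)) ∧ ContinuousOn p (closure (c.cell j k)) ∧
    ContinuousOn q (closure (c.cell j k)) ∧
    ∀ z ∈ c.cell j k,
      v z = ψ z ∧
      DifferentiableAt ℝ (fun s => ψ (s, z.2)) z.1 ∧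
      DifferentiableAt ℝ (fun t => ψ (z.1, t)) z.2 ∧
      (∀ α ∈ c.arc k, c.L₁ α = z.1 → p z = c.n₂ α • dS ψ z) ∧
      (∀ β ∈ c.arc j, c.L₂ β = z.2 → q z = c.n₁ β • dT ψ z)

end VertexCurve

/-! ### The control problem and its Hamiltonian -/

/-- The functions of the control problem: the dynamics `f (s, t, x, p, q, u)`, the cost densities
`Φ (s, t, x, p, q, u)` on the domain, `Φ₁ (s, t, x, η)` on the curve and `Φ₀ P x` at the vertices,
the boundary data `x₁`, `x₂`, a control `u` and the corresponding state `x`. -/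
structure ControlData (n m : ℕ) where
  f : ℝ × ℝ × Euc n × Euc n × Euc n × Euc m → Euc n
  Φ : ℝ × ℝ × Euc n × Euc n × Euc n × Euc m → ℝ
  Φ₁ : ℝ × ℝ × Euc n × Euc n → ℝ
  Φ₀ : ℝ × ℝ → Euc n → ℝ
  x₁ : ℝ → Euc n
  x₂ : ℝ → Euc n
  u : ℝ × ℝ → Euc m
  x : ℝ × ℝ → Euc n

namespace ControlData

variable {n m : ℕ} (D : ControlData n m) (c : VertexCurve)

/-- Differentiability of the data.  Along the boundary curve the cost density `Φ₁` has to be smooth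
along every arc up to the end points of that arc, but may jump at the vertices. -/
structure Smooth : Prop where
  interior_data : ∃ O : Set (ℝ × ℝ), IsOpen O ∧ c.G ⊆ O ∧
    ContDiffOn ℝ 2 D.f {y | (y.1, y.2.1) ∈ O} ∧ ContDiffOn ℝ 2 D.Φ {y | (y.1, y.2.1) ∈ O} ∧
    ContDiffOn ℝ 2 D.x O ∧ ContDiffOn ℝ 1 D.u O
  curve_data : ∀ j ≤ c.N, ∃ Ψ : ℝ × Euc n × Euc n → ℝ,
    ContDiffOn ℝ 2 Ψ (c.closedArc j ×ˢ univ) ∧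
    ∀ μ ∈ c.arc j, ∀ y η, D.Φ₁ (c.L₁ μ, c.L₂ μ, y, η) = Ψ (μ, y, η)
  vertex_data : ∀ r ≤ c.N + 1, ContDiff ℝ 1 (D.Φ₀ (c.vertex r))

/-- `x` is the state that belongs to the control `u`. -/
structure IsState : Prop where
  dynamics : ∀ z ∈ interior c.G ∪ c.gamma,
    dS (dT D.x) z = D.f (z.1, z.2, D.x z, dS D.x z, dT D.x z, D.u z)
  bottom : ∀ s ∈ Icc 0 (c.L₁ 0), D.x (s, 0) = D.x₁ s
  left : ∀ t ∈ Icc 0 (c.L₂ c.len), D.x (0, t) = D.x₂ t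

/-- The Hamiltonian `Φ + ψ_j f^j`. -/
def H (s t : ℝ) (x p q ψ : Euc n) (u : Euc m) : ℝ :=
  D.Φ (s, t, x, p, q, u) + ∑ j, ψ j * D.f (s, t, x, p, q, u) j

/-- The gradients of the Hamiltonian with respect to `x`, `p`, `q`, along the given trajectory. -/
def Hx (z : ℝ × ℝ) (ψ : Euc n) : Euc n :=
  gradient (fun y => D.H z.1 z.2 y (dS D.x z) (dT D.x z) ψ (D.u z)) (D.x z)

def Hp (z : ℝ × ℝ) (ψ : Euc n) : Euc n :=
  gradient (fun y => D.H z.1 z.2 (D.x z) y (dT D.x z) ψ (D.u z)) (dS D.x z)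

def Hq (z : ℝ × ℝ) (ψ : Euc n) : Euc n :=
  gradient (fun y => D.H z.1 z.2 (D.x z) (dS D.x z) y ψ (D.u z)) (dT D.x z)

/-- The right-hand side `H_x - D/Ds H_p - D/Dt H_q` of the Hamiltonian equations, as a function of
the point `z`, the value `ψ` of the co-state and its partial derivatives `P = ψ_s`, `Q = ψ_t` at `z`.
The total derivatives are derivatives of the composite functions along the coordinate lines; they
depend on the co-state through its value and its first derivative at `z` only, so that the co-state
may be replaced by its affine approximation. -/
def rhs (z : ℝ × ℝ) (ψ P Q : Euc n) : Euc n :=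
  D.Hx z ψ - deriv (fun s => D.Hp (s, z.2) (ψ + (s - z.1) • P)) z.1
    - deriv (fun t => D.Hq (z.1, t) (ψ + (t - z.2) • Q)) z.2

/-- The right-hand side is Lipschitz in `(ψ, ψ_s, ψ_t)`, uniformly over the domain. -/
def RhsLipschitz : Prop :=
  ∃ K : ℝ, ∀ z ∈ c.intGR, ∀ ψ ψ' P P' Q Q' : Euc n,
    ‖D.rhs z ψ P Q - D.rhs z ψ' P' Q'‖ ≤ K * (‖ψ - ψ'‖ + ‖P - P'‖ + ‖Q - Q'‖)

/-! ### The data of the side conditions -/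

/-- The tangential derivative `x_μ = -n₂ x_s + n₁ x_t` of the state. -/
def xTan (μ : ℝ) : Euc n :=
  -(c.n₂ μ) • dS D.x (c.point μ) + c.n₁ μ • dT D.x (c.point μ)

/-- `∂Φ₁/∂x` and `∂Φ₁/∂η` along the curve. -/
def Φ₁x (μ : ℝ) : Euc n :=
  gradient (fun y => D.Φ₁ (c.L₁ μ, c.L₂ μ, y, D.xTan c μ)) (D.x (c.point μ))

def Φ₁η (μ : ℝ) : Euc n :=
  gradient (fun η => D.Φ₁ (c.L₁ μ, c.L₂ μ, D.x (c.point μ), η)) (D.xTan c μ)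

/-- `∂Φ/∂p` and `∂Φ/∂q` along the trajectory. -/
def Φp (z : ℝ × ℝ) : Euc n :=
  gradient (fun y => D.Φ (z.1, z.2, D.x z, y, dT D.x z, D.u z)) (dS D.x z)

def Φq (z : ℝ × ℝ) : Euc n :=
  gradient (fun y => D.Φ (z.1, z.2, D.x z, dS D.x z, y, D.u z)) (dT D.x z)

/-- `F₁ = n₁ Φ_p + n₂ Φ_q + Φ₁_x - D/Dμ Φ₁_η`, at the points of the curve that are not vertices. -/
def F₁ (μ : ℝ) : Euc n :=
  c.n₁ μ • D.Φp (c.point μ) + c.n₂ μ • D.Φq (c.point μ) + D.Φ₁x c μ - deriv (D.Φ₁η c) μ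

/-- The jump at vertex `r` of a function on the curve, in the direction of increasing arc length. -/
def jumpAt (φ : ℝ → Euc n) (r : ℕ) : Euc n :=
  limUnder (𝓝[>] (c.node r)) φ - limUnder (𝓝[<] (c.node r)) φ

/-- `F₀ = Φ₀_x - V_r(Φ₁_η)` at vertex `r`; used for the vertices `1, …, N` only. -/
def F₀ (r : ℕ) : Euc n :=
  gradient (D.Φ₀ (c.vertex r)) (D.x (c.vertex r)) - jumpAt c (D.Φ₁η c) r

/-- The values `ρ₁ⁱ_j (s, t, τ) = Rⁱ_j (s, τ, s, t)` and `ρ₂ⁱ_j (s, t, σ) = Rⁱ_j (σ, t, s, t)` of the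
Riemann function on the characteristic lines, described by the differential equations
`∂ρ₁ⁱ_j/∂t = - (∂f^k/∂p^j) ρ₁ⁱ_k`, `ρ₁ (s, τ, τ) = 1` and
`∂ρ₂ⁱ_j/∂s = - (∂f^k/∂q^j) ρ₂ⁱ_k`, `ρ₂ (σ, t, σ) = 1` on the segments of the domain that end at
`(s, τ)`, respectively `(σ, t)`.  The fourth argument is the upper index `i`. -/
structure IsRiemann (ρ₁ ρ₂ : ℝ → ℝ → ℝ → Fin n → Euc n) : Prop where
  init₁ : ∀ s τ, (s, τ) ∈ c.G → ∀ i, ρ₁ s τ τ i = EuclideanSpace.single i 1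
  ode₁ : ∀ s τ, (s, τ) ∈ c.G → ∀ i, ∀ t ∈ Icc 0 τ,
    HasDerivWithinAt (fun t' => ρ₁ s t' τ i)
      (-gradient (fun y => ∑ k, D.f (s, t, D.x (s, t), y, dT D.x (s, t), D.u (s, t)) k
        * ρ₁ s t τ i k) (dS D.x (s, t))) (Icc 0 τ) t
  init₂ : ∀ σ t, (σ, t) ∈ c.G → ∀ i, ρ₂ σ t σ i = EuclideanSpace.single i 1
  ode₂ : ∀ σ t, (σ, t) ∈ c.G → ∀ i, ∀ s ∈ Icc 0 σ,
    HasDerivWithinAt (fun s' => ρ₂ s' t σ i)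
      (-gradient (fun y => ∑ k, D.f (s, t, D.x (s, t), dS D.x (s, t), y, D.u (s, t)) k
        * ρ₂ s t σ i k) (dT D.x (s, t))) (Icc 0 σ) s

/-- The contraction `F_i ρⁱ_j`. -/
def contract (F : Euc n) (ρ : Fin n → Euc n) : Euc n := ∑ i, F i • ρ i

/-- Contribution of the segment `Lt` and of the vertices `Tset` of vertex `k` at the point
`(s(P_k), t)` below them. -/
def aboveTerm (ρ₁ : ℝ → ℝ → ℝ → Fin n → Euc n) (k : ℕ) (t : ℝ) : Euc n :=
  (∫ μ in c.Lt k, contract (D.F₁ c μ) (ρ₁ (c.vs k) t (c.L₂ μ))) +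
    ∑ r ∈ c.Tset k, contract (D.F₀ c r) (ρ₁ (c.vs k) t (c.vt r))

/-- Contribution of the segment `Ls` and of the vertices `Sset` of vertex `k` at the point
`(s, t(P_k))` to the left of them. -/
def rightTerm (ρ₂ : ℝ → ℝ → ℝ → Fin n → Euc n) (k : ℕ) (s : ℝ) : Euc n :=
  (∫ μ in c.Ls k, contract (D.F₁ c μ) (ρ₂ s (c.vt k) (c.L₁ μ))) +
    ∑ r ∈ c.Sset k, contract (D.F₀ c r) (ρ₂ s (c.vt k) (c.vs r))

/-! ### The Hamiltonian equations with their side conditions -/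

/-- `ψ` solves the Hamiltonian equations in the regular part of the domain and satisfies the side
conditions on the arcs, at the vertices and across the lines through the vertices.  Only the values
of `ψ` on `c.intGR` matter. -/
structure IsCostate (ρ₁ ρ₂ : ℝ → ℝ → ℝ → Fin n → Euc n) (ψ : ℝ × ℝ → Euc n) : Prop where
  regular : ∀ j ≤ c.N, ∀ k ≤ c.N, c.RegularOnCell j k ψ
  /-- `ψ_st = H_x - D/Ds H_p - D/Dt H_q`, for both orders of differentiation. -/
  hamilton : ∀ z ∈ c.intGR,
    HasDerivAt (fun s => dT ψ (s, z.2)) (D.rhs z (ψ z) (dS ψ z) (dT ψ z)) z.1 ∧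
    HasDerivAt (fun t => dS ψ (z.1, t)) (D.rhs z (ψ z) (dS ψ z) (dT ψ z)) z.2
  /-- On a flat arc the boundary values `w` of `ψ` satisfy
  `(n₁² - n₂²) w_μ + n₁ H_p + n₂ H_q + Φ₁_x - D/Dμ Φ₁_η = 0`. -/
  flat : ∀ j ≤ c.N, c.IsFlat j → ∃ w : ℝ → Euc n, ∀ μ ∈ c.arc j,
    Tendsto ψ (𝓝[c.intGR] (c.point μ)) (𝓝 (w μ)) ∧ DifferentiableAt ℝ w μ ∧
    (c.n₁ μ ^ 2 - c.n₂ μ ^ 2) • deriv w μ + c.n₁ μ • D.Hp (c.point μ) (w μ)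
      + c.n₂ μ • D.Hq (c.point μ) (w μ) + D.Φ₁x c μ - deriv (D.Φ₁η c) μ = 0
  oblique : ∀ j ≤ c.N, c.IsOblique j → ∀ μ ∈ c.arc j,
    Tendsto ψ (𝓝[c.intGR] (c.point μ)) (𝓝 0) ∧
    Tendsto (fun z => c.n₂ μ • dS ψ z) (𝓝[c.intGR] (c.point μ)) (𝓝 (-D.F₁ c μ)) ∧
    Tendsto (fun z => c.n₁ μ • dT ψ z) (𝓝[c.intGR] (c.point μ)) (𝓝 (-D.F₁ c μ))
  vertex₃ : ∀ k ≤ c.N + 1, Tendsto ψ (𝓝[c.W3 k] (c.vertex k))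
    (𝓝 (D.rightTerm c ρ₂ k (c.vs k) + D.aboveTerm c ρ₁ k (c.vt k) + D.F₀ c k))
  vertex₂ : ∀ k ≤ c.N + 1, Tendsto ψ (𝓝[c.W2 k] (c.vertex k))
    (𝓝 (D.aboveTerm c ρ₁ k (c.vt k)))
  vertex₄ : ∀ k ≤ c.N + 1, Tendsto ψ (𝓝[c.W4 k] (c.vertex k))
    (𝓝 (D.rightTerm c ρ₂ k (c.vs k)))
  /-- Jump across the horizontal line that enters the domain at vertex `r`, the last vertex on
  that line: the value from below minus the value from above. -/
  jumpS : ∀ r ≤ c.N + 1, (∀ k ≤ c.N + 1, r < k → c.vt k ≠ c.vt r) →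
    ∀ s, (s, c.vt r) ∈ interior c.G → (∀ k ≤ c.N + 1, s ≠ c.vs k) →
    ∃ ψm ψp : Euc n,
      Tendsto (fun t => ψ (s, t)) (𝓝[<] (c.vt r)) (𝓝 ψm) ∧
      Tendsto (fun t => ψ (s, t)) (𝓝[>] (c.vt r)) (𝓝 ψp) ∧
      ψm - ψp = D.rightTerm c ρ₂ r s + contract (D.F₀ c r) (ρ₂ s (c.vt r) (c.vs r))
  /-- Jump across the vertical line that enters the domain at vertex `r`, the first vertex on that
  line: the value from the left minus the value from the right. -/
  jumpT : ∀ r ≤ c.N + 1, (∀ k < r, c.vs k ≠ c.vs r) →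
    ∀ t, (c.vs r, t) ∈ interior c.G → (∀ k ≤ c.N + 1, t ≠ c.vt k) →
    ∃ ψm ψp : Euc n,
      Tendsto (fun s => ψ (s, t)) (𝓝[<] (c.vs r)) (𝓝 ψm) ∧
      Tendsto (fun s => ψ (s, t)) (𝓝[>] (c.vs r)) (𝓝 ψp) ∧
      ψm - ψp = D.aboveTerm c ρ₁ r t + contract (D.F₀ c r) (ρ₁ (c.vs r) t (c.vt r))

end ControlData

end

open Set Filter Topology MeasureTheory

noncomputable section

set_option linter.unusedSectionVars false

/-! ### Integrals that depend on parameters -/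

/-! Existence. `H` is affine in the co-state, so the right-hand side is `a + A ψ - f_p* ψ_s - f_q*
ψ_t` with continuous coefficients (`SmoothOn.rhs_eq`). A point `(s, t)` is described by the
parameters `α ≥ β` of the curve points above it and to its right. In these coordinates the domain is
a triangle and the curve is its diagonal. Flat segments and vertices carry data as well, although no
open cell lies under them. Hence every vertex is blown up to a parameter interval of length one.
Along the stretched curve `ds = -ν₂ dα` and `dt = ν₁ dβ`, where `ν` is the normal on the arcs and
zero on the vertex intervals.

For `Ψ (α, β) = ψ (s, t)` the equations become `Ψ_αβ = K`, with `K` linear in `Ψ`, `Ψ_α`, `Ψ_β` up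
to an inhomogeneity. All side conditions merge into the single Cauchy condition `Ψ = 0`, `Ψ_α = F =
-Ψ_β` on the diagonal, where `F` equals `F₁` on arcs and `F₀` on vertex intervals. Indeed a vertical
line through vertices corresponds to a whole strip of values `α` with `ν₂ = 0`. There `Ψ_α = U F`,
where `U` solves a linear differential equation in `β` and turns out to be `ρ₁`
(`ControlData.U_apply`). Integration across the strip produces the contributions of the flat
segments and of the vertices, which are the prescribed jumps. Horizontal lines behave in the same
way with `ρ₂`. The differential equations on flat arcs and the limits at vertices are what `Ψ_αβ =
K` becomes where one or both of the `ν` vanish.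

Since `F` and `ν` jump, `Ψ` is not `C¹`. The discontinuities are made explicit by the ansatz `Ψ_α =
U F(α) - ν₂(α) V`, `Ψ_β = -U' F(β) + ν₁(β) W`. The factors `U`, `U'`, `V`, `W` and `Ψ` itself are
continuous and solve linear Volterra equations, which are contractive for the weight `exp (κ (α -
β))` (`exists_volterra_triangle`). That the two first-order equations determine the same `Ψ` is
Fubini's theorem (`TriangleProblem.Regular.exists_solution`). Reading the solution back in `(s, t)`
gives the co-state (`ControlData.isCostate_costate`).

Uniqueness. The difference of two co-states is shown to vanish cell by cell, by induction on `k -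
j`, the distance of the cell `(j, k)` from the curve (`ControlData.cell_eq_zero`). Under an oblique
arc it has zero Cauchy data on the arc. In a rectangle it vanishes on the upper and the right side.
Such a side either lies inside the domain, where equal jumps make the difference continuous and the
neighbouring cell is already settled, or it lies on a flat arc, where the difference solves a
homogeneous linear differential equation with zero value at a vertex (`ControlData.upper_side_zero`,
`ControlData.right_side_zero`). The hyperbolic uniqueness lemma `eq_zero_of_hyperbolic` then
applies. It is used in arc-length coordinates: the derivatives there are `n₂ ψ_s` and `n₁ ψ_t` up to
sign, and these stay bounded even where the curve becomes parallel to an axis at a vertex. -/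

theorem continuous_intervalIntegral_of_bounded {E : Type*} [NormedAddCommGroup E] [NormedSpace ℝ E]
    {X : Type*} [TopologicalSpace X] [FirstCountableTopology X] {g : X → ℝ → E} {M : ℝ}
    (hm : ∀ x, AEStronglyMeasurable (g x) volume) (hb : ∀ x b, ‖g x b‖ ≤ M)
    (hc : ∀ b, Continuous fun x => g x b) {p q : X → ℝ} (hp : Continuous p) (hq : Continuous q) :
    Continuous fun x => ∫ b in p x..q x, g x b := by
  have hint : ∀ x a b, IntervalIntegrable (g x) volume a b := fun x a b =>
    (intervalIntegrable_const (c := M)).mono_fun' (hm x).restrict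
      (Eventually.of_forall fun y => hb x y)
  have key : ∀ r : X → ℝ, Continuous r → Continuous fun x => ∫ b in (0 : ℝ)..r x, g x b := by
    intro r hr
    rw [continuous_iff_continuousAt]
    intro x₀
    have h := intervalIntegral.continuousAt_parametric_primitive_of_dominated (μ := volume)
      (F := g) (fun _ => M) (-(|r x₀| + 1)) (|r x₀| + 1) (a₀ := 0) (b₀ := r x₀) (x₀ := x₀)
      (fun x => (hm x).restrict)
      (Eventually.of_forall fun x => Eventually.of_forall fun y => hb x y)
      intervalIntegrable_const (Eventually.of_forall fun b => (hc b).continuousAt)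
      ⟨by have := abs_nonneg (r x₀); linarith, by have := abs_nonneg (r x₀); linarith⟩
      ⟨by have := neg_abs_le (r x₀); linarith, by have := le_abs_self (r x₀); linarith⟩
      Real.volume_singleton
    exact ContinuousAt.comp (f := fun x => (x, r x))
      (g := fun p : X × ℝ => ∫ b in (0 : ℝ)..p.2, g p.1 b) h
      (continuous_id.prodMk hr).continuousAt
  have : (fun x => ∫ b in p x..q x, g x b)
      = fun x => (∫ b in (0 : ℝ)..q x, g x b) - ∫ b in (0 : ℝ)..p x, g x b := by
    funext x
    rw [intervalIntegral.integral_interval_sub_left (hint x _ _) (hint x _ _)]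
  rw [this]
  exact (key q hq).sub (key p hp)

theorem stronglyMeasurable_clm_apply {α E E' : Type*} [MeasurableSpace α]
    [NormedAddCommGroup E] [NormedSpace ℝ E] [NormedAddCommGroup E'] [NormedSpace ℝ E']
    {c : α → E' →L[ℝ] E} {F : α → E'} (hc : StronglyMeasurable c) (hF : StronglyMeasurable F) :
    StronglyMeasurable fun x => c x (F x) :=
  isBoundedBilinearMap_apply.continuous.comp_stronglyMeasurable (hc.prodMk hF)

/-- Interchange of the order of integration over a triangle. -/
theorem integral_triangle_swap {E : Type*} [NormedAddCommGroup E] [NormedSpace ℝ E]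
    {K : ℝ × ℝ → E} {M : ℝ} (hK : StronglyMeasurable K) (hM : ∀ z, ‖K z‖ ≤ M) {α β : ℝ}
    (h : β ≤ α) :
    ∫ a in β..α, ∫ b in β..a, K (a, b) = ∫ b in β..α, ∫ a in b..α, K (a, b) := by
  set S : Set (ℝ × ℝ) := {z | z.2 ≤ z.1} with hS
  have hSm : MeasurableSet S := measurableSet_le measurable_snd measurable_fst
  have h1 : ∀ a ∈ Ioc β α, ∫ b in β..a, K (a, b) = ∫ b in Ioc β α, S.indicator K (a, b) := by
    intro a ha
    rw [intervalIntegral.integral_of_le ha.1.le]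
    have : (fun b => S.indicator K (a, b)) = (Iic a).indicator fun b => K (a, b) := by
      funext b
      by_cases hb : b ≤ a
      · rw [indicator_of_mem (show (a, b) ∈ S from hb), indicator_of_mem (show b ∈ Iic a from hb)]
      · rw [indicator_of_notMem (show (a, b) ∉ S from hb),
          indicator_of_notMem (show b ∉ Iic a from hb)]
    rw [this, setIntegral_indicator measurableSet_Iic]
    congr 2
    ext b
    simp only [mem_Ioc, mem_inter_iff, mem_Iic]
    exact ⟨fun hb => ⟨⟨hb.1, hb.2.trans ha.2⟩, hb.2⟩, fun hb => ⟨hb.1.1, hb.2⟩⟩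
  have h2 : ∀ b ∈ Ioc β α, ∫ a in b..α, K (a, b) = ∫ a in Ioc β α, S.indicator K (a, b) := by
    intro b hb
    rw [intervalIntegral.integral_of_le hb.2, ← integral_Icc_eq_integral_Ioc]
    have : (fun a => S.indicator K (a, b)) = (Ici b).indicator fun a => K (a, b) := by
      funext a
      by_cases hab : b ≤ a
      · rw [indicator_of_mem (show (a, b) ∈ S from hab), indicator_of_mem (show a ∈ Ici b from hab)]
      · rw [indicator_of_notMem (show (a, b) ∉ S from hab),
          indicator_of_notMem (show a ∉ Ici b from hab)]
    rw [this, setIntegral_indicator measurableSet_Ici]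
    congr 2
    ext a
    simp only [mem_Ioc, mem_inter_iff, mem_Ici, mem_Icc]
    exact ⟨fun ha => ⟨⟨hb.1.trans_le ha.1, ha.2⟩, ha.1⟩, fun ha => ⟨ha.2, ha.1.2⟩⟩
  rw [intervalIntegral.integral_of_le h, intervalIntegral.integral_of_le h,
    setIntegral_congr_fun measurableSet_Ioc h1, setIntegral_congr_fun measurableSet_Ioc h2]
  refine integral_integral_swap (f := fun a b => S.indicator K (a, b)) ?_
  refine Integrable.of_bound (C := M) (hK.indicator hSm).aestronglyMeasurable
    (Eventually.of_forall fun z => ?_)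
  exact (norm_indicator_le_norm_self _ _).trans (hM z)

/-- The weight `exp (κ (α - β))` gains a factor `1 / κ` under integration in either variable. For
large `κ` this makes the Volterra operators contractive without restricting the size of the
triangle. -/
theorem integral_exp_sub_left_le {κ : ℝ} (hκ : 0 < κ) (α β : ℝ) :
    ∫ b in β..α, Real.exp (κ * (α - b)) ≤ Real.exp (κ * (α - β)) / κ := by
  have h : ∀ b ∈ uIcc β α, HasDerivAt (fun b => -(Real.exp (κ * (α - b)) / κ))
      (Real.exp (κ * (α - b))) b := by
    intro b _
    have h1 : HasDerivAt (fun b => κ * (α - b)) (κ * (-1)) b :=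
      ((hasDerivAt_id b).const_sub α).const_mul κ
    exact (h1.exp.div_const κ).neg.congr_deriv (by field_simp)
  rw [intervalIntegral.integral_eq_sub_of_hasDerivAt h
    ((by fun_prop : Continuous fun b => Real.exp (κ * (α - b))).intervalIntegrable _ _)]
  have : 0 < Real.exp (κ * (α - α)) / κ := by positivity
  linarith

theorem integral_exp_sub_right_le {κ : ℝ} (hκ : 0 < κ) (α β : ℝ) :
    ∫ a in β..α, Real.exp (κ * (a - β)) ≤ Real.exp (κ * (α - β)) / κ := by
  have h : ∀ a ∈ uIcc β α, HasDerivAt (fun a => Real.exp (κ * (a - β)) / κ)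
      (Real.exp (κ * (a - β))) a := by
    intro a _
    have h1 : HasDerivAt (fun a => κ * (a - β)) (κ * 1) a :=
      ((hasDerivAt_id a).sub_const β).const_mul κ
    exact (h1.exp.div_const κ).congr_deriv (by field_simp)
  rw [intervalIntegral.integral_eq_sub_of_hasDerivAt h
    ((by fun_prop : Continuous fun a => Real.exp (κ * (a - β))).intervalIntegrable _ _)]
  have : 0 < Real.exp (κ * (β - β)) / κ := by positivity
  linarith

/-! ### A weighted contraction principle -/

/-- The hypothesis says that `T` contracts by `1/2` in the norm `sup ‖f‖ / w`, which is equivalent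
to the sup norm because `1 ≤ w ≤ R`. The Picard iterates starting from `0` therefore converge
uniformly. The pointwise formulation avoids a second norm on the space. -/
theorem exists_fixedPoint_of_weighted {X V : Type*} [TopologicalSpace X] [CompactSpace X]
    [NormedAddCommGroup V] [CompleteSpace V] (T : C(X, V) → C(X, V)) (w : X → ℝ) {R : ℝ}
    (hw1 : ∀ x, 1 ≤ w x) (hwR : ∀ x, w x ≤ R)
    (h : ∀ f g : C(X, V), ∀ S, 0 ≤ S → (∀ x, ‖f x - g x‖ ≤ S * w x) →
      ∀ x, ‖T f x - T g x‖ ≤ S / 2 * w x) :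
    ∃ f, T f = f := by
  set u : ℕ → C(X, V) := fun n => T^[n] 0 with hu
  have hus : ∀ n, u (n + 1) = T (u n) := fun n => Function.iterate_succ_apply' T n 0
  set S₀ := ‖u 1 - u 0‖
  have hS₀ : 0 ≤ S₀ := norm_nonneg _
  have hd : ∀ n x, ‖u (n + 1) x - u n x‖ ≤ S₀ / 2 ^ n * w x := by
    intro n
    induction n with
    | zero =>
      intro x
      have h1 : ‖u (0 + 1) x - u 0 x‖ ≤ S₀ := (u 1 - u 0).norm_coe_le_norm x
      have := mul_le_mul_of_nonneg_left (hw1 x) hS₀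
      simpa using h1.trans (by linarith)
    | succ n ih =>
      intro x
      have := h (u (n + 1)) (u n) (S₀ / 2 ^ n) (by positivity) ih x
      rw [← hus, ← hus] at this
      refine this.trans (le_of_eq ?_)
      rw [pow_succ]; field_simp
  have hcs : CauchySeq u := by
    refine cauchySeq_of_le_geometric (1 / 2) (S₀ * |R|) (by norm_num) fun n => ?_
    rw [dist_comm, dist_eq_norm, ContinuousMap.norm_le _ (by positivity)]
    intro x
    refine (hd n x).trans ?_
    have h1 : w x ≤ |R| := (hwR x).trans (le_abs_self R)
    calc S₀ / 2 ^ n * w x ≤ S₀ / 2 ^ n * |R| := by gcongr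
      _ = S₀ * |R| * (1 / 2) ^ n := by rw [one_div, inv_pow]; ring
  obtain ⟨f, hf⟩ := cauchySeq_tendsto_of_complete hcs
  refine ⟨f, ?_⟩
  have hTf : Tendsto (fun n => u (n + 1)) atTop (𝓝 (T f)) := by
    rw [tendsto_iff_norm_sub_tendsto_zero]
    refine squeeze_zero (g := fun n => ‖u n - f‖ / 2 * |R|) (fun _ => norm_nonneg _) (fun n => ?_) ?_
    · rw [ContinuousMap.norm_le _ (by positivity)]
      intro x
      have := h (u n) f ‖u n - f‖ (norm_nonneg _) (fun y => by
        have h1 : ‖u n y - f y‖ ≤ ‖u n - f‖ := (u n - f).norm_coe_le_norm y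
        have := mul_le_mul_of_nonneg_left (hw1 y) (norm_nonneg (u n - f))
        linarith) x
      rw [← hus] at this
      refine this.trans ?_
      have h1 : w x ≤ |R| := (hwR x).trans (le_abs_self R)
      gcongr
    · have := (tendsto_iff_norm_sub_tendsto_zero.1 hf).div_const 2 |>.mul_const |R|
      simpa using this
  exact tendsto_nhds_unique hTf ((tendsto_add_atTop_iff_nat 1).2 hf)

/-! ### Volterra equations on a triangle -/

/-- The triangle `0 ≤ β ≤ α ≤ Λ` in the `(α, β)`-plane. -/
def triangle (Λ : ℝ) : Set (ℝ × ℝ) := {z | 0 ≤ z.2 ∧ z.2 ≤ z.1 ∧ z.1 ≤ Λ}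

/-- For `0 ≤ Λ` this is a continuous retraction of the plane onto the triangle: both coordinates are
clamped to `[0, Λ]`, and then the first is raised to the second if necessary. It turns coefficients
continuous on the triangle into bounded continuous functions on the plane. -/
def triangleRetract (Λ : ℝ) (z : ℝ × ℝ) : ℝ × ℝ :=
  (max (max 0 (min z.1 Λ)) (max 0 (min z.2 Λ)), max 0 (min z.2 Λ))

theorem continuous_triangleRetract (Λ : ℝ) : Continuous (triangleRetract Λ) := by
  unfold triangleRetract; fun_prop

theorem triangleRetract_mem {Λ : ℝ} (hΛ : 0 ≤ Λ) (z : ℝ × ℝ) :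
    triangleRetract Λ z ∈ triangle Λ :=
  ⟨le_max_left _ _, le_max_right _ _, max_le (max_le hΛ (min_le_right _ _))
    (max_le hΛ (min_le_right _ _))⟩

theorem triangleRetract_eq {Λ : ℝ} {z : ℝ × ℝ} (hz : z ∈ triangle Λ) :
    triangleRetract Λ z = z := by
  obtain ⟨h1, h2, h3⟩ := hz
  unfold triangleRetract
  rw [min_eq_left h3, min_eq_left (h2.trans h3), max_eq_right h1, max_eq_right (h1.trans h2),
    max_eq_left h2]

theorem isCompact_triangle (Λ : ℝ) : IsCompact (triangle Λ) := by
  refine IsCompact.of_isClosed_subset (isCompact_Icc (a := ((0 : ℝ), (0 : ℝ))) (b := (Λ, Λ))) ?_ ?_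
  · exact (isClosed_le continuous_const continuous_snd).inter
      ((isClosed_le continuous_snd continuous_fst).inter
        (isClosed_le continuous_fst continuous_const))
  · rintro ⟨a, b⟩ ⟨h1, h2, h3⟩
    exact ⟨⟨h1.trans h2, h1⟩, ⟨h3, h2.trans h3⟩⟩

theorem mem_triangle_left {Λ : ℝ} {z : ℝ × ℝ} (hz : z ∈ triangle Λ) {b : ℝ}
    (hb : b ∈ Icc z.2 z.1) : (z.1, b) ∈ triangle Λ :=
  ⟨hz.1.trans hb.1, hb.2, hz.2.2⟩

theorem mem_triangle_right {Λ : ℝ} {z : ℝ × ℝ} (hz : z ∈ triangle Λ) {a : ℝ}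
    (ha : a ∈ Icc z.2 z.1) : (a, z.2) ∈ triangle Λ :=
  ⟨hz.1, ha.1, ha.2.trans hz.2.2⟩

theorem ContinuousOn.comp_triangleRetract {V : Type*} [TopologicalSpace V] {Λ : ℝ} (hΛ : 0 ≤ Λ)
    {c : ℝ × ℝ → V} (hc : ContinuousOn c (triangle Λ)) :
    Continuous fun z => c (triangleRetract Λ z) :=
  hc.comp_continuous (continuous_triangleRetract Λ) (triangleRetract_mem hΛ)

theorem ContinuousOn.bounded_triangleRetract {V : Type*} [NormedAddCommGroup V] {Λ : ℝ}
    (hΛ : 0 ≤ Λ) {c : ℝ × ℝ → V} (hc : ContinuousOn c (triangle Λ)) :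
    ∃ M, 0 ≤ M ∧ ∀ z, ‖c (triangleRetract Λ z)‖ ≤ M := by
  obtain ⟨M, hM⟩ := (isCompact_triangle Λ).exists_bound_of_continuousOn hc
  exact ⟨max M 0, le_max_right _ _, fun z => (hM _ (triangleRetract_mem hΛ z)).trans
    (le_max_left _ _)⟩

section

variable {E E' : Type*} [NormedAddCommGroup E] [NormedSpace ℝ E]
  [NormedAddCommGroup E'] [NormedSpace ℝ E']

/-- Jumps of `F` do no harm, because `F` occurs only under the integral; the dependence on the point
is through `c` and the limits of integration. This is why the free terms of the Volterra equations
are continuous although the Cauchy data are not. -/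
theorem continuousOn_triangle_integral_left {Λ : ℝ} (hΛ : 0 ≤ Λ) {c : ℝ × ℝ → E' →L[ℝ] E}
    (hc : ContinuousOn c (triangle Λ)) {F : ℝ → E'} (hF : StronglyMeasurable F) {M : ℝ}
    (hM : ∀ x, ‖F x‖ ≤ M) :
    ContinuousOn (fun z => ∫ b in z.2..z.1, c (z.1, b) (F b)) (triangle Λ) := by
  have hc' := hc.comp_triangleRetract hΛ
  obtain ⟨C, hC0, hC⟩ := hc.bounded_triangleRetract hΛ
  have := continuous_intervalIntegral_of_bounded (X := ℝ × ℝ) (M := C * M)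
    (g := fun z b => c (triangleRetract Λ (z.1, b)) (F b))
    (fun z => (stronglyMeasurable_clm_apply
      (hc'.comp (by fun_prop : Continuous fun b => (z.1, b))).stronglyMeasurable
      hF).aestronglyMeasurable)
    (fun z b => (ContinuousLinearMap.le_opNorm _ _).trans
      (mul_le_mul (hC _) (hM _) (norm_nonneg _) hC0))
    (fun b => (hc'.comp (by fun_prop : Continuous fun z : ℝ × ℝ => (z.1, b))).clm_apply
      continuous_const) continuous_snd continuous_fst
  refine this.continuousOn.congr fun z hz => ?_
  refine intervalIntegral.integral_congr fun b hb => ?_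
  rw [uIcc_of_le hz.2.1] at hb
  simp only [triangleRetract_eq (mem_triangle_left hz hb)]

theorem continuousOn_triangle_integral_right {Λ : ℝ} (hΛ : 0 ≤ Λ) {c : ℝ × ℝ → E' →L[ℝ] E}
    (hc : ContinuousOn c (triangle Λ)) {F : ℝ → E'} (hF : StronglyMeasurable F) {M : ℝ}
    (hM : ∀ x, ‖F x‖ ≤ M) :
    ContinuousOn (fun z => ∫ a in z.2..z.1, c (a, z.2) (F a)) (triangle Λ) := by
  have hc' := hc.comp_triangleRetract hΛ
  obtain ⟨C, hC0, hC⟩ := hc.bounded_triangleRetract hΛ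
  have := continuous_intervalIntegral_of_bounded (X := ℝ × ℝ) (M := C * M)
    (g := fun z a => c (triangleRetract Λ (a, z.2)) (F a))
    (fun z => (stronglyMeasurable_clm_apply
      (hc'.comp (by fun_prop : Continuous fun a => (a, z.2))).stronglyMeasurable
      hF).aestronglyMeasurable)
    (fun z b => (ContinuousLinearMap.le_opNorm _ _).trans
      (mul_le_mul (hC _) (hM _) (norm_nonneg _) hC0))
    (fun a => (hc'.comp (by fun_prop : Continuous fun z : ℝ × ℝ => (a, z.2))).clm_apply
      continuous_const) continuous_snd continuous_fst
  refine this.continuousOn.congr fun z hz => ?_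
  refine intervalIntegral.integral_congr fun b hb => ?_
  rw [uIcc_of_le hz.2.1] at hb
  simp only [triangleRetract_eq (mem_triangle_right hz hb)]

theorem continuousOn_triangle_integral_smul_left {Λ : ℝ} (hΛ : 0 ≤ Λ) {c : ℝ × ℝ → E}
    (hc : ContinuousOn c (triangle Λ)) {m : ℝ → ℝ} (hm : Measurable m) {M : ℝ}
    (hM : ∀ x, ‖m x‖ ≤ M) :
    ContinuousOn (fun z => ∫ b in z.2..z.1, m b • c (z.1, b)) (triangle Λ) :=
  continuousOn_triangle_integral_left hΛ (c := fun z => ContinuousLinearMap.toSpanSingleton ℝ (c z))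
    ((ContinuousLinearMap.toSpanSingletonCLE (𝕜 := ℝ) (E := E)).continuous.comp_continuousOn hc)
    hm.stronglyMeasurable hM

theorem continuousOn_triangle_integral_smul_right {Λ : ℝ} (hΛ : 0 ≤ Λ) {c : ℝ × ℝ → E}
    (hc : ContinuousOn c (triangle Λ)) {m : ℝ → ℝ} (hm : Measurable m) {M : ℝ}
    (hM : ∀ x, ‖m x‖ ≤ M) :
    ContinuousOn (fun z => ∫ a in z.2..z.1, m a • c (a, z.2)) (triangle Λ) :=
  continuousOn_triangle_integral_right hΛ
    (c := fun z => ContinuousLinearMap.toSpanSingleton ℝ (c z))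
    ((ContinuousLinearMap.toSpanSingletonCLE (𝕜 := ℝ) (E := E)).continuous.comp_continuousOn hc)
    hm.stronglyMeasurable hM

theorem intervalIntegrable_smul_of_continuousOn {m : ℝ → ℝ} (hm : Measurable m) {M : ℝ}
    (hM : ∀ x, ‖m x‖ ≤ M) {c : ℝ → E} {a b : ℝ} (hab : a ≤ b) (hc : ContinuousOn c (Icc a b)) :
    IntervalIntegrable (fun x => m x • c x) volume a b := by
  have h1 : IntervalIntegrable c volume a b :=
    ContinuousOn.intervalIntegrable (by rwa [uIcc_of_le hab])
  rw [intervalIntegrable_iff] at h1 ⊢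
  exact Integrable.bdd_smul h1 M hm.aestronglyMeasurable
    (Eventually.of_forall hM)

/-- Linear Volterra equations on the triangle have continuous solutions. -/
theorem exists_volterra_triangle [CompleteSpace E] {Λ : ℝ} (hΛ : 0 ≤ Λ) {m₁ m₂ : ℝ → ℝ}
    (hm₁ : Measurable m₁) (hm₂ : Measurable m₂) (hb₁ : ∀ x, ‖m₁ x‖ ≤ 1) (hb₂ : ∀ x, ‖m₂ x‖ ≤ 1)
    {c₁ c₂ : ℝ × ℝ → E →L[ℝ] E} (hc₁ : ContinuousOn c₁ (triangle Λ))
    (hc₂ : ContinuousOn c₂ (triangle Λ)) {Z₀ : ℝ × ℝ → E} (hZ₀ : ContinuousOn Z₀ (triangle Λ)) :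
    ∃ Z : ℝ × ℝ → E, ContinuousOn Z (triangle Λ) ∧ ∀ z ∈ triangle Λ,
      Z z = Z₀ z + (∫ b in z.2..z.1, m₁ b • c₁ (z.1, b) (Z (z.1, b)))
        + ∫ a in z.2..z.1, m₂ a • c₂ (a, z.2) (Z (a, z.2)) := by
  have hcomp : CompactSpace (triangle Λ) := isCompact_iff_compactSpace.1 (isCompact_triangle Λ)
  obtain ⟨M₁, hM₁0, hM₁⟩ := hc₁.bounded_triangleRetract hΛ
  obtain ⟨M₂, hM₂0, hM₂⟩ := hc₂.bounded_triangleRetract hΛ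
  let ext : C(triangle Λ, E) → ℝ × ℝ → E := fun f z =>
    f ⟨triangleRetract Λ z, triangleRetract_mem hΛ z⟩
  have hext : ∀ f, Continuous (ext f) := fun f =>
    f.continuous.comp ((continuous_triangleRetract Λ).subtype_mk _)
  have hextv : ∀ f (z : triangle Λ), ext f z = f z := fun f z => by
    simp only [ext, triangleRetract_eq z.2]
  let op : C(triangle Λ, E) → ℝ × ℝ → E := fun f z =>
    Z₀ z + (∫ b in z.2..z.1, m₁ b • c₁ (z.1, b) (ext f (z.1, b)))
        + ∫ a in z.2..z.1, m₂ a • c₂ (a, z.2) (ext f (a, z.2))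
  have hop : ∀ f, ContinuousOn (op f) (triangle Λ) := fun f =>
    (hZ₀.add (continuousOn_triangle_integral_smul_left hΛ
      (hc₁.clm_apply (hext f).continuousOn) hm₁ hb₁)).add
      (continuousOn_triangle_integral_smul_right hΛ
      (hc₂.clm_apply (hext f).continuousOn) hm₂ hb₂)
  let T : C(triangle Λ, E) → C(triangle Λ, E) := fun f =>
    ⟨fun z => op f z, continuousOn_iff_continuous_domRestrict.1 (hop f)⟩
  -- Each of the two integrals gains `1 / κ` from the weight, so the Lipschitz factor is `(M₁ + M₂)
  -- / κ ≤ 1/2`. The summand `1` keeps `κ` positive.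
  set κ := 2 * (M₁ + M₂) + 1 with hκ
  have hκ0 : 0 < κ := by positivity
  have hsub1 : ∀ z ∈ triangle Λ, ContinuousOn (fun b => c₁ (z.1, b)) (Icc z.2 z.1) := fun z hz =>
    hc₁.comp (by fun_prop) fun b hb => mem_triangle_left hz hb
  have hsub2 : ∀ z ∈ triangle Λ, ContinuousOn (fun a => c₂ (a, z.2)) (Icc z.2 z.1) := fun z hz =>
    hc₂.comp (by fun_prop) fun b hb => mem_triangle_right hz hb
  obtain ⟨f, hf⟩ := exists_fixedPoint_of_weighted T
    (fun z => Real.exp (κ * (z.1.1 - z.1.2))) (R := Real.exp (κ * Λ))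
    (fun z => Real.one_le_exp (mul_nonneg hκ0.le (sub_nonneg.2 z.2.2.1)))
    (fun z => Real.exp_le_exp.2 (by
      have := z.2.1; have := z.2.2.2
      gcongr; linarith)) (by
    intro f g S hS hfg z
    obtain ⟨z, hz⟩ := z
    have hI1 : ∀ f, IntervalIntegrable (fun b => m₁ b • c₁ (z.1, b) (ext f (z.1, b)))
        volume z.2 z.1 := fun f => intervalIntegrable_smul_of_continuousOn hm₁ hb₁ hz.2.1
      ((hsub1 z hz).clm_apply ((hext f).comp (by fun_prop)).continuousOn)
    have hI2 : ∀ f, IntervalIntegrable (fun a => m₂ a • c₂ (a, z.2) (ext f (a, z.2)))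
        volume z.2 z.1 := fun f => intervalIntegrable_smul_of_continuousOn hm₂ hb₂ hz.2.1
      ((hsub2 z hz).clm_apply ((hext f).comp (by fun_prop)).continuousOn)
    have hpt : ∀ y ∈ triangle Λ, ‖ext f y - ext g y‖ ≤ S * Real.exp (κ * (y.1 - y.2)) := by
      intro y hy
      have := hfg ⟨y, hy⟩
      rwa [← hextv f ⟨y, hy⟩, ← hextv g ⟨y, hy⟩] at this
    have e : op f z - op g z
        = (∫ b in z.2..z.1, m₁ b • c₁ (z.1, b) (ext f (z.1, b) - ext g (z.1, b)))
        + ∫ a in z.2..z.1, m₂ a • c₂ (a, z.2) (ext f (a, z.2) - ext g (a, z.2)) := by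
      simp only [map_sub, smul_sub]
      rw [intervalIntegral.integral_sub (hI1 f) (hI1 g),
        intervalIntegral.integral_sub (hI2 f) (hI2 g)]
      simp only [op]; abel
    have n1 : ‖∫ b in z.2..z.1, m₁ b • c₁ (z.1, b) (ext f (z.1, b) - ext g (z.1, b))‖
        ≤ ∫ b in z.2..z.1, M₁ * S * Real.exp (κ * (z.1 - b)) := by
      refine intervalIntegral.norm_integral_le_of_norm_le hz.2.1 (Eventually.of_forall fun b hb => ?_)
        ((by fun_prop : Continuous fun b => M₁ * S * Real.exp (κ * (z.1 - b))).intervalIntegrable _ _)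
      have hm := mem_triangle_left hz (Ioc_subset_Icc_self hb)
      have hcb : ‖c₁ (z.1, b)‖ ≤ M₁ := by
        have := hM₁ (z.1, b); rwa [triangleRetract_eq hm] at this
      rw [norm_smul]
      calc ‖m₁ b‖ * ‖c₁ (z.1, b) (ext f (z.1, b) - ext g (z.1, b))‖
          ≤ 1 * (M₁ * (S * Real.exp (κ * (z.1 - b)))) :=
            mul_le_mul (hb₁ b) ((ContinuousLinearMap.le_opNorm _ _).trans
              (mul_le_mul hcb (hpt _ hm) (norm_nonneg _) hM₁0)) (norm_nonneg _) zero_le_one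
        _ = _ := by ring
    have n2 : ‖∫ a in z.2..z.1, m₂ a • c₂ (a, z.2) (ext f (a, z.2) - ext g (a, z.2))‖
        ≤ ∫ a in z.2..z.1, M₂ * S * Real.exp (κ * (a - z.2)) := by
      refine intervalIntegral.norm_integral_le_of_norm_le hz.2.1 (Eventually.of_forall fun a ha => ?_)
        ((by fun_prop : Continuous fun a => M₂ * S * Real.exp (κ * (a - z.2))).intervalIntegrable _ _)
      have hm := mem_triangle_right hz (Ioc_subset_Icc_self ha)
      have hcb : ‖c₂ (a, z.2)‖ ≤ M₂ := by
        have := hM₂ (a, z.2); rwa [triangleRetract_eq hm] at this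
      rw [norm_smul]
      calc ‖m₂ a‖ * ‖c₂ (a, z.2) (ext f (a, z.2) - ext g (a, z.2))‖
          ≤ 1 * (M₂ * (S * Real.exp (κ * (a - z.2)))) :=
            mul_le_mul (hb₂ a) ((ContinuousLinearMap.le_opNorm _ _).trans
              (mul_le_mul hcb (hpt _ hm) (norm_nonneg _) hM₂0)) (norm_nonneg _) zero_le_one
        _ = _ := by ring
    rw [intervalIntegral.integral_const_mul] at n1 n2
    have i1 := integral_exp_sub_left_le hκ0 z.1 z.2
    have i2 := integral_exp_sub_right_le hκ0 z.1 z.2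
    have : ‖op f z - op g z‖ ≤ (M₁ * S + M₂ * S) * (Real.exp (κ * (z.1 - z.2)) / κ) := by
      rw [e]
      refine (norm_add_le _ _).trans ?_
      have j1 := mul_le_mul_of_nonneg_left i1 (mul_nonneg hM₁0 hS)
      have j2 := mul_le_mul_of_nonneg_left i2 (mul_nonneg hM₂0 hS)
      linarith
    refine this.trans ?_
    have hle : (M₁ * S + M₂ * S) / κ ≤ S / 2 := by
      rw [div_le_div_iff₀ hκ0 two_pos]; nlinarith
    calc (M₁ * S + M₂ * S) * (Real.exp (κ * (z.1 - z.2)) / κ)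
        = (M₁ * S + M₂ * S) / κ * Real.exp (κ * (z.1 - z.2)) := by ring
      _ ≤ S / 2 * Real.exp (κ * (z.1 - z.2)) := by gcongr)
  refine ⟨ext f, (hext f).continuousOn, fun z hz => ?_⟩
  rw [hextv f ⟨z, hz⟩]
  conv_lhs => rw [← hf]
  rfl

end

/-! ### A linear hyperbolic Cauchy problem with discontinuous data -/

theorem intervalIntegrable_clm_of_continuousOn {E E' : Type*} [NormedAddCommGroup E]
    [NormedSpace ℝ E] [NormedAddCommGroup E'] [NormedSpace ℝ E'] {F : ℝ → E'}
    (hF : StronglyMeasurable F) {M : ℝ} (hM : ∀ x, ‖F x‖ ≤ M) {c : ℝ → E' →L[ℝ] E} {a b : ℝ}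
    (hab : a ≤ b) (hc : ContinuousOn c (Icc a b)) :
    IntervalIntegrable (fun x => c x (F x)) volume a b := by
  have hc' : Continuous fun x => c (projIcc a b hab x) :=
    hc.comp_continuous (continuous_subtype_val.comp continuous_projIcc) fun x => Subtype.mem _
  obtain ⟨C, hC⟩ := isCompact_Icc.exists_bound_of_continuousOn hc
  have h1 : IntervalIntegrable (fun x => c (projIcc a b hab x) (F x)) volume a b :=
    (intervalIntegrable_const (c := C * M)).mono_fun'
      (stronglyMeasurable_clm_apply hc'.stronglyMeasurable hF).aestronglyMeasurable.restrict
      (Eventually.of_forall fun x => (ContinuousLinearMap.le_opNorm _ _).trans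
        (mul_le_mul (hC _ (Subtype.mem _)) (hM _) (norm_nonneg _)
          ((norm_nonneg _).trans (hC _ (Subtype.mem (projIcc a b hab x))))))
  refine h1.congr fun x hx => ?_
  rw [uIoc_of_le hab] at hx
  simp only [projIcc_of_mem hab (Ioc_subset_Icc_self hx)]

/-- Data of a linear hyperbolic Cauchy problem on the triangle: weights `ν₁`, `ν₂` and Cauchy data
`F` that are merely bounded and measurable, and continuous coefficients. -/
structure TriangleProblem (E : Type*) [NormedAddCommGroup E] [NormedSpace ℝ E] where
  Λ : ℝ
  ν₁ : ℝ → ℝ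
  ν₂ : ℝ → ℝ
  F : ℝ → E
  a : ℝ × ℝ → E
  A : ℝ × ℝ → E →L[ℝ] E
  B : ℝ × ℝ → E →L[ℝ] E
  C : ℝ × ℝ → E →L[ℝ] E

namespace TriangleProblem

variable {E : Type*} [NormedAddCommGroup E] [NormedSpace ℝ E] (T : TriangleProblem E)

structure Regular : Prop where
  nonneg : 0 ≤ T.Λ
  meas₁ : Measurable T.ν₁
  meas₂ : Measurable T.ν₂
  bound₁ : ∀ x, ‖T.ν₁ x‖ ≤ 1
  bound₂ : ∀ x, ‖T.ν₂ x‖ ≤ 1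
  measF : StronglyMeasurable T.F
  boundF : ∃ M, ∀ x, ‖T.F x‖ ≤ M
  cont_a : ContinuousOn T.a (triangle T.Λ)
  cont_A : ContinuousOn T.A (triangle T.Λ)
  cont_B : ContinuousOn T.B (triangle T.Λ)
  cont_C : ContinuousOn T.C (triangle T.Λ)

/-- A candidate solution, with its derivatives `X = U F - ν₂ V` and `Y = - U' F + ν₁ W`. -/
structure Ansatz (E : Type*) [NormedAddCommGroup E] [NormedSpace ℝ E] where
  Ψ : ℝ × ℝ → E
  V : ℝ × ℝ → E
  W : ℝ × ℝ → E
  U : ℝ × ℝ → E →L[ℝ] E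
  U' : ℝ × ℝ → E →L[ℝ] E

def X (S : Ansatz E) (z : ℝ × ℝ) : E := S.U z (T.F z.1) - T.ν₂ z.1 • S.V z

def Y (S : Ansatz E) (z : ℝ × ℝ) : E := -S.U' z (T.F z.2) + T.ν₁ z.2 • S.W z

/-- The right-hand side in the coordinates of the triangle. From `ds = -ν₂ dα` and `dt = ν₁ dβ` one
has `X = -ν₂ ψ_s` and `Y = ν₁ ψ_t`, so this is `-ν₂ ν₁ (a + A ψ + B ψ_s + C ψ_t)` written without a
division by `ν₁` or `ν₂`. -/
def K (S : Ansatz E) (z : ℝ × ℝ) : E :=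
  -(T.ν₂ z.1 * T.ν₁ z.2) • (T.a z + T.A z (S.Ψ z)) + T.ν₁ z.2 • T.B z (T.X S z)
    - T.ν₂ z.1 • T.C z (T.Y S z)

/-- The integrated form of `X_β = Y_α = K`, `Ψ_α = X`, `Ψ_β = Y` with the Cauchy data on the
diagonal. Integral identities are needed because `F`, `ν₁` and `ν₂` are merely measurable; they may
be differentiated only where these functions are continuous. -/
structure IsSolution (S : Ansatz E) : Prop where
  contΨ : ContinuousOn S.Ψ (triangle T.Λ)
  contV : ContinuousOn S.V (triangle T.Λ)
  contW : ContinuousOn S.W (triangle T.Λ)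
  contU : ContinuousOn S.U (triangle T.Λ)
  contU' : ContinuousOn S.U' (triangle T.Λ)
  eqU : ∀ z ∈ triangle T.Λ, S.U z
    = ContinuousLinearMap.id ℝ E - ∫ b in z.2..z.1, T.ν₁ b • (T.B (z.1, b)).comp (S.U (z.1, b))
  eqU' : ∀ z ∈ triangle T.Λ, S.U' z
    = ContinuousLinearMap.id ℝ E - ∫ a in z.2..z.1, T.ν₂ a • (T.C (a, z.2)).comp (S.U' (a, z.2))
  eqX : ∀ z ∈ triangle T.Λ, T.X S z = T.F z.1 - ∫ b in z.2..z.1, T.K S (z.1, b)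
  eqY : ∀ z ∈ triangle T.Λ, T.Y S z = -T.F z.2 + ∫ a in z.2..z.1, T.K S (a, z.2)
  eqΨX : ∀ z ∈ triangle T.Λ, S.Ψ z = ∫ a in z.2..z.1, T.X S (a, z.2)
  eqΨY : ∀ z ∈ triangle T.Λ, S.Ψ z = -∫ b in z.2..z.1, T.Y S (z.1, b)

variable {T} in
-- A Volterra equation in the Banach space of operators, whose coefficient is composition with `-B`
-- from the left. The integral in the other direction is switched off by the coefficient `0`.
theorem Regular.exists_U [CompleteSpace E] (hT : T.Regular) : ∃ U : ℝ × ℝ → E →L[ℝ] E,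
    ContinuousOn U (triangle T.Λ) ∧ ∀ z ∈ triangle T.Λ, U z
      = ContinuousLinearMap.id ℝ E - ∫ b in z.2..z.1, T.ν₁ b • (T.B (z.1, b)).comp (U (z.1, b)) := by
  obtain ⟨U, hU, h⟩ := exists_volterra_triangle (E := E →L[ℝ] E) hT.nonneg hT.meas₁ hT.meas₂
    hT.bound₁ hT.bound₂ (c₁ := fun z => -ContinuousLinearMap.compL ℝ E E E (T.B z))
    (c₂ := fun _ => 0) (Z₀ := fun _ => ContinuousLinearMap.id ℝ E)
    (((ContinuousLinearMap.compL ℝ E E E).continuous.comp_continuousOn hT.cont_B).neg)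
    continuousOn_const continuousOn_const
  refine ⟨U, hU, fun z hz => ?_⟩
  rw [h z hz]
  simp [sub_eq_add_neg]

variable {T} in
theorem Regular.exists_U' [CompleteSpace E] (hT : T.Regular) : ∃ U : ℝ × ℝ → E →L[ℝ] E,
    ContinuousOn U (triangle T.Λ) ∧ ∀ z ∈ triangle T.Λ, U z
      = ContinuousLinearMap.id ℝ E - ∫ a in z.2..z.1, T.ν₂ a • (T.C (a, z.2)).comp (U (a, z.2)) := by
  obtain ⟨U, hU, h⟩ := exists_volterra_triangle (E := E →L[ℝ] E) hT.nonneg hT.meas₁ hT.meas₂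
    hT.bound₁ hT.bound₂ (c₂ := fun z => -ContinuousLinearMap.compL ℝ E E E (T.C z))
    (c₁ := fun _ => 0) (Z₀ := fun _ => ContinuousLinearMap.id ℝ E)
    continuousOn_const
    (((ContinuousLinearMap.compL ℝ E E E).continuous.comp_continuousOn hT.cont_C).neg)
    continuousOn_const
  refine ⟨U, hU, fun z hz => ?_⟩
  rw [h z hz]
  simp [sub_eq_add_neg]

/-- Inserting the ansatz into `X = F - ∫ K` and `Y = -F + ∫ K` leaves equations for the factors of
`ν₂(α)` and `ν₁(β)`, because `U` and `U'` absorb the terms with `F(α)` and `F(β)`. Together with `Ψ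
= ∫ X` they form one Volterra system for the triple `(V, W, Ψ)`. The unknowns carry the weight `ν₁`
in the integrals over `b` and `ν₂` in those over `a`. -/
theorem Regular.exists_VWΨ [CompleteSpace E] {T : TriangleProblem E} (hT : T.Regular)
    {U U' : ℝ × ℝ → E →L[ℝ] E} (hU : ContinuousOn U (triangle T.Λ))
    (hU' : ContinuousOn U' (triangle T.Λ)) : ∃ V W Ψ : ℝ × ℝ → E,
    ContinuousOn V (triangle T.Λ) ∧ ContinuousOn W (triangle T.Λ) ∧ ContinuousOn Ψ (triangle T.Λ) ∧
    ∀ z ∈ triangle T.Λ,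
      (V z = -(∫ b in z.2..z.1, T.ν₁ b • T.a (z.1, b))
        + (∫ b in z.2..z.1, (T.C (z.1, b)).comp (U' (z.1, b)) (T.F b))
        - ∫ b in z.2..z.1, T.ν₁ b • (T.B (z.1, b) (V (z.1, b)) + T.A (z.1, b) (Ψ (z.1, b))
            + T.C (z.1, b) (W (z.1, b)))) ∧
      (W z = (∫ a in z.2..z.1, (T.B (a, z.2)).comp (U (a, z.2)) (T.F a))
        - (∫ a in z.2..z.1, T.ν₂ a • T.a (a, z.2))
        - ∫ a in z.2..z.1, T.ν₂ a • (T.B (a, z.2) (V (a, z.2)) + T.A (a, z.2) (Ψ (a, z.2))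
            + T.C (a, z.2) (W (a, z.2)))) ∧
      (Ψ z = (∫ a in z.2..z.1, U (a, z.2) (T.F a)) - ∫ a in z.2..z.1, T.ν₂ a • V (a, z.2)) := by
  obtain ⟨M, hM⟩ := hT.boundF
  let L : ℝ × ℝ → (E × E × E) →L[ℝ] E := fun z =>
    (T.B z).comp (ContinuousLinearMap.fst ℝ E (E × E))
      + (T.A z).comp ((ContinuousLinearMap.snd ℝ E E).comp (ContinuousLinearMap.snd ℝ E (E × E)))
      + (T.C z).comp ((ContinuousLinearMap.fst ℝ E E).comp (ContinuousLinearMap.snd ℝ E (E × E)))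
  have hL : ContinuousOn L (triangle T.Λ) :=
    ((hT.cont_B.clm_comp continuousOn_const).add (hT.cont_A.clm_comp continuousOn_const)).add
      (hT.cont_C.clm_comp continuousOn_const)
  -- The integral over `b` feeds only the component `V`; the integral over `a` feeds `W`, through
  -- `-L`, and `Ψ`, through `-V`.
  let c₁ : ℝ × ℝ → (E × E × E) →L[ℝ] (E × E × E) := fun z =>
    (ContinuousLinearMap.inl ℝ E (E × E)).comp (-L z)
  let c₂ : ℝ × ℝ → (E × E × E) →L[ℝ] (E × E × E) := fun z =>
    (ContinuousLinearMap.inr ℝ E (E × E)).comp ((ContinuousLinearMap.inl ℝ E E).comp (-L z)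
      + (ContinuousLinearMap.inr ℝ E E).comp (-ContinuousLinearMap.fst ℝ E (E × E)))
  have hc₁ : ContinuousOn c₁ (triangle T.Λ) := continuousOn_const.clm_comp hL.neg
  have hc₂ : ContinuousOn c₂ (triangle T.Λ) :=
    continuousOn_const.clm_comp ((continuousOn_const.clm_comp hL.neg).add continuousOn_const)
  let Z₀ : ℝ × ℝ → E × E × E := fun z =>
    (-(∫ b in z.2..z.1, T.ν₁ b • T.a (z.1, b))
        + (∫ b in z.2..z.1, (T.C (z.1, b)).comp (U' (z.1, b)) (T.F b)),
     (∫ a in z.2..z.1, (T.B (a, z.2)).comp (U (a, z.2)) (T.F a))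
        - (∫ a in z.2..z.1, T.ν₂ a • T.a (a, z.2)),
     ∫ a in z.2..z.1, U (a, z.2) (T.F a))
  have hZ₀ : ContinuousOn Z₀ (triangle T.Λ) := by
    refine ContinuousOn.prodMk ?_ (ContinuousOn.prodMk ?_ ?_)
    · exact (continuousOn_triangle_integral_smul_left hT.nonneg hT.cont_a hT.meas₁ hT.bound₁).neg.add
        (continuousOn_triangle_integral_left hT.nonneg (c := fun z => (T.C z).comp (U' z))
          (hT.cont_C.clm_comp hU') hT.measF hM)
    · exact (continuousOn_triangle_integral_right hT.nonneg (c := fun z => (T.B z).comp (U z))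
          (hT.cont_B.clm_comp hU) hT.measF hM).sub
        (continuousOn_triangle_integral_smul_right hT.nonneg hT.cont_a hT.meas₂ hT.bound₂)
    · exact continuousOn_triangle_integral_right hT.nonneg hU hT.measF hM
  obtain ⟨Z, hZ, h⟩ := exists_volterra_triangle hT.nonneg hT.meas₁ hT.meas₂ hT.bound₁ hT.bound₂
    hc₁ hc₂ hZ₀
  refine ⟨fun z => (Z z).1, fun z => (Z z).2.1, fun z => (Z z).2.2, hZ.fst, hZ.snd.fst, hZ.snd.snd,
    fun z hz => ?_⟩
  have hI1 : IntervalIntegrable (fun b => T.ν₁ b • c₁ (z.1, b) (Z (z.1, b))) volume z.2 z.1 :=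
    intervalIntegrable_smul_of_continuousOn hT.meas₁ hT.bound₁ hz.2.1
      ((hc₁.clm_apply hZ).comp (by fun_prop) fun b hb => mem_triangle_left hz hb)
  have hI2 : IntervalIntegrable (fun a => T.ν₂ a • c₂ (a, z.2) (Z (a, z.2))) volume z.2 z.1 :=
    intervalIntegrable_smul_of_continuousOn hT.meas₂ hT.bound₂ hz.2.1
      ((hc₂.clm_apply hZ).comp (by fun_prop) fun b hb => mem_triangle_right hz hb)
  have hp1 := (ContinuousLinearMap.fst ℝ E (E × E)).intervalIntegral_comp_comm hI1
  have hp2 := ((ContinuousLinearMap.fst ℝ E E).comp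
    (ContinuousLinearMap.snd ℝ E (E × E))).intervalIntegral_comp_comm hI1
  have hp3 := ((ContinuousLinearMap.snd ℝ E E).comp
    (ContinuousLinearMap.snd ℝ E (E × E))).intervalIntegral_comp_comm hI1
  have hq1 := (ContinuousLinearMap.fst ℝ E (E × E)).intervalIntegral_comp_comm hI2
  have hq2 := ((ContinuousLinearMap.fst ℝ E E).comp
    (ContinuousLinearMap.snd ℝ E (E × E))).intervalIntegral_comp_comm hI2
  have hq3 := ((ContinuousLinearMap.snd ℝ E E).comp
    (ContinuousLinearMap.snd ℝ E (E × E))).intervalIntegral_comp_comm hI2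
  have hz' := h z hz
  generalize (∫ b in z.2..z.1, T.ν₁ b • c₁ (z.1, b) (Z (z.1, b))) = I at *
  generalize (∫ a in z.2..z.1, T.ν₂ a • c₂ (a, z.2) (Z (a, z.2))) = J at *
  simp only [c₁, c₂, L, ContinuousLinearMap.comp_apply, ContinuousLinearMap.inl_apply,
    ContinuousLinearMap.inr_apply, Prod.fst_zero, Prod.snd_zero, ContinuousLinearMap.coe_fst',
    ContinuousLinearMap.coe_snd', add_apply, neg_apply,
    Prod.smul_fst, Prod.smul_snd, smul_neg, intervalIntegral.integral_neg, smul_zero,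
    intervalIntegral.integral_zero, Prod.mk_add_mk, add_zero, zero_add]
    at hp1 hp2 hp3 hq1 hq2 hq3
  refine ⟨?_, ?_, ?_⟩
  · dsimp only
    rw [hz', Prod.fst_add, Prod.fst_add, ← hp1, ← hq1]
    simp only [Z₀, add_zero, sub_eq_add_neg]
  · dsimp only
    rw [hz', Prod.snd_add, Prod.snd_add, Prod.fst_add, Prod.fst_add, ← hp2, ← hq2]
    simp only [Z₀, add_zero, sub_eq_add_neg]
  · dsimp only
    rw [hz', Prod.snd_add, Prod.snd_add, Prod.snd_add, Prod.snd_add, ← hp3, ← hq3]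
    simp only [Z₀, add_zero, sub_eq_add_neg]

theorem exists_bound_add {X E₀ : Type*} [NormedAddCommGroup E₀] {f g : X → E₀} (hf : ∃ M, ∀ x, ‖f x‖ ≤ M)
    (hg : ∃ M, ∀ x, ‖g x‖ ≤ M) : ∃ M, ∀ x, ‖f x + g x‖ ≤ M :=
  let ⟨M, hM⟩ := hf
  let ⟨M', hM'⟩ := hg
  ⟨M + M', fun x => (norm_add_le _ _).trans (add_le_add (hM x) (hM' x))⟩

theorem exists_bound_neg {X E₀ : Type*} [NormedAddCommGroup E₀] {f : X → E₀} (hf : ∃ M, ∀ x, ‖f x‖ ≤ M) :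
    ∃ M, ∀ x, ‖-f x‖ ≤ M :=
  let ⟨M, hM⟩ := hf
  ⟨M, fun x => (norm_neg (f x)).le.trans (hM x)⟩

theorem exists_bound_sub {X E₀ : Type*} [NormedAddCommGroup E₀] {f g : X → E₀} (hf : ∃ M, ∀ x, ‖f x‖ ≤ M)
    (hg : ∃ M, ∀ x, ‖g x‖ ≤ M) : ∃ M, ∀ x, ‖f x - g x‖ ≤ M := by
  simpa only [sub_eq_add_neg] using exists_bound_add hf (exists_bound_neg hg)

theorem exists_bound_smul {X : Type*} {m : X → ℝ} {f : X → E} (hm : ∀ x, ‖m x‖ ≤ 1)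
    (hf : ∃ M, ∀ x, ‖f x‖ ≤ M) : ∃ M, ∀ x, ‖m x • f x‖ ≤ M :=
  let ⟨M, hM⟩ := hf
  ⟨M, fun x => by
    rw [norm_smul]
    have := mul_le_mul (hm x) (hM x) (norm_nonneg _) zero_le_one
    linarith⟩

theorem exists_bound_clm {X : Type*} {c : X → E →L[ℝ] E} {f : X → E} (hc : ∃ M, ∀ x, ‖c x‖ ≤ M)
    (hf : ∃ M, ∀ x, ‖f x‖ ≤ M) : ∃ M, ∀ x, ‖c x (f x)‖ ≤ M :=
  let ⟨C, hC⟩ := hc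
  let ⟨M, hM⟩ := hf
  ⟨C * M, fun x => (ContinuousLinearMap.le_opNorm _ _).trans
    (mul_le_mul (hC x) (hM x) (norm_nonneg _) ((norm_nonneg _).trans (hC x)))⟩

/-- `K` is composed of continuous functions on the triangle and of measurable functions of one
variable. Composing only the former with the retraction yields a bounded, jointly measurable
function on the plane, to which Fubini's theorem applies. -/
theorem Regular.exists_K_extension {T : TriangleProblem E} (hT : T.Regular) {S : Ansatz E}
    (hΨ : ContinuousOn S.Ψ (triangle T.Λ)) (hV : ContinuousOn S.V (triangle T.Λ))
    (hW : ContinuousOn S.W (triangle T.Λ)) (hU : ContinuousOn S.U (triangle T.Λ))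
    (hU' : ContinuousOn S.U' (triangle T.Λ)) :
    ∃ K' : ℝ × ℝ → E, StronglyMeasurable K' ∧ (∃ M, ∀ z, ‖K' z‖ ≤ M) ∧
      ∀ z ∈ triangle T.Λ, T.K S z = K' z := by
  let r := triangleRetract T.Λ
  let T' : TriangleProblem E := ⟨T.Λ, T.ν₁, T.ν₂, T.F, fun z => T.a (r z), fun z => T.A (r z),
    fun z => T.B (r z), fun z => T.C (r z)⟩
  let S' : Ansatz E := ⟨fun z => S.Ψ (r z), fun z => S.V (r z), fun z => S.W (r z),
    fun z => S.U (r z), fun z => S.U' (r z)⟩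
  have heq : ∀ y ∈ triangle T.Λ, T.K S y = T'.K S' y := by
    intro y hy
    simp only [K, X, Y, T', S', r, triangleRetract_eq hy]
  have m1 : Measurable fun z : ℝ × ℝ => T.ν₁ z.2 := hT.meas₁.comp measurable_snd
  have m2 : Measurable fun z : ℝ × ℝ => T.ν₂ z.1 := hT.meas₂.comp measurable_fst
  have mF1 : StronglyMeasurable fun z : ℝ × ℝ => T.F z.1 := hT.measF.comp_measurable measurable_fst
  have mF2 : StronglyMeasurable fun z : ℝ × ℝ => T.F z.2 := hT.measF.comp_measurable measurable_snd
  have b1 : ∀ z : ℝ × ℝ, ‖T.ν₁ z.2‖ ≤ 1 := fun z => hT.bound₁ _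
  have b2 : ∀ z : ℝ × ℝ, ‖T.ν₂ z.1‖ ≤ 1 := fun z => hT.bound₂ _
  have bF1 : ∃ M, ∀ z : ℝ × ℝ, ‖T.F z.1‖ ≤ M := hT.boundF.imp fun M h z => h _
  have bF2 : ∃ M, ∀ z : ℝ × ℝ, ‖T.F z.2‖ ≤ M := hT.boundF.imp fun M h z => h _
  have sm : ∀ {V : Type _} [NormedAddCommGroup V] {c : ℝ × ℝ → V},
      ContinuousOn c (triangle T.Λ) → StronglyMeasurable fun z => c (r z) :=
    fun hc => (hc.comp_triangleRetract hT.nonneg).stronglyMeasurable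
  have bd : ∀ {V : Type _} [NormedAddCommGroup V] {c : ℝ × ℝ → V},
      ContinuousOn c (triangle T.Λ) → ∃ M, ∀ z, ‖c (r z)‖ ≤ M :=
    fun hc => (hc.bounded_triangleRetract hT.nonneg).imp fun M h => h.2
  have smX : StronglyMeasurable (T'.X S') :=
    (stronglyMeasurable_clm_apply (sm hU) mF1).sub (m2.stronglyMeasurable.smul (sm hV))
  have smY : StronglyMeasurable (T'.Y S') :=
    (stronglyMeasurable_clm_apply (sm hU') mF2).neg.add (m1.stronglyMeasurable.smul (sm hW))
  have bX : ∃ M, ∀ z, ‖T'.X S' z‖ ≤ M :=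
    exists_bound_sub (exists_bound_clm (bd hU) bF1) (exists_bound_smul b2 (bd hV))
  have bY : ∃ M, ∀ z, ‖T'.Y S' z‖ ≤ M :=
    exists_bound_add (exists_bound_neg (exists_bound_clm (bd hU') bF2))
      (exists_bound_smul b1 (bd hW))
  have smK : StronglyMeasurable (T'.K S') :=
    (((m2.mul m1).neg.stronglyMeasurable.smul ((sm hT.cont_a).add
      (stronglyMeasurable_clm_apply (sm hT.cont_A) (sm hΨ)))).add
      (m1.stronglyMeasurable.smul (stronglyMeasurable_clm_apply (sm hT.cont_B) smX))).sub
      (m2.stronglyMeasurable.smul (stronglyMeasurable_clm_apply (sm hT.cont_C) smY))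
  refine ⟨T'.K S', smK, ?_, heq⟩
  refine exists_bound_sub (exists_bound_add (exists_bound_smul (fun z => ?_)
      (exists_bound_add (bd hT.cont_a) (exists_bound_clm (bd hT.cont_A) (bd hΨ))))
      (exists_bound_smul b1 (exists_bound_clm (bd hT.cont_B) bX)))
      (exists_bound_smul b2 (exists_bound_clm (bd hT.cont_C) bY))
  rw [norm_neg, norm_mul]
  exact mul_le_one₀ (b2 z) (norm_nonneg _) (b1 z)


theorem Regular.integral_K_swap {T : TriangleProblem E} (hT : T.Regular) {S : Ansatz E}
    (hΨ : ContinuousOn S.Ψ (triangle T.Λ)) (hV : ContinuousOn S.V (triangle T.Λ))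
    (hW : ContinuousOn S.W (triangle T.Λ)) (hU : ContinuousOn S.U (triangle T.Λ))
    (hU' : ContinuousOn S.U' (triangle T.Λ)) {z : ℝ × ℝ} (hz : z ∈ triangle T.Λ) :
    ∫ a in z.2..z.1, ∫ b in z.2..a, T.K S (a, b) = ∫ b in z.2..z.1, ∫ a in b..z.1, T.K S (a, b) := by
  obtain ⟨K', smK, ⟨M, hM⟩, heq⟩ := hT.exists_K_extension hΨ hV hW hU hU'
  have key := integral_triangle_swap smK hM hz.2.1
  have e1 : ∫ a in z.2..z.1, ∫ b in z.2..a, T.K S (a, b)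
      = ∫ a in z.2..z.1, ∫ b in z.2..a, K' (a, b) := by
    refine intervalIntegral.integral_congr fun a ha => intervalIntegral.integral_congr fun b hb => ?_
    rw [uIcc_of_le hz.2.1] at ha
    rw [uIcc_of_le ha.1] at hb
    exact heq _ (mem_triangle_left (mem_triangle_right hz ha) hb)
  have e2 : ∫ b in z.2..z.1, ∫ a in b..z.1, T.K S (a, b)
      = ∫ b in z.2..z.1, ∫ a in b..z.1, K' (a, b) := by
    refine intervalIntegral.integral_congr fun b hb => intervalIntegral.integral_congr fun a ha => ?_
    rw [uIcc_of_le hz.2.1] at hb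
    rw [uIcc_of_le hb.2] at ha
    exact heq _ (mem_triangle_right (mem_triangle_left hz hb) ha)
  rw [e1, e2, key]

theorem Regular.intervalIntegrable_X {T : TriangleProblem E} (hT : T.Regular) {S : Ansatz E}
    (hV : ContinuousOn S.V (triangle T.Λ)) (hU : ContinuousOn S.U (triangle T.Λ)) {z : ℝ × ℝ}
    (hz : z ∈ triangle T.Λ) : IntervalIntegrable (fun a => T.X S (a, z.2)) volume z.2 z.1 := by
  obtain ⟨M, hM⟩ := hT.boundF
  have hm : MapsTo (fun a => (a, z.2)) (Icc z.2 z.1) (triangle T.Λ) :=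
    fun b hb => mem_triangle_right hz hb
  exact (intervalIntegrable_clm_of_continuousOn hT.measF hM hz.2.1 (hU.comp (by fun_prop) hm)).sub
    (intervalIntegrable_smul_of_continuousOn hT.meas₂ hT.bound₂ hz.2.1 (hV.comp (by fun_prop) hm))

theorem Regular.intervalIntegrable_Y {T : TriangleProblem E} (hT : T.Regular) {S : Ansatz E}
    (hW : ContinuousOn S.W (triangle T.Λ)) (hU' : ContinuousOn S.U' (triangle T.Λ)) {z : ℝ × ℝ}
    (hz : z ∈ triangle T.Λ) : IntervalIntegrable (fun b => T.Y S (z.1, b)) volume z.2 z.1 := by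
  obtain ⟨M, hM⟩ := hT.boundF
  have hm : MapsTo (fun b => (z.1, b)) (Icc z.2 z.1) (triangle T.Λ) :=
    fun b hb => mem_triangle_left hz hb
  exact (intervalIntegrable_clm_of_continuousOn hT.measF hM hz.2.1
    (hU'.comp (by fun_prop) hm)).neg.add
    (intervalIntegrable_smul_of_continuousOn hT.meas₁ hT.bound₁ hz.2.1 (hW.comp (by fun_prop) hm))

/-- The equations for `X` and `Y` and the formula `Ψ = ∫ X` are built into the Volterra system. The
formula `Ψ = -∫ Y` is a compatibility condition. The double integral of `K` over the triangle with
corner `z` equals `∫ (F - X)` when integrated over `b` first and `∫ (F + Y)` when integrated over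
`a` first; comparison gives the claim. -/
theorem Regular.exists_solution [CompleteSpace E] {T : TriangleProblem E} (hT : T.Regular) :
    ∃ S : Ansatz E, T.IsSolution S := by
  obtain ⟨U, hU, eU⟩ := hT.exists_U
  obtain ⟨U', hU', eU'⟩ := hT.exists_U'
  obtain ⟨V, W, Ψ, hV, hW, hΨ, h⟩ := hT.exists_VWΨ hU hU'
  obtain ⟨M, hM⟩ := hT.boundF
  let S : Ansatz E := ⟨Ψ, V, W, U, U'⟩
  have eqX : ∀ z ∈ triangle T.Λ, T.X S z = T.F z.1 - ∫ b in z.2..z.1, T.K S (z.1, b) := by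
    intro z hz
    have hm : MapsTo (fun b => (z.1, b)) (Icc z.2 z.1) (triangle T.Λ) :=
      fun b hb => mem_triangle_left hz hb
    have hc : Continuous fun b : ℝ => (z.1, b) := by fun_prop
    have hU1 : IntervalIntegrable (fun b => T.ν₁ b • (T.B (z.1, b)).comp (U (z.1, b)))
        volume z.2 z.1 := intervalIntegrable_smul_of_continuousOn hT.meas₁ hT.bound₁ hz.2.1
      ((hT.cont_B.clm_comp hU).comp hc.continuousOn hm)
    have i1 : IntervalIntegrable (fun b => T.ν₁ b • (T.B (z.1, b)).comp (U (z.1, b)) (T.F z.1))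
        volume z.2 z.1 := intervalIntegrable_smul_of_continuousOn hT.meas₁ hT.bound₁ hz.2.1
      (((hT.cont_B.clm_comp hU).comp hc.continuousOn hm).clm_apply continuousOn_const)
    have i2 : IntervalIntegrable (fun b => T.ν₁ b • T.a (z.1, b)) volume z.2 z.1 :=
      intervalIntegrable_smul_of_continuousOn hT.meas₁ hT.bound₁ hz.2.1
        (hT.cont_a.comp hc.continuousOn hm)
    have i3 : IntervalIntegrable (fun b => (T.C (z.1, b)).comp (U' (z.1, b)) (T.F b))
        volume z.2 z.1 := intervalIntegrable_clm_of_continuousOn hT.measF hM hz.2.1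
      ((hT.cont_C.clm_comp hU').comp hc.continuousOn hm)
    have i4 : IntervalIntegrable (fun b => T.ν₁ b • (T.B (z.1, b) (V (z.1, b))
        + T.A (z.1, b) (Ψ (z.1, b)) + T.C (z.1, b) (W (z.1, b)))) volume z.2 z.1 :=
      intervalIntegrable_smul_of_continuousOn hT.meas₁ hT.bound₁ hz.2.1
        ((((hT.cont_B.clm_apply hV).add (hT.cont_A.clm_apply hΨ)).add
          (hT.cont_C.clm_apply hW)).comp hc.continuousOn hm)
    -- `K` splits into a part with `F(α)`, which is the integrand of the equation for `U`, and
    -- `-ν₂(α)` times the integrand of the equation for `-V`.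
    have hK : ∀ b, T.K S (z.1, b) = T.ν₁ b • (T.B (z.1, b)).comp (U (z.1, b)) (T.F z.1)
        - T.ν₂ z.1 • (T.ν₁ b • T.a (z.1, b) - (T.C (z.1, b)).comp (U' (z.1, b)) (T.F b)
          + T.ν₁ b • (T.B (z.1, b) (V (z.1, b)) + T.A (z.1, b) (Ψ (z.1, b))
            + T.C (z.1, b) (W (z.1, b)))) := by
      intro b
      simp only [K, X, Y, S, ContinuousLinearMap.comp_apply, map_sub, map_add, map_neg, map_smul]
      module
    simp only [hK]
    have i5 : IntervalIntegrable (fun b => T.ν₂ z.1 • (T.ν₁ b • T.a (z.1, b)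
          - (T.C (z.1, b)).comp (U' (z.1, b)) (T.F b)
          + T.ν₁ b • (T.B (z.1, b) (V (z.1, b)) + T.A (z.1, b) (Ψ (z.1, b))
            + T.C (z.1, b) (W (z.1, b))))) volume z.2 z.1 := ((i2.sub i3).add i4).smul _
    rw [intervalIntegral.integral_sub i1 i5,
      intervalIntegral.integral_smul, intervalIntegral.integral_add (i2.sub i3) i4,
      intervalIntegral.integral_sub i2 i3]
    have e0 := ContinuousLinearMap.intervalIntegral_apply hU1 (T.F z.1)
    simp only [smul_apply] at e0
    rw [← e0]
    simp only [X, S]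
    rw [(h z hz).1, eU z hz]
    simp only [sub_apply, ContinuousLinearMap.id_apply]
    module
  have eqY : ∀ z ∈ triangle T.Λ, T.Y S z = -T.F z.2 + ∫ a in z.2..z.1, T.K S (a, z.2) := by
    intro z hz
    have hm : MapsTo (fun a => (a, z.2)) (Icc z.2 z.1) (triangle T.Λ) :=
      fun b hb => mem_triangle_right hz hb
    have hc : Continuous fun a : ℝ => (a, z.2) := by fun_prop
    have hU1 : IntervalIntegrable (fun a => T.ν₂ a • (T.C (a, z.2)).comp (U' (a, z.2)))
        volume z.2 z.1 := intervalIntegrable_smul_of_continuousOn hT.meas₂ hT.bound₂ hz.2.1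
      ((hT.cont_C.clm_comp hU').comp hc.continuousOn hm)
    have i1 : IntervalIntegrable (fun a => T.ν₂ a • (T.C (a, z.2)).comp (U' (a, z.2)) (T.F z.2))
        volume z.2 z.1 := intervalIntegrable_smul_of_continuousOn hT.meas₂ hT.bound₂ hz.2.1
      (((hT.cont_C.clm_comp hU').comp hc.continuousOn hm).clm_apply continuousOn_const)
    have i2 : IntervalIntegrable (fun a => T.ν₂ a • T.a (a, z.2)) volume z.2 z.1 :=
      intervalIntegrable_smul_of_continuousOn hT.meas₂ hT.bound₂ hz.2.1
        (hT.cont_a.comp hc.continuousOn hm)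
    have i3 : IntervalIntegrable (fun a => (T.B (a, z.2)).comp (U (a, z.2)) (T.F a))
        volume z.2 z.1 := intervalIntegrable_clm_of_continuousOn hT.measF hM hz.2.1
      ((hT.cont_B.clm_comp hU).comp hc.continuousOn hm)
    have i4 : IntervalIntegrable (fun a => T.ν₂ a • (T.B (a, z.2) (V (a, z.2))
        + T.A (a, z.2) (Ψ (a, z.2)) + T.C (a, z.2) (W (a, z.2)))) volume z.2 z.1 :=
      intervalIntegrable_smul_of_continuousOn hT.meas₂ hT.bound₂ hz.2.1
        ((((hT.cont_B.clm_apply hV).add (hT.cont_A.clm_apply hΨ)).add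
          (hT.cont_C.clm_apply hW)).comp hc.continuousOn hm)
    have hK : ∀ a, T.K S (a, z.2) = T.ν₂ a • (T.C (a, z.2)).comp (U' (a, z.2)) (T.F z.2)
        + T.ν₁ z.2 • ((T.B (a, z.2)).comp (U (a, z.2)) (T.F a) - T.ν₂ a • T.a (a, z.2)
          - T.ν₂ a • (T.B (a, z.2) (V (a, z.2)) + T.A (a, z.2) (Ψ (a, z.2))
            + T.C (a, z.2) (W (a, z.2)))) := by
      intro a
      simp only [K, X, Y, S, ContinuousLinearMap.comp_apply, map_sub, map_add, map_neg, map_smul]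
      module
    simp only [hK]
    have i5 : IntervalIntegrable (fun a => T.ν₁ z.2 • ((T.B (a, z.2)).comp (U (a, z.2)) (T.F a)
          - T.ν₂ a • T.a (a, z.2)
          - T.ν₂ a • (T.B (a, z.2) (V (a, z.2)) + T.A (a, z.2) (Ψ (a, z.2))
            + T.C (a, z.2) (W (a, z.2))))) volume z.2 z.1 := ((i3.sub i2).sub i4).smul _
    rw [intervalIntegral.integral_add i1 i5,
      intervalIntegral.integral_smul, intervalIntegral.integral_sub (i3.sub i2) i4,
      intervalIntegral.integral_sub i3 i2]
    have e0 := ContinuousLinearMap.intervalIntegral_apply hU1 (T.F z.2)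
    simp only [smul_apply] at e0
    rw [← e0]
    simp only [Y, S]
    rw [(h z hz).2.1, eU' z hz]
    simp only [sub_apply, ContinuousLinearMap.id_apply]
    module
  have eqΨX : ∀ z ∈ triangle T.Λ, Ψ z = ∫ a in z.2..z.1, T.X S (a, z.2) := by
    intro z hz
    have hm : MapsTo (fun a => (a, z.2)) (Icc z.2 z.1) (triangle T.Λ) :=
      fun b hb => mem_triangle_right hz hb
    have hc : Continuous fun a : ℝ => (a, z.2) := by fun_prop
    simp only [X]
    rw [(h z hz).2.2]
    exact (intervalIntegral.integral_sub
      (intervalIntegrable_clm_of_continuousOn hT.measF hM hz.2.1 (hU.comp hc.continuousOn hm))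
      (intervalIntegrable_smul_of_continuousOn hT.meas₂ hT.bound₂ hz.2.1
        (hV.comp hc.continuousOn hm))).symm
  refine ⟨S, hΨ, hV, hW, hU, hU', eU, eU', eqX, eqY, eqΨX, fun z hz => ?_⟩
  have hF : IntervalIntegrable T.F volume z.2 z.1 :=
    (intervalIntegrable_const (c := M)).mono_fun' hT.measF.aestronglyMeasurable.restrict
      (Eventually.of_forall hM)
  have hsw := hT.integral_K_swap (S := S) hΨ hV hW hU hU' hz
  have e1 : ∫ a in z.2..z.1, ∫ b in z.2..a, T.K S (a, b)
      = ∫ a in z.2..z.1, (T.F a - T.X S (a, z.2)) := by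
    refine intervalIntegral.integral_congr fun a ha => ?_
    rw [uIcc_of_le hz.2.1] at ha
    simp only [eqX _ (mem_triangle_right hz ha), sub_sub_cancel]
  have e2 : ∫ b in z.2..z.1, ∫ a in b..z.1, T.K S (a, b)
      = ∫ b in z.2..z.1, (T.F b + T.Y S (z.1, b)) := by
    refine intervalIntegral.integral_congr fun a ha => ?_
    rw [uIcc_of_le hz.2.1] at ha
    simp only [eqY _ (mem_triangle_left hz ha), add_neg_cancel_left]
  rw [e1, e2, intervalIntegral.integral_sub hF (hT.intervalIntegrable_X hV hU hz),
    intervalIntegral.integral_add hF (hT.intervalIntegrable_Y hW hU' hz), ← eqΨX z hz,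
    sub_eq_iff_eq_add, add_assoc, left_eq_add] at hsw
  exact eq_neg_of_add_eq_zero_right hsw

end TriangleProblem

/-! ### Geometry of the curve, the domain and the cells -/

namespace VertexCurve

variable {c : VertexCurve}

namespace Admissible

variable (hc : c.Admissible)
include hc

theorem node_strictMonoOn : StrictMonoOn c.node (Iic (c.N + 1)) := by
  refine strictMonoOn_of_lt_succ ordConnected_Iic fun a _ _ ha => ?_
  exact hc.node_lt a (by simpa using ha)

theorem node_lt_node {i j : ℕ} (hij : i < j) (hj : j ≤ c.N + 1) : c.node i < c.node j :=
  hc.node_strictMonoOn (hij.le.trans hj) hj hij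

theorem node_le_node {i j : ℕ} (hij : i ≤ j) (hj : j ≤ c.N + 1) : c.node i ≤ c.node j :=
  hc.node_strictMonoOn.monotoneOn (hij.trans hj) hj hij

theorem node_nonneg {j : ℕ} (hj : j ≤ c.N + 1) : 0 ≤ c.node j := by
  rw [← hc.node_zero]; exact hc.node_le_node (Nat.zero_le j) hj

theorem node_le_len {j : ℕ} (hj : j ≤ c.N + 1) : c.node j ≤ c.len := hc.node_le_node hj le_rfl

theorem len_pos : 0 < c.len := by
  have := hc.node_lt_node (i := 0) (Nat.succ_pos c.N) le_rfl
  rwa [hc.node_zero] at this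

theorem node_mem {j : ℕ} (hj : j ≤ c.N + 1) : c.node j ∈ Icc 0 c.len :=
  ⟨hc.node_nonneg hj, hc.node_le_len hj⟩

theorem closedArc_subset {j : ℕ} (hj : j ≤ c.N) : c.closedArc j ⊆ Icc 0 c.len := fun _ hμ =>
  ⟨(hc.node_nonneg (by lia)).trans hμ.1, hμ.2.trans (hc.node_le_len (by lia))⟩

omit hc in
theorem arc_subset_closedArc (j : ℕ) : c.arc j ⊆ c.closedArc j := Ioo_subset_Icc_self

theorem arc_subset {j : ℕ} (hj : j ≤ c.N) : c.arc j ⊆ Ioo 0 c.len := fun _ hμ =>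
  ⟨(hc.node_nonneg (by lia)).trans_lt hμ.1, hμ.2.trans_le (hc.node_le_len (by lia))⟩

theorem index_le_of_mem {j k : ℕ} (hj : j ≤ c.N) {α β : ℝ} (hα : α ∈ c.arc k)
    (hβ : β ∈ c.arc j) (h : β ≤ α) : j ≤ k := by
  by_contra hjk
  have := hc.node_le_node (i := k + 1) (j := j) (by lia) (by lia)
  have h1 := hα.2
  have h2 := hβ.1
  linarith

theorem continuousOn_of_closedArc {f : ℝ → ℝ}
    (hf : ∀ j ≤ c.N, ContinuousOn f (c.closedArc j)) : ContinuousOn f (Icc 0 c.len) := by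
  have key : ∀ k ≤ c.N, ContinuousOn f (Icc (c.node 0) (c.node (k + 1))) := by
    intro k
    induction k with
    | zero => exact fun h => hf 0 h
    | succ k ih =>
      intro hk
      rw [← Icc_union_Icc_eq_Icc (hc.node_le_node (Nat.zero_le (k + 1)) (by lia))
        (hc.node_lt (k + 1) hk).le]
      exact (ih (by lia)).union_of_isClosed (hf (k + 1) hk) isClosed_Icc isClosed_Icc
  have := key c.N le_rfl
  rwa [hc.node_zero] at this

theorem continuousOn_L₁ : ContinuousOn c.L₁ (Icc 0 c.len) :=
  hc.continuousOn_of_closedArc fun j hj => (hc.smooth₁ j hj).continuousOn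

theorem continuousOn_L₂ : ContinuousOn c.L₂ (Icc 0 c.len) :=
  hc.continuousOn_of_closedArc fun j hj => (hc.smooth₂ j hj).continuousOn

theorem vs_anti {i j : ℕ} (hij : i ≤ j) (hj : j ≤ c.N + 1) : c.vs j ≤ c.vs i :=
  hc.antitone₁ (hc.node_mem (hij.trans hj)) (hc.node_mem hj) (hc.node_le_node hij hj)

theorem vt_mono {i j : ℕ} (hij : i ≤ j) (hj : j ≤ c.N + 1) : c.vt i ≤ c.vt j :=
  hc.monotone₂ (hc.node_mem (hij.trans hj)) (hc.node_mem hj) (hc.node_le_node hij hj)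

theorem L₁_nonneg {μ : ℝ} (hμ : μ ∈ Icc 0 c.len) : 0 ≤ c.L₁ μ := by
  rw [← hc.finish]; exact hc.antitone₁ hμ ⟨hc.len_pos.le, le_rfl⟩ hμ.2

theorem L₂_nonneg {μ : ℝ} (hμ : μ ∈ Icc 0 c.len) : 0 ≤ c.L₂ μ := by
  rw [← hc.start]; exact hc.monotone₂ ⟨le_rfl, hc.len_pos.le⟩ hμ hμ.1

theorem L₁_pos {μ : ℝ} (hμ : μ ∈ Ico 0 c.len) : 0 < c.L₁ μ := by
  have hm : (μ + c.len) / 2 ∈ Ioo 0 c.len := ⟨by linarith [hμ.1, hc.len_pos], by linarith [hμ.2]⟩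
  exact (hc.pos _ hm).1.trans_le (hc.antitone₁ (Ico_subset_Icc_self hμ) (Ioo_subset_Icc_self hm)
    (by linarith [hμ.2]))

theorem L₂_pos {μ : ℝ} (hμ : μ ∈ Ioc 0 c.len) : 0 < c.L₂ μ := by
  have hm : μ / 2 ∈ Ioo 0 c.len := ⟨by linarith [hμ.1], by linarith [hμ.2, hμ.1]⟩
  exact (hc.pos _ hm).2.trans_le (hc.monotone₂ (Ioo_subset_Icc_self hm) (Ioc_subset_Icc_self hμ)
    (by linarith [hμ.1]))

theorem hasDerivAt_L₁ {j : ℕ} (hj : j ≤ c.N) {μ : ℝ} (hμ : μ ∈ c.arc j) :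
    HasDerivAt c.L₁ (-c.n₂ μ) μ := by
  have h := (hc.smooth₁ j hj).contDiffAt (Icc_mem_nhds hμ.1 hμ.2)
  simpa only [n₂, neg_neg] using (h.differentiableAt (by norm_num)).hasDerivAt

theorem hasDerivAt_L₂ {j : ℕ} (hj : j ≤ c.N) {μ : ℝ} (hμ : μ ∈ c.arc j) :
    HasDerivAt c.L₂ (c.n₁ μ) μ := by
  have h := (hc.smooth₂ j hj).contDiffAt (Icc_mem_nhds hμ.1 hμ.2)
  exact (h.differentiableAt (by norm_num)).hasDerivAt

theorem n₁_nonneg {j : ℕ} (hj : j ≤ c.N) {μ : ℝ} (hμ : μ ∈ c.arc j) : 0 ≤ c.n₁ μ := by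
  have h := (hasDerivAt_iff_tendsto_slope.1 (hc.hasDerivAt_L₂ hj hμ)).mono_left
    (nhdsWithin_mono μ (show Ioi μ ⊆ {μ}ᶜ from fun x hx => (show μ < x from hx).ne'))
  refine ge_of_tendsto h ?_
  filter_upwards [Ioo_mem_nhdsGT hμ.2] with x hx
  rw [slope_def_field]
  refine div_nonneg (sub_nonneg.2 (hc.monotone₂ (Ioo_subset_Icc_self (hc.arc_subset hj hμ)) ?_
    hx.1.le)) (sub_nonneg.2 hx.1.le)
  exact hc.closedArc_subset hj ⟨hμ.1.le.trans hx.1.le, hx.2.le⟩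

theorem n₂_nonneg {j : ℕ} (hj : j ≤ c.N) {μ : ℝ} (hμ : μ ∈ c.arc j) : 0 ≤ c.n₂ μ := by
  have h := (hasDerivAt_iff_tendsto_slope.1 (hc.hasDerivAt_L₁ hj hμ)).mono_left
    (nhdsWithin_mono μ (show Ioi μ ⊆ {μ}ᶜ from fun x hx => (show μ < x from hx).ne'))
  refine neg_nonpos.1 (le_of_tendsto h ?_)
  filter_upwards [Ioo_mem_nhdsGT hμ.2] with x hx
  rw [slope_def_field]
  refine div_nonpos_of_nonpos_of_nonneg (sub_nonpos.2 (hc.antitone₁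
    (Ioo_subset_Icc_self (hc.arc_subset hj hμ)) ?_ hx.1.le)) (sub_nonneg.2 hx.1.le)
  exact hc.closedArc_subset hj ⟨hμ.1.le.trans hx.1.le, hx.2.le⟩

theorem n_sq {j : ℕ} (hj : j ≤ c.N) {μ : ℝ} (hμ : μ ∈ c.arc j) : c.n₁ μ ^ 2 + c.n₂ μ ^ 2 = 1 := by
  have := hc.unit_speed j hj μ hμ
  simp only [n₁, n₂, neg_sq]; linarith

theorem n₁_le {j : ℕ} (hj : j ≤ c.N) {μ : ℝ} (hμ : μ ∈ c.arc j) : c.n₁ μ ≤ 1 := by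
  nlinarith [hc.n_sq hj hμ, sq_nonneg (c.n₂ μ)]

theorem n₂_le {j : ℕ} (hj : j ≤ c.N) {μ : ℝ} (hμ : μ ∈ c.arc j) : c.n₂ μ ≤ 1 := by
  nlinarith [hc.n_sq hj hμ, sq_nonneg (c.n₁ μ)]

theorem n_of_horizontal {j : ℕ} (hj : j ≤ c.N) (h : c.IsHorizontal j) {μ : ℝ} (hμ : μ ∈ c.arc j) :
    c.n₁ μ = 0 ∧ c.n₂ μ = 1 := by
  have h1 : c.n₁ μ = 0 := by
    have : c.L₂ =ᶠ[𝓝 μ] fun _ => c.vt j := by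
      filter_upwards [Icc_mem_nhds hμ.1 hμ.2] with x hx using h x hx
    rw [n₁, this.deriv_eq, deriv_const]
  have h2 := hc.n_sq hj hμ
  have h3 := hc.n₂_nonneg hj hμ
  rw [h1] at h2
  exact ⟨h1, by nlinarith⟩

theorem n_of_vertical {j : ℕ} (hj : j ≤ c.N) (h : c.IsVertical j) {μ : ℝ} (hμ : μ ∈ c.arc j) :
    c.n₁ μ = 1 ∧ c.n₂ μ = 0 := by
  have h1 : c.n₂ μ = 0 := by
    have : c.L₁ =ᶠ[𝓝 μ] fun _ => c.vs j := by
      filter_upwards [Icc_mem_nhds hμ.1 hμ.2] with x hx using h x hx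
    rw [n₂, this.deriv_eq, deriv_const, neg_zero]
  have h2 := hc.n_sq hj hμ
  have h3 := hc.n₁_nonneg hj hμ
  rw [h1] at h2
  exact ⟨by nlinarith, h1⟩

theorem n₂_pos {k : ℕ} (hk : k ≤ c.N) (h : ¬c.IsVertical k) {μ : ℝ} (hμ : μ ∈ c.arc k) :
    0 < c.n₂ μ := by
  rcases hc.arc_kind k hk with (h' | h') | h'
  · rw [(hc.n_of_horizontal hk h' hμ).2]; exact one_pos
  · exact absurd h' h
  · exact (h' μ hμ).2

theorem n₁_pos {k : ℕ} (hk : k ≤ c.N) (h : ¬c.IsHorizontal k) {μ : ℝ} (hμ : μ ∈ c.arc k) :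
    0 < c.n₁ μ := by
  rcases hc.arc_kind k hk with (h' | h') | h'
  · exact absurd h' h
  · rw [(hc.n_of_vertical hk h' hμ).1]; exact one_pos
  · exact (h' μ hμ).1

theorem not_vertical_of_horizontal {k : ℕ} (hk : k ≤ c.N) (h : c.IsHorizontal k) :
    ¬c.IsVertical k := by
  intro h'
  obtain ⟨μ, hμ⟩ := nonempty_Ioo.2 (hc.node_lt k hk)
  have h1 := (hc.n_of_horizontal hk h hμ).1
  have h2 := (hc.n_of_vertical hk h' hμ).1
  linarith

theorem oblique_iff {k : ℕ} (hk : k ≤ c.N) :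
    c.IsOblique k ↔ ¬c.IsVertical k ∧ ¬c.IsHorizontal k := by
  constructor
  · intro h
    obtain ⟨μ, hμ⟩ := nonempty_Ioo.2 (hc.node_lt k hk)
    have h0 := h μ hμ
    refine ⟨fun h' => ?_, fun h' => ?_⟩
    · have := (hc.n_of_vertical hk h' hμ).2; linarith
    · have := (hc.n_of_horizontal hk h' hμ).1; linarith
  · intro h μ hμ
    exact ⟨hc.n₁_pos hk h.2 hμ, hc.n₂_pos hk h.1 hμ⟩

theorem strictAntiOn_L₁ {k : ℕ} (hk : k ≤ c.N) (h : ¬c.IsVertical k) :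
    StrictAntiOn c.L₁ (c.closedArc k) := by
  refine strictAntiOn_of_deriv_neg (convex_Icc _ _) (hc.smooth₁ k hk).continuousOn fun x hx => ?_
  rw [interior_Icc] at hx
  have := hc.n₂_pos hk h hx
  rw [n₂] at this; linarith

theorem strictMonoOn_L₂ {k : ℕ} (hk : k ≤ c.N) (h : ¬c.IsHorizontal k) :
    StrictMonoOn c.L₂ (c.closedArc k) := by
  refine strictMonoOn_of_deriv_pos (convex_Icc _ _) (hc.smooth₂ k hk).continuousOn fun x hx => ?_
  rw [interior_Icc] at hx
  exact hc.n₁_pos hk h hx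

theorem left_mem_closedArc {k : ℕ} (hk : k ≤ c.N) : c.node k ∈ c.closedArc k :=
  ⟨le_rfl, (hc.node_lt k hk).le⟩

theorem right_mem_closedArc {k : ℕ} (hk : k ≤ c.N) : c.node (k + 1) ∈ c.closedArc k :=
  ⟨(hc.node_lt k hk).le, le_rfl⟩

theorem vertical_iff {k : ℕ} (hk : k ≤ c.N) : c.IsVertical k ↔ c.vs (k + 1) = c.vs k := by
  constructor
  · exact fun h => h _ (hc.right_mem_closedArc hk)
  · intro h μ hμ
    refine le_antisymm (hc.antitone₁ (hc.node_mem (by lia)) (hc.closedArc_subset hk hμ) hμ.1) ?_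
    rw [← h]
    exact hc.antitone₁ (hc.closedArc_subset hk hμ) (hc.node_mem (by lia)) hμ.2

theorem horizontal_iff {k : ℕ} (hk : k ≤ c.N) : c.IsHorizontal k ↔ c.vt (k + 1) = c.vt k := by
  constructor
  · exact fun h => h _ (hc.right_mem_closedArc hk)
  · intro h μ hμ
    refine le_antisymm ?_ (hc.monotone₂ (hc.node_mem (by lia)) (hc.closedArc_subset hk hμ) hμ.1)
    rw [← h]
    exact hc.monotone₂ (hc.closedArc_subset hk hμ) (hc.node_mem (by lia)) hμ.2

/-- An interior point remains in `G` after a small diagonal shift in both directions, which makes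
all inequalities strict. Conversely, the open rectangle spanned by the origin and a curve point lies
in `G`. -/
theorem mem_interior_iff {z : ℝ × ℝ} : z ∈ interior c.G ↔
    0 < z.1 ∧ 0 < z.2 ∧ ∃ μ ∈ Icc 0 c.len, z.1 < c.L₁ μ ∧ z.2 < c.L₂ μ := by
  constructor
  · intro hz
    obtain ⟨ε, hε, hb⟩ := Metric.isOpen_iff.1 isOpen_interior z hz
    have h1 : (z.1 + ε / 2, z.2 + ε / 2) ∈ c.G := interior_subset (hb (by
      rw [Metric.mem_ball, Prod.dist_eq]
      simp only [Real.dist_eq, add_sub_cancel_left, max_self]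
      rw [abs_of_pos (by linarith)]; linarith))
    have h2 : (z.1 - ε / 2, z.2 - ε / 2) ∈ c.G := interior_subset (hb (by
      rw [Metric.mem_ball, Prod.dist_eq]
      simp only [Real.dist_eq, sub_sub_cancel_left, max_self, abs_neg]
      rw [abs_of_pos (by linarith)]; linarith))
    obtain ⟨μ, hμ, h3, h4⟩ := h1
    obtain ⟨μ', hμ', h5, h6⟩ := h2
    exact ⟨by linarith [h5.1], by linarith [h6.1], μ, hμ, by linarith [h3.2], by linarith [h4.2]⟩
  · rintro ⟨h1, h2, μ, hμ, h3, h4⟩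
    refine interior_maximal (s := c.G) (t := Ioo 0 (c.L₁ μ) ×ˢ Ioo 0 (c.L₂ μ)) ?_
      (isOpen_Ioo.prod isOpen_Ioo) ⟨⟨h1, h3⟩, ⟨h2, h4⟩⟩
    rintro y ⟨hy1, hy2⟩
    exact ⟨μ, hμ, Ioo_subset_Icc_self hy1, Ioo_subset_Icc_self hy2⟩

theorem mem_G {α β : ℝ} (hβ : 0 ≤ β) (hβα : β ≤ α) (hα : α ≤ c.len) : (c.L₁ α, c.L₂ β) ∈ c.G := by
  have h1 : α ∈ Icc 0 c.len := ⟨hβ.trans hβα, hα⟩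
  have h2 : β ∈ Icc 0 c.len := ⟨hβ, hβα.trans hα⟩
  exact ⟨α, h1, ⟨hc.L₁_nonneg h1, le_rfl⟩, ⟨hc.L₂_nonneg h2, hc.monotone₂ h2 h1 hβα⟩⟩

theorem point_mem_G {μ : ℝ} (hμ : μ ∈ Icc 0 c.len) : c.point μ ∈ c.G :=
  hc.mem_G hμ.1 le_rfl hμ.2

theorem isOpen_cell (j k : ℕ) : IsOpen (c.cell j k) :=
  isOpen_interior.inter ((isOpen_Ioo.preimage continuous_fst).inter
    (isOpen_Ioo.preimage continuous_snd))

/-- The intermediate value theorem gives the curve points above and to the right of `z`. A curve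
point `μ` strictly beyond `z` in both coordinates separates them, `β < μ < α`, and this forces `j ≤
k`. -/
theorem exists_of_mem_cell {j k : ℕ} (hj : j ≤ c.N) (hk : k ≤ c.N) {z : ℝ × ℝ}
    (hz : z ∈ c.cell j k) :
    ¬c.IsHorizontal j ∧ ¬c.IsVertical k ∧ j ≤ k ∧
    ∃ α ∈ c.arc k, ∃ β ∈ c.arc j, β < α ∧ c.L₁ α = z.1 ∧ c.L₂ β = z.2 := by
  obtain ⟨hi, h1, h2⟩ := hz
  obtain ⟨p1, p2, μ, hμ, hm1, hm2⟩ := hc.mem_interior_iff.1 hi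
  have hnj : ¬c.IsHorizontal j := fun h => by
    have := (hc.horizontal_iff hj).1 h
    linarith [h2.1, h2.2]
  have hnk : ¬c.IsVertical k := fun h => by
    have := (hc.vertical_iff hk).1 h
    linarith [h1.1, h1.2]
  obtain ⟨α, hα, hα'⟩ := intermediate_value_Ioo' (hc.node_lt k hk).le
    (hc.smooth₁ k hk).continuousOn h1
  obtain ⟨β, hβ, hβ'⟩ := intermediate_value_Ioo (hc.node_lt j hj).le
    (hc.smooth₂ j hj).continuousOn h2
  have hαm := Ioo_subset_Icc_self (hc.arc_subset hk hα)
  have hβm := Ioo_subset_Icc_self (hc.arc_subset hj hβ)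
  have h3 : μ < α := by
    by_contra h
    have := hc.antitone₁ hαm hμ (not_lt.1 h)
    linarith
  have h4 : β < μ := by
    by_contra h
    have := hc.monotone₂ hμ hβm (not_lt.1 h)
    linarith
  exact ⟨hnj, hnk, hc.index_le_of_mem hj hα hβ (h4.trans h3).le, α, hα, β, hβ, h4.trans h3, hα', hβ'⟩

theorem mem_cell {j k : ℕ} (hj : j ≤ c.N) (hk : k ≤ c.N) (hnj : ¬c.IsHorizontal j)
    (hnk : ¬c.IsVertical k) {α β : ℝ} (hα : α ∈ c.arc k) (hβ : β ∈ c.arc j) (h : β < α) :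
    (c.L₁ α, c.L₂ β) ∈ c.cell j k := by
  have hs := hc.strictAntiOn_L₁ hk hnk
  have ht := hc.strictMonoOn_L₂ hj hnj
  have hα' := arc_subset_closedArc k hα
  have hβ' := arc_subset_closedArc j hβ
  have hjk := hc.index_le_of_mem hj hα hβ h.le
  refine ⟨hc.mem_interior_iff.2 ⟨(hc.pos α (hc.arc_subset hk hα)).1,
    (hc.pos β (hc.arc_subset hj hβ)).2, ?_⟩, ⟨hs hα' (hc.right_mem_closedArc hk) hα.2,
    hs (hc.left_mem_closedArc hk) hα' hα.1⟩, ⟨ht (hc.left_mem_closedArc hj) hβ' hβ.1,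
    ht hβ' (hc.right_mem_closedArc hj) hβ.2⟩⟩
  -- A curve point strictly beyond the given point is needed: on a single arc the midpoint of the
  -- parameters serves, for different arcs vertex `k`.
  rcases hjk.eq_or_lt with rfl | hjk
  · have hm : (α + β) / 2 ∈ c.closedArc j := ⟨by linarith [hα'.1, hβ'.1], by linarith [hα'.2, hβ'.2]⟩
    exact ⟨_, hc.closedArc_subset hj hm, hs hm hα' (by linarith), ht hβ' hm (by linarith)⟩
  · exact ⟨c.node k, hc.node_mem (by lia), hs (hc.left_mem_closedArc hk) hα' hα.1,
      (ht hβ' (hc.right_mem_closedArc hj) hβ.2).trans_le (hc.vt_mono (by lia) (by lia))⟩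

theorem ne_vs {k : ℕ} (hk : k ≤ c.N) {s : ℝ} (hs : s ∈ Ioo (c.vs (k + 1)) (c.vs k)) :
    ∀ r ≤ c.N + 1, s ≠ c.vs r := by
  intro r hr h
  rcases le_or_gt r k with h' | h'
  · have := hc.vs_anti h' (by lia); linarith [hs.2]
  · have := hc.vs_anti (i := k + 1) h' hr; linarith [hs.1]

theorem ne_vt {k : ℕ} (hk : k ≤ c.N) {t : ℝ} (ht : t ∈ Ioo (c.vt k) (c.vt (k + 1))) :
    ∀ r ≤ c.N + 1, t ≠ c.vt r := by
  intro r hr h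
  rcases le_or_gt r k with h' | h'
  · have := hc.vt_mono h' (by lia); linarith [ht.1]
  · have := hc.vt_mono (i := k + 1) h' hr; linarith [ht.2]

theorem cell_subset_intGR {j k : ℕ} (hj : j ≤ c.N) (hk : k ≤ c.N) : c.cell j k ⊆ c.intGR :=
  fun _ hz => ⟨hz.1, interior_subset hz.1, fun r hr =>
    ⟨hc.ne_vs hk hz.2.1 r hr, hc.ne_vt hj hz.2.2 r hr⟩⟩

theorem exists_vs_between {s : ℝ} (h0 : 0 < s) {μ : ℝ} (hμ : μ ∈ Icc 0 c.len) (h1 : s < c.L₁ μ)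
    (hne : ∀ r ≤ c.N + 1, s ≠ c.vs r) : ∃ k ≤ c.N, s ∈ Ioo (c.vs (k + 1)) (c.vs k) := by
  have key : ∀ k ≤ c.N + 1, s < c.vs k ∨ ∃ i ≤ c.N, s ∈ Ioo (c.vs (i + 1)) (c.vs i) := by
    intro k
    induction k with
    | zero =>
      intro _
      left
      rw [vs, hc.node_zero]
      exact h1.trans_le (hc.antitone₁ ⟨le_rfl, hc.len_pos.le⟩ hμ hμ.1)
    | succ k ih =>
      intro hk
      rcases ih (by lia) with h | h
      · rcases lt_or_gt_of_ne (hne (k + 1) hk) with h' | h'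
        · exact Or.inl h'
        · exact Or.inr ⟨k, by lia, h', h⟩
      · exact Or.inr h
  rcases key (c.N + 1) le_rfl with h | h
  · have : c.vs (c.N + 1) = 0 := hc.finish
    linarith
  · exact h

theorem exists_vt_between {t : ℝ} (h0 : 0 < t) {μ : ℝ} (hμ : μ ∈ Icc 0 c.len) (h1 : t < c.L₂ μ)
    (hne : ∀ r ≤ c.N + 1, t ≠ c.vt r) : ∃ k ≤ c.N, t ∈ Ioo (c.vt k) (c.vt (k + 1)) := by
  have key : ∀ k ≤ c.N + 1, c.vt k < t ∨ ∃ i ≤ c.N, t ∈ Ioo (c.vt i) (c.vt (i + 1)) := by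
    intro k
    induction k with
    | zero =>
      intro _
      left
      rw [vt, hc.node_zero, hc.start]
      exact h0
    | succ k ih =>
      intro hk
      rcases ih (by lia) with h | h
      · rcases lt_or_gt_of_ne (hne (k + 1) hk) with h' | h'
        · exact Or.inr ⟨k, by lia, h, h'⟩
        · exact Or.inl h'
      · exact Or.inr h
  rcases key (c.N + 1) le_rfl with h | h
  · have : c.L₂ μ ≤ c.vt (c.N + 1) := hc.monotone₂ hμ (hc.node_mem le_rfl) hμ.2
    linarith
  · exact h

theorem exists_cell {z : ℝ × ℝ} (hz : z ∈ c.intGR) : ∃ j ≤ c.N, ∃ k ≤ c.N, z ∈ c.cell j k := by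
  obtain ⟨h1, h2, μ, hμ, h3, h4⟩ := hc.mem_interior_iff.1 hz.1
  obtain ⟨k, hk, hk'⟩ := hc.exists_vs_between h1 hμ h3 fun r hr => (hz.2.2 r hr).1
  obtain ⟨j, hj, hj'⟩ := hc.exists_vt_between h2 hμ h4 fun r hr => (hz.2.2 r hr).2
  exact ⟨j, hj, k, hk, hz.1, hk', hj'⟩

end Admissible

end VertexCurve

/-! ### Partial derivatives and gradients -/

theorem dS_eq_fderiv {F : Type*} [NormedAddCommGroup F] [NormedSpace ℝ F] {φ : ℝ × ℝ → F}
    {z : ℝ × ℝ} (h : DifferentiableAt ℝ φ z) : dS φ z = fderiv ℝ φ z (1, 0) := by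
  have h1 : HasDerivAt (fun s : ℝ => (s, z.2)) (1, 0) z.1 :=
    (hasDerivAt_id z.1).prodMk (hasDerivAt_const z.1 z.2)
  exact (HasFDerivAt.comp_hasDerivAt z.1 (f := fun s : ℝ => (s, z.2)) h.hasFDerivAt h1).deriv

theorem dT_eq_fderiv {F : Type*} [NormedAddCommGroup F] [NormedSpace ℝ F] {φ : ℝ × ℝ → F}
    {z : ℝ × ℝ} (h : DifferentiableAt ℝ φ z) : dT φ z = fderiv ℝ φ z (0, 1) := by
  have h1 : HasDerivAt (fun t : ℝ => (z.1, t)) (0, 1) z.2 :=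
    (hasDerivAt_const z.2 z.1).prodMk (hasDerivAt_id z.2)
  exact (HasFDerivAt.comp_hasDerivAt z.2 (f := fun t : ℝ => (z.1, t)) h.hasFDerivAt h1).deriv

theorem hasDerivAt_dS {F : Type*} [NormedAddCommGroup F] [NormedSpace ℝ F] {φ : ℝ × ℝ → F}
    {z : ℝ × ℝ} (h : DifferentiableAt ℝ φ z) :
    HasDerivAt (fun s => φ (s, z.2)) (dS φ z) z.1 := by
  have h1 : HasDerivAt (fun s : ℝ => (s, z.2)) (1, 0) z.1 :=
    (hasDerivAt_id z.1).prodMk (hasDerivAt_const z.1 z.2)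
  exact (HasFDerivAt.comp_hasDerivAt z.1 (f := fun s : ℝ => (s, z.2))
    h.hasFDerivAt h1).differentiableAt.hasDerivAt

theorem hasDerivAt_dT {F : Type*} [NormedAddCommGroup F] [NormedSpace ℝ F] {φ : ℝ × ℝ → F}
    {z : ℝ × ℝ} (h : DifferentiableAt ℝ φ z) :
    HasDerivAt (fun t => φ (z.1, t)) (dT φ z) z.2 := by
  have h1 : HasDerivAt (fun t : ℝ => (z.1, t)) (0, 1) z.2 :=
    (hasDerivAt_const z.2 z.1).prodMk (hasDerivAt_id z.2)
  exact (HasFDerivAt.comp_hasDerivAt z.2 (f := fun t : ℝ => (z.1, t))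
    h.hasFDerivAt h1).differentiableAt.hasDerivAt

theorem contDiffOn_dS {F : Type*} [NormedAddCommGroup F] [NormedSpace ℝ F] {φ : ℝ × ℝ → F}
    {O : Set (ℝ × ℝ)} (hO : IsOpen O) {k : ℕ} (h : ContDiffOn ℝ (k + 1) φ O) :
    ContDiffOn ℝ k (dS φ) O := by
  have h1 : ContDiffOn ℝ k (fun z => fderiv ℝ φ z (1, 0)) O :=
    (h.fderiv_of_isOpen hO le_rfl).clm_apply contDiffOn_const
  exact h1.congr fun z hz => dS_eq_fderiv ((h.contDiffAt (hO.mem_nhds hz)).differentiableAt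
    (by simp))

theorem contDiffOn_dT {F : Type*} [NormedAddCommGroup F] [NormedSpace ℝ F] {φ : ℝ × ℝ → F}
    {O : Set (ℝ × ℝ)} (hO : IsOpen O) {k : ℕ} (h : ContDiffOn ℝ (k + 1) φ O) :
    ContDiffOn ℝ k (dT φ) O := by
  have h1 : ContDiffOn ℝ k (fun z => fderiv ℝ φ z (0, 1)) O :=
    (h.fderiv_of_isOpen hO le_rfl).clm_apply contDiffOn_const
  exact h1.congr fun z hz => dT_eq_fderiv ((h.contDiffAt (hO.mem_nhds hz)).differentiableAt
    (by simp))

theorem sum_mul_eq_inner {n : ℕ} (ψ y : Euc n) : ∑ j, ψ j * y j = inner ℝ ψ y := by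
  rw [EuclideanSpace.inner_eq_star_dotProduct]
  simp [dotProduct, mul_comm]

theorem gradient_eq_symm {n : ℕ} {g : Euc n → ℝ} {y : Euc n} :
    gradient g y = (InnerProductSpace.toDual ℝ (Euc n)).symm (fderiv ℝ g y) := rfl

theorem gradient_inner_comp {n : ℕ} {h : Euc n → Euc n} {y : Euc n}
    (hh : DifferentiableAt ℝ h y) (ψ : Euc n) :
    gradient (fun y => inner ℝ ψ (h y)) y = ContinuousLinearMap.adjoint (fderiv ℝ h y) ψ := by
  refine HasGradientAt.gradient ?_
  rw [hasGradientAt_iff_hasFDerivAt]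
  have h1 := ((innerSL ℝ ψ).hasFDerivAt (x := h y)).comp y hh.hasFDerivAt
  refine h1.congr_fderiv ?_
  ext v
  simp [ContinuousLinearMap.adjoint_inner_left]

/-- The gradient of the Hamiltonian in one group of arguments: affine in the co-state, with the
adjoint of the partial derivative of `f` as its linear part. -/
theorem gradient_add_inner_comp {n : ℕ} {g : Euc n → ℝ} {h : Euc n → Euc n} {y : Euc n}
    (hg : DifferentiableAt ℝ g y) (hh : DifferentiableAt ℝ h y) (ψ : Euc n) :
    gradient (fun y => g y + ∑ j, ψ j * h y j) y
      = gradient g y + ContinuousLinearMap.adjoint (fderiv ℝ h y) ψ := by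
  rw [← gradient_inner_comp hh]
  simp only [sum_mul_eq_inner, gradient_eq_symm]
  rw [fderiv_fun_add hg ((differentiableAt_const ψ).inner ℝ hh), map_add]

namespace ControlData

variable {n m : ℕ} (D : ControlData n m) (c : VertexCurve)

/-! ### The trajectory and the coefficients of the Hamiltonian equations -/

/-- The arguments of `f` and `Φ` along the trajectory. -/
def traj (z : ℝ × ℝ) : ℝ × ℝ × Euc n × Euc n × Euc n × Euc m :=
  (z.1, z.2, D.x z, dS D.x z, dT D.x z, D.u z)

def fx (z : ℝ × ℝ) : Euc n →L[ℝ] Euc n :=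
  fderiv ℝ (fun y => D.f (z.1, z.2, y, dS D.x z, dT D.x z, D.u z)) (D.x z)

def fp (z : ℝ × ℝ) : Euc n →L[ℝ] Euc n :=
  fderiv ℝ (fun y => D.f (z.1, z.2, D.x z, y, dT D.x z, D.u z)) (dS D.x z)

def fq (z : ℝ × ℝ) : Euc n →L[ℝ] Euc n :=
  fderiv ℝ (fun y => D.f (z.1, z.2, D.x z, dS D.x z, y, D.u z)) (dT D.x z)

def Φx (z : ℝ × ℝ) : Euc n :=
  gradient (fun y => D.Φ (z.1, z.2, y, dS D.x z, dT D.x z, D.u z)) (D.x z)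

def adjfp (z : ℝ × ℝ) : Euc n →L[ℝ] Euc n := ContinuousLinearMap.adjoint (D.fp z)

def adjfq (z : ℝ × ℝ) : Euc n →L[ℝ] Euc n := ContinuousLinearMap.adjoint (D.fq z)

/-- The coefficients of the right-hand side `a + A ψ - f_p* ψ_s - f_q* ψ_t`. -/
def coefa (z : ℝ × ℝ) : Euc n := D.Φx z - dS D.Φp z - dT D.Φq z

def coefA (z : ℝ × ℝ) : Euc n →L[ℝ] Euc n :=
  ContinuousLinearMap.adjoint (D.fx z) - dS D.adjfp z - dT D.adjfq z

def coefB (z : ℝ × ℝ) : Euc n →L[ℝ] Euc n := -D.adjfp z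

def coefC (z : ℝ × ℝ) : Euc n →L[ℝ] Euc n := -D.adjfq z

abbrev embx : Euc n →L[ℝ] ℝ × ℝ × Euc n × Euc n × Euc n × Euc m :=
  (ContinuousLinearMap.inr ℝ ℝ (ℝ × Euc n × Euc n × Euc n × Euc m)).comp
    ((ContinuousLinearMap.inr ℝ ℝ (Euc n × Euc n × Euc n × Euc m)).comp
      (ContinuousLinearMap.inl ℝ (Euc n) (Euc n × Euc n × Euc m)))

abbrev embp : Euc n →L[ℝ] ℝ × ℝ × Euc n × Euc n × Euc n × Euc m :=
  (ContinuousLinearMap.inr ℝ ℝ (ℝ × Euc n × Euc n × Euc n × Euc m)).comp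
    ((ContinuousLinearMap.inr ℝ ℝ (Euc n × Euc n × Euc n × Euc m)).comp
      ((ContinuousLinearMap.inr ℝ (Euc n) (Euc n × Euc n × Euc m)).comp
        (ContinuousLinearMap.inl ℝ (Euc n) (Euc n × Euc m))))

abbrev embq : Euc n →L[ℝ] ℝ × ℝ × Euc n × Euc n × Euc n × Euc m :=
  (ContinuousLinearMap.inr ℝ ℝ (ℝ × Euc n × Euc n × Euc n × Euc m)).comp
    ((ContinuousLinearMap.inr ℝ ℝ (Euc n × Euc n × Euc n × Euc m)).comp
      ((ContinuousLinearMap.inr ℝ (Euc n) (Euc n × Euc n × Euc m)).comp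
        ((ContinuousLinearMap.inr ℝ (Euc n) (Euc n × Euc m)).comp
          (ContinuousLinearMap.inl ℝ (Euc n) (Euc m)))))

section partials

variable {V : Type*} [NormedAddCommGroup V] [NormedSpace ℝ V]
  {g : ℝ × ℝ × Euc n × Euc n × Euc n × Euc m → V} {D} {z : ℝ × ℝ}

theorem hasFDerivAt_x (h : DifferentiableAt ℝ g (D.traj z)) :
    HasFDerivAt (fun y => g (z.1, z.2, y, dS D.x z, dT D.x z, D.u z))
      ((fderiv ℝ g (D.traj z)).comp embx) (D.x z) := by
  have h1 : HasFDerivAt (fun y : Euc n => (z.1, z.2, y, dS D.x z, dT D.x z, D.u z))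
      (embx (n := n) (m := m)) (D.x z) :=
    HasFDerivAt.congr_fderiv ((hasFDerivAt_const _ _).prodMk ((hasFDerivAt_const _ _).prodMk
      ((hasFDerivAt_id _).prodMk (hasFDerivAt_const _ _)))) (ContinuousLinearMap.ext fun _ => rfl)
  exact HasFDerivAt.comp (D.x z) (g := g)
    (f := fun y : Euc n => (z.1, z.2, y, dS D.x z, dT D.x z, D.u z)) h.hasFDerivAt h1

theorem hasFDerivAt_p (h : DifferentiableAt ℝ g (D.traj z)) :
    HasFDerivAt (fun y => g (z.1, z.2, D.x z, y, dT D.x z, D.u z))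
      ((fderiv ℝ g (D.traj z)).comp embp) (dS D.x z) := by
  have h1 : HasFDerivAt (fun y : Euc n => (z.1, z.2, D.x z, y, dT D.x z, D.u z))
      (embp (n := n) (m := m)) (dS D.x z) :=
    HasFDerivAt.congr_fderiv ((hasFDerivAt_const _ _).prodMk ((hasFDerivAt_const _ _).prodMk
      ((hasFDerivAt_const _ _).prodMk ((hasFDerivAt_id _).prodMk (hasFDerivAt_const _ _)))))
      (ContinuousLinearMap.ext fun _ => rfl)
  exact HasFDerivAt.comp (dS D.x z) (g := g)
    (f := fun y : Euc n => (z.1, z.2, D.x z, y, dT D.x z, D.u z)) h.hasFDerivAt h1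

theorem hasFDerivAt_q (h : DifferentiableAt ℝ g (D.traj z)) :
    HasFDerivAt (fun y => g (z.1, z.2, D.x z, dS D.x z, y, D.u z))
      ((fderiv ℝ g (D.traj z)).comp embq) (dT D.x z) := by
  have h1 : HasFDerivAt (fun y : Euc n => (z.1, z.2, D.x z, dS D.x z, y, D.u z))
      (embq (n := n) (m := m)) (dT D.x z) :=
    HasFDerivAt.congr_fderiv ((hasFDerivAt_const _ _).prodMk ((hasFDerivAt_const _ _).prodMk
      ((hasFDerivAt_const _ _).prodMk ((hasFDerivAt_const _ _).prodMk
        ((hasFDerivAt_id _).prodMk (hasFDerivAt_const _ _))))))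
      (ContinuousLinearMap.ext fun _ => rfl)
  exact HasFDerivAt.comp (dT D.x z) (g := g)
    (f := fun y : Euc n => (z.1, z.2, D.x z, dS D.x z, y, D.u z)) h.hasFDerivAt h1

end partials

/-- The data are smooth on the open set `O`. -/
structure SmoothOn (O : Set (ℝ × ℝ)) : Prop where
  isOpen : IsOpen O
  f : ContDiffOn ℝ 2 D.f {y | (y.1, y.2.1) ∈ O}
  Φ : ContDiffOn ℝ 2 D.Φ {y | (y.1, y.2.1) ∈ O}
  x : ContDiffOn ℝ 2 D.x O
  u : ContDiffOn ℝ 1 D.u O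

theorem Smooth.smoothOn {D : ControlData n m} {c : VertexCurve} (h : D.Smooth c) :
    ∃ O, c.G ⊆ O ∧ D.SmoothOn O := by
  obtain ⟨O, h1, h2, h3, h4, h5, h6⟩ := h.interior_data
  exact ⟨O, h2, h1, h3, h4, h5, h6⟩

namespace SmoothOn

variable {D} {O : Set (ℝ × ℝ)} (h : D.SmoothOn O)
include h

theorem isOpen_dom : IsOpen {y : ℝ × ℝ × Euc n × Euc n × Euc n × Euc m | (y.1, y.2.1) ∈ O} :=
  h.isOpen.preimage (by fun_prop)

theorem contDiffOn_traj : ContDiffOn ℝ 1 D.traj O :=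
  contDiffOn_fst.prodMk (contDiffOn_snd.prodMk ((h.x.of_le (by norm_num)).prodMk
    ((contDiffOn_dS h.isOpen (k := 1) (by norm_num; exact h.x)).prodMk
      ((contDiffOn_dT h.isOpen (k := 1) (by norm_num; exact h.x)).prodMk h.u))))

theorem differentiableAt_f {z : ℝ × ℝ} (hz : z ∈ O) : DifferentiableAt ℝ D.f (D.traj z) :=
  (h.f.contDiffAt (h.isOpen_dom.mem_nhds hz)).differentiableAt (by norm_num)

theorem differentiableAt_Φ {z : ℝ × ℝ} (hz : z ∈ O) : DifferentiableAt ℝ D.Φ (D.traj z) :=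
  (h.Φ.contDiffAt (h.isOpen_dom.mem_nhds hz)).differentiableAt (by norm_num)

theorem contDiffOn_fderiv_f : ContDiffOn ℝ 1 (fun z => fderiv ℝ D.f (D.traj z)) O :=
  (h.f.fderiv_of_isOpen h.isOpen_dom (m := 1) (by norm_num)).comp h.contDiffOn_traj fun _ hz => hz

theorem contDiffOn_fderiv_Φ : ContDiffOn ℝ 1 (fun z => fderiv ℝ D.Φ (D.traj z)) O :=
  (h.Φ.fderiv_of_isOpen h.isOpen_dom (m := 1) (by norm_num)).comp h.contDiffOn_traj fun _ hz => hz

theorem contDiffOn_fx : ContDiffOn ℝ 1 D.fx O :=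
  (h.contDiffOn_fderiv_f.clm_comp contDiffOn_const).congr fun _ hz =>
    (hasFDerivAt_x (h.differentiableAt_f hz)).fderiv

theorem contDiffOn_fp : ContDiffOn ℝ 1 D.fp O :=
  (h.contDiffOn_fderiv_f.clm_comp contDiffOn_const).congr fun _ hz =>
    (hasFDerivAt_p (h.differentiableAt_f hz)).fderiv

theorem contDiffOn_fq : ContDiffOn ℝ 1 D.fq O :=
  (h.contDiffOn_fderiv_f.clm_comp contDiffOn_const).congr fun _ hz =>
    (hasFDerivAt_q (h.differentiableAt_f hz)).fderiv

omit h in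
theorem contDiff_adjoint : ContDiff ℝ 1 fun A : Euc n →L[ℝ] Euc n =>
    ContinuousLinearMap.adjoint A :=
  ((ContinuousLinearMap.adjoint (𝕜 := ℝ) (E := Euc n)
    (F := Euc n)).toLinearIsometry.toContinuousLinearMap).contDiff

omit h in
theorem contDiff_toDual_symm : ContDiff ℝ 1 (InnerProductSpace.toDual ℝ (Euc n)).symm :=
  ((InnerProductSpace.toDual ℝ (Euc n)).symm.toLinearIsometry.toContinuousLinearMap).contDiff

theorem contDiffOn_adjfp : ContDiffOn ℝ 1 D.adjfp O :=
  contDiff_adjoint.comp_contDiffOn h.contDiffOn_fp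

theorem contDiffOn_adjfq : ContDiffOn ℝ 1 D.adjfq O :=
  contDiff_adjoint.comp_contDiffOn h.contDiffOn_fq

theorem contDiffOn_Φx : ContDiffOn ℝ 1 D.Φx O :=
  (contDiff_toDual_symm.comp_contDiffOn
    (h.contDiffOn_fderiv_Φ.clm_comp (contDiffOn_const (c := embx)))).congr fun _ hz => by
    rw [Φx, gradient_eq_symm, (hasFDerivAt_x (h.differentiableAt_Φ hz)).fderiv]
    rfl

theorem contDiffOn_Φp : ContDiffOn ℝ 1 D.Φp O :=
  (contDiff_toDual_symm.comp_contDiffOn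
    (h.contDiffOn_fderiv_Φ.clm_comp (contDiffOn_const (c := embp)))).congr fun _ hz => by
    rw [Φp, gradient_eq_symm, (hasFDerivAt_p (h.differentiableAt_Φ hz)).fderiv]
    rfl

theorem contDiffOn_Φq : ContDiffOn ℝ 1 D.Φq O :=
  (contDiff_toDual_symm.comp_contDiffOn
    (h.contDiffOn_fderiv_Φ.clm_comp (contDiffOn_const (c := embq)))).congr fun _ hz => by
    rw [Φq, gradient_eq_symm, (hasFDerivAt_q (h.differentiableAt_Φ hz)).fderiv]
    rfl

theorem continuousOn_coefa : ContinuousOn D.coefa O :=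
  (h.contDiffOn_Φx.continuousOn.sub (contDiffOn_dS h.isOpen (k := 0)
    (by simpa using h.contDiffOn_Φp)).continuousOn).sub
    (contDiffOn_dT h.isOpen (k := 0) (by simpa using h.contDiffOn_Φq)).continuousOn

theorem continuousOn_coefA : ContinuousOn D.coefA O :=
  ((contDiff_adjoint.comp_contDiffOn h.contDiffOn_fx).continuousOn.sub
    (contDiffOn_dS h.isOpen (k := 0) (by simpa using h.contDiffOn_adjfp)).continuousOn).sub
    (contDiffOn_dT h.isOpen (k := 0) (by simpa using h.contDiffOn_adjfq)).continuousOn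

theorem continuousOn_coefB : ContinuousOn D.coefB O := h.contDiffOn_adjfp.continuousOn.neg

theorem continuousOn_coefC : ContinuousOn D.coefC O := h.contDiffOn_adjfq.continuousOn.neg

theorem Hx_eq {z : ℝ × ℝ} (hz : z ∈ O) (ψ : Euc n) :
    D.Hx z ψ = D.Φx z + ContinuousLinearMap.adjoint (D.fx z) ψ :=
  gradient_add_inner_comp (hasFDerivAt_x (h.differentiableAt_Φ hz)).differentiableAt
    (hasFDerivAt_x (h.differentiableAt_f hz)).differentiableAt ψ

theorem Hp_eq {z : ℝ × ℝ} (hz : z ∈ O) (ψ : Euc n) : D.Hp z ψ = D.Φp z + D.adjfp z ψ :=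
  gradient_add_inner_comp (hasFDerivAt_p (h.differentiableAt_Φ hz)).differentiableAt
    (hasFDerivAt_p (h.differentiableAt_f hz)).differentiableAt ψ

theorem Hq_eq {z : ℝ × ℝ} (hz : z ∈ O) (ψ : Euc n) : D.Hq z ψ = D.Φq z + D.adjfq z ψ :=
  gradient_add_inner_comp (hasFDerivAt_q (h.differentiableAt_Φ hz)).differentiableAt
    (hasFDerivAt_q (h.differentiableAt_f hz)).differentiableAt ψ

theorem gradient_p_eq {z : ℝ × ℝ} (hz : z ∈ O) (ρ : Euc n) :
    -gradient (fun y => ∑ k, D.f (z.1, z.2, D.x z, y, dT D.x z, D.u z) k * ρ k) (dS D.x z)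
      = D.coefB z ρ := by
  rw [coefB, neg_apply, adjfp, fp,
    ← gradient_inner_comp (hasFDerivAt_p (h.differentiableAt_f hz)).differentiableAt]
  simp only [← sum_mul_eq_inner, mul_comm]

theorem gradient_q_eq {z : ℝ × ℝ} (hz : z ∈ O) (ρ : Euc n) :
    -gradient (fun y => ∑ k, D.f (z.1, z.2, D.x z, dS D.x z, y, D.u z) k * ρ k) (dT D.x z)
      = D.coefC z ρ := by
  rw [coefC, neg_apply, adjfq, fq,
    ← gradient_inner_comp (hasFDerivAt_q (h.differentiableAt_f hz)).differentiableAt]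
  simp only [← sum_mul_eq_inner, mul_comm]

/-- `H_p = Φ_p + f_p* ψ` and `H_q = Φ_q + f_q* ψ`. The product rule along the affine approximation
of the co-state separates the derivatives of the coefficients, which enter `coefa` and `coefA`, from
the derivatives of `ψ`, which are multiplied by `-f_p*` and `-f_q*`. -/
theorem rhs_eq {z : ℝ × ℝ} (hz : z ∈ O) (ψ P Q : Euc n) :
    D.rhs z ψ P Q = D.coefa z + D.coefA z ψ + D.coefB z P + D.coefC z Q := by
  have hd : ∀ {V : Type} [NormedAddCommGroup V] [NormedSpace ℝ V] {g : ℝ × ℝ → V},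
      ContDiffOn ℝ 1 g O → DifferentiableAt ℝ g z := fun hg =>
    (hg.contDiffAt (h.isOpen.mem_nhds hz)).differentiableAt (by norm_num)
  have e1 : HasDerivAt (fun s => D.Hp (s, z.2) (ψ + (s - z.1) • P))
      (dS D.Φp z + (dS D.adjfp z ψ + D.adjfp z P)) z.1 := by
    have h0 : HasDerivAt (fun s : ℝ => ψ + (s - z.1) • P) P z.1 := by
      simpa using (((hasDerivAt_id z.1).sub_const z.1).smul_const P).const_add ψ
    have h1 := (hasDerivAt_dS (hd h.contDiffOn_Φp)).add
      ((hasDerivAt_dS (hd h.contDiffOn_adjfp)).clm_apply h0)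
    simp only [sub_self, zero_smul, add_zero] at h1
    refine h1.congr_of_eventuallyEq ?_
    have : ∀ᶠ s in 𝓝 z.1, (s, z.2) ∈ O :=
      (Continuous.continuousAt (by fun_prop : Continuous fun s : ℝ => (s, z.2))).preimage_mem_nhds
        (h.isOpen.mem_nhds hz)
    filter_upwards [this] with s hs using h.Hp_eq hs _
  have e2 : HasDerivAt (fun t => D.Hq (z.1, t) (ψ + (t - z.2) • Q))
      (dT D.Φq z + (dT D.adjfq z ψ + D.adjfq z Q)) z.2 := by
    have h0 : HasDerivAt (fun t : ℝ => ψ + (t - z.2) • Q) Q z.2 := by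
      simpa using (((hasDerivAt_id z.2).sub_const z.2).smul_const Q).const_add ψ
    have h1 := (hasDerivAt_dT (hd h.contDiffOn_Φq)).add
      ((hasDerivAt_dT (hd h.contDiffOn_adjfq)).clm_apply h0)
    simp only [sub_self, zero_smul, add_zero] at h1
    refine h1.congr_of_eventuallyEq ?_
    have : ∀ᶠ t in 𝓝 z.2, (z.1, t) ∈ O :=
      (Continuous.continuousAt (by fun_prop : Continuous fun t : ℝ => (z.1, t))).preimage_mem_nhds
        (h.isOpen.mem_nhds hz)
    filter_upwards [this] with s hs using h.Hq_eq hs _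
  rw [rhs, e1.deriv, e2.deriv, h.Hx_eq hz]
  simp only [coefa, coefA, coefB, coefC, sub_apply, neg_apply]
  abel

end SmoothOn

/-! ### Regularity along the arcs -/

variable {D} {c}

/-- One-sided derivatives of the coordinate functions extend the normal to the closed arc. The
functions `n₁`, `n₂` themselves are two-sided derivatives and say nothing at a vertex, where the
curve may have a corner. -/
theorem continuousOn_ext_n (hc : c.Admissible) {j : ℕ} (hj : j ≤ c.N) :
    ∃ m₁ m₂ : ℝ → ℝ, ContDiffOn ℝ 1 m₁ (c.closedArc j) ∧ ContDiffOn ℝ 1 m₂ (c.closedArc j) ∧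
      ∀ μ ∈ c.arc j, c.n₁ μ = m₁ μ ∧ c.n₂ μ = m₂ μ := by
  have hu : UniqueDiffOn ℝ (c.closedArc j) := uniqueDiffOn_Icc (hc.node_lt j hj)
  refine ⟨derivWithin c.L₂ (c.closedArc j), fun μ => -derivWithin c.L₁ (c.closedArc j) μ,
    (hc.smooth₂ j hj).derivWithin hu (by norm_num),
    ((hc.smooth₁ j hj).derivWithin hu (by norm_num)).neg, fun μ hμ => ?_⟩
  have hn : c.closedArc j ∈ 𝓝 μ := Icc_mem_nhds hμ.1 hμ.2
  simp only [derivWithin_of_mem_nhds hn]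
  exact ⟨rfl, rfl⟩

/-- Along a closed arc `Φ₁` is replaced by its `C²` representative `Ψ` and the normal by its `C¹`
extension; then `Φ₁_η` becomes a `C¹` function of the parameter, with a continuous one-sided
derivative. Hence `F₁` is bounded on the arc and has limits at the two vertices. -/
theorem exists_F₁_extension (hc : c.Admissible) (hD : D.Smooth c) {j : ℕ} (hj : j ≤ c.N) :
    ∃ F : ℝ → Euc n, ContinuousOn F (c.closedArc j) ∧ ∀ μ ∈ c.arc j, D.F₁ c μ = F μ := by
  obtain ⟨O, hGO, hO⟩ := hD.smoothOn
  obtain ⟨m₁, m₂, hm₁, hm₂, hm⟩ := continuousOn_ext_n hc hj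
  obtain ⟨Ψ, hΨ, hΨe⟩ := hD.curve_data j hj
  have hu : UniqueDiffOn ℝ (c.closedArc j) := uniqueDiffOn_Icc (hc.node_lt j hj)
  have huS : UniqueDiffOn ℝ (c.closedArc j ×ˢ (univ : Set (Euc n × Euc n))) :=
    hu.prod uniqueDiffOn_univ
  have hpt : MapsTo c.point (c.closedArc j) O := fun μ hμ =>
    hGO (hc.point_mem_G (hc.closedArc_subset hj hμ))
  have hptC : ContDiffOn ℝ 1 c.point (c.closedArc j) :=
    ((hc.smooth₁ j hj).prodMk (hc.smooth₂ j hj)).of_le (by norm_num)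
  have hcomp : ∀ {V : Type} [NormedAddCommGroup V] [NormedSpace ℝ V] {g : ℝ × ℝ → V},
      ContDiffOn ℝ 1 g O → ContDiffOn ℝ 1 (fun μ => g (c.point μ)) (c.closedArc j) :=
    fun hg => hg.comp hptC hpt
  have hxs := hcomp (contDiffOn_dS hO.isOpen (k := 1) (by norm_num; exact hO.x))
  have hxt := hcomp (contDiffOn_dT hO.isOpen (k := 1) (by norm_num; exact hO.x))
  have hxx := hcomp (hO.x.of_le (by norm_num : (1 : WithTop ℕ∞) ≤ 2))
  let η : ℝ → Euc n := fun μ =>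
    -(m₂ μ) • dS D.x (c.point μ) + m₁ μ • dT D.x (c.point μ)
  have hη : ContDiffOn ℝ 1 η (c.closedArc j) := (hm₂.neg.smul hxs).add (hm₁.smul hxt)
  have hηe : ∀ μ ∈ c.arc j, D.xTan c μ = η μ := fun μ hμ => by
    simp only [xTan, η, (hm μ hμ).1, (hm μ hμ).2]
  let θ : ℝ → ℝ × Euc n × Euc n := fun μ => (μ, D.x (c.point μ), η μ)
  have hθ : ContDiffOn ℝ 1 θ (c.closedArc j) := contDiffOn_id.prodMk (hxx.prodMk hη)
  have hdΨ : ContDiffOn ℝ 1 (fun μ => fderivWithin ℝ Ψ (c.closedArc j ×ˢ univ) (θ μ))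
      (c.closedArc j) :=
    (hΨ.fderivWithin huS (m := 1) (by norm_num)).comp hθ fun μ hμ => ⟨hμ, mem_univ _⟩
  let Ψx : ℝ → Euc n := fun μ => (InnerProductSpace.toDual ℝ (Euc n)).symm
    ((fderivWithin ℝ Ψ (c.closedArc j ×ˢ univ) (θ μ)).comp
      ((ContinuousLinearMap.inr ℝ ℝ (Euc n × Euc n)).comp
        (ContinuousLinearMap.inl ℝ (Euc n) (Euc n))))
  let Ψη : ℝ → Euc n := fun μ => (InnerProductSpace.toDual ℝ (Euc n)).symm
    ((fderivWithin ℝ Ψ (c.closedArc j ×ˢ univ) (θ μ)).comp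
      ((ContinuousLinearMap.inr ℝ ℝ (Euc n × Euc n)).comp
        (ContinuousLinearMap.inr ℝ (Euc n) (Euc n))))
  have hΨx : ContDiffOn ℝ 1 Ψx (c.closedArc j) :=
    SmoothOn.contDiff_toDual_symm.comp_contDiffOn (hdΨ.clm_comp contDiffOn_const)
  have hΨη : ContDiffOn ℝ 1 Ψη (c.closedArc j) :=
    SmoothOn.contDiff_toDual_symm.comp_contDiffOn (hdΨ.clm_comp contDiffOn_const)
  have hdiff : ∀ μ ∈ c.arc j, HasFDerivAt Ψ
      (fderivWithin ℝ Ψ (c.closedArc j ×ˢ univ) (θ μ)) (θ μ) := by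
    intro μ hμ
    have hn : c.closedArc j ×ˢ (univ : Set (Euc n × Euc n)) ∈ 𝓝 (θ μ) :=
      prod_mem_nhds (Icc_mem_nhds hμ.1 hμ.2) univ_mem
    rw [fderivWithin_of_mem_nhds hn]
    exact ((hΨ.contDiffAt hn).differentiableAt (by norm_num)).hasFDerivAt
  have ex : ∀ μ ∈ c.arc j, D.Φ₁x c μ = Ψx μ := by
    intro μ hμ
    have h1 : HasFDerivAt (fun y : Euc n => (μ, y, η μ))
        ((ContinuousLinearMap.inr ℝ ℝ (Euc n × Euc n)).comp
          (ContinuousLinearMap.inl ℝ (Euc n) (Euc n))) (D.x (c.point μ)) :=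
      HasFDerivAt.congr_fderiv ((hasFDerivAt_const _ _).prodMk
        ((hasFDerivAt_id _).prodMk (hasFDerivAt_const _ _)))
        (ContinuousLinearMap.ext fun _ => rfl)
    have h2 := HasFDerivAt.comp (D.x (c.point μ)) (g := Ψ) (f := fun y : Euc n => (μ, y, η μ))
      (hdiff μ hμ) h1
    rw [Φ₁x, gradient_eq_symm]
    have h3 : (fun y => D.Φ₁ (c.L₁ μ, c.L₂ μ, y, D.xTan c μ)) = Ψ ∘ fun y => (μ, y, η μ) := by
      funext y
      rw [hΨe μ hμ, hηe μ hμ]; rfl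
    rw [h3, h2.fderiv]
  have eη : ∀ μ ∈ c.arc j, D.Φ₁η c μ = Ψη μ := by
    intro μ hμ
    have h1 : HasFDerivAt (fun y : Euc n => (μ, D.x (c.point μ), y))
        ((ContinuousLinearMap.inr ℝ ℝ (Euc n × Euc n)).comp
          (ContinuousLinearMap.inr ℝ (Euc n) (Euc n))) (η μ) :=
      HasFDerivAt.congr_fderiv ((hasFDerivAt_const _ _).prodMk
        ((hasFDerivAt_const _ _).prodMk (hasFDerivAt_id _)))
        (ContinuousLinearMap.ext fun _ => rfl)
    have h2 := HasFDerivAt.comp (η μ) (g := Ψ) (f := fun y : Euc n => (μ, D.x (c.point μ), y))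
      (hdiff μ hμ) h1
    rw [Φ₁η, gradient_eq_symm]
    have h3 : (fun y => D.Φ₁ (c.L₁ μ, c.L₂ μ, D.x (c.point μ), y))
        = Ψ ∘ fun y => (μ, D.x (c.point μ), y) := by
      funext y
      rw [hΨe μ hμ]; rfl
    rw [h3, hηe μ hμ, h2.fderiv]
  refine ⟨fun μ => m₁ μ • D.Φp (c.point μ) + m₂ μ • D.Φq (c.point μ) + Ψx μ
    - derivWithin Ψη (c.closedArc j) μ, ?_, fun μ hμ => ?_⟩
  · exact (((hm₁.continuousOn.smul (hcomp hO.contDiffOn_Φp).continuousOn).add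
      (hm₂.continuousOn.smul (hcomp hO.contDiffOn_Φq).continuousOn)).add hΨx.continuousOn).sub
      (hΨη.continuousOn_derivWithin hu (by norm_num))
  · have hev : D.Φ₁η c =ᶠ[𝓝 μ] Ψη := by
      filter_upwards [Ioo_mem_nhds hμ.1 hμ.2] with x hx using eη x hx
    have hn : c.closedArc j ∈ 𝓝 μ := Icc_mem_nhds hμ.1 hμ.2
    simp only [F₁, ex μ hμ, hev.deriv_eq, (hm μ hμ).1, (hm μ hμ).2, derivWithin_of_mem_nhds hn]

end ControlData

/-! ### Linear ordinary differential equations and differential inequalities -/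

/-- A linear differential equation with terminal value at `τ` is the Volterra equation on the
triangle with the second integral suppressed and the first variable frozen at `τ`. -/
theorem exists_linear_ode {E : Type*} [NormedAddCommGroup E] [NormedSpace ℝ E] [CompleteSpace E]
    {τ : ℝ} (hτ : 0 ≤ τ) {k : ℝ → E →L[ℝ] E} (hk : ContinuousOn k (Icc 0 τ)) (y₀ : E) :
    ∃ y : ℝ → E, y τ = y₀ ∧ ∀ t ∈ Icc 0 τ, HasDerivWithinAt y (k t (y t)) (Icc 0 τ) t := by
  obtain ⟨Z, hZ, h⟩ := exists_volterra_triangle hτ (m₁ := fun _ => 1) (m₂ := fun _ => 0)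
    measurable_const measurable_const (by simp) (by simp) (c₁ := fun z => -k z.2)
    (c₂ := fun _ => 0) (Z₀ := fun _ => y₀)
    ((hk.comp continuousOn_snd fun z hz => ⟨hz.1, hz.2.1.trans hz.2.2⟩).neg) continuousOn_const
    continuousOn_const
  -- Constant continuation outside `[0, τ]` makes the integrand continuous on the line, so that the
  -- primitive is differentiable at the end points too.
  let g : ℝ → E := fun t => k (projIcc 0 τ hτ t) (Z (τ, projIcc 0 τ hτ t))
  have hp : Continuous fun t => (projIcc 0 τ hτ t : ℝ) :=
    continuous_subtype_val.comp continuous_projIcc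
  have hg : Continuous g := (hk.comp_continuous hp fun t => Subtype.mem _).clm_apply
    (hZ.comp_continuous (continuous_const.prodMk hp) fun t =>
      ⟨(projIcc 0 τ hτ t).2.1, (projIcc 0 τ hτ t).2.2, le_rfl⟩)
  let y : ℝ → E := fun t => y₀ - ∫ b in t..τ, g b
  have hy : ∀ t ∈ Icc 0 τ, y t = Z (τ, t) := by
    intro t ht
    rw [h (τ, t) ⟨ht.1, ht.2, le_rfl⟩]
    simp only [y, one_smul, neg_apply, intervalIntegral.integral_neg, zero_smul,
      intervalIntegral.integral_zero, add_zero, sub_eq_add_neg]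
    congr 2
    refine intervalIntegral.integral_congr fun b hb => ?_
    rw [uIcc_of_le ht.2] at hb
    simp only [g, projIcc_of_mem hτ (show b ∈ Icc 0 τ from ⟨ht.1.trans hb.1, hb.2⟩)]
  refine ⟨y, by simp [y], fun t ht => ?_⟩
  have h1 : HasDerivAt y (-(-g t)) t := by
    refine HasDerivAt.const_sub y₀ ?_
    exact intervalIntegral.integral_hasDerivAt_left (hg.intervalIntegrable _ _)
      (hg.stronglyMeasurableAtFilter _ _) hg.continuousAt
  rw [neg_neg] at h1
  have h2 : g t = k t (y t) := by
    simp only [g, projIcc_of_mem hτ ht, hy t ht]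
  rw [← h2]
  exact h1.hasDerivWithinAt

/-- The mean value inequality is applied on `[a', b]` with `a' > a`, and `a'` then tends to `a`;
this dispenses with a derivative of `f` at the end points. -/
theorem norm_sub_le_of_norm_deriv_le {E : Type*} [NormedAddCommGroup E] [NormedSpace ℝ E]
    {f f' : ℝ → E} {B B' : ℝ → ℝ} {a b : ℝ} (hab : a ≤ b) (hf : ContinuousOn f (Icc a b))
    (hf' : ∀ x ∈ Ioo a b, HasDerivAt f (f' x) x) (hB : ∀ x, HasDerivAt B (B' x) x)
    (h : ∀ x ∈ Ioo a b, ‖f' x‖ ≤ B' x) : ‖f b - f a‖ ≤ B b - B a := by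
  rcases hab.eq_or_lt with rfl | hab
  · simp
  have hBc : Continuous B := continuous_iff_continuousAt.2 fun x => (hB x).continuousAt
  have key : ∀ a' ∈ Ioo a b, ‖f b - f a'‖ ≤ B b - B a' := by
    intro a' ha'
    refine image_norm_le_of_norm_deriv_right_le_deriv_boundary (f := fun x => f x - f a')
      (B := fun x => B x - B a') (f' := f') (B' := B') (a := a') (b := b) ?_ ?_ ?_ ?_ ?_
      (right_mem_Icc.2 ha'.2.le)
    · exact (hf.mono (Icc_subset_Icc_left ha'.1.le)).sub continuousOn_const
    · intro x hx
      exact ((hf' x ⟨ha'.1.trans_le hx.1, hx.2⟩).sub_const _).hasDerivWithinAt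
    · simp
    · exact fun x => (hB x).sub_const _
    · exact fun x hx => h x ⟨ha'.1.trans_le hx.1, hx.2⟩
  have h1 : Tendsto (fun a' => ‖f b - f a'‖) (𝓝[Ioo a b] a) (𝓝 ‖f b - f a‖) :=
    (tendsto_const_nhds.sub ((hf a (left_mem_Icc.2 hab.le)).mono Ioo_subset_Icc_self)).norm
  have h2 : Tendsto (fun a' => B b - B a') (𝓝[Ioo a b] a) (𝓝 (B b - B a)) :=
    tendsto_const_nhds.sub (hBc.continuousAt.mono_left nhdsWithin_le_nhds)
  have : (𝓝[Ioo a b] a).NeBot := by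
    rw [nhdsWithin_Ioo_eq_nhdsGT hab]; infer_instance
  exact le_of_tendsto_of_tendsto h1 h2 (eventually_mem_nhdsWithin.mono key)

/-- Gronwall's inequality from `a'` to `x`, followed by `a' → a`. The initial value enters only as a
limit, as is the case for boundary values of a co-state at a vertex. -/
theorem eq_zero_of_norm_deriv_le {E : Type*} [NormedAddCommGroup E] [NormedSpace ℝ E]
    {f f' : ℝ → E} {M a b : ℝ} (hf' : ∀ x ∈ Ioo a b, HasDerivAt f (f' x) x)
    (h : ∀ x ∈ Ioo a b, ‖f' x‖ ≤ M * ‖f x‖) (h0 : Tendsto f (𝓝[>] a) (𝓝 0)) :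
    ∀ x ∈ Ioo a b, f x = 0 := by
  intro x hx
  have key : ∀ᶠ a' in 𝓝[>] a, ‖f x‖ ≤ ‖f a'‖ * Real.exp (M * (x - a')) := by
    filter_upwards [Ioo_mem_nhdsGT hx.1] with a' ha'
    have hsub : Icc a' x ⊆ Ioo a b := fun y hy => ⟨ha'.1.trans_le hy.1, hy.2.trans_lt hx.2⟩
    have := norm_le_gronwallBound_of_norm_deriv_right_le (f := f) (f' := f') (δ := ‖f a'‖)
      (K := M) (ε := 0) (a := a') (b := x)
      (fun y hy => (hf' y (hsub hy)).continuousAt.continuousWithinAt)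
      (fun y hy => (hf' y (hsub (Ico_subset_Icc_self hy))).hasDerivWithinAt) le_rfl
      (fun y hy => by simpa using h y (hsub (Ico_subset_Icc_self hy))) x
      (right_mem_Icc.2 ha'.2.le)
    rwa [gronwallBound_ε0] at this
  have hlim : Tendsto (fun a' => ‖f a'‖ * Real.exp (M * (x - a'))) (𝓝[>] a)
      (𝓝 (‖(0 : E)‖ * Real.exp (M * (x - a)))) :=
    h0.norm.mul ((by fun_prop : Continuous fun a' =>
      Real.exp (M * (x - a'))).continuousAt.mono_left nhdsWithin_le_nhds)
  rw [norm_zero, zero_mul] at hlim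
  exact norm_le_zero_iff.1 (ge_of_tendsto hlim key)

theorem eq_zero_of_norm_deriv_le' {E : Type*} [NormedAddCommGroup E] [NormedSpace ℝ E]
    {f f' : ℝ → E} {M a b : ℝ} (hf' : ∀ x ∈ Ioo a b, HasDerivAt f (f' x) x)
    (h : ∀ x ∈ Ioo a b, ‖f' x‖ ≤ M * ‖f x‖) (h0 : Tendsto f (𝓝[<] b) (𝓝 0)) :
    ∀ x ∈ Ioo a b, f x = 0 := by
  intro x hx
  have hneg : ∀ y ∈ Ioo (-b) (-a), -y ∈ Ioo a b := fun y hy =>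
    ⟨by linarith [hy.2], by linarith [hy.1]⟩
  have := eq_zero_of_norm_deriv_le (f := fun y => f (-y)) (f' := fun y => -f' (-y)) (M := M)
    (a := -b) (b := -a) (fun y hy => by
      have := (hf' _ (hneg y hy)).scomp y (hasDerivAt_neg y)
      rwa [neg_smul, one_smul] at this)
    (fun y hy => by simpa using h _ (hneg y hy)) (by
      refine h0.comp ?_
      simpa using tendsto_neg_nhdsGT_neg (a := b)) (-x) ⟨by linarith [hx.2], by linarith [hx.1]⟩
  simpa using this

/-- If `V` tends to zero along a family of curves, then so does its derivative `P` along these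
curves, provided that `P` converges. -/
theorem eq_zero_of_tendsto_deriv {E : Type*} [NormedAddCommGroup E] [NormedSpace ℝ E]
    {V P : ℝ → ℝ → E} {a₀ a₁ α : ℝ} (hα : α ∈ Ioo a₀ a₁) {l : Filter ℝ} [l.NeBot]
    (hV : ∀ᶠ b in l, ∀ a ∈ Ioo a₀ a₁, HasDerivAt (fun x => V x b) (P a b) a)
    (hlim : ∀ a ∈ Ioo a₀ a₁, Tendsto (V a) l (𝓝 0)) {P₀ : E}
    (hP : Tendsto (fun z : ℝ × ℝ => P z.1 z.2) (𝓝 α ×ˢ l) (𝓝 P₀)) : P₀ = 0 := by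
  rw [← norm_le_zero_iff]
  refine le_of_forall_pos_le_add fun ε hε => ?_
  rw [zero_add]
  have h1 := hP (Metric.closedBall_mem_nhds P₀ hε)
  rw [mem_map, mem_prod_iff] at h1
  obtain ⟨t, ht, u, hu, htu⟩ := h1
  obtain ⟨η, hη, hηt⟩ := Metric.mem_nhds_iff.1 ht
  set α' := α + min (η / 2) ((a₁ - α) / 2) with hα'
  have hm : 0 < min (η / 2) ((a₁ - α) / 2) :=
    lt_min (by linarith) (by linarith [hα.2])
  have h2 : α < α' := by linarith
  have h3 : α' < a₁ := by linarith [min_le_right (η / 2) ((a₁ - α) / 2), hα.2]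
  have h4 : α' < α + η := by linarith [min_le_left (η / 2) ((a₁ - α) / 2)]
  have h5 : ∀ x ∈ Icc α α', x ∈ Ioo a₀ a₁ := fun x hx =>
    ⟨hα.1.trans_le hx.1, hx.2.trans_lt h3⟩
  -- Between `α` and the nearby point `α'` the derivative stays within `ε` of `P₀`, so the increment
  -- of `V` is `(α' - α) P₀` up to `ε (α' - α)`. In the limit the increment is zero, whence `‖P₀‖ ≤
  -- ε`.
  have key : ∀ᶠ b in l, ‖V α' b - V α b - (α' - α) • P₀‖ ≤ ε * (α' - α) := by
    filter_upwards [hV, hu] with b hb hbu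
    have hd : ∀ x ∈ Icc α α', HasDerivAt (fun x => V x b - (x - α) • P₀) (P x b - P₀) x := by
      intro x hx
      have := ((hasDerivAt_id x).sub_const α).smul_const P₀
      simp only [one_smul] at this
      exact (hb x (h5 x hx)).sub this
    have := norm_sub_le_of_norm_deriv_le (f := fun x => V x b - (x - α) • P₀)
      (f' := fun x => P x b - P₀) (B := fun x => ε * x) (B' := fun _ => ε) h2.le
      (fun x hx => (hd x hx).continuousAt.continuousWithinAt)
      (fun x hx => hd x (Ioo_subset_Icc_self hx))
      (fun x => by simpa using (hasDerivAt_id x).const_mul ε) (fun x hx => by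
        rw [← dist_eq_norm]
        refine htu (a := (x, b)) ⟨hηt ?_, hbu⟩
        rw [Metric.mem_ball, Real.dist_eq, abs_of_pos (by linarith [hx.1])]
        linarith [hx.2])
    simp only [sub_self, zero_smul, sub_zero] at this
    rw [mul_sub]
    convert this using 2
    abel
  have hl : Tendsto (fun b => ‖V α' b - V α b - (α' - α) • P₀‖) l
      (𝓝 ‖(0 : E) - 0 - (α' - α) • P₀‖) :=
    (((hlim α' ⟨by linarith [hα.1], h3⟩).sub (hlim α hα)).sub tendsto_const_nhds).norm
  have := le_of_tendsto hl key
  rw [sub_zero, zero_sub, norm_neg, norm_smul, Real.norm_eq_abs, abs_of_pos (by linarith)] at this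
  have h6 : 0 < α' - α := by linarith
  nlinarith

/-- Uniqueness for hyperbolic problems in a rectangle or a triangle with vanishing data on its
upper and right sides. -/
theorem eq_zero_of_hyperbolic {E : Type*} [NormedAddCommGroup E] [NormedSpace ℝ E]
    {a₀ a₁ b₀ b₁ K : ℝ} (hK : 0 ≤ K) {V P Q P' Q' : ℝ → ℝ → E}
    (cV : ∀ α ∈ Ioo a₀ a₁, ContinuousOn (fun b => V α b) (Ioc b₀ (min b₁ α)))
    (cP : ∀ α ∈ Ioo a₀ a₁, ContinuousOn (fun b => P α b) (Ioc b₀ (min b₁ α)))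
    (cQ : ∀ β ∈ Ioo b₀ b₁, ContinuousOn (fun a => Q a β) (Ico (max a₀ β) a₁))
    (dV : ∀ α ∈ Ioo a₀ a₁, ∀ β ∈ Ioo b₀ b₁, β < α → HasDerivAt (fun b => V α b) (Q α β) β)
    (dP : ∀ α ∈ Ioo a₀ a₁, ∀ β ∈ Ioo b₀ b₁, β < α → HasDerivAt (fun b => P α b) (P' α β) β)
    (dQ : ∀ α ∈ Ioo a₀ a₁, ∀ β ∈ Ioo b₀ b₁, β < α → HasDerivAt (fun a => Q a β) (Q' α β) α)
    (bP : ∀ α ∈ Ioo a₀ a₁, ∀ β ∈ Ioo b₀ b₁, β < α →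
      ‖P' α β‖ ≤ K * (‖V α β‖ + ‖P α β‖ + ‖Q α β‖))
    (bQ : ∀ α ∈ Ioo a₀ a₁, ∀ β ∈ Ioo b₀ b₁, β < α →
      ‖Q' α β‖ ≤ K * (‖V α β‖ + ‖P α β‖ + ‖Q α β‖))
    (zV : ∀ α ∈ Ioo a₀ a₁, V α (min b₁ α) = 0) (zP : ∀ α ∈ Ioo a₀ a₁, P α (min b₁ α) = 0)
    (zQ : ∀ β ∈ Ioo b₀ b₁, Q (max a₀ β) β = 0)
    (hbd : ∃ M, ∀ α ∈ Ioo a₀ a₁, ∀ β ∈ Ioo b₀ b₁, β < α → ‖V α β‖ + ‖P α β‖ + ‖Q α β‖ ≤ M) :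
    ∀ α ∈ Ioo a₀ a₁, ∀ β ∈ Ioo b₀ b₁, β < α → V α β = 0 := by
  obtain ⟨M, hM⟩ := hbd
  -- Integrating the exponential weight, `V` contributes `1 / κ`, and `P` and `Q` contribute `K / κ`
  -- each; the sum is exactly `1/2`.
  set κ := 2 * (2 * K + 1) with hκ
  have hκ0 : 0 < κ := by positivity
  have step : ∀ S, 0 ≤ S → (∀ α ∈ Ioo a₀ a₁, ∀ β ∈ Ioo b₀ b₁, β < α →
      ‖V α β‖ + ‖P α β‖ + ‖Q α β‖ ≤ S * Real.exp (κ * (α - β))) →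
      ∀ α ∈ Ioo a₀ a₁, ∀ β ∈ Ioo b₀ b₁, β < α →
      ‖V α β‖ + ‖P α β‖ + ‖Q α β‖ ≤ S / 2 * Real.exp (κ * (α - β)) := by
    intro S hS hN α hα β hβ hβα
    have hB1 : ∀ L x, HasDerivAt (fun b => -(L * S * Real.exp (κ * (α - b)) / κ))
        (L * S * Real.exp (κ * (α - x))) x := by
      intro L x
      have h1 : HasDerivAt (fun b => κ * (α - b)) (κ * (-1)) x :=
        ((hasDerivAt_id x).const_sub α).const_mul κ
      exact ((h1.exp.const_mul (L * S)).div_const κ).neg.congr_deriv (by field_simp)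
    have hB2 : ∀ L x, HasDerivAt (fun a => L * S * Real.exp (κ * (a - β)) / κ)
        (L * S * Real.exp (κ * (x - β))) x := by
      intro L x
      have h1 : HasDerivAt (fun a => κ * (a - β)) (κ * 1) x :=
        ((hasDerivAt_id x).sub_const β).const_mul κ
      exact ((h1.exp.const_mul (L * S)).div_const κ).congr_deriv (by field_simp)
    -- `V` and `P` are integrated from the upper end `min b₁ α` of the vertical line, `Q` from the
    -- right end `max a₀ β` of the horizontal one. Under a single arc both are points of the
    -- diagonal; in a rectangle they are `b₁` and `a₀`.
    have htop : β ≤ min b₁ α := le_min hβ.2.le hβα.le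
    have hright : max a₀ β ≤ α := max_le hα.1.le hβα.le
    have s1 : Icc β (min b₁ α) ⊆ Ioc b₀ (min b₁ α) := fun x hx => ⟨hβ.1.trans_le hx.1, hx.2⟩
    have s2 : Icc (max a₀ β) α ⊆ Ico (max a₀ β) a₁ := fun x hx => ⟨hx.1, hx.2.trans_lt hα.2⟩
    have s3 : ∀ x ∈ Ioo β (min b₁ α), x ∈ Ioo b₀ b₁ ∧ x < α := fun x hx =>
      ⟨⟨hβ.1.trans hx.1, hx.2.trans_le (min_le_left _ _)⟩, hx.2.trans_le (min_le_right _ _)⟩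
    have s4 : ∀ x ∈ Ioo (max a₀ β) α, x ∈ Ioo a₀ a₁ ∧ β < x := fun x hx =>
      ⟨⟨(le_max_left _ _).trans_lt hx.1, hx.2.trans hα.2⟩, (le_max_right _ _).trans_lt hx.1⟩
    have e1 := norm_sub_le_of_norm_deriv_le htop ((cV α hα).mono s1)
      (fun x hx => dV α hα x (s3 x hx).1 (s3 x hx).2) (hB1 1) (fun x hx => by
        have := hN α hα x (s3 x hx).1 (s3 x hx).2
        have := norm_nonneg (V α x); have := norm_nonneg (P α x); linarith)
    have e2 := norm_sub_le_of_norm_deriv_le htop ((cP α hα).mono s1)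
      (fun x hx => dP α hα x (s3 x hx).1 (s3 x hx).2) (hB1 K) (fun x hx => by
        have := hN α hα x (s3 x hx).1 (s3 x hx).2
        have h2 := mul_le_mul_of_nonneg_left this hK
        have h3 := bP α hα x (s3 x hx).1 (s3 x hx).2
        linarith)
    have e3 := norm_sub_le_of_norm_deriv_le hright ((cQ β hβ).mono s2)
      (fun x hx => dQ x (s4 x hx).1 β hβ (s4 x hx).2) (hB2 K) (fun x hx => by
        have := hN x (s4 x hx).1 β hβ (s4 x hx).2
        have h2 := mul_le_mul_of_nonneg_left this hK
        have h3 := bQ x (s4 x hx).1 β hβ (s4 x hx).2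
        linarith)
    rw [zV α hα, zero_sub, norm_neg] at e1
    rw [zP α hα, zero_sub, norm_neg] at e2
    rw [zQ β hβ, sub_zero] at e3
    have p1 : 0 ≤ 1 * S * Real.exp (κ * (α - min b₁ α)) / κ := by positivity
    have p2 : 0 ≤ K * S * Real.exp (κ * (α - min b₁ α)) / κ := by positivity
    have p3 : 0 ≤ K * S * Real.exp (κ * (max a₀ β - β)) / κ := by positivity
    have : S / 2 * Real.exp (κ * (α - β)) = 1 * S * Real.exp (κ * (α - β)) / κ
        + K * S * Real.exp (κ * (α - β)) / κ + K * S * Real.exp (κ * (α - β)) / κ := by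
      rw [hκ]; field_simp; ring
    linarith
  have hall : ∀ m : ℕ, ∀ α ∈ Ioo a₀ a₁, ∀ β ∈ Ioo b₀ b₁, β < α →
      ‖V α β‖ + ‖P α β‖ + ‖Q α β‖ ≤ |M| / 2 ^ m * Real.exp (κ * (α - β)) := by
    intro m
    induction m with
    | zero =>
      intro α hα β hβ h
      have h1 := hM α hα β hβ h
      have h2 : 1 ≤ Real.exp (κ * (α - β)) :=
        Real.one_le_exp (mul_nonneg hκ0.le (sub_nonneg.2 h.le))
      have h3 := mul_le_mul_of_nonneg_left h2 (abs_nonneg M)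
      have h4 := le_abs_self M
      simp only [pow_zero, div_one]
      linarith
    | succ m ih =>
      intro α hα β hβ h
      have := step _ (by positivity) ih α hα β hβ h
      rwa [div_div, ← pow_succ] at this
  intro α hα β hβ h
  rw [← norm_le_zero_iff]
  have hlim : Tendsto (fun m : ℕ => |M| / 2 ^ m * Real.exp (κ * (α - β))) atTop
      (𝓝 (0 * Real.exp (κ * (α - β)))) := by
    refine Tendsto.mul_const _ ?_
    have := (tendsto_pow_atTop_nhds_zero_of_lt_one (r := (1 / 2 : ℝ)) (by norm_num)
      (by norm_num)).const_mul |M|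
    simpa [div_eq_mul_inv] using this
  rw [zero_mul] at hlim
  refine ge_of_tendsto' hlim fun m => ?_
  have := hall m α hα β hβ h
  have := norm_nonneg (P α β); have := norm_nonneg (Q α β); linarith

/-! ### Existence of the Riemann matrices on the characteristics -/

namespace ControlData

variable {n m : ℕ} {D : ControlData n m} {c : VertexCurve}

theorem mem_G_of_le {s t τ : ℝ} (h : (s, τ) ∈ c.G) (ht : t ∈ Icc 0 τ) : (s, t) ∈ c.G := by
  obtain ⟨μ, hμ, h1, h2⟩ := h
  exact ⟨μ, hμ, h1, ht.1, ht.2.trans h2.2⟩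

theorem mem_G_of_le' {s σ t : ℝ} (h : (σ, t) ∈ c.G) (hs : s ∈ Icc 0 σ) : (s, t) ∈ c.G := by
  obtain ⟨μ, hμ, h1, h2⟩ := h
  exact ⟨μ, hμ, ⟨hs.1, hs.2.trans h1.2⟩, h2⟩

theorem exists_isRiemann (hD : D.Smooth c) :
    ∃ ρ₁ ρ₂ : ℝ → ℝ → ℝ → Fin n → Euc n, D.IsRiemann c ρ₁ ρ₂ := by
  obtain ⟨O, hGO, hO⟩ := hD.smoothOn
  have h1 : ∀ s τ : ℝ, ∀ i : Fin n, ∃ y : ℝ → Euc n, (s, τ) ∈ c.G →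
      y τ = EuclideanSpace.single i 1 ∧ ∀ t ∈ Icc 0 τ,
        HasDerivWithinAt y (D.coefB (s, t) (y t)) (Icc 0 τ) t := by
    intro s τ i
    by_cases h : (s, τ) ∈ c.G
    · obtain ⟨y, hy⟩ := exists_linear_ode (E := Euc n) (τ := τ) (by
        obtain ⟨μ, hμ, h1, h2⟩ := h; exact h2.1) (k := fun t => D.coefB (s, t))
        (hO.continuousOn_coefB.comp (by fun_prop) fun t ht => hGO (mem_G_of_le h ht))
        (EuclideanSpace.single i 1)
      exact ⟨y, fun _ => hy⟩
    · exact ⟨0, fun h' => absurd h' h⟩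
  have h2 : ∀ σ t : ℝ, ∀ i : Fin n, ∃ y : ℝ → Euc n, (σ, t) ∈ c.G →
      y σ = EuclideanSpace.single i 1 ∧ ∀ s ∈ Icc 0 σ,
        HasDerivWithinAt y (D.coefC (s, t) (y s)) (Icc 0 σ) s := by
    intro σ t i
    by_cases h : (σ, t) ∈ c.G
    · obtain ⟨y, hy⟩ := exists_linear_ode (E := Euc n) (τ := σ) (by
        obtain ⟨μ, hμ, h1, h2⟩ := h; exact h1.1) (k := fun s => D.coefC (s, t))
        (hO.continuousOn_coefC.comp (by fun_prop) fun s hs => hGO (mem_G_of_le' h hs))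
        (EuclideanSpace.single i 1)
      exact ⟨y, fun _ => hy⟩
    · exact ⟨0, fun h' => absurd h' h⟩
  choose y₁ hy₁ using h1
  choose y₂ hy₂ using h2
  refine ⟨fun s t τ i => y₁ s τ i t, fun s t σ i => y₂ σ t i s, ?_, ?_, ?_, ?_⟩
  · exact fun s τ h i => (hy₁ s τ i h).1
  · intro s τ h i t ht
    have := (hy₁ s τ i h).2 t ht
    rwa [← hO.gradient_p_eq (hGO (mem_G_of_le h ht))] at this
  · exact fun σ t h i => (hy₂ σ t i h).1
  · intro σ t h i s hs
    have := (hy₂ σ t i h).2 s hs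
    rwa [← hO.gradient_q_eq (hGO (mem_G_of_le' h hs))] at this

end ControlData

/-! ### Extremal vertices on a line and closures of the cells -/

theorem exists_last_index {P : ℕ → Prop} {i M : ℕ} (hi : i ≤ M) (h : P i) :
    ∃ r, i ≤ r ∧ r ≤ M ∧ P r ∧ ∀ k ≤ M, r < k → ¬P k := by
  classical
  exact ⟨Nat.findGreatest P M, Nat.le_findGreatest hi h, Nat.findGreatest_le M,
    Nat.findGreatest_spec hi h, fun k hk hr => Nat.findGreatest_is_greatest hr hk⟩

theorem exists_first_index {P : ℕ → Prop} {i : ℕ} (h : P i) :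
    ∃ r, r ≤ i ∧ P r ∧ ∀ k < r, ¬P k := by
  classical
  exact ⟨Nat.find ⟨i, h⟩, Nat.find_min' _ h, Nat.find_spec ⟨i, h⟩, fun k hk => Nat.find_min _ hk⟩

namespace VertexCurve.Admissible

variable {c : VertexCurve} (hc : c.Admissible)
include hc

/-- Arc `r` is not horizontal, so it leaves vertex `r` strictly upwards, and by continuity its first
points still lie to the right of `s`. Such a point of the curve is strictly beyond `(s, c.vt r)` in
both coordinates. -/
theorem mem_interior_of_last {r : ℕ} (hr : r ≤ c.N) (hnr : ¬c.IsHorizontal r) {s : ℝ} (h0 : 0 < s)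
    (hs : s < c.vs r) (ht : 0 < c.vt r) : (s, c.vt r) ∈ interior c.G := by
  have h1 : ∀ᶠ μ in 𝓝[c.closedArc r] (c.node r), s < c.L₁ μ :=
    ((hc.smooth₁ r hr).continuousOn _ (hc.left_mem_closedArc hr)).eventually (lt_mem_nhds hs)
  rw [closedArc, nhdsWithin_Icc_eq_nhdsGE (hc.node_lt r hr)] at h1
  obtain ⟨μ, h2, h3⟩ := ((h1.filter_mono (nhdsWithin_mono _ Ioi_subset_Ici_self)).and
    (Ioo_mem_nhdsGT (hc.node_lt r hr))).exists
  have h4 : μ ∈ c.closedArc r := Ioo_subset_Icc_self h3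
  exact hc.mem_interior_iff.2 ⟨h0, ht, μ, hc.closedArc_subset hr h4, h2,
    hc.strictMonoOn_L₂ hr hnr (hc.left_mem_closedArc hr) h4 h3.1⟩

theorem mem_interior_of_first {i : ℕ} (hi : i ≤ c.N) (hni : ¬c.IsVertical i) {t : ℝ} (h0 : 0 < t)
    (ht : t < c.vt (i + 1)) (hs : 0 < c.vs (i + 1)) : (c.vs (i + 1), t) ∈ interior c.G := by
  have h1 : ∀ᶠ μ in 𝓝[c.closedArc i] (c.node (i + 1)), t < c.L₂ μ :=
    ((hc.smooth₂ i hi).continuousOn _ (hc.right_mem_closedArc hi)).eventually (lt_mem_nhds ht)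
  rw [closedArc, nhdsWithin_Icc_eq_nhdsLE (hc.node_lt i hi)] at h1
  obtain ⟨μ, h2, h3⟩ := ((h1.filter_mono (nhdsWithin_mono _ Iio_subset_Iic_self)).and
    (Ioo_mem_nhdsLT (hc.node_lt i hi))).exists
  have h4 : μ ∈ c.closedArc i := Ioo_subset_Icc_self h3
  exact hc.mem_interior_iff.2 ⟨hs, h0, μ, hc.closedArc_subset hi h4,
    hc.strictAntiOn_L₁ hi hni h4 (hc.right_mem_closedArc hi) h3.2, h2⟩

theorem isCompact_closure_cell (j k : ℕ) : IsCompact (closure (c.cell j k)) := by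
  refine IsCompact.of_isClosed_subset (isCompact_Icc.prod isCompact_Icc) isClosed_closure
    (closure_minimal (s := c.cell j k) (t := Icc (c.vs (k + 1)) (c.vs k)
      ×ˢ Icc (c.vt j) (c.vt (j + 1))) (fun z hz => ⟨Ioo_subset_Icc_self hz.2.1,
        Ioo_subset_Icc_self hz.2.2⟩) (isClosed_Icc.prod isClosed_Icc))

/-- The point is approached from below along its vertical line, inside the cell. The admitted end
value of `β` describes the upper side of a rectangle or a point of the arc itself. -/
theorem closedArc_inter_closure {j k : ℕ} (hj : j ≤ c.N) (hk : k ≤ c.N) (hnj : ¬c.IsHorizontal j)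
    (hnk : ¬c.IsVertical k) {α β : ℝ} (hα : α ∈ c.arc k)
    (hβ : β ∈ Ioc (c.node j) (min (c.node (j + 1)) α)) :
    (c.L₁ α, c.L₂ β) ∈ closure (c.cell j k) := by
  have hcl : β ∈ c.closedArc j := ⟨hβ.1.le, hβ.2.trans (min_le_left _ _)⟩
  have hcont : ContinuousWithinAt (fun b => (c.L₁ α, c.L₂ b)) (Ioo (c.node j) β) β :=
    continuousWithinAt_const.prodMk (((hc.smooth₂ j hj).continuousOn β hcl).mono
      fun x hx => ⟨hx.1.le, hx.2.le.trans hcl.2⟩)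
  have : (𝓝[Ioo (c.node j) β] β).NeBot := by
    rw [nhdsWithin_Ioo_eq_nhdsLT hβ.1]; infer_instance
  refine mem_closure_of_tendsto hcont (eventually_mem_nhdsWithin.mono fun b hb => ?_)
  exact hc.mem_cell hj hk hnj hnk hα ⟨hb.1, hb.2.trans_le hcl.2⟩
    (hb.2.trans_le (hβ.2.trans (min_le_right _ _)))

theorem closedArc_inter_closure' {j k : ℕ} (hj : j ≤ c.N) (hk : k ≤ c.N) (hnj : ¬c.IsHorizontal j)
    (hnk : ¬c.IsVertical k) {α β : ℝ} (hβ : β ∈ c.arc j)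
    (hα : α ∈ Ico (max (c.node k) β) (c.node (k + 1))) :
    (c.L₁ α, c.L₂ β) ∈ closure (c.cell j k) := by
  have hcl : α ∈ c.closedArc k := ⟨(le_max_left _ _).trans hα.1, hα.2.le⟩
  have hcont : ContinuousWithinAt (fun a => (c.L₁ a, c.L₂ β)) (Ioo α (c.node (k + 1))) α :=
    (((hc.smooth₁ k hk).continuousOn α hcl).mono
      fun x hx => ⟨hcl.1.trans hx.1.le, hx.2.le⟩).prodMk continuousWithinAt_const
  have : (𝓝[Ioo α (c.node (k + 1))] α).NeBot := by
    rw [nhdsWithin_Ioo_eq_nhdsGT hα.2]; infer_instance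
  refine mem_closure_of_tendsto hcont (eventually_mem_nhdsWithin.mono fun a ha => ?_)
  exact hc.mem_cell hj hk hnj hnk ⟨hcl.1.trans_lt ha.1, ha.2⟩ hβ
    (((le_max_right _ _).trans hα.1).trans_lt ha.1)

end VertexCurve.Admissible

/-! ### The difference of two co-states in one cell -/

namespace ControlData

variable {n m : ℕ} {D : ControlData n m} {c : VertexCurve}
  {ρ₁ ρ₂ : ℝ → ℝ → ℝ → Fin n → Euc n} {ψ ψ' : ℝ × ℝ → Euc n}

/-- The difference of two co-states in a cell. -/
structure CellDifference (c : VertexCurve) (δ : ℝ × ℝ → Euc n) (K : ℝ) (j k : ℕ)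
    (v p q : ℝ × ℝ → Euc n) : Prop where
  cv : ContinuousOn v (closure (c.cell j k))
  cp : ContinuousOn p (closure (c.cell j k))
  cq : ContinuousOn q (closure (c.cell j k))
  ev : ∀ z ∈ c.cell j k, v z = δ z
  ds : ∀ z ∈ c.cell j k, HasDerivAt (fun s => δ (s, z.2)) (dS δ z) z.1
  dt : ∀ z ∈ c.cell j k, HasDerivAt (fun t => δ (z.1, t)) (dT δ z) z.2
  ep : ∀ z ∈ c.cell j k, ∀ α ∈ c.arc k, c.L₁ α = z.1 → p z = c.n₂ α • dS δ z
  eq : ∀ z ∈ c.cell j k, ∀ β ∈ c.arc j, c.L₂ β = z.2 → q z = c.n₁ β • dT δ z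
  mixed : ∀ z ∈ c.cell j k, ∃ R, HasDerivAt (fun s => dT δ (s, z.2)) R z.1 ∧
    HasDerivAt (fun t => dS δ (z.1, t)) R z.2 ∧ ‖R‖ ≤ K * (‖δ z‖ + ‖dS δ z‖ + ‖dT δ z‖)

/-- The Lipschitz condition enters here: it bounds the mixed derivative of the difference by the
difference and its first derivatives, which is all that uniqueness requires of the equation. -/
theorem exists_cellDifference (hc : c.Admissible) {K : ℝ}
    (hLip : ∀ z ∈ c.intGR, ∀ ψ ψ' P P' Q Q' : Euc n,
      ‖D.rhs z ψ P Q - D.rhs z ψ' P' Q'‖ ≤ K * (‖ψ - ψ'‖ + ‖P - P'‖ + ‖Q - Q'‖))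
    (h : D.IsCostate c ρ₁ ρ₂ ψ) (h' : D.IsCostate c ρ₁ ρ₂ ψ') {j k : ℕ} (hj : j ≤ c.N)
    (hk : k ≤ c.N) : ∃ v p q, CellDifference c (fun z => ψ z - ψ' z) K j k v p q := by
  obtain ⟨v, p, q, cv, cp, cq, hr⟩ := h.regular j hj k hk
  obtain ⟨v', p', q', cv', cp', cq', hr'⟩ := h'.regular j hj k hk
  have hs : ∀ z ∈ c.cell j k, HasDerivAt (fun s => ψ (s, z.2) - ψ' (s, z.2)) (dS ψ z - dS ψ' z) z.1 :=
    fun z hz => (hr z hz).2.1.hasDerivAt.sub (hr' z hz).2.1.hasDerivAt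
  have ht : ∀ z ∈ c.cell j k, HasDerivAt (fun t => ψ (z.1, t) - ψ' (z.1, t)) (dT ψ z - dT ψ' z) z.2 :=
    fun z hz => (hr z hz).2.2.1.hasDerivAt.sub (hr' z hz).2.2.1.hasDerivAt
  have es : ∀ z ∈ c.cell j k, dS (fun z => ψ z - ψ' z) z = dS ψ z - dS ψ' z :=
    fun z hz => (hs z hz).deriv
  have et : ∀ z ∈ c.cell j k, dT (fun z => ψ z - ψ' z) z = dT ψ z - dT ψ' z :=
    fun z hz => (ht z hz).deriv
  have ns : ∀ z ∈ c.cell j k, ∀ᶠ s in 𝓝 z.1, (s, z.2) ∈ c.cell j k := fun z hz =>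
    (Continuous.continuousAt (by fun_prop : Continuous fun s : ℝ => (s, z.2))).preimage_mem_nhds
      ((hc.isOpen_cell j k).mem_nhds hz)
  have nt : ∀ z ∈ c.cell j k, ∀ᶠ t in 𝓝 z.2, (z.1, t) ∈ c.cell j k := fun z hz =>
    (Continuous.continuousAt (by fun_prop : Continuous fun t : ℝ => (z.1, t))).preimage_mem_nhds
      ((hc.isOpen_cell j k).mem_nhds hz)
  refine ⟨fun z => v z - v' z, fun z => p z - p' z, fun z => q z - q' z, cv.sub cv', cp.sub cp',
    cq.sub cq', ?_, ?_, ?_, ?_, ?_, ?_⟩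
  · intro z hz; simp only [(hr z hz).1, (hr' z hz).1]
  · intro z hz; rw [es z hz]; exact hs z hz
  · intro z hz; rw [et z hz]; exact ht z hz
  · intro z hz α hα e
    simp only [es z hz, smul_sub, (hr z hz).2.2.2.1 α hα e, (hr' z hz).2.2.2.1 α hα e]
  · intro z hz α hα e
    simp only [et z hz, smul_sub, (hr z hz).2.2.2.2 α hα e, (hr' z hz).2.2.2.2 α hα e]
  · intro z hz
    have hzi := hc.cell_subset_intGR hj hk hz
    have h1 := h.hamilton z hzi
    have h2 := h'.hamilton z hzi
    refine ⟨_, (h1.1.sub h2.1).congr_of_eventuallyEq ?_,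
      (h1.2.sub h2.2).congr_of_eventuallyEq ?_, ?_⟩
    · filter_upwards [ns z hz] with s hs' using et _ hs'
    · filter_upwards [nt z hz] with s hs' using es _ hs'
    · rw [es z hz, et z hz]
      exact hLip z hzi _ _ _ _ _ _

/-- A difference of co-states vanishes in a cell if it vanishes on the upper and right sides. -/
theorem CellDifference.eq_zero (hc : c.Admissible) {δ : ℝ × ℝ → Euc n} {K : ℝ} (hK : 0 ≤ K)
    {j k : ℕ} (hj : j ≤ c.N) (hk : k ≤ c.N) {v p q : ℝ × ℝ → Euc n}
    (h : CellDifference c δ K j k v p q) (hnj : ¬c.IsHorizontal j) (hnk : ¬c.IsVertical k)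
    (zv : ∀ α ∈ c.arc k, v (c.L₁ α, c.L₂ (min (c.node (j + 1)) α)) = 0)
    (zp : ∀ α ∈ c.arc k, p (c.L₁ α, c.L₂ (min (c.node (j + 1)) α)) = 0)
    (zq : ∀ β ∈ c.arc j, q (c.L₁ (max (c.node k) β), c.L₂ β) = 0) :
    ∀ z ∈ c.cell j k, δ z = 0 := by
  have hm : ∀ α ∈ Ioo (c.node k) (c.node (k + 1)), ∀ β ∈ Ioo (c.node j) (c.node (j + 1)), β < α →
      (c.L₁ α, c.L₂ β) ∈ c.cell j k := fun α hα β hβ hβα => hc.mem_cell hj hk hnj hnk hα hβ hβα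
  choose! R hR1 hR2 hR3 using h.mixed
  -- In arc-length coordinates the mixed derivative acquires the factor `n₂ n₁`, which is at most
  -- `1`, `n₂` and `n₁`. So it is controlled by `v`, `p` and `q`, which are bounded on the closed
  -- cell even if `δ_s` or `δ_t` is not.
  have kv : ∀ α ∈ Ioo (c.node k) (c.node (k + 1)), ∀ β ∈ Ioo (c.node j) (c.node (j + 1)), β < α →
      ‖(c.n₂ α * c.n₁ β) • R (c.L₁ α, c.L₂ β)‖ ≤ K * (‖v (c.L₁ α, c.L₂ β)‖ + ‖p (c.L₁ α, c.L₂ β)‖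
        + ‖q (c.L₁ α, c.L₂ β)‖) := by
    intro α hα β hβ hβα
    have hz := hm α hα β hβ hβα
    have a0 := hc.n₂_nonneg hk hα
    have a1 := hc.n₂_le hk hα
    have b0 := hc.n₁_nonneg hj hβ
    have b1 := hc.n₁_le hj hβ
    rw [h.ev _ hz, h.ep _ hz α hα rfl, h.eq _ hz β hβ rfl, norm_smul, norm_smul, norm_smul,
      Real.norm_of_nonneg a0, Real.norm_of_nonneg b0, Real.norm_of_nonneg (mul_nonneg a0 b0)]
    have r := hR3 _ hz
    have x1 := norm_nonneg (δ (c.L₁ α, c.L₂ β))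
    have x2 := norm_nonneg (dS δ (c.L₁ α, c.L₂ β))
    have x3 := norm_nonneg (dT δ (c.L₁ α, c.L₂ β))
    have y0 : c.n₂ α * c.n₁ β ≤ 1 := mul_le_one₀ a1 b0 b1
    have y1 : c.n₂ α * c.n₁ β ≤ c.n₂ α := mul_le_of_le_one_right a0 b1
    have y2 : c.n₂ α * c.n₁ β ≤ c.n₁ β := mul_le_of_le_one_left b0 a1
    refine (mul_le_mul_of_nonneg_left r (mul_nonneg a0 b0)).trans ?_
    have w1 := mul_le_mul_of_nonneg_right y0 x1
    have w2 := mul_le_mul_of_nonneg_right y1 x2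
    have w3 := mul_le_mul_of_nonneg_right y2 x3
    have : c.n₂ α * c.n₁ β * (‖δ (c.L₁ α, c.L₂ β)‖ + ‖dS δ (c.L₁ α, c.L₂ β)‖
        + ‖dT δ (c.L₁ α, c.L₂ β)‖) ≤ ‖δ (c.L₁ α, c.L₂ β)‖ + c.n₂ α * ‖dS δ (c.L₁ α, c.L₂ β)‖
        + c.n₁ β * ‖dT δ (c.L₁ α, c.L₂ β)‖ := by linarith
    have := mul_le_mul_of_nonneg_left this hK
    linarith
  have evt : ∀ α ∈ Ioo (c.node k) (c.node (k + 1)), ∀ β ∈ Ioo (c.node j) (c.node (j + 1)), β < α →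
      (∀ᶠ b in 𝓝 β, b ∈ Ioo (c.node j) (c.node (j + 1)) ∧ b < α) ∧
      ∀ᶠ a in 𝓝 α, a ∈ Ioo (c.node k) (c.node (k + 1)) ∧ β < a := fun α hα β hβ hβα =>
    ⟨Filter.inter_mem (Ioo_mem_nhds hβ.1 hβ.2) (gt_mem_nhds hβα),
      Filter.inter_mem (Ioo_mem_nhds hα.1 hα.2) (lt_mem_nhds hβα)⟩
  have hconv : ∀ α ∈ Ioo (c.node k) (c.node (k + 1)), ContinuousOn (fun b => (c.L₁ α, c.L₂ b))
      (Ioc (c.node j) (min (c.node (j + 1)) α)) := fun α hα => continuousOn_const.prodMk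
    ((hc.smooth₂ j hj).continuousOn.mono fun x hx => ⟨hx.1.le, hx.2.trans (min_le_left _ _)⟩)
  have hconh : ∀ β ∈ Ioo (c.node j) (c.node (j + 1)), ContinuousOn (fun a => (c.L₁ a, c.L₂ β))
      (Ico (max (c.node k) β) (c.node (k + 1))) := fun β hβ =>
    ((hc.smooth₁ k hk).continuousOn.mono fun x hx => ⟨(le_max_left _ _).trans hx.1,
      hx.2.le⟩).prodMk continuousOn_const
  -- The minus sign in `Q'` comes from `L₁' = -n₂`: increasing `α` means decreasing `s`.
  have main := eq_zero_of_hyperbolic (a₀ := c.node k) (a₁ := c.node (k + 1)) (b₀ := c.node j)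
    (b₁ := c.node (j + 1)) hK
    (V := fun α β => v (c.L₁ α, c.L₂ β)) (P := fun α β => p (c.L₁ α, c.L₂ β))
    (Q := fun α β => q (c.L₁ α, c.L₂ β))
    (P' := fun α β => (c.n₂ α * c.n₁ β) • R (c.L₁ α, c.L₂ β))
    (Q' := fun α β => -((c.n₂ α * c.n₁ β) • R (c.L₁ α, c.L₂ β)))
    (fun α hα => h.cv.comp (hconv α hα) fun b hb =>
      hc.closedArc_inter_closure hj hk hnj hnk hα hb)
    (fun α hα => h.cp.comp (hconv α hα) fun b hb =>
      hc.closedArc_inter_closure hj hk hnj hnk hα hb)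
    (fun β hβ => h.cq.comp (hconh β hβ) fun a ha =>
      hc.closedArc_inter_closure' hj hk hnj hnk hβ ha)
    (fun α hα β hβ hβα => by
      have hz := hm α hα β hβ hβα
      have := (h.dt _ hz).scomp β (hc.hasDerivAt_L₂ hj hβ)
      rw [h.eq _ hz β hβ rfl]
      refine this.congr_of_eventuallyEq ?_
      filter_upwards [(evt α hα β hβ hβα).1] with b hb
      exact h.ev _ (hm α hα b hb.1 hb.2))
    (fun α hα β hβ hβα => by
      have hz := hm α hα β hβ hβα
      have := ((hR2 _ hz).scomp β (hc.hasDerivAt_L₂ hj hβ)).const_smul (c.n₂ α)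
      rw [smul_smul] at this
      refine this.congr_of_eventuallyEq ?_
      filter_upwards [(evt α hα β hβ hβα).1] with b hb
      exact h.ep _ (hm α hα b hb.1 hb.2) α hα rfl)
    (fun α hα β hβ hβα => by
      have hz := hm α hα β hβ hβα
      have := ((hR1 _ hz).scomp α (hc.hasDerivAt_L₁ hk hα)).const_smul (c.n₁ β)
      rw [smul_smul, mul_neg, neg_smul, mul_comm] at this
      refine this.congr_of_eventuallyEq ?_
      filter_upwards [(evt α hα β hβ hβα).2] with a ha
      exact h.eq _ (hm a ha.1 β hβ ha.2) β hβ rfl)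
    kv (fun α hα β hβ hβα => by rw [norm_neg]; exact kv α hα β hβ hβα) zv zp zq (by
      obtain ⟨M₁, hM₁⟩ := (hc.isCompact_closure_cell j k).exists_bound_of_continuousOn h.cv
      obtain ⟨M₂, hM₂⟩ := (hc.isCompact_closure_cell j k).exists_bound_of_continuousOn h.cp
      obtain ⟨M₃, hM₃⟩ := (hc.isCompact_closure_cell j k).exists_bound_of_continuousOn h.cq
      refine ⟨M₁ + M₂ + M₃, fun α hα β hβ hβα => ?_⟩
      have hz := subset_closure (hm α hα β hβ hβα)
      exact add_le_add (add_le_add (hM₁ _ hz) (hM₂ _ hz)) (hM₃ _ hz))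
  intro z hz
  obtain ⟨_, _, _, α, hα, β, hβ, hβα, e1, e2⟩ := hc.exists_of_mem_cell hj hk hz
  have := main α hα β hβ hβα
  rw [e1, e2] at this
  rw [← h.ev z hz]; exact this

end ControlData

/-! ### Approach to the upper and the right side of a cell -/

namespace VertexCurve.Admissible

variable {c : VertexCurve} (hc : c.Admissible)
include hc

theorem tendsto_L₂_left {j : ℕ} (hj : j ≤ c.N) (hnj : ¬c.IsHorizontal j) :
    Tendsto c.L₂ (𝓝[<] (c.node (j + 1))) (𝓝[<] (c.vt (j + 1))) := by
  rw [← nhdsWithin_Ioo_eq_nhdsLT (hc.node_lt j hj)]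
  refine tendsto_nhdsWithin_iff.2 ⟨((hc.smooth₂ j hj).continuousOn _
    (hc.right_mem_closedArc hj)).mono Ioo_subset_Icc_self, eventually_mem_nhdsWithin.mono
    fun b hb => ?_⟩
  exact hc.strictMonoOn_L₂ hj hnj (Ioo_subset_Icc_self hb) (hc.right_mem_closedArc hj) hb.2

theorem tendsto_L₁_right {k : ℕ} (hk : k ≤ c.N) (hnk : ¬c.IsVertical k) :
    Tendsto c.L₁ (𝓝[>] (c.node k)) (𝓝[<] (c.vs k)) := by
  rw [← nhdsWithin_Ioo_eq_nhdsGT (hc.node_lt k hk)]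
  refine tendsto_nhdsWithin_iff.2 ⟨((hc.smooth₁ k hk).continuousOn _
    (hc.left_mem_closedArc hk)).mono Ioo_subset_Icc_self, eventually_mem_nhdsWithin.mono
    fun b hb => ?_⟩
  exact hc.strictAntiOn_L₁ hk hnk (hc.left_mem_closedArc hk) (Ioo_subset_Icc_self hb) hb.1

theorem L₁_mem_Ioo {k : ℕ} (hk : k ≤ c.N) (hnk : ¬c.IsVertical k) {α : ℝ} (hα : α ∈ c.arc k) :
    c.L₁ α ∈ Ioo (c.vs (k + 1)) (c.vs k) :=
  ⟨hc.strictAntiOn_L₁ hk hnk (Ioo_subset_Icc_self hα) (hc.right_mem_closedArc hk) hα.2,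
    hc.strictAntiOn_L₁ hk hnk (hc.left_mem_closedArc hk) (Ioo_subset_Icc_self hα) hα.1⟩

theorem L₂_mem_Ioo {j : ℕ} (hj : j ≤ c.N) (hnj : ¬c.IsHorizontal j) {β : ℝ} (hβ : β ∈ c.arc j) :
    c.L₂ β ∈ Ioo (c.vt j) (c.vt (j + 1)) :=
  ⟨hc.strictMonoOn_L₂ hj hnj (hc.left_mem_closedArc hj) (Ioo_subset_Icc_self hβ) hβ.1,
    hc.strictMonoOn_L₂ hj hnj (Ioo_subset_Icc_self hβ) (hc.right_mem_closedArc hj) hβ.2⟩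

theorem tendsto_up {j k : ℕ} (hj : j ≤ c.N) (hk : k ≤ c.N) (hjk : j < k) (hnj : ¬c.IsHorizontal j)
    (hnk : ¬c.IsVertical k) {α : ℝ} (hα : α ∈ c.arc k) :
    Tendsto (fun b => (c.L₁ α, c.L₂ b)) (𝓝[<] (c.node (j + 1)))
      (𝓝[c.cell j k] (c.L₁ α, c.vt (j + 1))) := by
  refine tendsto_nhdsWithin_iff.2 ⟨tendsto_const_nhds.prodMk_nhds
    ((hc.tendsto_L₂_left hj hnj).mono_right nhdsWithin_le_nhds), ?_⟩
  filter_upwards [Ioo_mem_nhdsLT (hc.node_lt j hj)] with b hb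
  exact hc.mem_cell hj hk hnj hnk hα hb
    (hb.2.trans_le ((hc.node_le_node (Nat.succ_le_of_lt hjk) (by lia)).trans hα.1.le))

theorem tendsto_right {j k : ℕ} (hj : j ≤ c.N) (hk : k ≤ c.N) (hjk : j < k)
    (hnj : ¬c.IsHorizontal j) (hnk : ¬c.IsVertical k) {β : ℝ} (hβ : β ∈ c.arc j) :
    Tendsto (fun a => (c.L₁ a, c.L₂ β)) (𝓝[>] (c.node k))
      (𝓝[c.cell j k] (c.vs k, c.L₂ β)) := by
  refine tendsto_nhdsWithin_iff.2 ⟨((hc.tendsto_L₁_right hk hnk).mono_right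
    nhdsWithin_le_nhds).prodMk_nhds tendsto_const_nhds, ?_⟩
  filter_upwards [Ioo_mem_nhdsGT (hc.node_lt k hk)] with a ha
  exact hc.mem_cell hj hk hnj hnk ha hβ
    ((hβ.2.le.trans (hc.node_le_node (Nat.succ_le_of_lt hjk) (by lia))).trans_lt ha.1)

theorem mem_closure_up {j k : ℕ} (hj : j ≤ c.N) (hk : k ≤ c.N) (hjk : j < k)
    (hnj : ¬c.IsHorizontal j) (hnk : ¬c.IsVertical k) {α : ℝ} (hα : α ∈ c.arc k) :
    (c.L₁ α, c.vt (j + 1)) ∈ closure (c.cell j k) :=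
  hc.closedArc_inter_closure hj hk hnj hnk hα ⟨hc.node_lt j hj, le_min le_rfl
    ((hc.node_le_node (Nat.succ_le_of_lt hjk) (by lia)).trans hα.1.le)⟩

theorem mem_closure_right {j k : ℕ} (hj : j ≤ c.N) (hk : k ≤ c.N) (hjk : j < k)
    (hnj : ¬c.IsHorizontal j) (hnk : ¬c.IsVertical k) {β : ℝ} (hβ : β ∈ c.arc j) :
    (c.vs k, c.L₂ β) ∈ closure (c.cell j k) :=
  hc.closedArc_inter_closure' hj hk hnj hnk hβ ⟨max_le le_rfl
    (hβ.2.le.trans (hc.node_le_node (Nat.succ_le_of_lt hjk) (by lia))), hc.node_lt k hk⟩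

end VertexCurve.Admissible

/-! ### Vanishing of the difference of two co-states -/

namespace ControlData

variable {n m : ℕ} {D : ControlData n m} {c : VertexCurve}
  {ρ₁ ρ₂ : ℝ → ℝ → ℝ → Fin n → Euc n} {ψ ψ' : ℝ × ℝ → Euc n} {K : ℝ} {j k : ℕ}
  {v p q : ℝ × ℝ → Euc n}

theorem CellDifference.tendsto {δ : ℝ × ℝ → Euc n} (h : CellDifference c δ K j k v p q)
    {z : ℝ × ℝ} (hz : z ∈ closure (c.cell j k)) : Tendsto δ (𝓝[c.cell j k] z) (𝓝 (v z)) :=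
  ((h.cv z hz).mono subset_closure).congr' (eventually_mem_nhdsWithin.mono fun y hy => h.ev y hy)

/-- Let `r` be the last vertex on the line of the upper side. If `r ≤ k`, the side lies inside the
domain; both co-states have the same jump there, and the cell above is `(r, k)`, which the induction
hypothesis covers. If `r > k`, the side is the horizontal arc `k`, and the difference of the
boundary values solves a homogeneous linear differential equation. -/
theorem upper_side_zero (hc : c.Admissible) (hD : D.Smooth c) (hψ : D.IsCostate c ρ₁ ρ₂ ψ)
    (hψ' : D.IsCostate c ρ₁ ρ₂ ψ') (hj : j ≤ c.N) (hk : k ≤ c.N) (hjk : j < k)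
    (hnj : ¬c.IsHorizontal j) (hnk : ¬c.IsVertical k)
    (h : CellDifference c (fun z => ψ z - ψ' z) K j k v p q)
    (ih : ∀ j' ≤ c.N, ∀ k' ≤ c.N, k' - j' < k - j → ∀ z ∈ c.cell j' k', ψ z - ψ' z = 0)
    {α : ℝ} (hα : α ∈ c.arc k) : v (c.L₁ α, c.vt (j + 1)) = 0 := by
  have hlim : ∀ α ∈ c.arc k, Tendsto (fun b => ψ (c.L₁ α, c.L₂ b) - ψ' (c.L₁ α, c.L₂ b))
      (𝓝[<] (c.node (j + 1))) (𝓝 (v (c.L₁ α, c.vt (j + 1)))) := fun α hα =>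
    (h.tendsto (hc.mem_closure_up hj hk hjk hnj hnk hα)).comp
      (hc.tendsto_up hj hk hjk hnj hnk hα)
  have hpos : 0 < c.vt (j + 1) := hc.L₂_pos
    ⟨(hc.node_nonneg (by lia)).trans_lt (hc.node_lt j hj), hc.node_le_len (by lia)⟩
  obtain ⟨r, hr1, hr2, hr3, hr4⟩ := exists_last_index (P := fun r => c.vt r = c.vt (j + 1))
    (i := j + 1) (M := c.N + 1) (by lia) rfl
  rcases le_or_gt r k with hrk | hrk
  · have hnr : ¬c.IsHorizontal r := fun h' =>
      hr4 (r + 1) (by lia) (by lia) (((hc.horizontal_iff (by lia)).1 h').trans hr3)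
    have hs := hc.L₁_mem_Ioo hk hnk hα
    have hs0 : 0 < c.L₁ α := (hc.pos α (hc.arc_subset hk hα)).1
    have hint : (c.L₁ α, c.vt r) ∈ interior c.G :=
      hc.mem_interior_of_last (by lia) hnr hs0 (hs.2.trans_le (hc.vs_anti hrk (by lia)))
        (by rw [hr3]; exact hpos)
    have hlast : ∀ k ≤ c.N + 1, r < k → c.vt k ≠ c.vt r := fun k' h1 h2 h3 =>
      hr4 k' h1 h2 (h3.trans hr3)
    obtain ⟨a₁, a₂, ha1, ha2, ha3⟩ := hψ.jumpS r hr2 hlast _ hint (hc.ne_vs hk hs)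
    obtain ⟨b₁, b₂, hb1, hb2, hb3⟩ := hψ'.jumpS r hr2 hlast _ hint (hc.ne_vs hk hs)
    have habove : ∀ᶠ t in 𝓝[>] (c.vt r), ψ (c.L₁ α, t) - ψ' (c.L₁ α, t) = 0 := by
      have h1 : ∀ᶠ t in 𝓝[>] (c.vt r), (c.L₁ α, t) ∈ interior c.G :=
        nhdsWithin_le_nhds ((Continuous.continuousAt (by fun_prop : Continuous fun t : ℝ =>
          (c.L₁ α, t))).preimage_mem_nhds (isOpen_interior.mem_nhds hint))
      have h2 : c.vt r < c.vt (r + 1) := lt_of_le_of_ne (hc.vt_mono (by lia) (by lia))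
        (fun e => hnr ((hc.horizontal_iff (by lia)).2 e.symm))
      filter_upwards [h1, Ioo_mem_nhdsGT h2] with t ht1 ht2
      exact ih r (by lia) k hk (by lia) _ ⟨ht1, hs, ht2⟩
    have e1 : a₂ - b₂ = 0 := tendsto_nhds_unique (ha2.sub hb2)
      (tendsto_const_nhds.congr' (habove.mono fun t ht => ht.symm))
    have e2 : v (c.L₁ α, c.vt (j + 1)) = a₁ - b₁ := by
      have ht := hc.tendsto_L₂_left hj hnj
      rw [← hr3] at ht
      exact tendsto_nhds_unique (hlim α hα) ((ha1.sub hb1).comp ht)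
    rw [e2]
    have e3 : a₁ - a₂ = b₁ - b₂ := ha3.trans hb3.symm
    -- Equal jumps mean that the difference of the co-states is continuous across the line, so its
    -- limit from below is the limit from above.
    have e4 : a₁ - b₁ = a₂ - b₂ := by
      rw [sub_eq_sub_iff_add_eq_add] at e3 ⊢
      rw [e3, add_comm]
    rw [e4, e1]
  · have hvk : c.vt k = c.vt (j + 1) := le_antisymm
      ((hc.vt_mono (by lia) hr2).trans hr3.le) (hc.vt_mono (by lia) (by lia))
    have hvk1 : c.vt (k + 1) = c.vt k := le_antisymm
      ((hc.vt_mono (by lia) hr2).trans (hr3.trans hvk.symm).le) (hc.vt_mono (by lia) (by lia))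
    have hh : c.IsHorizontal k := (hc.horizontal_iff hk).2 hvk1
    obtain ⟨w, hw⟩ := hψ.flat k hk (Or.inl hh)
    obtain ⟨w', hw'⟩ := hψ'.flat k hk (Or.inl hh)
    have hpt : ∀ μ ∈ c.arc k, c.point μ = (c.L₁ μ, c.vt (j + 1)) := fun μ hμ => by
      rw [VertexCurve.point, hh μ (Ioo_subset_Icc_self hμ), hvk]
    have hvω : ∀ μ ∈ c.arc k, v (c.L₁ μ, c.vt (j + 1)) = w μ - w' μ := by
      intro μ hμ
      have h1 := (hw μ hμ).1.sub (hw' μ hμ).1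
      rw [hpt μ hμ] at h1
      exact tendsto_nhds_unique (hlim μ hμ) ((h1.mono_left (nhdsWithin_mono _
        (hc.cell_subset_intGR hj hk))).comp (hc.tendsto_up hj hk hjk hnj hnk hμ))
    obtain ⟨O, hGO, hO⟩ := hD.smoothOn
    have hptO : ∀ μ ∈ c.closedArc k, c.point μ ∈ O := fun μ hμ =>
      hGO (hc.point_mem_G (hc.closedArc_subset hk hμ))
    obtain ⟨M, hM⟩ := isCompact_Icc.exists_bound_of_continuousOn
      (hO.contDiffOn_adjfq.continuousOn.comp (((hc.smooth₁ k hk).continuousOn).prodMk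
        (hc.smooth₂ k hk).continuousOn) hptO)
    -- On a horizontal arc `n₁ = 0` and `n₂ = 1`, so the arc condition reads `w' = H_q + …`, with
    -- `H_q` affine in `w`. The inhomogeneous terms cancel in the difference.
    have hode : ∀ μ ∈ c.arc k, HasDerivAt (fun μ => w μ - w' μ)
        (D.adjfq (c.point μ) (w μ - w' μ)) μ := by
      intro μ hμ
      have h1 := (hw μ hμ).2.2
      have h2 := (hw' μ hμ).2.2
      have hz := hptO μ (Ioo_subset_Icc_self hμ)
      rw [(hc.n_of_horizontal hk hh hμ).1, (hc.n_of_horizontal hk hh hμ).2, hO.Hq_eq hz] at h1 h2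
      refine ((hw μ hμ).2.1.hasDerivAt.sub (hw' μ hμ).2.1.hasDerivAt).congr_deriv ?_
      rw [← sub_eq_zero] at *
      rw [map_sub]
      have h3 := congrArg₂ (· - ·) h2 h1
      simp only [sub_zero] at h3
      rw [← h3]
      module
    have hclk : c.vertex k ∈ closure (c.cell j k) := by
      have : Tendsto (fun μ => (c.L₁ μ, c.vt (j + 1))) (𝓝[>] (c.node k)) (𝓝 (c.vertex k)) := by
        have h1 := ((hc.tendsto_L₁_right hk hnk).mono_right nhdsWithin_le_nhds).prodMk_nhds
          (tendsto_const_nhds (x := c.vt (j + 1)))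
        rwa [← hvk] at h1 ⊢
      refine closure_minimal subset_rfl isClosed_closure (mem_closure_of_tendsto this ?_)
      filter_upwards [Ioo_mem_nhdsGT (hc.node_lt k hk)] with μ hμ
      exact hc.mem_closure_up hj hk hjk hnj hnk hμ
    -- The cell lies in the quadrant `W3` of vertex `k`, where the vertex condition prescribes the
    -- same limit for both co-states. This is the initial value at the right end of the arc.
    have hv0 : v (c.vertex k) = 0 := by
      have h1 := (hψ.vertex₃ k (by lia)).sub (hψ'.vertex₃ k (by lia))
      rw [sub_self] at h1
      have hsub : c.cell j k ⊆ c.W3 k := fun z hz => ⟨hz.1, hz.2.1.2, hvk ▸ hz.2.2.2⟩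
      have : (𝓝[c.cell j k] (c.vertex k)).NeBot := mem_closure_iff_nhdsWithin_neBot.1 hclk
      exact tendsto_nhds_unique (h.tendsto hclk) (h1.mono_left (nhdsWithin_mono _ hsub))
    have hω0 : Tendsto (fun μ => w μ - w' μ) (𝓝[>] (c.node k)) (𝓝 0) := by
      rw [← hv0]
      have h1 : Tendsto (fun μ => (c.L₁ μ, c.vt (j + 1))) (𝓝[>] (c.node k))
          (𝓝[closure (c.cell j k)] (c.vertex k)) := by
        refine tendsto_nhdsWithin_iff.2 ⟨?_, ?_⟩
        · have h1 := ((hc.tendsto_L₁_right hk hnk).mono_right nhdsWithin_le_nhds).prodMk_nhds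
            (tendsto_const_nhds (x := c.vt (j + 1)))
          rwa [← hvk] at h1 ⊢
        · filter_upwards [Ioo_mem_nhdsGT (hc.node_lt k hk)] with μ hμ
          exact hc.mem_closure_up hj hk hjk hnj hnk hμ
      refine ((h.cv _ hclk).tendsto.comp h1).congr' ?_
      filter_upwards [Ioo_mem_nhdsGT (hc.node_lt k hk)] with μ hμ using hvω μ hμ
    rw [hvω α hα]
    refine eq_zero_of_norm_deriv_le (M := M) hode (fun μ hμ => ?_) hω0 α hα
    exact (ContinuousLinearMap.le_opNorm _ _).trans (mul_le_mul_of_nonneg_right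
      (hM μ (Ioo_subset_Icc_self hμ)) (norm_nonneg _))

/-- The mirror image of `upper_side_zero`, with the first vertex `r = i + 1` on the vertical line.
If `j < r`, the side is interior and the cell to the right is `(j, i)`. Otherwise the side is the
vertical arc `j`, and the equation is solved downwards from its upper end, vertex `j + 1`. -/
theorem right_side_zero (hc : c.Admissible) (hD : D.Smooth c) (hψ : D.IsCostate c ρ₁ ρ₂ ψ)
    (hψ' : D.IsCostate c ρ₁ ρ₂ ψ') (hj : j ≤ c.N) (hk : k ≤ c.N) (hjk : j < k)
    (hnj : ¬c.IsHorizontal j) (hnk : ¬c.IsVertical k)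
    (h : CellDifference c (fun z => ψ z - ψ' z) K j k v p q)
    (ih : ∀ j' ≤ c.N, ∀ k' ≤ c.N, k' - j' < k - j → ∀ z ∈ c.cell j' k', ψ z - ψ' z = 0)
    {β : ℝ} (hβ : β ∈ c.arc j) : v (c.vs k, c.L₂ β) = 0 := by
  have hlim : ∀ β ∈ c.arc j, Tendsto (fun a => ψ (c.L₁ a, c.L₂ β) - ψ' (c.L₁ a, c.L₂ β))
      (𝓝[>] (c.node k)) (𝓝 (v (c.vs k, c.L₂ β))) := fun β hβ =>
    (h.tendsto (hc.mem_closure_right hj hk hjk hnj hnk hβ)).comp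
      (hc.tendsto_right hj hk hjk hnj hnk hβ)
  have hpos : 0 < c.vs k := hc.L₁_pos
    ⟨hc.node_nonneg (by lia), (hc.node_lt k hk).trans_le (hc.node_le_len (by lia))⟩
  obtain ⟨r, hr1, hr3, hr4⟩ := exists_first_index (P := fun r => c.vs r = c.vs k) (i := k) rfl
  rcases lt_or_ge j r with hrj | hrj
  · obtain ⟨i, rfl⟩ : ∃ i, r = i + 1 := ⟨r - 1, by lia⟩
    have hni : ¬c.IsVertical i := fun h' =>
      hr4 i (by lia) (((hc.vertical_iff (by lia)).1 h').symm.trans hr3)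
    have ht := hc.L₂_mem_Ioo hj hnj hβ
    have ht0 : 0 < c.L₂ β := (hc.pos β (hc.arc_subset hj hβ)).2
    have hint : (c.vs (i + 1), c.L₂ β) ∈ interior c.G :=
      hc.mem_interior_of_first (by lia) hni ht0 (ht.2.trans_le (hc.vt_mono (by lia) (by lia)))
        (by rw [hr3]; exact hpos)
    have hfirst : ∀ k < i + 1, c.vs k ≠ c.vs (i + 1) := fun k' h1 h3 =>
      hr4 k' h1 (h3.trans hr3)
    obtain ⟨a₁, a₂, ha1, ha2, ha3⟩ := hψ.jumpT (i + 1) (by lia) hfirst _ hint (hc.ne_vt hj ht)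
    obtain ⟨b₁, b₂, hb1, hb2, hb3⟩ := hψ'.jumpT (i + 1) (by lia) hfirst _ hint (hc.ne_vt hj ht)
    have habove : ∀ᶠ s in 𝓝[>] (c.vs (i + 1)), ψ (s, c.L₂ β) - ψ' (s, c.L₂ β) = 0 := by
      have h1 : ∀ᶠ s in 𝓝[>] (c.vs (i + 1)), (s, c.L₂ β) ∈ interior c.G :=
        nhdsWithin_le_nhds ((Continuous.continuousAt (by fun_prop : Continuous fun s : ℝ =>
          (s, c.L₂ β))).preimage_mem_nhds (isOpen_interior.mem_nhds hint))
      have h2 : c.vs (i + 1) < c.vs i := lt_of_le_of_ne (hc.vs_anti (by lia) (by lia))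
        (fun e => hni ((hc.vertical_iff (by lia)).2 e))
      filter_upwards [h1, Ioo_mem_nhdsGT h2] with s hs1 hs2
      exact ih j hj i (by lia) (by lia) _ ⟨hs1, hs2, ht⟩
    have e1 : a₂ - b₂ = 0 := tendsto_nhds_unique (ha2.sub hb2)
      (tendsto_const_nhds.congr' (habove.mono fun t ht => ht.symm))
    have e2 : v (c.vs k, c.L₂ β) = a₁ - b₁ := by
      have ht := hc.tendsto_L₁_right hk hnk
      rw [← hr3] at ht
      exact tendsto_nhds_unique (hlim β hβ) ((ha1.sub hb1).comp ht)
    rw [e2]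
    have e3 : a₁ - a₂ = b₁ - b₂ := ha3.trans hb3.symm
    have e4 : a₁ - b₁ = a₂ - b₂ := by
      rw [sub_eq_sub_iff_add_eq_add] at e3 ⊢
      rw [e3, add_comm]
    rw [e4, e1]
  · have hvj1 : c.vs (j + 1) = c.vs k := le_antisymm
      ((hc.vs_anti (by lia) (by lia)).trans hr3.le) (hc.vs_anti (by lia) (by lia))
    have hvj : c.vs j = c.vs k := le_antisymm
      ((hc.vs_anti (by lia) (by lia)).trans hr3.le) (hc.vs_anti (by lia) (by lia))
    have hh : c.IsVertical j := (hc.vertical_iff hj).2 (hvj1.trans hvj.symm)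
    obtain ⟨w, hw⟩ := hψ.flat j hj (Or.inr hh)
    obtain ⟨w', hw'⟩ := hψ'.flat j hj (Or.inr hh)
    have hpt : ∀ μ ∈ c.arc j, c.point μ = (c.vs k, c.L₂ μ) := fun μ hμ => by
      rw [VertexCurve.point, hh μ (Ioo_subset_Icc_self hμ), hvj]
    have hvω : ∀ μ ∈ c.arc j, v (c.vs k, c.L₂ μ) = w μ - w' μ := by
      intro μ hμ
      have h1 := (hw μ hμ).1.sub (hw' μ hμ).1
      rw [hpt μ hμ] at h1
      exact tendsto_nhds_unique (hlim μ hμ) ((h1.mono_left (nhdsWithin_mono _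
        (hc.cell_subset_intGR hj hk))).comp (hc.tendsto_right hj hk hjk hnj hnk hμ))
    obtain ⟨O, hGO, hO⟩ := hD.smoothOn
    have hptO : ∀ μ ∈ c.closedArc j, c.point μ ∈ O := fun μ hμ =>
      hGO (hc.point_mem_G (hc.closedArc_subset hj hμ))
    obtain ⟨M, hM⟩ := isCompact_Icc.exists_bound_of_continuousOn
      (hO.contDiffOn_adjfp.continuousOn.comp (((hc.smooth₁ j hj).continuousOn).prodMk
        (hc.smooth₂ j hj).continuousOn) hptO)
    have hode : ∀ μ ∈ c.arc j, HasDerivAt (fun μ => w μ - w' μ)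
        (-D.adjfp (c.point μ) (w μ - w' μ)) μ := by
      intro μ hμ
      have h1 := (hw μ hμ).2.2
      have h2 := (hw' μ hμ).2.2
      have hz := hptO μ (Ioo_subset_Icc_self hμ)
      rw [(hc.n_of_vertical hj hh hμ).1, (hc.n_of_vertical hj hh hμ).2, hO.Hp_eq hz] at h1 h2
      refine ((hw μ hμ).2.1.hasDerivAt.sub (hw' μ hμ).2.1.hasDerivAt).congr_deriv ?_
      rw [← sub_eq_zero] at *
      rw [map_sub]
      have h3 := congrArg₂ (· - ·) h1 h2
      simp only [sub_zero] at h3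
      rw [← h3]
      module
    have htend : Tendsto (fun μ => (c.vs k, c.L₂ μ)) (𝓝[<] (c.node (j + 1)))
        (𝓝 (c.vertex (j + 1))) := by
      have h1 := (tendsto_const_nhds (x := c.vs k)).prodMk_nhds
        ((hc.tendsto_L₂_left hj hnj).mono_right nhdsWithin_le_nhds)
      rwa [← hvj1] at h1 ⊢
    have hclk : c.vertex (j + 1) ∈ closure (c.cell j k) := by
      refine closure_minimal subset_rfl isClosed_closure (mem_closure_of_tendsto htend ?_)
      filter_upwards [Ioo_mem_nhdsLT (hc.node_lt j hj)] with μ hμ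
      exact hc.mem_closure_right hj hk hjk hnj hnk hμ
    have hv0 : v (c.vertex (j + 1)) = 0 := by
      have h1 := (hψ.vertex₃ (j + 1) (by lia)).sub (hψ'.vertex₃ (j + 1) (by lia))
      rw [sub_self] at h1
      have hsub : c.cell j k ⊆ c.W3 (j + 1) := fun z hz => ⟨hz.1, hvj1 ▸ hz.2.1.2, hz.2.2.2⟩
      have : (𝓝[c.cell j k] (c.vertex (j + 1))).NeBot := mem_closure_iff_nhdsWithin_neBot.1 hclk
      exact tendsto_nhds_unique (h.tendsto hclk) (h1.mono_left (nhdsWithin_mono _ hsub))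
    have hω0 : Tendsto (fun μ => w μ - w' μ) (𝓝[<] (c.node (j + 1))) (𝓝 0) := by
      rw [← hv0]
      have h1 : Tendsto (fun μ => (c.vs k, c.L₂ μ)) (𝓝[<] (c.node (j + 1)))
          (𝓝[closure (c.cell j k)] (c.vertex (j + 1))) := by
        refine tendsto_nhdsWithin_iff.2 ⟨htend, ?_⟩
        filter_upwards [Ioo_mem_nhdsLT (hc.node_lt j hj)] with μ hμ
        exact hc.mem_closure_right hj hk hjk hnj hnk hμ
      refine ((h.cv _ hclk).tendsto.comp h1).congr' ?_
      filter_upwards [Ioo_mem_nhdsLT (hc.node_lt j hj)] with μ hμ using hvω μ hμ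
    rw [hvω β hβ]
    refine eq_zero_of_norm_deriv_le' (M := M) hode (fun μ hμ => ?_) hω0 β hβ
    rw [norm_neg]
    exact (ContinuousLinearMap.le_opNorm _ _).trans (mul_le_mul_of_nonneg_right
      (hM μ (Ioo_subset_Icc_self hμ)) (norm_nonneg _))

theorem tendsto_within_closure (hc : c.Admissible) (hk : k ≤ c.N) {z : ℝ × ℝ}
    {f : ℝ × ℝ → Euc n} {y : Euc n} (hf : Tendsto f (𝓝[c.intGR] z) (𝓝 y)) (hj : j ≤ c.N) :
    Tendsto f (𝓝[c.cell j k] z) (𝓝 y) :=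
  hf.mono_left (nhdsWithin_mono _ (hc.cell_subset_intGR hj hk))

/-- Induction on the distance `k - j` from the curve. For `j = k` the oblique condition supplies
zero Cauchy data. For `j < k` the values on the upper and right sides vanish by the preceding
lemmas, and the derivatives along these sides are zero as limits of derivatives of functions that
tend to zero. Cells with `j > k` are empty, so truncated subtraction is harmless. -/
theorem cell_eq_zero (hc : c.Admissible) (hD : D.Smooth c) (hK : 0 ≤ K)
    (hLip : ∀ z ∈ c.intGR, ∀ ψ ψ' P P' Q Q' : Euc n,
      ‖D.rhs z ψ P Q - D.rhs z ψ' P' Q'‖ ≤ K * (‖ψ - ψ'‖ + ‖P - P'‖ + ‖Q - Q'‖))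
    (hψ : D.IsCostate c ρ₁ ρ₂ ψ) (hψ' : D.IsCostate c ρ₁ ρ₂ ψ') (d : ℕ) :
    ∀ j ≤ c.N, ∀ k ≤ c.N, k - j = d → ∀ z ∈ c.cell j k, ψ z - ψ' z = 0 := by
  induction d using Nat.strong_induction_on with
  | _ d ih =>
  intro j hj k hk hd z hz
  obtain ⟨hnj, hnk, hjk, -⟩ := hc.exists_of_mem_cell hj hk hz
  obtain ⟨v, p, q, h⟩ := exists_cellDifference hc hLip hψ hψ' hj hk
  rcases hjk.eq_or_lt with rfl | hjk
  · have hob : c.IsOblique j := (hc.oblique_iff hj).2 ⟨hnk, hnj⟩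
    have hcl : ∀ μ ∈ c.arc j, c.point μ ∈ closure (c.cell j j) := fun μ hμ =>
      hc.closedArc_inter_closure hj hj hnj hnk hμ ⟨hμ.1, le_min hμ.2.le le_rfl⟩
    have hmin : ∀ μ ∈ c.arc j, min (c.node (j + 1)) μ = μ := fun μ hμ => min_eq_right hμ.2.le
    have hmax : ∀ μ ∈ c.arc j, max (c.node j) μ = μ := fun μ hμ => max_eq_right hμ.1.le
    have hne : ∀ μ ∈ c.arc j, (𝓝[c.cell j j] (c.point μ)).NeBot := fun μ hμ =>
      mem_closure_iff_nhdsWithin_neBot.1 (hcl μ hμ)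
    choose! α' hα' β' hβ' hlt eα eβ using fun z hz => (hc.exists_of_mem_cell (z := z) hj hj hz).2.2.2
    refine h.eq_zero hc hK hj hj hnj hnk ?_ ?_ ?_ z hz
    · intro μ hμ
      rw [hmin μ hμ]
      have : (𝓝[c.cell j j] (c.L₁ μ, c.L₂ μ)).NeBot := hne μ hμ
      have h1 := (hψ.oblique j hj hob μ hμ).1.sub (hψ'.oblique j hj hob μ hμ).1
      rw [sub_zero] at h1
      exact tendsto_nhds_unique (h.tendsto (hcl μ hμ)) (tendsto_within_closure hc hj h1 hj)
    · intro μ hμ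
      rw [hmin μ hμ]
      have := hne μ hμ
      have h1 := (hψ.oblique j hj hob μ hμ).2.1.sub (hψ'.oblique j hj hob μ hμ).2.1
      rw [sub_self] at h1
      have h1 := tendsto_within_closure hc hj h1 hj
      have hn := (hob μ hμ).2
      refine tendsto_nhds_unique ((h.cp _ (hcl μ hμ)).mono subset_closure).tendsto ?_
      -- The arc condition controls `n₂ (μ) δ_s` with the normal at the limit point, whereas `p`
      -- carries the normal above the moving point. The latter is at most `1`, and `n₂ (μ) > 0` can
      -- be divided out.
      have h2 := h1.norm.const_mul (c.n₂ μ)⁻¹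
      rw [norm_zero, mul_zero] at h2
      refine squeeze_zero_norm' ?_ h2
      filter_upwards [eventually_mem_nhdsWithin] with y hy
      have hds : dS (fun z => ψ z - ψ' z) y = dS ψ y - dS ψ' y := by
        obtain ⟨_, _, _, _, _, _, hr⟩ := hψ.regular j hj j hj
        obtain ⟨_, _, _, _, _, _, hr'⟩ := hψ'.regular j hj j hj
        exact ((hr y hy).2.1.hasDerivAt.sub (hr' y hy).2.1.hasDerivAt).deriv
      rw [h.ep y hy _ (hα' y hy) (eα y hy), ← smul_sub, norm_smul, norm_smul,
        Real.norm_of_nonneg (hc.n₂_nonneg hj (hα' y hy)), Real.norm_of_nonneg hn.le,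
        inv_mul_cancel_left₀ hn.ne', hds]
      exact mul_le_of_le_one_left (norm_nonneg _) (hc.n₂_le hj (hα' y hy))
    · intro μ hμ
      rw [hmax μ hμ]
      have := hne μ hμ
      have h1 := (hψ.oblique j hj hob μ hμ).2.2.sub (hψ'.oblique j hj hob μ hμ).2.2
      rw [sub_self] at h1
      have h1 := tendsto_within_closure hc hj h1 hj
      have hn := (hob μ hμ).1
      refine tendsto_nhds_unique ((h.cq _ (hcl μ hμ)).mono subset_closure).tendsto ?_
      have h2 := h1.norm.const_mul (c.n₁ μ)⁻¹
      rw [norm_zero, mul_zero] at h2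
      refine squeeze_zero_norm' ?_ h2
      filter_upwards [eventually_mem_nhdsWithin] with y hy
      have hds : dT (fun z => ψ z - ψ' z) y = dT ψ y - dT ψ' y := by
        obtain ⟨_, _, _, _, _, _, hr⟩ := hψ.regular j hj j hj
        obtain ⟨_, _, _, _, _, _, hr'⟩ := hψ'.regular j hj j hj
        exact ((hr y hy).2.2.1.hasDerivAt.sub (hr' y hy).2.2.1.hasDerivAt).deriv
      rw [h.eq y hy _ (hβ' y hy) (eβ y hy), ← smul_sub, norm_smul, norm_smul,
        Real.norm_of_nonneg (hc.n₁_nonneg hj (hβ' y hy)), Real.norm_of_nonneg hn.le,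
        inv_mul_cancel_left₀ hn.ne', hds]
      exact mul_le_of_le_one_left (norm_nonneg _) (hc.n₁_le hj (hβ' y hy))
  · have ih' : ∀ j' ≤ c.N, ∀ k' ≤ c.N, k' - j' < k - j → ∀ z ∈ c.cell j' k', ψ z - ψ' z = 0 :=
      fun j' hj' k' hk' hlt => ih (k' - j') (hd ▸ hlt) j' hj' k' hk' rfl
    have hnode : c.node (j + 1) ≤ c.node k := hc.node_le_node hjk (by lia)
    have hmin : ∀ μ ∈ c.arc k, min (c.node (j + 1)) μ = c.node (j + 1) := fun μ hμ =>
      min_eq_left (hnode.trans hμ.1.le)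
    have hmax : ∀ μ ∈ c.arc j, max (c.node k) μ = c.node k := fun μ hμ =>
      max_eq_left (hμ.2.le.trans hnode)
    have zv : ∀ α ∈ c.arc k, v (c.L₁ α, c.vt (j + 1)) = 0 := fun α hα =>
      upper_side_zero hc hD hψ hψ' hj hk hjk hnj hnk h ih' hα
    have zr : ∀ β ∈ c.arc j, v (c.vs k, c.L₂ β) = 0 := fun β hβ =>
      right_side_zero hc hD hψ hψ' hj hk hjk hnj hnk h ih' hβ
    have hmem : ∀ a ∈ c.arc k, ∀ b ∈ c.arc j, (c.L₁ a, c.L₂ b) ∈ c.cell j k := fun a ha b hb =>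
      hc.mem_cell hj hk hnj hnk ha hb (hb.2.trans_le (hnode.trans ha.1.le))
    refine h.eq_zero hc hK hj hk hnj hnk ?_ ?_ ?_ z hz
    · intro α hα
      rw [hmin α hα]; exact zv α hα
    · intro α hα
      rw [hmin α hα]
      -- Along horizontal lines that approach the upper side from below, `v` tends to zero and its
      -- derivative with respect to the arc length is `-p`, which converges.
      refine eq_zero_of_tendsto_deriv (V := fun a b => v (c.L₁ a, c.L₂ b))
        (P := fun a b => -p (c.L₁ a, c.L₂ b)) (P₀ := -p (c.L₁ α, c.vt (j + 1)))
        (l := 𝓝[<] (c.node (j + 1))) hα ?_ ?_ ?_ |> neg_eq_zero.1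
      · filter_upwards [Ioo_mem_nhdsLT (hc.node_lt j hj)] with b hb a ha
        have hz := hmem a ha b hb
        have := (h.ds _ hz).scomp a (hc.hasDerivAt_L₁ hk ha)
        rw [h.ep _ hz a ha rfl, ← neg_smul]
        refine this.congr_of_eventuallyEq ?_
        filter_upwards [Ioo_mem_nhds ha.1 ha.2] with x hx using h.ev _ (hmem x hx b hb)
      · intro a ha
        rw [← zv a ha]
        exact ((h.cv _ (hc.mem_closure_up hj hk hjk hnj hnk ha)).mono subset_closure).tendsto.comp
          (hc.tendsto_up hj hk hjk hnj hnk ha)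
      · refine Tendsto.neg ?_
        refine ((h.cp _ (hc.mem_closure_up hj hk hjk hnj hnk hα)).mono
          subset_closure).tendsto.comp (tendsto_nhdsWithin_iff.2 ⟨?_, ?_⟩)
        · exact (((hc.hasDerivAt_L₁ hk hα).continuousAt.tendsto).comp tendsto_fst).prodMk_nhds
            (((hc.tendsto_L₂_left hj hnj).mono_right nhdsWithin_le_nhds).comp tendsto_snd)
        · filter_upwards [prod_mem_prod (Ioo_mem_nhds hα.1 hα.2)
            (Ioo_mem_nhdsLT (hc.node_lt j hj))] with y hy using hmem _ hy.1 _ hy.2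
    · intro β hβ
      rw [hmax β hβ]
      refine eq_zero_of_tendsto_deriv (V := fun b a => v (c.L₁ a, c.L₂ b))
        (P := fun b a => q (c.L₁ a, c.L₂ b)) (P₀ := q (c.vs k, c.L₂ β))
        (l := 𝓝[>] (c.node k)) hβ ?_ ?_ ?_
      · filter_upwards [Ioo_mem_nhdsGT (hc.node_lt k hk)] with a ha b hb
        have hz := hmem a ha b hb
        have := (h.dt _ hz).scomp b (hc.hasDerivAt_L₂ hj hb)
        rw [h.eq _ hz b hb rfl]
        refine this.congr_of_eventuallyEq ?_
        filter_upwards [Ioo_mem_nhds hb.1 hb.2] with x hx using h.ev _ (hmem a ha x hx)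
      · intro b hb
        rw [← zr b hb]
        exact ((h.cv _ (hc.mem_closure_right hj hk hjk hnj hnk hb)).mono
          subset_closure).tendsto.comp (hc.tendsto_right hj hk hjk hnj hnk hb)
      · refine ((h.cq _ (hc.mem_closure_right hj hk hjk hnj hnk hβ)).mono
          subset_closure).tendsto.comp (tendsto_nhdsWithin_iff.2 ⟨?_, ?_⟩)
        · exact (((hc.tendsto_L₁_right hk hnk).mono_right nhdsWithin_le_nhds).comp
            tendsto_snd).prodMk_nhds
            (((hc.hasDerivAt_L₂ hj hβ).continuousAt.tendsto).comp tendsto_fst)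
        · filter_upwards [prod_mem_prod (Ioo_mem_nhds hβ.1 hβ.2)
            (Ioo_mem_nhdsGT (hc.node_lt k hk))] with y hy using hmem _ hy.2 _ hy.1

theorem costate_unique (hc : c.Admissible) (hD : D.Smooth c) (hLip : D.RhsLipschitz c)
    (hψ : D.IsCostate c ρ₁ ρ₂ ψ) (hψ' : D.IsCostate c ρ₁ ρ₂ ψ') : EqOn ψ ψ' c.intGR := by
  intro z hz
  obtain ⟨K, hK⟩ := hLip
  have hK' : ∀ z ∈ c.intGR, ∀ ψ ψ' P P' Q Q' : Euc n,
      ‖D.rhs z ψ P Q - D.rhs z ψ' P' Q'‖ ≤ |K| * (‖ψ - ψ'‖ + ‖P - P'‖ + ‖Q - Q'‖) := by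
    intro z hz ψ ψ' P P' Q Q'
    exact (hK z hz ψ ψ' P P' Q Q').trans (mul_le_mul_of_nonneg_right (le_abs_self K) (by positivity))
  obtain ⟨j, hj, k, hk, hzc⟩ := hc.exists_cell hz
  exact sub_eq_zero.1 (cell_eq_zero hc hD (abs_nonneg K) hK' hψ hψ' _ j hj k hk rfl z hzc)

end ControlData

/-! ### Blowing up the vertices

The parameter interval is stretched: every vertex is replaced by an interval of length one, so that
the contributions of the vertices become integrals over these intervals. -/

namespace VertexCurve

variable (c : VertexCurve)

/-- The left end of the interval that replaces vertex `r`. -/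
def knot (r : ℕ) : ℝ := c.node r + r

/-- The length of the stretched parameter interval. -/
def blowLen : ℝ := c.knot (c.N + 1) + 1

/-- The interval that corresponds to the open arc `j`. -/
def blowArc (j : ℕ) : Set ℝ := Ioo (c.knot j + 1) (c.knot (j + 1))

/-- The interval that replaces vertex `r`. -/
def blowNode (r : ℕ) : Set ℝ := Ioo (c.knot r) (c.knot r + 1)

/-- The map of the stretched interval onto the interval of parameters. -/
def collapse (l : ℝ) : ℝ :=
  ∑ j ∈ Finset.range (c.N + 1), max 0 (min (c.node (j + 1) - c.node j) (l - (c.knot j + 1)))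

/-- A function on the stretched interval that is given by `g` on the arcs and by `v` on the
vertices. -/
def glue {E : Type*} [AddCommGroup E] (g : ℝ → E) (v : ℕ → E) (l : ℝ) : E :=
  ∑ j ∈ Finset.range (c.N + 1), (c.blowArc j).indicator (fun l => g (l - (j + 1))) l +
    ∑ r ∈ Finset.range (c.N + 2), (c.blowNode r).indicator (fun _ => v r) l

def blow₁ (l : ℝ) : ℝ := c.L₁ (c.collapse l)

def blow₂ (l : ℝ) : ℝ := c.L₂ (c.collapse l)

theorem knot_succ (j : ℕ) : c.knot (j + 1) = c.node (j + 1) + (j + 1) := by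
  rw [knot]; push_cast; ring

/-- The shift on arc `j` is `j + 1`, because the `j + 1` vertices `0, …, j` precede it, each
occupying an interval of length one. -/
theorem add_mem_blowArc_iff {j : ℕ} {μ : ℝ} : μ + (j + 1) ∈ c.blowArc j ↔ μ ∈ c.arc j := by
  rw [blowArc, arc, knot_succ, knot]
  constructor <;> rintro ⟨h1, h2⟩ <;> constructor <;> linarith

theorem sub_mem_arc {j : ℕ} {l : ℝ} (hl : l ∈ c.blowArc j) : l - (j + 1) ∈ c.arc j := by
  rw [← add_mem_blowArc_iff, sub_add_cancel]; exact hl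

theorem continuous_collapse : Continuous c.collapse := by
  unfold collapse
  fun_prop

theorem monotone_collapse : Monotone c.collapse := by
  intro x y hxy
  refine Finset.sum_le_sum fun j _ => max_le_max le_rfl (min_le_min le_rfl ?_)
  linarith

namespace Admissible

variable {c} (hc : c.Admissible)
include hc

theorem knot_add_one_le {i j : ℕ} (hij : i < j) (hj : j ≤ c.N + 1) : c.knot i + 1 < c.knot j := by
  have h1 := hc.node_lt_node hij hj
  have h2 : ((i + 1 : ℕ) : ℝ) ≤ j := Nat.cast_le.2 hij
  rw [knot, knot]
  push_cast at h2
  linarith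

theorem knot_le {i j : ℕ} (hij : i ≤ j) (hj : j ≤ c.N + 1) : c.knot i ≤ c.knot j := by
  rcases hij.eq_or_lt with rfl | h
  · exact le_rfl
  · linarith [hc.knot_add_one_le h hj]

theorem le_of_knot_le {i j : ℕ} (hi : i ≤ c.N + 1) (h : c.knot i ≤ c.knot j) : i ≤ j := by
  by_contra! hlt
  linarith [hc.knot_add_one_le hlt hi]

theorem knot_nonneg {j : ℕ} (hj : j ≤ c.N + 1) : 0 ≤ c.knot j :=
  add_nonneg (hc.node_nonneg hj) (Nat.cast_nonneg j)

theorem knot_add_one_le_blowLen {j : ℕ} (hj : j ≤ c.N + 1) : c.knot j + 1 ≤ c.blowLen := by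
  rw [blowLen]
  linarith [hc.knot_le hj le_rfl]

/-- To the right of `knot m` the first `m` summands of `collapse` have reached their maxima and
telescope; to the left of `knot m + 1` the remaining ones are still zero (`sum_Ico_collapse`). Hence
`collapse` is constant on the vertex intervals and has slope one on the arcs. -/
theorem sum_collapse {m : ℕ} (hm : m ≤ c.N + 1) {l : ℝ} (hl : c.knot m ≤ l) :
    ∑ j ∈ Finset.range m, max 0 (min (c.node (j + 1) - c.node j) (l - (c.knot j + 1)))
      = c.node m := by
  have : ∀ j ∈ Finset.range m, max 0 (min (c.node (j + 1) - c.node j) (l - (c.knot j + 1)))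
      = c.node (j + 1) - c.node j := by
    intro j hj
    rw [Finset.mem_range] at hj
    have h1 := hc.node_lt j (by lia)
    have h2 := hc.knot_le (Nat.succ_le_of_lt hj) hm
    rw [Nat.succ_eq_add_one, knot_succ] at h2
    have h3 : c.knot j = c.node j + j := rfl
    rw [min_eq_left (by linarith), max_eq_right (by linarith)]
  rw [Finset.sum_congr rfl this, Finset.sum_range_sub, hc.node_zero, sub_zero]

theorem sum_Ico_collapse {m : ℕ} {l : ℝ} (hl : l ≤ c.knot m + 1) :
    ∑ j ∈ Finset.Ico m (c.N + 1), max 0 (min (c.node (j + 1) - c.node j) (l - (c.knot j + 1)))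
      = 0 := by
  refine Finset.sum_eq_zero fun j hj => ?_
  rw [Finset.mem_Ico] at hj
  have := hc.knot_le hj.1 (by lia)
  exact max_eq_left ((min_le_right _ _).trans (by linarith))

theorem collapse_node {r : ℕ} (hr : r ≤ c.N + 1) {l : ℝ} (hl : l ∈ Icc (c.knot r) (c.knot r + 1)) :
    c.collapse l = c.node r := by
  rw [collapse, ← Finset.sum_range_add_sum_Ico _ hr, hc.sum_collapse hr hl.1,
    hc.sum_Ico_collapse hl.2, add_zero]

theorem collapse_arc {j : ℕ} (hj : j ≤ c.N) {l : ℝ}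
    (hl : l ∈ Icc (c.knot j + 1) (c.knot (j + 1))) : c.collapse l = l - (j + 1) := by
  have h1 : c.knot j = c.node j + j := rfl
  have h2 := c.knot_succ j
  rw [collapse, ← Finset.sum_range_add_sum_Ico _ (Nat.succ_le_succ hj), Nat.succ_eq_add_one,
    Finset.sum_range_succ,
    hc.sum_collapse (by lia) (by linarith [hl.1]), hc.sum_Ico_collapse (by linarith [hl.2]),
    min_eq_right (by linarith [hl.2]), max_eq_right (by linarith [hl.1])]
  linarith

theorem collapse_nonneg (l : ℝ) : 0 ≤ c.collapse l :=
  Finset.sum_nonneg fun _ _ => le_max_left _ _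

theorem collapse_le (l : ℝ) : c.collapse l ≤ c.len := by
  have : c.len = ∑ j ∈ Finset.range (c.N + 1), (c.node (j + 1) - c.node j) := by
    rw [Finset.sum_range_sub, hc.node_zero, sub_zero, len]
  rw [this]
  refine Finset.sum_le_sum fun j hj => max_le ?_ (min_le_left _ _)
  rw [Finset.mem_range] at hj
  linarith [hc.node_lt j (by lia)]

theorem collapse_mem (l : ℝ) : c.collapse l ∈ Icc 0 c.len := ⟨hc.collapse_nonneg l, hc.collapse_le l⟩

/-- By monotonicity, a stretched parameter outside the interval of arc `k` is mapped to an end point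
of the arc or beyond. So interior points of an arc have exactly one preimage. -/
theorem eq_of_collapse_mem_arc {k : ℕ} (hk : k ≤ c.N) {l : ℝ} (h : c.collapse l ∈ c.arc k) :
    l = c.collapse l + (k + 1) := by
  have h1 : c.knot k + 1 ≤ l := by
    by_contra! hl
    have := c.monotone_collapse hl.le
    rw [hc.collapse_node (r := k) (by lia) ⟨by linarith, le_rfl⟩] at this
    exact absurd h.1 (not_lt.2 this)
  have h2 : l ≤ c.knot (k + 1) := by
    by_contra! hl
    have := c.monotone_collapse hl.le
    rw [hc.collapse_node (r := k + 1) (by lia) ⟨le_rfl, by linarith⟩] at this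
    exact absurd h.2 (not_lt.2 this)
  rw [hc.collapse_arc hk ⟨h1, h2⟩]
  ring

theorem blowArc_subset {j : ℕ} (hj : j ≤ c.N) : c.blowArc j ⊆ Ioo 0 c.blowLen := fun l hl =>
  ⟨lt_of_lt_of_le (by linarith [hc.knot_nonneg (j := j) (by lia)]) hl.1.le,
    by linarith [hl.2, hc.knot_add_one_le_blowLen (j := j + 1) (by lia)]⟩

theorem blow₁_node {r : ℕ} (hr : r ≤ c.N + 1) {l : ℝ} (hl : l ∈ Icc (c.knot r) (c.knot r + 1)) :
    c.blow₁ l = c.vs r := by rw [blow₁, hc.collapse_node hr hl, vs]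

theorem blow₂_node {r : ℕ} (hr : r ≤ c.N + 1) {l : ℝ} (hl : l ∈ Icc (c.knot r) (c.knot r + 1)) :
    c.blow₂ l = c.vt r := by rw [blow₂, hc.collapse_node hr hl, vt]

theorem collapse_add {j : ℕ} (hj : j ≤ c.N) {μ : ℝ} (hμ : μ ∈ c.closedArc j) :
    c.collapse (μ + (j + 1)) = μ := by
  have h1 : c.knot j = c.node j + j := rfl
  have h2 := c.knot_succ j
  rw [hc.collapse_arc hj ⟨by linarith [hμ.1], by linarith [hμ.2]⟩, add_sub_cancel_right]

theorem blow₁_add {j : ℕ} (hj : j ≤ c.N) {μ : ℝ} (hμ : μ ∈ c.closedArc j) :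
    c.blow₁ (μ + (j + 1)) = c.L₁ μ := by rw [blow₁, hc.collapse_add hj hμ]

theorem blow₂_add {j : ℕ} (hj : j ≤ c.N) {μ : ℝ} (hμ : μ ∈ c.closedArc j) :
    c.blow₂ (μ + (j + 1)) = c.L₂ μ := by rw [blow₂, hc.collapse_add hj hμ]

theorem continuous_blow₁ : Continuous c.blow₁ :=
  hc.continuousOn_L₁.comp_continuous c.continuous_collapse hc.collapse_mem

theorem continuous_blow₂ : Continuous c.blow₂ :=
  hc.continuousOn_L₂.comp_continuous c.continuous_collapse hc.collapse_mem

theorem blow₁_anti : Antitone c.blow₁ := fun _ _ h =>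
  hc.antitone₁ (hc.collapse_mem _) (hc.collapse_mem _) (c.monotone_collapse h)

theorem blow₂_mono : Monotone c.blow₂ := fun _ _ h =>
  hc.monotone₂ (hc.collapse_mem _) (hc.collapse_mem _) (c.monotone_collapse h)

theorem blow_mem_G {z : ℝ × ℝ} (hz : z.2 ≤ z.1) : (c.blow₁ z.1, c.blow₂ z.2) ∈ c.G :=
  hc.mem_G (hc.collapse_nonneg _) (c.monotone_collapse hz) (hc.collapse_le _)

theorem eq_of_mem_blowArc {i j : ℕ} (hi : i ≤ c.N) (hj : j ≤ c.N) {l : ℝ} (h : l ∈ c.blowArc i)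
    (h' : l ∈ c.blowArc j) : i = j := by
  rcases lt_trichotomy i j with hlt | h0 | hlt
  · linarith [h.2, h'.1, hc.knot_le (Nat.succ_le_of_lt hlt) (by lia)]
  · exact h0
  · linarith [h.1, h'.2, hc.knot_le (Nat.succ_le_of_lt hlt) (by lia)]

theorem eq_of_mem_blowNode {i j : ℕ} (hi : i ≤ c.N + 1) (hj : j ≤ c.N + 1) {l : ℝ}
    (h : l ∈ c.blowNode i) (h' : l ∈ c.blowNode j) : i = j := by
  rcases lt_trichotomy i j with hlt | h0 | hlt
  · linarith [h.2, h'.1, hc.knot_add_one_le hlt hj]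
  · exact h0
  · linarith [h.1, h'.2, hc.knot_add_one_le hlt hi]

theorem not_mem_blowNode {j r : ℕ} (hj : j ≤ c.N) (hr : r ≤ c.N + 1) {l : ℝ}
    (h : l ∈ c.blowArc j) : l ∉ c.blowNode r := by
  intro h'
  rcases le_or_gt r j with hle | hlt
  · linarith [h.1, h'.2, hc.knot_le hle (by lia)]
  · linarith [h.2, h'.1, hc.knot_le (Nat.succ_le_of_lt hlt) hr]

section Glue

variable {E : Type*} [NormedAddCommGroup E] {g : ℝ → E} {v : ℕ → E}

theorem glue_arc {j : ℕ} (hj : j ≤ c.N) {l : ℝ} (h : l ∈ c.blowArc j) :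
    c.glue g v l = g (l - (j + 1)) := by
  rw [glue, Finset.sum_eq_single_of_mem j (Finset.mem_range.2 (by lia)), indicator_of_mem h,
    Finset.sum_eq_zero, add_zero]
  · intro r hr
    exact indicator_of_notMem (hc.not_mem_blowNode hj (by rw [Finset.mem_range] at hr; lia) h) _
  · intro i hi hij
    rw [Finset.mem_range] at hi
    exact indicator_of_notMem (fun h' => hij (hc.eq_of_mem_blowArc (by lia) hj h' h)) _

theorem glue_node {r : ℕ} (hr : r ≤ c.N + 1) {l : ℝ} (h : l ∈ c.blowNode r) :
    c.glue g v l = v r := by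
  rw [glue, Finset.sum_eq_zero, zero_add,
    Finset.sum_eq_single_of_mem r (Finset.mem_range.2 (by lia)), indicator_of_mem h]
  · intro i hi hij
    rw [Finset.mem_range] at hi
    exact indicator_of_notMem (fun h' => hij (hc.eq_of_mem_blowNode (by lia) hr h' h)) _
  · intro j hj
    rw [Finset.mem_range] at hj
    exact indicator_of_notMem (fun h' => hc.not_mem_blowNode (by lia) hr h' h) _

omit hc in
theorem glue_of_notMem {l : ℝ} (h : ∀ j ≤ c.N, l ∉ c.blowArc j)
    (h' : ∀ r ≤ c.N + 1, l ∉ c.blowNode r) : c.glue g v l = 0 := by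
  rw [glue, Finset.sum_eq_zero, Finset.sum_eq_zero, add_zero]
  · intro r hr
    rw [Finset.mem_range] at hr
    exact indicator_of_notMem (h' r (by lia)) _
  · intro j hj
    rw [Finset.mem_range] at hj
    exact indicator_of_notMem (h j (by lia)) _

/-- The case `p 0` is needed for the stretched parameters outside all the open intervals, in
particular for the knots, where `glue` takes the default value zero. -/
theorem glue_induction {p : E → Prop} (h0 : p 0) (hg : ∀ j ≤ c.N, ∀ μ ∈ c.arc j, p (g μ))
    (hv : ∀ r ≤ c.N + 1, p (v r)) (l : ℝ) : p (c.glue g v l) := by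
  by_cases h : ∃ j ≤ c.N, l ∈ c.blowArc j
  · obtain ⟨j, hj, h⟩ := h
    rw [hc.glue_arc hj h]
    exact hg j hj _ (c.sub_mem_arc h)
  by_cases h' : ∃ r ≤ c.N + 1, l ∈ c.blowNode r
  · obtain ⟨r, hr, h'⟩ := h'
    rw [hc.glue_node hr h']
    exact hv r hr
  push Not at h h'
  rwa [glue_of_notMem h h']

theorem exists_continuous_extension (hg : ∀ j ≤ c.N, ∃ G : ℝ → E, ContinuousOn G (c.closedArc j) ∧
    ∀ μ ∈ c.arc j, g μ = G μ) {j : ℕ} (hj : j ≤ c.N) :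
    ∃ G : ℝ → E, Continuous G ∧ ∀ μ ∈ c.arc j, g μ = G μ := by
  obtain ⟨G, hG, h⟩ := hg j hj
  refine ⟨IccExtend (hc.node_lt j hj).le ((c.closedArc j).domRestrict G),
    (continuousOn_iff_continuous_domRestrict.1 hG).Icc_extend', fun μ hμ => ?_⟩
  rw [h μ hμ]
  exact (IccExtend_of_mem (hc.node_lt j hj).le ((c.closedArc j).domRestrict G)
    (Ioo_subset_Icc_self hμ)).symm

theorem stronglyMeasurable_glue (hg : ∀ j ≤ c.N, ∃ G : ℝ → E, ContinuousOn G (c.closedArc j) ∧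
    ∀ μ ∈ c.arc j, g μ = G μ) : StronglyMeasurable (c.glue g v) := by
  unfold glue
  refine StronglyMeasurable.add (Finset.stronglyMeasurable_fun_sum _ fun j hj => ?_)
    (Finset.stronglyMeasurable_fun_sum _ fun r hr =>
      stronglyMeasurable_const.indicator measurableSet_Ioo)
  rw [Finset.mem_range] at hj
  obtain ⟨G, hG, h⟩ := hc.exists_continuous_extension hg (j := j) (by lia)
  have : (c.blowArc j).indicator (fun l => g (l - (j + 1)))
      = (c.blowArc j).indicator (fun l => G (l - (j + 1))) :=
    indicator_congr fun l hl => h _ (c.sub_mem_arc hl)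
  rw [this]
  exact (hG.comp (continuous_sub_right _)).stronglyMeasurable.indicator measurableSet_Ioo

theorem exists_bound_glue (hg : ∀ j ≤ c.N, ∃ G : ℝ → E, ContinuousOn G (c.closedArc j) ∧
    ∀ μ ∈ c.arc j, g μ = G μ) : ∃ M, ∀ l, ‖c.glue g v l‖ ≤ M := by
  have h1 : ∀ j : ℕ, ∃ M, 0 ≤ M ∧ (j ≤ c.N → ∀ μ ∈ c.arc j, ‖g μ‖ ≤ M) := by
    intro j
    by_cases hj : j ≤ c.N
    · obtain ⟨G, hG, h⟩ := hg j hj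
      obtain ⟨M, hM⟩ := isCompact_Icc.exists_bound_of_continuousOn hG
      refine ⟨max 0 M, le_max_left _ _, fun _ μ hμ => ?_⟩
      rw [h μ hμ]
      exact (hM μ (Ioo_subset_Icc_self hμ)).trans (le_max_right _ _)
    · exact ⟨0, le_rfl, fun h => absurd h hj⟩
  choose M hM0 hM using h1
  refine ⟨∑ j ∈ Finset.range (c.N + 1), M j + ∑ r ∈ Finset.range (c.N + 2), ‖v r‖, ?_⟩
  have s1 : ∀ j ≤ c.N, M j ≤ ∑ j ∈ Finset.range (c.N + 1), M j := fun j hj =>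
    Finset.single_le_sum (fun i _ => hM0 i) (Finset.mem_range.2 (by lia))
  have s2 : ∀ r ≤ c.N + 1, ‖v r‖ ≤ ∑ r ∈ Finset.range (c.N + 2), ‖v r‖ := fun r hr =>
    Finset.single_le_sum (f := fun r => ‖v r‖) (fun i _ => norm_nonneg _)
      (Finset.mem_range.2 (by lia))
  have p1 : 0 ≤ ∑ j ∈ Finset.range (c.N + 1), M j := Finset.sum_nonneg fun i _ => hM0 i
  have p2 : 0 ≤ ∑ r ∈ Finset.range (c.N + 2), ‖v r‖ := Finset.sum_nonneg fun i _ => norm_nonneg _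
  refine hc.glue_induction (p := fun x => ‖x‖ ≤ _) ?_ ?_ ?_
  · rw [norm_zero]; positivity
  · intro j hj μ hμ
    linarith [hM j hj μ hμ, s1 j hj]
  · intro r hr
    linarith [s2 r hr]

theorem continuousAt_glue (hg : ∀ j ≤ c.N, ContinuousOn g (c.arc j)) {j : ℕ} (hj : j ≤ c.N) {l : ℝ}
    (hl : l ∈ c.blowArc j) : ContinuousAt (c.glue g v) l := by
  have h1 : ContinuousAt (fun l => g (l - (j + 1))) l :=
    ContinuousAt.comp (f := fun l : ℝ => l - (j + 1)) (g := g)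
      ((hg j hj).continuousAt (Ioo_mem_nhds (c.sub_mem_arc hl).1 (c.sub_mem_arc hl).2))
      (continuous_sub_right _).continuousAt
  refine h1.congr ?_
  filter_upwards [Ioo_mem_nhds hl.1 hl.2] with x hx using (hc.glue_arc hj hx).symm

end Glue

/-- Off a finite set the stretched parameter belongs to an arc or to a vertex. -/
theorem mem_blowArc_or_mem_blowNode {l : ℝ} (hl : l ∈ Icc 0 c.blowLen)
    (h : ∀ r ≤ c.N + 1, l ≠ c.knot r ∧ l ≠ c.knot r + 1) :
    (∃ j ≤ c.N, l ∈ c.blowArc j) ∨ ∃ r ≤ c.N + 1, l ∈ c.blowNode r := by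
  have h0 : c.knot 0 ≤ l := by
    rw [knot, hc.node_zero, Nat.cast_zero, add_zero]; exact hl.1
  obtain ⟨r, -, hr, hrl, hlast⟩ := exists_last_index (P := fun r => c.knot r ≤ l)
    (Nat.zero_le (c.N + 1)) h0
  have hr1 : c.knot r < l := lt_of_le_of_ne hrl (h r hr).1.symm
  rcases lt_or_gt_of_ne (h r hr).2 with h1 | h1
  · exact Or.inr ⟨r, hr, hr1, h1⟩
  · left
    rcases hr.eq_or_lt with rfl | hlt
    · exact absurd hl.2 (not_le.2 h1)
    · exact ⟨r, by lia, h1, not_le.1 (hlast (r + 1) hlt (by lia))⟩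

theorem hasDerivAt_blow₁ {j : ℕ} (hj : j ≤ c.N) {l : ℝ} (hl : l ∈ c.blowArc j) :
    HasDerivAt c.blow₁ (-c.glue c.n₂ 0 l) l := by
  rw [hc.glue_arc hj hl]
  have h1 := (hc.hasDerivAt_L₁ hj (c.sub_mem_arc hl)).comp_sub_const l (j + 1 : ℝ)
  refine h1.congr_of_eventuallyEq ?_
  filter_upwards [Ioo_mem_nhds hl.1 hl.2] with x hx
  rw [blow₁, hc.collapse_arc hj (Ioo_subset_Icc_self hx)]

theorem hasDerivAt_blow₂ {j : ℕ} (hj : j ≤ c.N) {l : ℝ} (hl : l ∈ c.blowArc j) :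
    HasDerivAt c.blow₂ (c.glue c.n₁ 0 l) l := by
  rw [hc.glue_arc hj hl]
  have h1 := (hc.hasDerivAt_L₂ hj (c.sub_mem_arc hl)).comp_sub_const l (j + 1 : ℝ)
  refine h1.congr_of_eventuallyEq ?_
  filter_upwards [Ioo_mem_nhds hl.1 hl.2] with x hx
  rw [blow₂, hc.collapse_arc hj (Ioo_subset_Icc_self hx)]

theorem hasDerivAt_blow₁_node {r : ℕ} (hr : r ≤ c.N + 1) {l : ℝ} (hl : l ∈ c.blowNode r) :
    HasDerivAt c.blow₁ (-c.glue c.n₂ 0 l) l := by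
  rw [hc.glue_node hr hl, Pi.zero_apply, neg_zero]
  refine (hasDerivAt_const l (c.vs r)).congr_of_eventuallyEq ?_
  filter_upwards [Ioo_mem_nhds hl.1 hl.2] with x hx
    using hc.blow₁_node hr (Ioo_subset_Icc_self hx)

theorem hasDerivAt_blow₂_node {r : ℕ} (hr : r ≤ c.N + 1) {l : ℝ} (hl : l ∈ c.blowNode r) :
    HasDerivAt c.blow₂ (c.glue c.n₁ 0 l) l := by
  rw [hc.glue_node hr hl, Pi.zero_apply]
  refine (hasDerivAt_const l (c.vt r)).congr_of_eventuallyEq ?_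
  filter_upwards [Ioo_mem_nhds hl.1 hl.2] with x hx
    using hc.blow₂_node hr (Ioo_subset_Icc_self hx)

/-! ### The inverse of the parametrization -/

end Admissible

/-- The stretched parameter of the point of the curve above a point with first coordinate `s`. -/
def lift₁ (s : ℝ) : ℝ := Function.invFunOn c.blow₁ (Icc 0 c.blowLen) s

def lift₂ (t : ℝ) : ℝ := Function.invFunOn c.blow₂ (Icc 0 c.blowLen) t

end VertexCurve

/-- A function on the image of a compact set is continuous if its composition with the map is. -/
theorem IsCompact.continuousOn_image {X Y Z : Type*} [TopologicalSpace X] [TopologicalSpace Y]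
    [T2Space Y] [TopologicalSpace Z] {K : Set X} (hK : IsCompact K) {f : X → Y} {g : X → Z}
    {h : Y → Z} (hf : ContinuousOn f K) (hg : ContinuousOn g K) (hfg : ∀ x ∈ K, h (f x) = g x) :
    ContinuousOn h (f '' K) := by
  rw [continuousOn_iff_isClosed]
  intro t ht
  obtain ⟨u, hu, hu'⟩ := continuousOn_iff_isClosed.1 hg t ht
  refine ⟨f '' (K ∩ g ⁻¹' t), ?_, ?_⟩
  · have : K ∩ g ⁻¹' t = K ∩ u := by rw [inter_comm, hu', inter_comm]
    rw [this]
    exact ((hK.inter_right hu).image_of_continuousOn (hf.mono inter_subset_left)).isClosed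
  · ext y
    constructor
    · rintro ⟨hy, x, hx, rfl⟩
      refine ⟨⟨x, ⟨hx, ?_⟩, rfl⟩, x, hx, rfl⟩
      rw [mem_preimage, ← hfg x hx]; exact hy
    · rintro ⟨⟨x, ⟨hx, hxt⟩, rfl⟩, hy⟩
      refine ⟨?_, hy⟩
      rw [mem_preimage, hfg x hx]; exact hxt

namespace VertexCurve.Admissible

variable {c : VertexCurve} (hc : c.Admissible)
include hc

/-- Monotonicity of the whole curve is only weak, but between `μ` and `α` there is a further point
of the arc, and from it to `α` the coordinate changes strictly. -/
theorem eq_of_L₁_eq {k : ℕ} (hk : k ≤ c.N) (hnk : ¬c.IsVertical k) {α : ℝ} (hα : α ∈ c.arc k)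
    {μ : ℝ} (hμ : μ ∈ Icc 0 c.len) (h : c.L₁ μ = c.L₁ α) : μ = α := by
  have hs := hc.strictAntiOn_L₁ hk hnk
  have hα' := VertexCurve.Admissible.arc_subset_closedArc k hα
  rcases lt_trichotomy μ α with hlt | h0 | hlt
  · obtain ⟨x, hx1, hx2⟩ := exists_between (max_lt hlt hα.1)
    have hx : x ∈ c.closedArc k := ⟨(le_max_right _ _).trans hx1.le, hx2.le.trans hα.2.le⟩
    have h1 := hs hx hα' hx2
    have h2 := hc.antitone₁ hμ (hc.closedArc_subset hk hx) ((le_max_left _ _).trans hx1.le)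
    linarith
  · exact h0
  · obtain ⟨x, hx1, hx2⟩ := exists_between (lt_min hlt hα.2)
    have hx : x ∈ c.closedArc k := ⟨hα.1.le.trans hx1.le, hx2.le.trans (min_le_right _ _)⟩
    have h1 := hs hα' hx hx1
    have h2 := hc.antitone₁ (hc.closedArc_subset hk hx) hμ (hx2.le.trans (min_le_left _ _))
    linarith

theorem eq_of_L₂_eq {k : ℕ} (hk : k ≤ c.N) (hnk : ¬c.IsHorizontal k) {α : ℝ} (hα : α ∈ c.arc k)
    {μ : ℝ} (hμ : μ ∈ Icc 0 c.len) (h : c.L₂ μ = c.L₂ α) : μ = α := by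
  have hs := hc.strictMonoOn_L₂ hk hnk
  have hα' := VertexCurve.Admissible.arc_subset_closedArc k hα
  rcases lt_trichotomy μ α with hlt | h0 | hlt
  · obtain ⟨x, hx1, hx2⟩ := exists_between (max_lt hlt hα.1)
    have hx : x ∈ c.closedArc k := ⟨(le_max_right _ _).trans hx1.le, hx2.le.trans hα.2.le⟩
    have h1 := hs hx hα' hx2
    have h2 := hc.monotone₂ hμ (hc.closedArc_subset hk hx) ((le_max_left _ _).trans hx1.le)
    linarith
  · exact h0
  · obtain ⟨x, hx1, hx2⟩ := exists_between (lt_min hlt hα.2)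
    have hx : x ∈ c.closedArc k := ⟨hα.1.le.trans hx1.le, hx2.le.trans (min_le_right _ _)⟩
    have h1 := hs hα' hx hx1
    have h2 := hc.monotone₂ (hc.closedArc_subset hk hx) hμ (hx2.le.trans (min_le_left _ _))
    linarith

/-- The preimage under `blow₁` is unique over interior points of arcs that are not vertical, so
there the choice in `lift₁` is forced. Only such points are used. -/
theorem lift₁_eq {k : ℕ} (hk : k ≤ c.N) (hnk : ¬c.IsVertical k) {α : ℝ} (hα : α ∈ c.arc k) :
    c.lift₁ (c.L₁ α) = α + (k + 1) := by
  have hα' := VertexCurve.Admissible.arc_subset_closedArc k hα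
  have hex : ∃ l ∈ Icc 0 c.blowLen, c.blow₁ l = c.L₁ α :=
    ⟨α + (k + 1), Ioo_subset_Icc_self (hc.blowArc_subset hk (c.add_mem_blowArc_iff.2 hα)),
      hc.blow₁_add hk hα'⟩
  have h1 := hc.eq_of_L₁_eq hk hnk hα (hc.collapse_mem _) (Function.invFunOn_eq hex)
  have h2 := hc.eq_of_collapse_mem_arc hk (h1 ▸ hα)
  rw [h1] at h2
  exact h2

theorem lift₂_eq {k : ℕ} (hk : k ≤ c.N) (hnk : ¬c.IsHorizontal k) {α : ℝ} (hα : α ∈ c.arc k) :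
    c.lift₂ (c.L₂ α) = α + (k + 1) := by
  have hα' := VertexCurve.Admissible.arc_subset_closedArc k hα
  have hex : ∃ l ∈ Icc 0 c.blowLen, c.blow₂ l = c.L₂ α :=
    ⟨α + (k + 1), Ioo_subset_Icc_self (hc.blowArc_subset hk (c.add_mem_blowArc_iff.2 hα)),
      hc.blow₂_add hk hα'⟩
  have h1 := hc.eq_of_L₂_eq hk hnk hα (hc.collapse_mem _) (Function.invFunOn_eq hex)
  have h2 := hc.eq_of_collapse_mem_arc hk (h1 ▸ hα)
  rw [h1] at h2
  exact h2

theorem image_L₁ {k : ℕ} (hk : k ≤ c.N) : c.L₁ '' c.closedArc k ⊇ Icc (c.vs (k + 1)) (c.vs k) :=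
  intermediate_value_Icc' (hc.node_lt k hk).le (hc.continuousOn_L₁.mono (hc.closedArc_subset hk))

theorem image_L₂ {k : ℕ} (hk : k ≤ c.N) : c.L₂ '' c.closedArc k ⊇ Icc (c.vt k) (c.vt (k + 1)) :=
  intermediate_value_Icc (hc.node_lt k hk).le (hc.continuousOn_L₂.mono (hc.closedArc_subset hk))

theorem exists_L₁_eq {k : ℕ} (hk : k ≤ c.N) {s : ℝ} (hs : s ∈ Ioo (c.vs (k + 1)) (c.vs k)) :
    ∃ α ∈ c.arc k, c.L₁ α = s := by
  obtain ⟨α, hα, rfl⟩ := hc.image_L₁ hk (Ioo_subset_Icc_self hs)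
  refine ⟨α, ⟨lt_of_le_of_ne hα.1 ?_, lt_of_le_of_ne hα.2 ?_⟩, rfl⟩
  · rintro rfl; exact hs.2.ne rfl
  · rintro rfl; exact hs.1.ne rfl

theorem exists_L₂_eq {k : ℕ} (hk : k ≤ c.N) {t : ℝ} (ht : t ∈ Ioo (c.vt k) (c.vt (k + 1))) :
    ∃ α ∈ c.arc k, c.L₂ α = t := by
  obtain ⟨α, hα, rfl⟩ := hc.image_L₂ hk (Ioo_subset_Icc_self ht)
  refine ⟨α, ⟨lt_of_le_of_ne hα.1 ?_, lt_of_le_of_ne hα.2 ?_⟩, rfl⟩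
  · rintro rfl; exact ht.1.ne rfl
  · rintro rfl; exact ht.2.ne rfl

/-- The inverse of the first coordinate on a closed arc that is not vertical. -/
theorem exists_inverse₁ {k : ℕ} (hk : k ≤ c.N) (hnk : ¬c.IsVertical k) : ∃ g : ℝ → ℝ,
    ContinuousOn g (Icc (c.vs (k + 1)) (c.vs k)) ∧ (∀ α ∈ c.closedArc k, g (c.L₁ α) = α) ∧
    EqOn c.lift₁ (fun s => g s + (k + 1)) (Ioo (c.vs (k + 1)) (c.vs k)) := by
  have hinj := (hc.strictAntiOn_L₁ hk hnk).injOn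
  have h1 : ∀ α ∈ c.closedArc k, Function.invFunOn c.L₁ (c.closedArc k) (c.L₁ α) = α :=
    hinj.leftInvOn_invFunOn
  refine ⟨Function.invFunOn c.L₁ (c.closedArc k), ?_, h1, ?_⟩
  · exact (isCompact_Icc.continuousOn_image (hc.continuousOn_L₁.mono (hc.closedArc_subset hk))
      continuousOn_id h1).mono (hc.image_L₁ hk)
  · intro s hs
    obtain ⟨α, hα, rfl⟩ := hc.exists_L₁_eq hk hs
    simp only [h1 α (VertexCurve.Admissible.arc_subset_closedArc k hα), hc.lift₁_eq hk hnk hα]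

theorem exists_inverse₂ {k : ℕ} (hk : k ≤ c.N) (hnk : ¬c.IsHorizontal k) : ∃ g : ℝ → ℝ,
    ContinuousOn g (Icc (c.vt k) (c.vt (k + 1))) ∧ (∀ α ∈ c.closedArc k, g (c.L₂ α) = α) ∧
    EqOn c.lift₂ (fun s => g s + (k + 1)) (Ioo (c.vt k) (c.vt (k + 1))) := by
  have hinj := (hc.strictMonoOn_L₂ hk hnk).injOn
  have h1 : ∀ α ∈ c.closedArc k, Function.invFunOn c.L₂ (c.closedArc k) (c.L₂ α) = α :=
    hinj.leftInvOn_invFunOn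
  refine ⟨Function.invFunOn c.L₂ (c.closedArc k), ?_, h1, ?_⟩
  · exact (isCompact_Icc.continuousOn_image (hc.continuousOn_L₂.mono (hc.closedArc_subset hk))
      continuousOn_id h1).mono (hc.image_L₂ hk)
  · intro s hs
    obtain ⟨α, hα, rfl⟩ := hc.exists_L₂_eq hk hs
    simp only [h1 α (VertexCurve.Admissible.arc_subset_closedArc k hα), hc.lift₂_eq hk hnk hα]

theorem vs_lt {k : ℕ} (hk : k ≤ c.N) (hnk : ¬c.IsVertical k) : c.vs (k + 1) < c.vs k :=
  hc.strictAntiOn_L₁ hk hnk (hc.left_mem_closedArc hk) (hc.right_mem_closedArc hk)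
    (hc.node_lt k hk)

theorem vt_lt {k : ℕ} (hk : k ≤ c.N) (hnk : ¬c.IsHorizontal k) : c.vt k < c.vt (k + 1) :=
  hc.strictMonoOn_L₂ hk hnk (hc.left_mem_closedArc hk) (hc.right_mem_closedArc hk)
    (hc.node_lt k hk)

/-- To the left of a vertical line through vertices the stretched parameter tends to the end of the
last vertex interval on that line; to the right (`tendsto_lift₁_right`) it tends to the beginning of
the first one. The gap is filled by all vertices and vertical arcs on the line and is responsible
for the jump of the co-state. -/
theorem tendsto_lift₁_left {k : ℕ} (hk : k ≤ c.N) (hnk : ¬c.IsVertical k) :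
    Tendsto c.lift₁ (𝓝[<] (c.vs k)) (𝓝 (c.knot k + 1)) := by
  obtain ⟨g, hg, hinv, he⟩ := hc.exists_inverse₁ hk hnk
  have hlt := hc.vs_lt hk hnk
  have h1 := ((hg _ (right_mem_Icc.2 hlt.le)).mono Ioo_subset_Icc_self).tendsto.add_const (k + 1 : ℝ)
  rw [nhdsWithin_Ioo_eq_nhdsLT hlt, vs, hinv _ (hc.left_mem_closedArc hk)] at h1
  have h2 : c.knot k + 1 = c.node k + (k + 1) := by rw [knot]; ring
  rw [h2]
  exact h1.congr' (he.symm.eventuallyEq_of_mem (Ioo_mem_nhdsLT hlt))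

theorem tendsto_lift₁_right {k : ℕ} (hk : k ≤ c.N) (hnk : ¬c.IsVertical k) :
    Tendsto c.lift₁ (𝓝[>] (c.vs (k + 1))) (𝓝 (c.knot (k + 1))) := by
  obtain ⟨g, hg, hinv, he⟩ := hc.exists_inverse₁ hk hnk
  have hlt := hc.vs_lt hk hnk
  have h1 := ((hg _ (left_mem_Icc.2 hlt.le)).mono Ioo_subset_Icc_self).tendsto.add_const (k + 1 : ℝ)
  rw [nhdsWithin_Ioo_eq_nhdsGT hlt, vs, hinv _ (hc.right_mem_closedArc hk)] at h1
  rw [knot_succ]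
  exact h1.congr' (he.symm.eventuallyEq_of_mem (Ioo_mem_nhdsGT hlt))

theorem tendsto_lift₂_left {k : ℕ} (hk : k ≤ c.N) (hnk : ¬c.IsHorizontal k) :
    Tendsto c.lift₂ (𝓝[<] (c.vt (k + 1))) (𝓝 (c.knot (k + 1))) := by
  obtain ⟨g, hg, hinv, he⟩ := hc.exists_inverse₂ hk hnk
  have hlt := hc.vt_lt hk hnk
  have h1 := ((hg _ (right_mem_Icc.2 hlt.le)).mono Ioo_subset_Icc_self).tendsto.add_const (k + 1 : ℝ)
  rw [nhdsWithin_Ioo_eq_nhdsLT hlt, vt, hinv _ (hc.right_mem_closedArc hk)] at h1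
  rw [knot_succ]
  exact h1.congr' (he.symm.eventuallyEq_of_mem (Ioo_mem_nhdsLT hlt))

theorem tendsto_lift₂_right {k : ℕ} (hk : k ≤ c.N) (hnk : ¬c.IsHorizontal k) :
    Tendsto c.lift₂ (𝓝[>] (c.vt k)) (𝓝 (c.knot k + 1)) := by
  obtain ⟨g, hg, hinv, he⟩ := hc.exists_inverse₂ hk hnk
  have hlt := hc.vt_lt hk hnk
  have h1 := ((hg _ (left_mem_Icc.2 hlt.le)).mono Ioo_subset_Icc_self).tendsto.add_const (k + 1 : ℝ)
  rw [nhdsWithin_Ioo_eq_nhdsGT hlt, vt, hinv _ (hc.left_mem_closedArc hk)] at h1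
  have h2 : c.knot k + 1 = c.node k + (k + 1) := by rw [knot]; ring
  rw [h2]
  exact h1.congr' (he.symm.eventuallyEq_of_mem (Ioo_mem_nhdsGT hlt))

theorem hasDerivAt_lift₁ {k : ℕ} (hk : k ≤ c.N) (hnk : ¬c.IsVertical k) {α : ℝ}
    (hα : α ∈ c.arc k) : HasDerivAt c.lift₁ (-c.n₂ α)⁻¹ (c.L₁ α) := by
  obtain ⟨g, hg, hinv, he⟩ := hc.exists_inverse₁ hk hnk
  have hs := hc.L₁_mem_Ioo hk hnk hα
  have hmem := Ioo_mem_nhds hs.1 hs.2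
  have hga := hinv α (VertexCurve.Admissible.arc_subset_closedArc k hα)
  have h1 : HasDerivAt g (-c.n₂ α)⁻¹ (c.L₁ α) := by
    refine HasDerivAt.of_local_left_inverse (f := c.L₁)
      (hg.continuousAt (Icc_mem_nhds hs.1 hs.2)) ?_ (neg_ne_zero.2 (hc.n₂_pos hk hnk hα).ne') ?_
    · rw [hga]; exact hc.hasDerivAt_L₁ hk hα
    · filter_upwards [hmem] with s hs
      obtain ⟨a, ha, rfl⟩ := hc.exists_L₁_eq hk hs
      rw [hinv a (VertexCurve.Admissible.arc_subset_closedArc k ha)]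
  exact (h1.add_const _).congr_of_eventuallyEq (he.eventuallyEq_of_mem hmem)

theorem hasDerivAt_lift₂ {k : ℕ} (hk : k ≤ c.N) (hnk : ¬c.IsHorizontal k) {α : ℝ}
    (hα : α ∈ c.arc k) : HasDerivAt c.lift₂ (c.n₁ α)⁻¹ (c.L₂ α) := by
  obtain ⟨g, hg, hinv, he⟩ := hc.exists_inverse₂ hk hnk
  have hs := hc.L₂_mem_Ioo hk hnk hα
  have hmem := Ioo_mem_nhds hs.1 hs.2
  have hga := hinv α (VertexCurve.Admissible.arc_subset_closedArc k hα)
  have h1 : HasDerivAt g (c.n₁ α)⁻¹ (c.L₂ α) := by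
    refine HasDerivAt.of_local_left_inverse (f := c.L₂)
      (hg.continuousAt (Icc_mem_nhds hs.1 hs.2)) ?_ (hc.n₁_pos hk hnk hα).ne' ?_
    · rw [hga]; exact hc.hasDerivAt_L₂ hk hα
    · filter_upwards [hmem] with s hs
      obtain ⟨a, ha, rfl⟩ := hc.exists_L₂_eq hk hs
      rw [hinv a (VertexCurve.Admissible.arc_subset_closedArc k ha)]
  exact (h1.add_const _).congr_of_eventuallyEq (he.eventuallyEq_of_mem hmem)

end VertexCurve.Admissible

/-! ### Properties of the solutions of the problem on the triangle -/

section Integral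

variable {E : Type*} [NormedAddCommGroup E] [NormedSpace ℝ E]

theorem stronglyMeasurableAtFilter_of_mem_Ioo {f : ℝ → E} {p q x : ℝ} (hx : x ∈ Ioo p q)
    (hf : IntervalIntegrable f volume p q) : StronglyMeasurableAtFilter f (𝓝 x) volume :=
  ⟨Ioc p q, Ioc_mem_nhds hx.1 hx.2, hf.1.aestronglyMeasurable⟩

theorem hasDerivAt_integral_upper [CompleteSpace E] {f : ℝ → E} {p q x : ℝ} (hx : x ∈ Ioo p q)
    (hf : IntervalIntegrable f volume p q) (hc : ContinuousAt f x) :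
    HasDerivAt (fun y => ∫ t in p..y, f t) (f x) x :=
  intervalIntegral.integral_hasDerivAt_right
    (hf.mono_set (uIcc_subset_uIcc_left (Icc_subset_uIcc (Ioo_subset_Icc_self hx))))
    (stronglyMeasurableAtFilter_of_mem_Ioo hx hf) hc

theorem hasDerivAt_integral_lower [CompleteSpace E] {f : ℝ → E} {p q x : ℝ} (hx : x ∈ Ioo p q)
    (hf : IntervalIntegrable f volume p q) (hc : ContinuousAt f x) :
    HasDerivAt (fun y => ∫ t in y..q, f t) (-f x) x :=
  intervalIntegral.integral_hasDerivAt_left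
    (hf.mono_set (uIcc_subset_uIcc_right (Icc_subset_uIcc (Ioo_subset_Icc_self hx))))
    (stronglyMeasurableAtFilter_of_mem_Ioo hx hf) hc

/-- Gronwall's inequality for `J x = ∫ t in x..q, ‖f t‖`: here `J' = -‖f‖`, so `|J'| ≤ M J`, and `J`
vanishes at `q`. Continuity extends the conclusion to the end points. -/
theorem eq_zero_of_norm_le_integral_upper {f : ℝ → E} {M p q : ℝ} (hf : ContinuousOn f (Icc p q))
    (h : ∀ x ∈ Icc p q, ‖f x‖ ≤ M * ∫ t in x..q, ‖f t‖) : ∀ x ∈ Icc p q, f x = 0 := by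
  intro x hx
  rcases (hx.1.trans hx.2).eq_or_lt with rfl | hpq
  · have h1 := h x hx
    rw [le_antisymm hx.2 hx.1, intervalIntegral.integral_same, mul_zero] at h1
    rw [le_antisymm hx.2 hx.1]
    exact norm_le_zero_iff.1 h1
  have hi : IntervalIntegrable (fun t => ‖f t‖) volume p q :=
    hf.norm.intervalIntegrable_of_Icc hpq.le
  have hg0 : ∀ x ∈ Icc p q, 0 ≤ ∫ t in x..q, ‖f t‖ := fun x hx =>
    intervalIntegral.integral_nonneg hx.2 fun _ _ => norm_nonneg _
  have hcont : ContinuousOn (fun x => ∫ t in x..q, ‖f t‖) (Icc p q) := by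
    have := intervalIntegral.continuousOn_primitive_interval_left (f := fun t => ‖f t‖) (a := p)
      (b := q) (μ := volume) (by
        rw [uIcc_of_le hpq.le, integrableOn_Icc_iff_integrableOn_Ioc]; exact hi.1)
    rwa [uIcc_of_le hpq.le] at this
  have h0 : Tendsto (fun x => ∫ t in x..q, ‖f t‖) (𝓝[<] q) (𝓝 0) := by
    have h1 := ((hcont q (right_mem_Icc.2 hpq.le)).mono Ioo_subset_Icc_self).tendsto
    rwa [intervalIntegral.integral_same, nhdsWithin_Ioo_eq_nhdsLT hpq] at h1
  have hz := eq_zero_of_norm_deriv_le' (f := fun x => ∫ t in x..q, ‖f t‖) (f' := fun x => -‖f x‖)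
    (M := M) (a := p) (b := q)
    (fun x hx => hasDerivAt_integral_lower hx hi
      (hf.norm.continuousAt (Icc_mem_nhds hx.1 hx.2)))
    (fun x hx => by
      have hx' := Ioo_subset_Icc_self hx
      rw [norm_neg, norm_norm, Real.norm_of_nonneg (hg0 x hx')]
      exact h x hx') h0
  refine Set.EqOn.of_subset_closure (s := Ioo p q) (f := f) (g := fun _ => 0) (fun y hy => ?_) hf
    continuousOn_const Ioo_subset_Icc_self (by rw [closure_Ioo hpq.ne]) hx
  have h1 := h y (Ioo_subset_Icc_self hy)
  rw [hz y hy, mul_zero] at h1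
  exact norm_le_zero_iff.1 h1

theorem eq_zero_of_norm_le_integral_lower {f : ℝ → E} {M p q : ℝ} (hf : ContinuousOn f (Icc p q))
    (h : ∀ x ∈ Icc p q, ‖f x‖ ≤ M * ∫ t in p..x, ‖f t‖) : ∀ x ∈ Icc p q, f x = 0 := by
  intro x hx
  have hm : MapsTo (fun y : ℝ => -y) (Icc (-q) (-p)) (Icc p q) := fun y hy =>
    ⟨by linarith [hy.2], by linarith [hy.1]⟩
  have := eq_zero_of_norm_le_integral_upper (f := fun y => f (-y)) (M := M) (p := -q) (q := -p)
    (hf.comp continuous_neg.continuousOn hm) (fun y hy => by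
      rw [intervalIntegral.integral_comp_neg (fun t => ‖f t‖), neg_neg]
      exact h _ (hm hy)) (-x) ⟨neg_le_neg hx.2, neg_le_neg hx.1⟩
  simpa using this

end Integral

namespace TriangleProblem

variable {E : Type*} [NormedAddCommGroup E] [NormedSpace ℝ E] [CompleteSpace E]
  {T : TriangleProblem E} {S : Ansatz E} (hT : T.Regular) (hS : T.IsSolution S) {α β : ℝ}
include hT hS

theorem IsSolution.intervalIntegrable_K_left {z : ℝ × ℝ} (hz : z ∈ triangle T.Λ) :
    IntervalIntegrable (fun b => T.K S (z.1, b)) volume z.2 z.1 := by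
  obtain ⟨K', smK, ⟨M, hM⟩, heq⟩ :=
    hT.exists_K_extension hS.contΨ hS.contV hS.contW hS.contU hS.contU'
  have : IntervalIntegrable (fun b => K' (z.1, b)) volume z.2 z.1 :=
    (intervalIntegrable_const (c := M)).mono_fun
      (smK.comp_measurable measurable_prodMk_left).aestronglyMeasurable
      (Eventually.of_forall fun b => (hM _).trans (le_abs_self M))
  refine this.congr fun b hb => ?_
  rw [uIoc_of_le hz.2.1] at hb
  exact (heq _ (mem_triangle_left hz (Ioc_subset_Icc_self hb))).symm

theorem IsSolution.intervalIntegrable_K_right {z : ℝ × ℝ} (hz : z ∈ triangle T.Λ) :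
    IntervalIntegrable (fun a => T.K S (a, z.2)) volume z.2 z.1 := by
  obtain ⟨K', smK, ⟨M, hM⟩, heq⟩ :=
    hT.exists_K_extension hS.contΨ hS.contV hS.contW hS.contU hS.contU'
  have : IntervalIntegrable (fun a => K' (a, z.2)) volume z.2 z.1 :=
    (intervalIntegrable_const (c := M)).mono_fun
      (smK.comp_measurable measurable_prodMk_right).aestronglyMeasurable
      (Eventually.of_forall fun b => (hM _).trans (le_abs_self M))
  refine this.congr fun b hb => ?_
  rw [uIoc_of_le hz.2.1] at hb
  exact (heq _ (mem_triangle_right hz (Ioc_subset_Icc_self hb))).symm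

omit hT in
theorem IsSolution.Ψ_diag {d : ℝ} (hd : d ∈ Icc 0 T.Λ) : S.Ψ (d, d) = 0 := by
  rw [hS.eqΨX _ ⟨hd.1, le_rfl, hd.2⟩, intervalIntegral.integral_same]

omit hT in
theorem IsSolution.X_diag {d : ℝ} (hd : d ∈ Icc 0 T.Λ) : T.X S (d, d) = T.F d := by
  rw [hS.eqX _ ⟨hd.1, le_rfl, hd.2⟩, intervalIntegral.integral_same, sub_zero]

omit hT in
theorem IsSolution.Y_diag {d : ℝ} (hd : d ∈ Icc 0 T.Λ) : T.Y S (d, d) = -T.F d := by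
  rw [hS.eqY _ ⟨hd.1, le_rfl, hd.2⟩, intervalIntegral.integral_same, add_zero]

omit hT in
-- By the ansatz the only discontinuities of `X` are those of `F` and `ν₂` in the first variable.
-- They lie over knots, whereas the regular part of the domain lies over open arcs.
theorem IsSolution.continuousWithinAt_X {z : ℝ × ℝ} (hz : z ∈ triangle T.Λ)
    (hF : ContinuousAt T.F z.1) (hν : ContinuousAt T.ν₂ z.1) :
    ContinuousWithinAt (T.X S) (triangle T.Λ) z := by
  have h1 : ContinuousWithinAt (fun y : ℝ × ℝ => T.F y.1) (triangle T.Λ) z :=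
    (ContinuousAt.comp (f := Prod.fst) hF continuousAt_fst).continuousWithinAt
  have h2 : ContinuousWithinAt (fun y : ℝ × ℝ => T.ν₂ y.1) (triangle T.Λ) z :=
    (ContinuousAt.comp (f := Prod.fst) hν continuousAt_fst).continuousWithinAt
  exact ((hS.contU z hz).clm_apply h1).sub (h2.smul (hS.contV z hz))

omit hT in
theorem IsSolution.continuousWithinAt_Y {z : ℝ × ℝ} (hz : z ∈ triangle T.Λ)
    (hF : ContinuousAt T.F z.2) (hν : ContinuousAt T.ν₁ z.2) :
    ContinuousWithinAt (T.Y S) (triangle T.Λ) z := by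
  have h1 : ContinuousWithinAt (fun y : ℝ × ℝ => T.F y.2) (triangle T.Λ) z :=
    (ContinuousAt.comp (f := Prod.snd) hF continuousAt_snd).continuousWithinAt
  have h2 : ContinuousWithinAt (fun y : ℝ × ℝ => T.ν₁ y.2) (triangle T.Λ) z :=
    (ContinuousAt.comp (f := Prod.snd) hν continuousAt_snd).continuousWithinAt
  exact ((hS.contU' z hz).clm_apply h1).neg.add (h2.smul (hS.contW z hz))

theorem IsSolution.continuousWithinAt_K {z : ℝ × ℝ} (hz : z ∈ triangle T.Λ)
    (hF : ContinuousAt T.F z.1) (hF' : ContinuousAt T.F z.2) (hν₂ : ContinuousAt T.ν₂ z.1)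
    (hν₁ : ContinuousAt T.ν₁ z.2) : ContinuousWithinAt (T.K S) (triangle T.Λ) z := by
  have h2 : ContinuousWithinAt (fun y : ℝ × ℝ => T.ν₂ y.1) (triangle T.Λ) z :=
    (ContinuousAt.comp (f := Prod.fst) hν₂ continuousAt_fst).continuousWithinAt
  have h1 : ContinuousWithinAt (fun y : ℝ × ℝ => T.ν₁ y.2) (triangle T.Λ) z :=
    (ContinuousAt.comp (f := Prod.snd) hν₁ continuousAt_snd).continuousWithinAt
  exact (((h2.mul h1).neg.smul ((hT.cont_a z hz).add
    ((hT.cont_A z hz).clm_apply (hS.contΨ z hz)))).add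
    (h1.smul ((hT.cont_B z hz).clm_apply (hS.continuousWithinAt_X hz hF hν₂)))).sub
    (h2.smul ((hT.cont_C z hz).clm_apply (hS.continuousWithinAt_Y hz hF' hν₁)))

omit [CompleteSpace E] hT hS in
theorem continuousAt_of_triangle_left {G : ℝ × ℝ → E}
    (h : ContinuousWithinAt G (triangle T.Λ) (α, β)) (hβ : 0 ≤ β) (hβα : β < α) (hα : α < T.Λ) :
    ContinuousAt (fun a => G (a, β)) α := by
  refine ContinuousWithinAt.continuousAt (s := Ioo β T.Λ) ?_ (Ioo_mem_nhds hβα hα)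
  exact ContinuousWithinAt.comp (f := fun a => (a, β)) (t := triangle T.Λ) h
    (by fun_prop) fun a ha => ⟨hβ, ha.1.le, ha.2.le⟩

omit [CompleteSpace E] hT hS in
theorem continuousAt_of_triangle_right {G : ℝ × ℝ → E}
    (h : ContinuousWithinAt G (triangle T.Λ) (α, β)) (hβ : 0 < β) (hβα : β < α) (hα : α ≤ T.Λ) :
    ContinuousAt (fun b => G (α, b)) β := by
  refine ContinuousWithinAt.continuousAt (s := Ioo 0 α) ?_ (Ioo_mem_nhds hβ hβα)
  exact ContinuousWithinAt.comp (f := fun b => (α, b)) (t := triangle T.Λ) h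
    (by fun_prop) fun a ha => ⟨ha.1.le, ha.2.le, hα⟩

theorem IsSolution.hasDerivAt_Ψ_left (hβ : 0 ≤ β) (hβα : β < α) (hα : α < T.Λ)
    (hF : ContinuousAt T.F α) (hν : ContinuousAt T.ν₂ α) :
    HasDerivAt (fun a => S.Ψ (a, β)) (T.X S (α, β)) α := by
  have hz : (T.Λ, β) ∈ triangle T.Λ := ⟨hβ, (hβα.trans hα).le, le_rfl⟩
  have hc := continuousAt_of_triangle_left (T := T)
    (hS.continuousWithinAt_X (z := (α, β)) ⟨hβ, hβα.le, hα.le⟩ hF hν) hβ hβα hα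
  refine (hasDerivAt_integral_upper ⟨hβα, hα⟩ (hT.intervalIntegrable_X hS.contV hS.contU hz)
    hc).congr_of_eventuallyEq ?_
  filter_upwards [Ioo_mem_nhds hβα hα] with a ha using hS.eqΨX (a, β) ⟨hβ, ha.1.le, ha.2.le⟩

theorem IsSolution.hasDerivAt_Ψ_right (hβ : 0 < β) (hβα : β < α) (hα : α ≤ T.Λ)
    (hF : ContinuousAt T.F β) (hν : ContinuousAt T.ν₁ β) :
    HasDerivAt (fun b => S.Ψ (α, b)) (T.Y S (α, β)) β := by
  have hz : (α, 0) ∈ triangle T.Λ := ⟨le_rfl, (hβ.trans hβα).le, hα⟩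
  have hc := continuousAt_of_triangle_right (T := T)
    (hS.continuousWithinAt_Y (z := (α, β)) ⟨hβ.le, hβα.le, hα⟩ hF hν) hβ hβα hα
  have h1 := (hasDerivAt_integral_lower ⟨hβ, hβα⟩
    (hT.intervalIntegrable_Y hS.contW hS.contU' hz) hc).neg
  rw [neg_neg] at h1
  refine h1.congr_of_eventuallyEq ?_
  filter_upwards [Ioo_mem_nhds hβ hβα] with b hb using hS.eqΨY (α, b) ⟨hb.1.le, hb.2.le, hα⟩

theorem IsSolution.hasDerivAt_Y (hβ : 0 ≤ β) (hβα : β < α) (hα : α < T.Λ)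
    (hF : ContinuousAt T.F α) (hF' : ContinuousAt T.F β) (hν : ContinuousAt T.ν₂ α)
    (hν' : ContinuousAt T.ν₁ β) :
    HasDerivAt (fun a => T.Y S (a, β)) (T.K S (α, β)) α := by
  have hz : (T.Λ, β) ∈ triangle T.Λ := ⟨hβ, (hβα.trans hα).le, le_rfl⟩
  have hc := continuousAt_of_triangle_left (T := T)
    (hS.continuousWithinAt_K hT (z := (α, β)) ⟨hβ, hβα.le, hα.le⟩ hF hF' hν hν') hβ hβα hα
  refine ((hasDerivAt_integral_upper ⟨hβα, hα⟩ (hS.intervalIntegrable_K_right hT hz)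
    hc).const_add (-T.F β)).congr_of_eventuallyEq ?_
  filter_upwards [Ioo_mem_nhds hβα hα] with a ha using hS.eqY (a, β) ⟨hβ, ha.1.le, ha.2.le⟩

theorem IsSolution.hasDerivAt_X (hβ : 0 < β) (hβα : β < α) (hα : α ≤ T.Λ)
    (hF : ContinuousAt T.F α) (hF' : ContinuousAt T.F β) (hν : ContinuousAt T.ν₂ α)
    (hν' : ContinuousAt T.ν₁ β) :
    HasDerivAt (fun b => T.X S (α, b)) (T.K S (α, β)) β := by
  have hz : (α, 0) ∈ triangle T.Λ := ⟨le_rfl, (hβ.trans hβα).le, hα⟩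
  have hc := continuousAt_of_triangle_right (T := T)
    (hS.continuousWithinAt_K hT (z := (α, β)) ⟨hβ.le, hβα.le, hα⟩ hF hF' hν hν') hβ hβα hα
  have h1 := (hasDerivAt_integral_lower ⟨hβ, hβα⟩
    (hS.intervalIntegrable_K_left hT hz) hc).const_sub (T.F α)
  rw [neg_neg] at h1
  refine h1.congr_of_eventuallyEq ?_
  filter_upwards [Ioo_mem_nhds hβ hβα] with b hb using hS.eqX (α, b) ⟨hb.1.le, hb.2.le, hα⟩

/-- The kernel `U` describes the solutions of the linear equation along the line `α = const`. -/
theorem IsSolution.U_apply_eq (hβ : 0 ≤ β) (hα : α ≤ T.Λ) {φ : ℝ → E}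
    {v : E} (hφ : ContinuousOn φ (Icc β α))
    (h : ∀ b ∈ Icc β α, φ b = v - ∫ x in b..α, T.ν₁ x • T.B (α, x) (φ x)) :
    ∀ b ∈ Icc β α, φ b = S.U (α, b) v := by
  have hm : ∀ b ∈ Icc β α, MapsTo (fun x => (α, x)) (Icc b α) (triangle T.Λ) :=
    fun b hb x hx => ⟨hβ.trans (hb.1.trans hx.1), hx.2, hα⟩
  have hU : ContinuousOn (fun b => S.U (α, b)) (Icc β α) := fun b hb =>
    (hS.contU.comp (by fun_prop) (hm β ⟨le_rfl, hb.1.trans hb.2⟩)) b hb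
  have hB : ContinuousOn (fun b => T.B (α, b)) (Icc β α) := fun b hb =>
    (hT.cont_B.comp (by fun_prop) (hm β ⟨le_rfl, hb.1.trans hb.2⟩)) b hb
  obtain ⟨M, hM⟩ := isCompact_Icc.exists_bound_of_continuousOn hB
  intro b hb
  rw [← sub_eq_zero]
  refine eq_zero_of_norm_le_integral_upper (f := fun b => φ b - S.U (α, b) v) (M := M) (p := β)
    (q := α) (hφ.sub (hU.clm_apply continuousOn_const)) (fun x hx => ?_) b hb
  have hsub : Icc x α ⊆ Icc β α := Icc_subset_Icc_left hx.1
  have i1 : IntervalIntegrable (fun t => T.ν₁ t • T.B (α, t) (φ t)) volume x α :=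
    intervalIntegrable_smul_of_continuousOn hT.meas₁ hT.bound₁ hx.2
      ((hB.clm_apply hφ).mono hsub)
  have i2 : IntervalIntegrable (fun t => T.ν₁ t • (T.B (α, t)).comp (S.U (α, t))) volume x α :=
    intervalIntegrable_smul_of_continuousOn hT.meas₁ hT.bound₁ hx.2
      ((hB.clm_comp hU).mono hsub)
  have i3 : IntervalIntegrable (fun t => T.ν₁ t • T.B (α, t) (S.U (α, t) v)) volume x α :=
    intervalIntegrable_smul_of_continuousOn hT.meas₁ hT.bound₁ hx.2
      ((hB.clm_apply (hU.clm_apply continuousOn_const)).mono hsub)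
  have e2 : S.U (α, x) v = v - ∫ t in x..α, T.ν₁ t • T.B (α, t) (S.U (α, t) v) := by
    rw [hS.eqU (α, x) (hm x hx ⟨le_rfl, hx.2⟩), sub_apply, ContinuousLinearMap.id_apply,
      ContinuousLinearMap.intervalIntegral_apply i2]
    rfl
  have e3 : φ x - S.U (α, x) v
      = -∫ t in x..α, T.ν₁ t • T.B (α, t) (φ t - S.U (α, t) v) := by
    have : ∫ t in x..α, T.ν₁ t • T.B (α, t) (φ t - S.U (α, t) v)
        = (∫ t in x..α, T.ν₁ t • T.B (α, t) (φ t))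
          - ∫ t in x..α, T.ν₁ t • T.B (α, t) (S.U (α, t) v) := by
      rw [← intervalIntegral.integral_sub i1 i3]
      simp only [map_sub, smul_sub]
    rw [this, e2, h x hx]
    abel
  simp only [e3, norm_neg]
  rw [← intervalIntegral.integral_const_mul]
  refine intervalIntegral.norm_integral_le_of_norm_le hx.2 (Eventually.of_forall fun t ht => ?_)
    ((((hφ.sub (hU.clm_apply continuousOn_const)).norm.mono hsub).intervalIntegrable_of_Icc
      hx.2).const_mul M)
  have ht' : t ∈ Icc β α := hsub (Ioc_subset_Icc_self ht)
  rw [norm_smul]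
  calc ‖T.ν₁ t‖ * ‖T.B (α, t) (φ t - S.U (α, t) v)‖
      ≤ 1 * (M * ‖φ t - S.U (α, t) v‖) :=
        mul_le_mul (hT.bound₁ t) (((T.B (α, t)).le_opNorm _).trans
          (mul_le_mul_of_nonneg_right (hM t ht') (norm_nonneg _))) (norm_nonneg _) zero_le_one
    _ = M * ‖φ t - S.U (α, t) v‖ := one_mul _

theorem IsSolution.U'_apply_eq (hβ : 0 ≤ β) (hα : α ≤ T.Λ) {φ : ℝ → E}
    {v : E} (hφ : ContinuousOn φ (Icc β α))
    (h : ∀ a ∈ Icc β α, φ a = v - ∫ x in β..a, T.ν₂ x • T.C (x, β) (φ x)) :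
    ∀ a ∈ Icc β α, φ a = S.U' (a, β) v := by
  have hm : ∀ a ∈ Icc β α, MapsTo (fun x => (x, β)) (Icc β a) (triangle T.Λ) :=
    fun b hb x hx => ⟨hβ, hx.1, hx.2.trans (hb.2.trans hα)⟩
  have hU : ContinuousOn (fun b => S.U' (b, β)) (Icc β α) := fun b hb =>
    (hS.contU'.comp (by fun_prop) (hm α ⟨hb.1.trans hb.2, le_rfl⟩)) b hb
  have hB : ContinuousOn (fun b => T.C (b, β)) (Icc β α) := fun b hb =>
    (hT.cont_C.comp (by fun_prop) (hm α ⟨hb.1.trans hb.2, le_rfl⟩)) b hb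
  obtain ⟨M, hM⟩ := isCompact_Icc.exists_bound_of_continuousOn hB
  intro b hb
  rw [← sub_eq_zero]
  refine eq_zero_of_norm_le_integral_lower (f := fun b => φ b - S.U' (b, β) v) (M := M) (p := β)
    (q := α) (hφ.sub (hU.clm_apply continuousOn_const)) (fun x hx => ?_) b hb
  have hsub : Icc β x ⊆ Icc β α := Icc_subset_Icc_right hx.2
  have i1 : IntervalIntegrable (fun t => T.ν₂ t • T.C (t, β) (φ t)) volume β x :=
    intervalIntegrable_smul_of_continuousOn hT.meas₂ hT.bound₂ hx.1
      ((hB.clm_apply hφ).mono hsub)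
  have i2 : IntervalIntegrable (fun t => T.ν₂ t • (T.C (t, β)).comp (S.U' (t, β))) volume β x :=
    intervalIntegrable_smul_of_continuousOn hT.meas₂ hT.bound₂ hx.1
      ((hB.clm_comp hU).mono hsub)
  have i3 : IntervalIntegrable (fun t => T.ν₂ t • T.C (t, β) (S.U' (t, β) v)) volume β x :=
    intervalIntegrable_smul_of_continuousOn hT.meas₂ hT.bound₂ hx.1
      ((hB.clm_apply (hU.clm_apply continuousOn_const)).mono hsub)
  have e2 : S.U' (x, β) v = v - ∫ t in β..x, T.ν₂ t • T.C (t, β) (S.U' (t, β) v) := by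
    rw [hS.eqU' (x, β) (hm x hx ⟨hx.1, le_rfl⟩), sub_apply, ContinuousLinearMap.id_apply,
      ContinuousLinearMap.intervalIntegral_apply i2]
    rfl
  have e3 : φ x - S.U' (x, β) v
      = -∫ t in β..x, T.ν₂ t • T.C (t, β) (φ t - S.U' (t, β) v) := by
    have : ∫ t in β..x, T.ν₂ t • T.C (t, β) (φ t - S.U' (t, β) v)
        = (∫ t in β..x, T.ν₂ t • T.C (t, β) (φ t))
          - ∫ t in β..x, T.ν₂ t • T.C (t, β) (S.U' (t, β) v) := by
      rw [← intervalIntegral.integral_sub i1 i3]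
      simp only [map_sub, smul_sub]
    rw [this, e2, h x hx]
    abel
  simp only [e3, norm_neg]
  rw [← intervalIntegral.integral_const_mul]
  refine intervalIntegral.norm_integral_le_of_norm_le hx.1 (Eventually.of_forall fun t ht => ?_)
    ((((hφ.sub (hU.clm_apply continuousOn_const)).norm.mono hsub).intervalIntegrable_of_Icc
      hx.1).const_mul M)
  have ht' : t ∈ Icc β α := hsub (Ioc_subset_Icc_self ht)
  rw [norm_smul]
  calc ‖T.ν₂ t‖ * ‖T.C (t, β) (φ t - S.U' (t, β) v)‖
      ≤ 1 * (M * ‖φ t - S.U' (t, β) v‖) :=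
        mul_le_mul (hT.bound₂ t) (((T.C (t, β)).le_opNorm _).trans
          (mul_le_mul_of_nonneg_right (hM t ht') (norm_nonneg _))) (norm_nonneg _) zero_le_one
    _ = M * ‖φ t - S.U' (t, β) v‖ := one_mul _

/-- On lines along which the second coordinate of the curve is constant. -/
theorem IsSolution.X_eq_of_ν₁_eq_zero (hz : (α, β) ∈ triangle T.Λ) {C₀ : E →L[ℝ] E}
    (hν : ∀ b ∈ Icc β α, T.ν₁ b = 0) (hC : ∀ b ∈ Icc β α, T.C (α, b) = C₀) :
    T.X S (α, β) = T.F α - T.ν₂ α • C₀ (S.Ψ (α, β)) := by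
  -- With `ν₁ = 0` only the last summand of `K` survives; its coefficient is constant along the
  -- line, and `∫ Y = -Ψ`. The result is the differential equation on a horizontal arc.
  have hK : ∫ b in β..α, T.K S (α, b) = ∫ b in β..α, -(T.ν₂ α • C₀ (T.Y S (α, b))) := by
    refine intervalIntegral.integral_congr fun b hb => ?_
    rw [uIcc_of_le hz.2.1] at hb
    simp only [K, hν b hb, hC b hb, mul_zero, neg_zero, zero_smul, zero_add, zero_sub]
  rw [hS.eqX _ hz, hK, intervalIntegral.integral_neg, intervalIntegral.integral_smul,
    ContinuousLinearMap.intervalIntegral_comp_comm _ (hT.intervalIntegrable_Y hS.contW hS.contU' hz),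
    hS.eqΨY _ hz, map_neg, smul_neg]

/-- The counterpart for vertical arcs: `K` reduces to `ν₁(β) B₀ X`, and the integral of `X` is `Ψ`.
-/
theorem IsSolution.Y_eq_of_ν₂_eq_zero (hz : (α, β) ∈ triangle T.Λ) {B₀ : E →L[ℝ] E}
    (hν : ∀ a ∈ Icc β α, T.ν₂ a = 0) (hB : ∀ a ∈ Icc β α, T.B (a, β) = B₀) :
    T.Y S (α, β) = -T.F β + T.ν₁ β • B₀ (S.Ψ (α, β)) := by
  have hK : ∫ a in β..α, T.K S (a, β) = ∫ a in β..α, T.ν₁ β • B₀ (T.X S (a, β)) := by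
    refine intervalIntegral.integral_congr fun b hb => ?_
    rw [uIcc_of_le hz.2.1] at hb
    simp only [K, hν b hb, hB b hb, zero_mul, neg_zero, zero_smul, zero_add, sub_zero]
  rw [hS.eqY _ hz, hK, intervalIntegral.integral_smul,
    ContinuousLinearMap.intervalIntegral_comp_comm _ (hT.intervalIntegrable_X hS.contV hS.contU hz),
    hS.eqΨX _ hz]

/-- Where `ν₂` vanishes the ansatz reduces to `X = U F`. The increment of `Ψ` across such a strip is
therefore known explicitly in terms of the data; this is the source of the jump conditions. -/
theorem IsSolution.Ψ_sub_left {p q : ℝ} (hβ : 0 ≤ β) (hp : β ≤ p) (hpq : p ≤ q) (hq : q ≤ T.Λ)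
    (hν : ∀ a ∈ Icc p q, T.ν₂ a = 0) :
    S.Ψ (q, β) - S.Ψ (p, β) = ∫ a in p..q, S.U (a, β) (T.F a) := by
  have h1 := hT.intervalIntegrable_X (S := S) hS.contV hS.contU (z := (p, β))
    ⟨hβ, hp, hpq.trans hq⟩
  have h2 := hT.intervalIntegrable_X (S := S) hS.contV hS.contU (z := (q, β))
    ⟨hβ, hp.trans hpq, hq⟩
  rw [hS.eqΨX (p, β) ⟨hβ, hp, hpq.trans hq⟩, hS.eqΨX (q, β) ⟨hβ, hp.trans hpq, hq⟩,
    intervalIntegral.integral_interval_sub_left h2 h1]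
  refine intervalIntegral.integral_congr fun a ha => ?_
  rw [uIcc_of_le hpq] at ha
  simp only [X, hν a ha, zero_smul, sub_zero]

theorem IsSolution.Ψ_sub_right {p q : ℝ} (hp : 0 ≤ p) (hpq : p ≤ q) (hq : q ≤ α) (hα : α ≤ T.Λ)
    (hν : ∀ b ∈ Icc p q, T.ν₁ b = 0) :
    S.Ψ (α, p) - S.Ψ (α, q) = ∫ b in p..q, S.U' (α, b) (T.F b) := by
  have h1 := hT.intervalIntegrable_Y (S := S) hS.contW hS.contU' (z := (α, p))
    ⟨hp, hpq.trans hq, hα⟩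
  have h2 := hT.intervalIntegrable_Y (S := S) hS.contW hS.contU' (z := (α, q))
    ⟨hp.trans hpq, hq, hα⟩
  have h3 : IntervalIntegrable (fun b => T.Y S (α, b)) volume p q :=
    h1.mono_set (uIcc_subset_uIcc_left (Icc_subset_uIcc ⟨hpq, hq⟩))
  rw [hS.eqΨY (α, p) ⟨hp, hpq.trans hq, hα⟩, hS.eqΨY (α, q) ⟨hp.trans hpq, hq, hα⟩,
    ← intervalIntegral.integral_add_adjacent_intervals h3 h2, neg_add, sub_neg_eq_add,
    neg_add_cancel_right, ← intervalIntegral.integral_neg]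
  refine intervalIntegral.integral_congr fun a ha => ?_
  rw [uIcc_of_le hpq] at ha
  simp only [Y, hν a ha, zero_smul, add_zero, neg_neg]

/-- The value at a corner of the boundary curve. -/
theorem IsSolution.Ψ_corner {e₀ f₀ f₁ e₁ : ℝ} (h0 : 0 ≤ e₀) (h1 : e₀ ≤ f₀) (h2 : f₀ ≤ f₁)
    (h3 : f₁ ≤ e₁) (h4 : e₁ ≤ T.Λ) (hν₁ : ∀ b ∈ Icc e₀ f₁, T.ν₁ b = 0)
    (hν₂ : ∀ a ∈ Icc f₀ e₁, T.ν₂ a = 0) :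
    S.Ψ (e₁, e₀) = S.Ψ (f₀, e₀) + (∫ a in f₀..f₁, T.F a) + S.Ψ (e₁, f₁) := by
  have hI := hT.intervalIntegrable_X (S := S) hS.contV hS.contU (z := (e₁, e₀))
    ⟨h0, h1.trans (h2.trans h3), h4⟩
  -- Every summand of `K` contains `ν₂(a)` or `ν₁(b)`, and both vanish in this region. Hence `X` is
  -- constant in `b` there, equal to `F` where the diagonal is reached, and the contributions simply
  -- add up.
  have hX : ∀ a ∈ Icc f₀ e₁, ∀ b ∈ Icc e₀ (min a f₁), T.K S (a, b) = 0 := fun a ha b hb => by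
    simp only [K, hν₂ a ha, hν₁ b ⟨hb.1, hb.2.trans (min_le_right _ _)⟩, zero_mul, neg_zero,
      zero_smul, zero_add, sub_zero]
  have sub : ∀ {p q : ℝ}, e₀ ≤ p → p ≤ q → q ≤ e₁ →
      IntervalIntegrable (fun a => T.X S (a, e₀)) volume p q := fun hp hpq hq =>
    hI.mono_set (by rw [uIcc_of_le hpq]; exact (Icc_subset_Icc hp hq).trans Icc_subset_uIcc)
  have e1 : ∫ a in f₀..f₁, T.X S (a, e₀) = ∫ a in f₀..f₁, T.F a := by
    refine intervalIntegral.integral_congr fun a ha => ?_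
    rw [uIcc_of_le h2] at ha
    have hz : ∫ b in e₀..a, T.K S (a, b) = 0 := by
      rw [intervalIntegral.integral_congr (g := fun _ => 0), intervalIntegral.integral_zero]
      intro b hb
      rw [uIcc_of_le (h1.trans ha.1)] at hb
      exact hX a ⟨ha.1, ha.2.trans h3⟩ b ⟨hb.1, le_min hb.2 (hb.2.trans ha.2)⟩
    simp only [hS.eqX (a, e₀) ⟨h0, h1.trans ha.1, (ha.2.trans h3).trans h4⟩, hz, sub_zero]
  have e2 : ∫ a in f₁..e₁, T.X S (a, e₀) = ∫ a in f₁..e₁, T.X S (a, f₁) := by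
    refine intervalIntegral.integral_congr fun a ha => ?_
    rw [uIcc_of_le h3] at ha
    have hz0 : (a, e₀) ∈ triangle T.Λ := ⟨h0, (h1.trans h2).trans ha.1, ha.2.trans h4⟩
    have hz1 : (a, f₁) ∈ triangle T.Λ := ⟨h0.trans (h1.trans h2), ha.1, ha.2.trans h4⟩
    have hz : ∫ b in e₀..f₁, T.K S (a, b) = 0 := by
      rw [intervalIntegral.integral_congr (g := fun _ => 0), intervalIntegral.integral_zero]
      intro b hb
      rw [uIcc_of_le (h1.trans h2)] at hb
      exact hX a ⟨h2.trans ha.1, ha.2⟩ b ⟨hb.1, le_min (hb.2.trans ha.1) hb.2⟩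
    have hK0 := hS.intervalIntegrable_K_left hT hz0
    have hK1 := hS.intervalIntegrable_K_left hT hz1
    have hK2 : IntervalIntegrable (fun b => T.K S (a, b)) volume e₀ f₁ :=
      hK0.mono_set (uIcc_subset_uIcc_left (Icc_subset_uIcc ⟨h1.trans h2, ha.1⟩))
    simp only [hS.eqX _ hz0, hS.eqX _ hz1]
    rw [← intervalIntegral.integral_add_adjacent_intervals hK2 hK1, hz, zero_add]
  rw [hS.eqΨX (e₁, e₀) ⟨h0, h1.trans (h2.trans h3), h4⟩,
    hS.eqΨX (f₀, e₀) ⟨h0, h1, (h2.trans h3).trans h4⟩,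
    hS.eqΨX (e₁, f₁) ⟨h0.trans (h1.trans h2), h3, h4⟩, ← e1]
  simp only [← e2]
  rw [intervalIntegral.integral_add_adjacent_intervals (sub le_rfl h1 (h2.trans h3))
    (sub h1 h2 h3), intervalIntegral.integral_add_adjacent_intervals
    (sub le_rfl (h1.trans h2) h3) (sub (h1.trans h2) h3 le_rfl)]

end TriangleProblem

/-! ### The co-state obtained from the stretched problem -/

namespace VertexCurve.Admissible

variable {c : VertexCurve} (hc : c.Admissible)
include hc

theorem lift_of_mem_cell {j k : ℕ} (hj : j ≤ c.N) (hk : k ≤ c.N) {z : ℝ × ℝ}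
    (hz : z ∈ c.cell j k) : ¬c.IsHorizontal j ∧ ¬c.IsVertical k ∧ j ≤ k ∧
      ∃ α ∈ c.arc k, ∃ β ∈ c.arc j, c.L₁ α = z.1 ∧ c.L₂ β = z.2 ∧
        c.lift₁ z.1 = α + (k + 1) ∧ c.lift₂ z.2 = β + (j + 1) ∧ c.lift₁ z.1 ∈ c.blowArc k ∧
        c.lift₂ z.2 ∈ c.blowArc j ∧ c.lift₂ z.2 < c.lift₁ z.1 := by
  obtain ⟨hnj, hnk, hjk, α, hα, β, hβ, hlt, h1, h2⟩ := hc.exists_of_mem_cell hj hk hz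
  have e1 := hc.lift₁_eq hk hnk hα
  have e2 := hc.lift₂_eq hj hnj hβ
  rw [h1] at e1
  rw [h2] at e2
  refine ⟨hnj, hnk, hjk, α, hα, β, hβ, h1, h2, e1, e2, e1 ▸ c.add_mem_blowArc_iff.2 hα,
    e2 ▸ c.add_mem_blowArc_iff.2 hβ, ?_⟩
  have : (j : ℝ) ≤ k := Nat.cast_le.2 hjk
  linarith

theorem lift_mem_triangle {z : ℝ × ℝ} (hz : z ∈ c.intGR) :
    (c.lift₁ z.1, c.lift₂ z.2) ∈ triangle c.blowLen := by
  obtain ⟨j, hj, k, hk, hzc⟩ := hc.exists_cell hz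
  obtain ⟨-, -, -, α, hα, β, hβ, -, -, -, -, h1, h2, h3⟩ := hc.lift_of_mem_cell hj hk hzc
  exact ⟨(hc.blowArc_subset hj h2).1.le, h3.le, (hc.blowArc_subset hk h1).2.le⟩

theorem continuousOn_n₁ {j : ℕ} (hj : j ≤ c.N) : ContinuousOn c.n₁ (c.arc j) := by
  obtain ⟨m₁, m₂, h1, h2, h⟩ := ControlData.continuousOn_ext_n hc hj
  exact (h1.continuousOn.mono Ioo_subset_Icc_self).congr fun μ hμ => (h μ hμ).1

theorem continuousOn_n₂ {j : ℕ} (hj : j ≤ c.N) : ContinuousOn c.n₂ (c.arc j) := by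
  obtain ⟨m₁, m₂, h1, h2, h⟩ := ControlData.continuousOn_ext_n hc hj
  exact (h2.continuousOn.mono Ioo_subset_Icc_self).congr fun μ hμ => (h μ hμ).2

end VertexCurve.Admissible

namespace ControlData

variable {n m : ℕ} (D : ControlData n m) (c : VertexCurve)

/-- The Cauchy problem on the triangle that belongs to the stretched curve. -/
def problem : TriangleProblem (Euc n) where
  Λ := c.blowLen
  ν₁ := c.glue c.n₁ 0
  ν₂ := c.glue c.n₂ 0
  F := c.glue (D.F₁ c) (D.F₀ c)
  a z := D.coefa (c.blow₁ z.1, c.blow₂ z.2)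
  A z := D.coefA (c.blow₁ z.1, c.blow₂ z.2)
  B z := D.coefB (c.blow₁ z.1, c.blow₂ z.2)
  C z := D.coefC (c.blow₁ z.1, c.blow₂ z.2)

variable {D c}

theorem continuousOn_F₁ (hc : c.Admissible) (hD : D.Smooth c) {j : ℕ} (hj : j ≤ c.N) :
    ContinuousOn (D.F₁ c) (c.arc j) := by
  obtain ⟨F, hF, h⟩ := exists_F₁_extension hc hD hj
  exact (hF.mono Ioo_subset_Icc_self).congr h

theorem problem_regular (hc : c.Admissible) (hD : D.Smooth c) : (D.problem c).Regular := by
  obtain ⟨O, hGO, hO⟩ := hD.smoothOn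
  have hmap : MapsTo (fun z : ℝ × ℝ => (c.blow₁ z.1, c.blow₂ z.2)) (triangle c.blowLen) O :=
    fun z hz => hGO (hc.blow_mem_G hz.2.1)
  have hcont : ContinuousOn (fun z : ℝ × ℝ => (c.blow₁ z.1, c.blow₂ z.2)) (triangle c.blowLen) :=
    ((hc.continuous_blow₁.comp continuous_fst).prodMk
      (hc.continuous_blow₂.comp continuous_snd)).continuousOn
  have e1 : ∀ j ≤ c.N, ∃ G : ℝ → ℝ, ContinuousOn G (c.closedArc j) ∧
      ∀ μ ∈ c.arc j, c.n₁ μ = G μ := fun j hj => by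
    obtain ⟨m₁, m₂, h1, h2, h⟩ := continuousOn_ext_n hc hj
    exact ⟨m₁, h1.continuousOn, fun μ hμ => (h μ hμ).1⟩
  have e2 : ∀ j ≤ c.N, ∃ G : ℝ → ℝ, ContinuousOn G (c.closedArc j) ∧
      ∀ μ ∈ c.arc j, c.n₂ μ = G μ := fun j hj => by
    obtain ⟨m₁, m₂, h1, h2, h⟩ := continuousOn_ext_n hc hj
    exact ⟨m₂, h2.continuousOn, fun μ hμ => (h μ hμ).2⟩
  have e3 : ∀ j ≤ c.N, ∃ G : ℝ → Euc n, ContinuousOn G (c.closedArc j) ∧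
      ∀ μ ∈ c.arc j, D.F₁ c μ = G μ := fun j hj => exists_F₁_extension hc hD hj
  refine ⟨?_, (hc.stronglyMeasurable_glue e1).measurable, (hc.stronglyMeasurable_glue e2).measurable,
    hc.glue_induction (p := fun x => ‖x‖ ≤ 1) (by simp) ?_ (by simp),
    hc.glue_induction (p := fun x => ‖x‖ ≤ 1) (by simp) ?_ (by simp),
    hc.stronglyMeasurable_glue e3, hc.exists_bound_glue e3,
    hO.continuousOn_coefa.comp hcont hmap, hO.continuousOn_coefA.comp hcont hmap,
    hO.continuousOn_coefB.comp hcont hmap, hO.continuousOn_coefC.comp hcont hmap⟩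
  · exact le_trans (by linarith [hc.knot_nonneg (Nat.zero_le _ : 0 ≤ c.N + 1)])
      (hc.knot_add_one_le_blowLen (Nat.zero_le (c.N + 1)))
  · intro j hj μ hμ
    rw [Real.norm_of_nonneg (hc.n₁_nonneg hj hμ)]
    exact hc.n₁_le hj hμ
  · intro j hj μ hμ
    rw [Real.norm_of_nonneg (hc.n₂_nonneg hj hμ)]
    exact hc.n₂_le hj hμ

section Continuity

variable (hc : c.Admissible) (hD : D.Smooth c) {j : ℕ} (hj : j ≤ c.N) {l : ℝ}
  (hl : l ∈ c.blowArc j)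
include hc hj hl

theorem problem_ν₁ : (D.problem c).ν₁ l = c.n₁ (l - (j + 1)) := hc.glue_arc hj hl

theorem problem_ν₂ : (D.problem c).ν₂ l = c.n₂ (l - (j + 1)) := hc.glue_arc hj hl

theorem problem_F : (D.problem c).F l = D.F₁ c (l - (j + 1)) := hc.glue_arc hj hl

theorem continuousAt_problem_ν₁ : ContinuousAt (D.problem c).ν₁ l :=
  hc.continuousAt_glue (fun _ => hc.continuousOn_n₁) hj hl

theorem continuousAt_problem_ν₂ : ContinuousAt (D.problem c).ν₂ l :=
  hc.continuousAt_glue (fun _ => hc.continuousOn_n₂) hj hl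

include hD in
theorem continuousAt_problem_F : ContinuousAt (D.problem c).F l :=
  hc.continuousAt_glue (fun _ => continuousOn_F₁ hc hD) hj hl

end Continuity

/-- The co-state that belongs to a solution of the problem on the triangle. -/
def costate (c : VertexCurve) (S : TriangleProblem.Ansatz (Euc n)) (z : ℝ × ℝ) : Euc n :=
  S.Ψ (c.lift₁ z.1, c.lift₂ z.2)

variable {S : TriangleProblem.Ansatz (Euc n)}

section

variable (hc : c.Admissible) (hD : D.Smooth c) (hS : (D.problem c).IsSolution S)
include hc hD hS

theorem hasDerivAt_costate_left {j k : ℕ} (hj : j ≤ c.N) (hk : k ≤ c.N) {z : ℝ × ℝ}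
    (hz : z ∈ c.cell j k) {α : ℝ} (hα : α ∈ c.arc k) (hαz : c.L₁ α = z.1) :
    HasDerivAt (fun s => costate c S (s, z.2))
      ((-c.n₂ α)⁻¹ • (D.problem c).X S (c.lift₁ z.1, c.lift₂ z.2)) z.1 := by
  obtain ⟨-, hnk, -, -, -, -, -, -, -, -, -, h1, h2, h3⟩ := hc.lift_of_mem_cell hj hk hz
  have hl := hc.hasDerivAt_lift₁ hk hnk hα
  rw [hαz] at hl
  exact (hS.hasDerivAt_Ψ_left (problem_regular hc hD) (hc.blowArc_subset hj h2).1.le h3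
    (hc.blowArc_subset hk h1).2 (continuousAt_problem_F hc hD hk h1)
    (continuousAt_problem_ν₂ hc hk h1)).scomp z.1 hl

theorem hasDerivAt_costate_right {j k : ℕ} (hj : j ≤ c.N) (hk : k ≤ c.N) {z : ℝ × ℝ}
    (hz : z ∈ c.cell j k) {β : ℝ} (hβ : β ∈ c.arc j) (hβz : c.L₂ β = z.2) :
    HasDerivAt (fun t => costate c S (z.1, t))
      ((c.n₁ β)⁻¹ • (D.problem c).Y S (c.lift₁ z.1, c.lift₂ z.2)) z.2 := by
  obtain ⟨hnj, -, -, -, -, -, -, -, -, -, -, h1, h2, h3⟩ := hc.lift_of_mem_cell hj hk hz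
  have hl := hc.hasDerivAt_lift₂ hj hnj hβ
  rw [hβz] at hl
  exact (hS.hasDerivAt_Ψ_right (problem_regular hc hD) (hc.blowArc_subset hj h2).1 h3
    (hc.blowArc_subset hk h1).2.le (continuousAt_problem_F hc hD hj h2)
    (continuousAt_problem_ν₁ hc hj h2)).scomp z.2 hl

/-- In the arc parameters the required extensions are explicit expressions in `U`, `U'`, `V`, `W`,
`Ψ`. The map from the parameters to the plane is a continuous injection of a compact set, so
continuity carries over to the image, which contains the closed cell. `F` and `ν` are replaced by
the continuous extensions from the closed arcs, since their values in the stretched problem jump at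
the knots. -/
theorem costate_regularOnCell {j k : ℕ} (hj : j ≤ c.N) (hk : k ≤ c.N) :
    c.RegularOnCell j k (costate c S) := by
  rcases (c.cell j k).eq_empty_or_nonempty with he | ⟨z₀, hz₀⟩
  · refine ⟨0, 0, 0, continuousOn_const, continuousOn_const, continuousOn_const, fun z hz => ?_⟩
    rw [he] at hz
    exact hz.elim
  obtain ⟨hnj, hnk, hjk, -⟩ := hc.exists_of_mem_cell hj hk hz₀
  obtain ⟨m₁, m₁', hm₁, -, hm⟩ := continuousOn_ext_n hc hj
  obtain ⟨m₂', m₂, -, hm₂, hm'⟩ := continuousOn_ext_n hc hk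
  obtain ⟨Fj, hFj, hFj'⟩ := exists_F₁_extension hc hD hj
  obtain ⟨Fk, hFk, hFk'⟩ := exists_F₁_extension hc hD hk
  -- For `j < k` the condition `y.2 ≤ y.1` holds automatically and `Q` is a rectangle; for `j = k`
  -- it is a triangle.
  set Q : Set (ℝ × ℝ) := (c.closedArc k ×ˢ c.closedArc j) ∩ {y | y.2 ≤ y.1} with hQ
  have hQc : IsCompact Q := (isCompact_Icc.prod isCompact_Icc).inter_right
    (isClosed_le continuous_snd continuous_fst)
  let f : ℝ × ℝ → ℝ × ℝ := fun y => (c.L₁ y.1, c.L₂ y.2)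
  let e : ℝ × ℝ → ℝ × ℝ := fun y => (y.1 + (k + 1), y.2 + (j + 1))
  have q1 : MapsTo Prod.fst Q (c.closedArc k) := fun y hy => hy.1.1
  have q2 : MapsTo Prod.snd Q (c.closedArc j) := fun y hy => hy.1.2
  have hf : ContinuousOn f Q :=
    ((hc.continuousOn_L₁.mono (hc.closedArc_subset hk)).comp continuousOn_fst q1).prodMk
      ((hc.continuousOn_L₂.mono (hc.closedArc_subset hj)).comp continuousOn_snd q2)
  have hinj : InjOn f Q := by
    intro y hy y' hy' h
    rw [Prod.ext_iff] at h
    exact Prod.ext ((hc.strictAntiOn_L₁ hk hnk).injOn (q1 hy) (q1 hy') h.1)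
      ((hc.strictMonoOn_L₂ hj hnj).injOn (q2 hy) (q2 hy') h.2)
  have hcj : (j : ℝ) ≤ k := Nat.cast_le.2 hjk
  have hcN : (k : ℝ) ≤ c.N := Nat.cast_le.2 hk
  have he : MapsTo e Q (triangle c.blowLen) := by
    rintro y ⟨⟨hy1, hy2⟩, hy3⟩
    have h1 := (hc.closedArc_subset hk hy1).2
    have h2 := (hc.closedArc_subset hj hy2).1
    refine ⟨by positivity, ?_, ?_⟩
    · have : y.2 ≤ y.1 := hy3
      change y.2 + _ ≤ y.1 + _
      linarith
    · rw [VertexCurve.blowLen, VertexCurve.knot_succ]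
      change y.1 + _ ≤ _
      rw [VertexCurve.len] at h1
      linarith
  have hec : ContinuousOn e Q := by fun_prop
  have hcell : ∀ z ∈ c.cell j k, ∃ y ∈ Q, f y = z ∧ e y = (c.lift₁ z.1, c.lift₂ z.2) ∧
      y.1 ∈ c.arc k ∧ y.2 ∈ c.arc j := by
    intro z hz
    obtain ⟨-, -, -, α, hα, β, hβ, h1, h2, h3, h4, -⟩ := hc.lift_of_mem_cell hj hk hz
    obtain ⟨-, -, -, α', hα', β', hβ', hlt, h5, h6⟩ := hc.exists_of_mem_cell hj hk hz
    have ea := (hc.strictAntiOn_L₁ hk hnk).injOn (Ioo_subset_Icc_self hα)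
      (Ioo_subset_Icc_self hα') (h1.trans h5.symm)
    have eb := (hc.strictMonoOn_L₂ hj hnj).injOn (Ioo_subset_Icc_self hβ)
      (Ioo_subset_Icc_self hβ') (h2.trans h6.symm)
    subst ea eb
    exact ⟨(α, β), ⟨⟨Ioo_subset_Icc_self hα, Ioo_subset_Icc_self hβ⟩, hlt.le⟩, Prod.ext h1 h2,
      Prod.ext h3.symm h4.symm, hα, hβ⟩
  have hcl : closure (c.cell j k) ⊆ f '' Q :=
    closure_minimal (fun z hz => let ⟨y, hy, hyz, _⟩ := hcell z hz; ⟨y, hy, hyz⟩)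
      (hQc.image_of_continuousOn hf).isClosed
  let g : ℝ × ℝ → ℝ × ℝ := Function.invFunOn f Q
  have hg : ∀ y ∈ Q, g (f y) = y := hinj.leftInvOn_invFunOn
  have key : ∀ {h : ℝ × ℝ → Euc n}, ContinuousOn h Q →
      ContinuousOn (fun z => h (g z)) (closure (c.cell j k)) := fun {h} hh =>
    (hQc.continuousOn_image (h := fun z => h (g z)) hf hh fun y hy => by rw [hg y hy]).mono hcl
  refine ⟨fun z => S.Ψ (e (g z)),
    -- The signs follow from `n₂ ψ_s = -X` and `n₁ ψ_t = Y`.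
    fun z => -(S.U (e (g z)) (Fk (g z).1) - m₂ (g z).1 • S.V (e (g z))),
    fun z => -S.U' (e (g z)) (Fj (g z).2) + m₁ (g z).2 • S.W (e (g z)),
    key (hS.contΨ.comp hec he),
    key (h := fun y => -(S.U (e y) (Fk y.1) - m₂ y.1 • S.V (e y)))
      (((hS.contU.comp hec he).clm_apply (hFk.comp continuousOn_fst q1)).sub
        ((hm₂.continuousOn.comp continuousOn_fst q1).smul (hS.contV.comp hec he))).neg,
    key (h := fun y => -S.U' (e y) (Fj y.2) + m₁ y.2 • S.W (e y))
      (((hS.contU'.comp hec he).clm_apply (hFj.comp continuousOn_snd q2)).neg.add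
        ((hm₁.continuousOn.comp continuousOn_snd q2).smul (hS.contW.comp hec he))),
    fun z hz => ?_⟩
  obtain ⟨y, hy, rfl, hye, hy1, hy2⟩ := hcell z hz
  obtain ⟨-, -, -, -, -, -, -, -, -, -, -, b1, b2, -⟩ := hc.lift_of_mem_cell hj hk hz
  simp only [hg y hy]
  have hk1 : c.lift₁ (f y).1 - (k + 1) = y.1 :=
    sub_eq_of_eq_add (congrArg Prod.fst hye).symm
  have hj1 : c.lift₂ (f y).2 - (j + 1) = y.2 :=
    sub_eq_of_eq_add (congrArg Prod.snd hye).symm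
  refine ⟨by rw [hye, costate], (hasDerivAt_costate_left hc hD hS hj hk hz hy1 rfl).differentiableAt,
    (hasDerivAt_costate_right hc hD hS hj hk hz hy2 rfl).differentiableAt, ?_, ?_⟩
  · intro α hα hαz
    have hn := (hc.n₂_pos hk hnk hα).ne'
    rw [dS, (hasDerivAt_costate_left hc hD hS hj hk hz hα hαz).deriv, inv_neg, neg_smul, smul_neg,
      smul_inv_smul₀ hn, TriangleProblem.X, hye]
    dsimp only
    rw [problem_F hc hk b1, problem_ν₂ hc hk b1, hk1, hFk' _ hy1, (hm' _ hy1).2]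
  · intro β hβ hβz
    have hn := (hc.n₁_pos hj hnj hβ).ne'
    rw [dT, (hasDerivAt_costate_right hc hD hS hj hk hz hβ hβz).deriv,
      smul_inv_smul₀ hn, TriangleProblem.Y, hye]
    dsimp only
    rw [problem_F hc hj b2, problem_ν₁ hc hj b2, hj1, hFj' _ hy2, (hm _ hy2).1]

omit hD hc hS in
-- Division of `K` by `-n₂ n₁` restores the form `a + A ψ + B ψ_s + C ψ_t` of the right-hand side.
theorem smul_inv_aux {E : Type*} [AddCommGroup E] [Module ℝ E] {p q : ℝ} (hp : p ≠ 0) (hq : q ≠ 0)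
    (u x y : E) : p⁻¹ • (-q)⁻¹ • (-(q * p) • u + p • x - q • y) = u + (-q)⁻¹ • x + p⁻¹ • y := by
  match_scalars <;> field_simp

/-- The chain rule with `lift₁' = -1 / n₂` and `lift₂' = 1 / n₁`, applied to `ψ_t = Y / n₁` with
`Y_α = K` and to `ψ_s = -X / n₂` with `X_β = K`. Both mixed derivatives equal `-K / (n₂ n₁)`. -/
theorem costate_hamilton {z : ℝ × ℝ} (hz : z ∈ c.intGR) :
    HasDerivAt (fun s => dT (costate c S) (s, z.2))
      (D.rhs z (costate c S z) (dS (costate c S) z) (dT (costate c S) z)) z.1 ∧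
    HasDerivAt (fun t => dS (costate c S) (z.1, t))
      (D.rhs z (costate c S z) (dS (costate c S) z) (dT (costate c S) z)) z.2 := by
  obtain ⟨O, hGO, hO⟩ := hD.smoothOn
  have hT := problem_regular hc hD
  have hzO : z ∈ O := hGO (interior_subset hz.1)
  obtain ⟨j, hj, k, hk, hzc⟩ := hc.exists_cell hz
  obtain ⟨hnj, hnk, hjk, α, hα, β, hβ, hαz, hβz, ea, eb, b1, b2, hlt⟩ :=
    hc.lift_of_mem_cell hj hk hzc
  have p1 := (hc.n₁_pos hj hnj hβ).ne'
  have p2 := (hc.n₂_pos hk hnk hα).ne'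
  have hSd : dS (costate c S) z
      = (-c.n₂ α)⁻¹ • (D.problem c).X S (c.lift₁ z.1, c.lift₂ z.2) :=
    (hasDerivAt_costate_left hc hD hS hj hk hzc hα hαz).deriv
  have hTd : dT (costate c S) z
      = (c.n₁ β)⁻¹ • (D.problem c).Y S (c.lift₁ z.1, c.lift₂ z.2) :=
    (hasDerivAt_costate_right hc hD hS hj hk hzc hβ hβz).deriv
  have hν₁ : (D.problem c).ν₁ (c.lift₂ z.2) = c.n₁ β := by
    rw [problem_ν₁ hc hj b2, eb, add_sub_cancel_right]
  have hν₂ : (D.problem c).ν₂ (c.lift₁ z.1) = c.n₂ α := by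
    rw [problem_ν₂ hc hk b1, ea, add_sub_cancel_right]
  have hpt : (c.blow₁ (c.lift₁ z.1), c.blow₂ (c.lift₂ z.2)) = z := by
    rw [ea, eb, hc.blow₁_add hk (Ioo_subset_Icc_self hα), hc.blow₂_add hj (Ioo_subset_Icc_self hβ),
      hαz, hβz]
  have hrhs : D.rhs z (costate c S z) (dS (costate c S) z) (dT (costate c S) z)
      = (c.n₁ β)⁻¹ • (-c.n₂ α)⁻¹ • (D.problem c).K S (c.lift₁ z.1, c.lift₂ z.2) := by
    have hK : (D.problem c).K S (c.lift₁ z.1, c.lift₂ z.2)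
        = -(c.n₂ α * c.n₁ β) • (D.coefa z + D.coefA z (costate c S z))
          + c.n₁ β • D.coefB z ((D.problem c).X S (c.lift₁ z.1, c.lift₂ z.2))
          - c.n₂ α • D.coefC z ((D.problem c).Y S (c.lift₁ z.1, c.lift₂ z.2)) := by
      have ha : (D.problem c).a (c.lift₁ z.1, c.lift₂ z.2) = D.coefa z := congrArg D.coefa hpt
      have hA : (D.problem c).A (c.lift₁ z.1, c.lift₂ z.2) = D.coefA z := congrArg D.coefA hpt
      have hB : (D.problem c).B (c.lift₁ z.1, c.lift₂ z.2) = D.coefB z := congrArg D.coefB hpt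
      have hC : (D.problem c).C (c.lift₁ z.1, c.lift₂ z.2) = D.coefC z := congrArg D.coefC hpt
      rw [TriangleProblem.K, ha, hA, hB, hC]
      dsimp only
      rw [hν₁, hν₂]
      rfl
    rw [hO.rhs_eq hzO, hK, smul_inv_aux p1 p2, hSd, hTd, map_smul, map_smul]
  have n1 := (hc.isOpen_cell j k).mem_nhds hzc
  have mem1 : ∀ᶠ s in 𝓝 z.1, (s, z.2) ∈ c.cell j k :=
    (Continuous.prodMk_left z.2).continuousAt.eventually n1
  have mem2 : ∀ᶠ t in 𝓝 z.2, (z.1, t) ∈ c.cell j k :=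
    (Continuous.prodMk_right z.1).continuousAt.eventually n1
  have cF1 := continuousAt_problem_F hc hD hk b1
  have cF2 := continuousAt_problem_F hc hD hj b2
  have cν1 := continuousAt_problem_ν₂ (D := D) hc hk b1
  have cν2 := continuousAt_problem_ν₁ (D := D) hc hj b2
  have i1 := hc.blowArc_subset hk b1
  have i2 := hc.blowArc_subset hj b2
  have l1 := hc.hasDerivAt_lift₁ hk hnk hα
  have l2 := hc.hasDerivAt_lift₂ hj hnj hβ
  rw [hαz] at l1
  rw [hβz] at l2
  constructor
  · have h1 := ((hS.hasDerivAt_Y hT i2.1.le hlt i1.2 cF1 cF2 cν1 cν2).scomp z.1 l1).const_smul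
      (c.n₁ β)⁻¹
    rw [hrhs]
    refine h1.congr_of_eventuallyEq ?_
    filter_upwards [mem1] with s hs
    exact (hasDerivAt_costate_right hc hD hS hj hk hs hβ hβz).deriv
  · have h1 := ((hS.hasDerivAt_X hT i2.1 hlt i1.2.le cF1 cF2 cν1 cν2).scomp z.2 l2).const_smul
      (-c.n₂ α)⁻¹
    rw [hrhs, smul_comm]
    refine h1.congr_of_eventuallyEq ?_
    filter_upwards [mem2] with s hs
    exact (hasDerivAt_costate_left hc hD hS hj hk hs hα hαz).deriv

end

end ControlData

/-! ### Integrals over the stretched intervals -/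

theorem intervalIntegral_congr_Ioo {E : Type*} [NormedAddCommGroup E] [NormedSpace ℝ E]
    {f g : ℝ → E} {a b : ℝ} (hab : a ≤ b) (h : EqOn f g (Ioo a b)) :
    ∫ x in a..b, f x = ∫ x in a..b, g x := by
  rw [intervalIntegral.integral_of_le hab, intervalIntegral.integral_of_le hab,
    integral_Ioc_eq_integral_Ioo, integral_Ioc_eq_integral_Ioo]
  exact setIntegral_congr_fun measurableSet_Ioo h

theorem IntervalIntegrable.congr_Ioo {E : Type*} [NormedAddCommGroup E] {f g : ℝ → E} {a b : ℝ}
    (hf : IntervalIntegrable f volume a b) (hab : a ≤ b) (h : EqOn f g (Ioo a b)) :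
    IntervalIntegrable g volume a b := by
  rw [intervalIntegrable_iff_integrableOn_Ioo_of_le hab] at hf ⊢
  exact hf.congr_fun h measurableSet_Ioo

namespace VertexCurve.Admissible

variable {c : VertexCurve} (hc : c.Admissible)
include hc

section

variable {E : Type*} [NormedAddCommGroup E] [NormedSpace ℝ E] {I h : ℝ → E} {v : ℕ → E}

omit hc in
theorem integral_blowNode [CompleteSpace E] {r : ℕ} {x : E} (hI : ∀ l ∈ c.blowNode r, I l = x) :
    ∫ l in c.knot r..c.knot r + 1, I l = x := by
  rw [intervalIntegral_congr_Ioo (by linarith) hI, intervalIntegral.integral_const,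
    add_sub_cancel_left, one_smul]

theorem knot_add_one_le_knot_succ {j : ℕ} (hj : j ≤ c.N) : c.knot j + 1 ≤ c.knot (j + 1) :=
  (hc.knot_add_one_le (Nat.lt_succ_self j) (by lia)).le

omit hc in
theorem knot_add_one_sub (j : ℕ) : c.knot j + 1 - (j + 1) = c.node j := by
  rw [knot]; ring

omit hc in
theorem knot_succ_sub (j : ℕ) : c.knot (j + 1) - (j + 1) = c.node (j + 1) := by
  rw [knot_succ]; ring

theorem integral_blowArc {j : ℕ} (hj : j ≤ c.N)
    (hI : IntervalIntegrable I volume (c.knot j + 1) (c.knot (j + 1)))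
    (h' : ∀ l ∈ c.blowArc j, I l = h (l - (j + 1))) :
    IntervalIntegrable h volume (c.node j) (c.node (j + 1)) ∧
      ∫ l in c.knot j + 1..c.knot (j + 1), I l = ∫ μ in c.node j..c.node (j + 1), h μ := by
  have hle := hc.knot_add_one_le_knot_succ hj
  constructor
  · have h1 := (hI.congr_Ioo hle h').comp_add_right (j + 1 : ℝ)
    simp only [add_sub_cancel_right] at h1
    rwa [knot_add_one_sub, knot_succ_sub] at h1
  · rw [intervalIntegral_congr_Ioo hle h', intervalIntegral.integral_comp_sub_right,
      knot_add_one_sub, knot_succ_sub]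

/-- Undoes the blow-up: intervals of arcs return integrals over the curve, and vertex intervals,
having length one, return summands. This version starts after vertex `i` and includes vertex `i'`;
`integral_blow_Ico` does the opposite. They match the vertices after, respectively before, a given
one on its line. -/
theorem integral_blow_Ioc [CompleteSpace E] {i i' : ℕ} (hii : i ≤ i') (hi' : i' ≤ c.N + 1)
    (hI : IntervalIntegrable I volume (c.knot i + 1) (c.knot i' + 1))
    (harc : ∀ j, i ≤ j → j < i' → ∀ l ∈ c.blowArc j, I l = h (l - (j + 1)))
    (hnode : ∀ r, i < r → r ≤ i' → ∀ l ∈ c.blowNode r, I l = v r) :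
    IntervalIntegrable h volume (c.node i) (c.node i') ∧
      ∫ l in c.knot i + 1..c.knot i' + 1, I l
        = (∫ μ in c.node i..c.node i', h μ) + ∑ r ∈ Finset.Ioc i i', v r := by
  induction i', hii using Nat.le_induction with
  | base => simp
  | succ k hik ih =>
    have hk : k ≤ c.N := by lia
    have k1 := hc.knot_le hik (by lia)
    have k2 := hc.knot_add_one_le_knot_succ hk
    have sub : ∀ {p q : ℝ}, c.knot i + 1 ≤ p → p ≤ q → q ≤ c.knot (k + 1) + 1 →
        IntervalIntegrable I volume p q := fun hp hpq hq =>
      hI.mono_set (by rw [uIcc_of_le hpq]; exact (Icc_subset_Icc hp hq).trans Icc_subset_uIcc)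
    have s1 := sub (p := c.knot i + 1) (q := c.knot k + 1) (by linarith) (by linarith) (by linarith)
    have s2 := sub (p := c.knot k + 1) (q := c.knot (k + 1)) (by linarith) (by linarith)
      (by linarith)
    have s3 := sub (p := c.knot (k + 1)) (q := c.knot (k + 1) + 1) (by linarith) (by linarith)
      (by linarith)
    obtain ⟨a1, a2⟩ := ih (by lia) s1 (fun j h1 h2 => harc j h1 (by lia))
      (fun r h1 h2 => hnode r h1 (by lia))
    obtain ⟨b1, b2⟩ := hc.integral_blowArc hk s2 (harc k hik (by lia))
    refine ⟨a1.trans b1, ?_⟩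
    rw [← intervalIntegral.integral_add_adjacent_intervals (s1.trans s2) s3,
      ← intervalIntegral.integral_add_adjacent_intervals s1 s2, a2, b2,
      integral_blowNode (hnode (k + 1) (by lia) le_rfl),
      ← intervalIntegral.integral_add_adjacent_intervals a1 b1,
      ← Finset.insert_Ioc_right_eq_Ioc_add_one (by lia : i ≤ k),
      Finset.sum_insert (by simp)]
    abel

theorem integral_blow_Ico [CompleteSpace E] {i i' : ℕ} (hii : i ≤ i') (hi' : i' ≤ c.N + 1)
    (hI : IntervalIntegrable I volume (c.knot i) (c.knot i'))
    (harc : ∀ j, i ≤ j → j < i' → ∀ l ∈ c.blowArc j, I l = h (l - (j + 1)))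
    (hnode : ∀ r, i ≤ r → r < i' → ∀ l ∈ c.blowNode r, I l = v r) :
    IntervalIntegrable h volume (c.node i) (c.node i') ∧
      ∫ l in c.knot i..c.knot i', I l
        = (∫ μ in c.node i..c.node i', h μ) + ∑ r ∈ Finset.Ico i i', v r := by
  induction i', hii using Nat.le_induction with
  | base => simp
  | succ k hik ih =>
    have hk : k ≤ c.N := by lia
    have k1 := hc.knot_le hik (by lia)
    have k2 := hc.knot_add_one_le_knot_succ hk
    have sub : ∀ {p q : ℝ}, c.knot i ≤ p → p ≤ q → q ≤ c.knot (k + 1) →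
        IntervalIntegrable I volume p q := fun hp hpq hq =>
      hI.mono_set (by rw [uIcc_of_le hpq]; exact (Icc_subset_Icc hp hq).trans Icc_subset_uIcc)
    have s1 := sub (p := c.knot i) (q := c.knot k) (by linarith) (by linarith) (by linarith)
    have s2 := sub (p := c.knot k) (q := c.knot k + 1) (by linarith) (by linarith)
      (by linarith)
    have s3 := sub (p := c.knot k + 1) (q := c.knot (k + 1)) (by linarith) (by linarith)
      (by linarith)
    obtain ⟨a1, a2⟩ := ih (by lia) s1 (fun j h1 h2 => harc j h1 (by lia))
      (fun r h1 h2 => hnode r h1 (by lia))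
    obtain ⟨b1, b2⟩ := hc.integral_blowArc hk s3 (harc k hik (by lia))
    refine ⟨a1.trans b1, ?_⟩
    rw [← intervalIntegral.integral_add_adjacent_intervals (s1.trans s2) s3,
      ← intervalIntegral.integral_add_adjacent_intervals s1 s2, a2, b2,
      integral_blowNode (hnode k hik (by lia)),
      ← intervalIntegral.integral_add_adjacent_intervals a1 b1,
      ← Finset.insert_Ico_right_eq_Ico_add_one (by lia : i ≤ k),
      Finset.sum_insert (by simp)]
    abel

end

/-! ### Stretches of the curve that are parallel to an axis -/

theorem mem_range_of_mem_blowArc {i i' j : ℕ} (hi : i ≤ c.N + 1) (hj : j ≤ c.N) {l : ℝ}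
    (hl : l ∈ Icc (c.knot i) (c.knot i' + 1)) (h : l ∈ c.blowArc j) : i ≤ j ∧ j < i' := by
  constructor
  · by_contra! hlt
    linarith [hc.knot_le (Nat.succ_le_of_lt hlt) hi, hl.1, h.2]
  · by_contra! hle
    linarith [hc.knot_le hle (by lia), hl.2, h.1]

theorem isVertical_of_vs_eq {i i' j : ℕ} (hi' : i' ≤ c.N + 1) (h : c.vs i' = c.vs i) (hij : i ≤ j)
    (hj : j < i') : c.IsVertical j := by
  rw [hc.vertical_iff (by lia)]
  exact le_antisymm (hc.vs_anti (by lia) (by lia))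
    (((hc.vs_anti hij (by lia)).trans h.ge).trans (hc.vs_anti (by lia) (by lia)))

theorem isHorizontal_of_vt_eq {i i' j : ℕ} (hi' : i' ≤ c.N + 1) (h : c.vt i' = c.vt i) (hij : i ≤ j)
    (hj : j < i') : c.IsHorizontal j := by
  rw [hc.horizontal_iff (by lia)]
  exact le_antisymm
    (((hc.vt_mono (by lia) (by lia)).trans h.le).trans (hc.vt_mono hij (by lia)))
    (hc.vt_mono (by lia) (by lia))

/-- The arcs between two vertices on one vertical line are vertical and have `n₂ = 0`; on vertex
intervals and at knots the value is zero by the definition of `glue`. -/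
theorem glue_n₂_eq_zero {i i' : ℕ} (hii : i ≤ i') (hi' : i' ≤ c.N + 1) (h : c.vs i' = c.vs i)
    {l : ℝ} (hl : l ∈ Icc (c.knot i) (c.knot i' + 1)) : c.glue c.n₂ 0 l = 0 := by
  by_cases h1 : ∃ j ≤ c.N, l ∈ c.blowArc j
  · obtain ⟨j, hj, h1⟩ := h1
    obtain ⟨h2, h3⟩ := hc.mem_range_of_mem_blowArc (by lia) hj hl h1
    rw [hc.glue_arc hj h1]
    exact (hc.n_of_vertical hj (hc.isVertical_of_vs_eq hi' h h2 h3) (c.sub_mem_arc h1)).2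
  by_cases h2 : ∃ r ≤ c.N + 1, l ∈ c.blowNode r
  · obtain ⟨r, hr, h2⟩ := h2
    rw [hc.glue_node hr h2, Pi.zero_apply]
  push Not at h1 h2
  exact glue_of_notMem h1 h2

theorem glue_n₁_eq_zero {i i' : ℕ} (hii : i ≤ i') (hi' : i' ≤ c.N + 1) (h : c.vt i' = c.vt i)
    {l : ℝ} (hl : l ∈ Icc (c.knot i) (c.knot i' + 1)) : c.glue c.n₁ 0 l = 0 := by
  by_cases h1 : ∃ j ≤ c.N, l ∈ c.blowArc j
  · obtain ⟨j, hj, h1⟩ := h1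
    obtain ⟨h2, h3⟩ := hc.mem_range_of_mem_blowArc (by lia) hj hl h1
    rw [hc.glue_arc hj h1]
    exact (hc.n_of_horizontal hj (hc.isHorizontal_of_vt_eq hi' h h2 h3) (c.sub_mem_arc h1)).1
  by_cases h2 : ∃ r ≤ c.N + 1, l ∈ c.blowNode r
  · obtain ⟨r, hr, h2⟩ := h2
    rw [hc.glue_node hr h2, Pi.zero_apply]
  push Not at h1 h2
  exact glue_of_notMem h1 h2

theorem blow₁_eq_vs {i i' : ℕ} (hii : i ≤ i') (hi' : i' ≤ c.N + 1) (h : c.vs i' = c.vs i)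
    {l : ℝ} (hl : l ∈ Icc (c.knot i) (c.knot i' + 1)) : c.blow₁ l = c.vs i := by
  have h1 := hc.blow₁_anti hl.1
  have h2 := hc.blow₁_anti hl.2
  rw [hc.blow₁_node (r := i) (by lia) ⟨le_rfl, by linarith⟩] at h1
  rw [hc.blow₁_node hi' ⟨by linarith, le_rfl⟩, h] at h2
  exact le_antisymm h1 h2

theorem blow₂_eq_vt {i i' : ℕ} (hii : i ≤ i') (hi' : i' ≤ c.N + 1) (h : c.vt i' = c.vt i)
    {l : ℝ} (hl : l ∈ Icc (c.knot i) (c.knot i' + 1)) : c.blow₂ l = c.vt i := by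
  have h1 := hc.blow₂_mono hl.1
  have h2 := hc.blow₂_mono hl.2
  rw [hc.blow₂_node (r := i) (by lia) ⟨le_rfl, by linarith⟩] at h1
  rw [hc.blow₂_node hi' ⟨by linarith, le_rfl⟩, h] at h2
  exact le_antisymm h2 h1

/-- The arc after the last vertex `k'` on the line is not vertical, so the first coordinate drops
strictly as soon as `k'` is passed. -/
theorem Lt_eq {k k' : ℕ} (hkk : k ≤ k') (hk' : k' ≤ c.N + 1) (h : c.vs k' = c.vs k)
    (hlast : ∀ r ≤ c.N + 1, k' < r → c.vs r ≠ c.vs k) : c.Lt k = Ioc (c.node k) (c.node k') := by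
  ext μ
  constructor
  · rintro ⟨h1, h2, h3⟩
    refine ⟨h1, ?_⟩
    by_contra! hlt
    have hN : k' ≤ c.N := by
      by_contra! hN
      have : k' = c.N + 1 := by lia
      rw [this] at hlt
      exact absurd h2 (not_le.2 hlt)
    have hnv : ¬c.IsVertical k' := fun hv =>
      hlast (k' + 1) (by lia) (by lia) (((hc.vertical_iff hN).1 hv).trans h)
    have hx : min μ (c.node (k' + 1)) ∈ c.closedArc k' :=
      ⟨le_min hlt.le (hc.node_lt k' hN).le, min_le_right _ _⟩
    have h4 := hc.strictAntiOn_L₁ hN hnv (hc.left_mem_closedArc hN) hx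
      (lt_min hlt (hc.node_lt k' hN))
    have h5 := hc.antitone₁ (hc.closedArc_subset hN hx)
      ⟨(hc.node_nonneg (j := k) (by lia)).trans h1.le, h2⟩ (min_le_left _ _)
    have h6 : c.L₁ (c.node k') = c.vs k := h
    linarith
  · rintro ⟨h1, h2⟩
    have hm : μ ∈ Icc 0 c.len :=
      ⟨(hc.node_nonneg (j := k) (by lia)).trans h1.le, h2.trans (hc.node_le_len hk')⟩
    exact ⟨h1, hm.2, le_antisymm (hc.antitone₁ (hc.node_mem (by lia)) hm h1.le)
      (h.symm.le.trans (hc.antitone₁ hm (hc.node_mem hk') h2))⟩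

theorem Ls_eq {k k' : ℕ} (hkk : k' ≤ k) (hk : k ≤ c.N + 1) (h : c.vt k' = c.vt k)
    (hfirst : ∀ r < k', c.vt r ≠ c.vt k) : c.Ls k = Ico (c.node k') (c.node k) := by
  ext μ
  constructor
  · rintro ⟨h1, h2, h3⟩
    refine ⟨?_, h2⟩
    by_contra! hlt
    obtain ⟨i, rfl⟩ : ∃ i, k' = i + 1 := by
      refine Nat.exists_eq_succ_of_ne_zero ?_
      rintro rfl
      rw [hc.node_zero] at hlt
      linarith
    have hN : i ≤ c.N := by lia
    have hnv : ¬c.IsHorizontal i := fun hv =>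
      hfirst i (by lia) (((hc.horizontal_iff hN).1 hv).symm.trans h)
    have hx : max μ (c.node i) ∈ c.closedArc i :=
      ⟨le_max_right _ _, max_le hlt.le (hc.node_lt i hN).le⟩
    have h4 := hc.strictMonoOn_L₂ hN hnv hx (hc.right_mem_closedArc hN)
      (max_lt hlt (hc.node_lt i hN))
    have h5 := hc.monotone₂ ⟨h1, h2.le.trans (hc.node_le_len hk)⟩ (hc.closedArc_subset hN hx)
      (le_max_left _ _)
    have h6 : c.L₂ (c.node (i + 1)) = c.vt k := h
    linarith
  · rintro ⟨h1, h2⟩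
    have hm : μ ∈ Icc 0 c.len :=
      ⟨(hc.node_nonneg (j := k') (by lia)).trans h1, h2.le.trans (hc.node_le_len hk)⟩
    exact ⟨hm.1, h2, le_antisymm (hc.monotone₂ hm (hc.node_mem hk) h2.le)
      (h.symm.le.trans (hc.monotone₂ (hc.node_mem (by lia)) hm h1))⟩

theorem Tset_eq {k k' : ℕ} (hk' : k' ≤ c.N + 1) (h : c.vs k' = c.vs k)
    (hlast : ∀ r ≤ c.N + 1, k' < r → c.vs r ≠ c.vs k) : c.Tset k = Finset.Ioc k k' := by
  ext r
  simp only [Tset, Finset.mem_filter, Finset.mem_range, Finset.mem_Ioc]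
  constructor
  · rintro ⟨h1, h2, h3⟩
    exact ⟨h2, not_lt.1 fun hlt => hlast r (by lia) hlt h3⟩
  · rintro ⟨h1, h2⟩
    exact ⟨by lia, h1, le_antisymm (hc.vs_anti h1.le (by lia)) (h.symm.le.trans (hc.vs_anti h2 hk'))⟩

theorem Sset_eq {k k' : ℕ} (hk : k ≤ c.N + 1) (h : c.vt k' = c.vt k)
    (hfirst : ∀ r < k', c.vt r ≠ c.vt k) : c.Sset k = Finset.Ico k' k := by
  ext r
  simp only [Sset, Finset.mem_filter, Finset.mem_range, Finset.mem_Ico]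
  constructor
  · rintro ⟨h1, h2, h3⟩
    exact ⟨not_lt.1 fun hlt => hfirst r hlt h3, h2⟩
  · rintro ⟨h1, h2⟩
    exact ⟨by lia, h2, le_antisymm (hc.vt_mono h2.le (by lia)) (h.symm.le.trans
      (hc.vt_mono h1 (by lia)))⟩

end VertexCurve.Admissible

/-! ### The Riemann matrices as kernels and the increments over flat stretches -/

namespace ControlData

variable {n m : ℕ} {D : ControlData n m} {c : VertexCurve}
  {ρ₁ ρ₂ : ℝ → ℝ → ℝ → Fin n → Euc n} {S : TriangleProblem.Ansatz (Euc n)}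

theorem contract_single (v : Euc n) : contract v (fun i => EuclideanSpace.single i 1) = v := by
  ext j
  simp [contract, Finset.sum_apply, Pi.single_apply]

theorem IsRiemann.hasDerivWithinAt_contract₁ (hD : D.Smooth c) (hρ : D.IsRiemann c ρ₁ ρ₂) {s τ : ℝ}
    (h : (s, τ) ∈ c.G) (v : Euc n) {t : ℝ} (ht : t ∈ Icc 0 τ) :
    HasDerivWithinAt (fun t => contract v (ρ₁ s t τ)) (D.coefB (s, t) (contract v (ρ₁ s t τ)))
      (Icc 0 τ) t := by
  obtain ⟨O, hGO, hO⟩ := hD.smoothOn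
  have h1 := HasDerivWithinAt.fun_sum (u := Finset.univ)
    fun i _ => (hρ.ode₁ s τ h i t ht).const_smul (v i)
  refine h1.congr_deriv ?_
  rw [contract, map_sum]
  refine Finset.sum_congr rfl fun i _ => ?_
  rw [map_smul, ← hO.gradient_p_eq (hGO (mem_G_of_le h ht))]

theorem IsRiemann.hasDerivWithinAt_contract₂ (hD : D.Smooth c) (hρ : D.IsRiemann c ρ₁ ρ₂) {σ t : ℝ}
    (h : (σ, t) ∈ c.G) (v : Euc n) {s : ℝ} (hs : s ∈ Icc 0 σ) :
    HasDerivWithinAt (fun s => contract v (ρ₂ s t σ)) (D.coefC (s, t) (contract v (ρ₂ s t σ)))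
      (Icc 0 σ) s := by
  obtain ⟨O, hGO, hO⟩ := hD.smoothOn
  have h1 := HasDerivWithinAt.fun_sum (u := Finset.univ)
    fun i _ => (hρ.ode₂ σ t h i s hs).const_smul (v i)
  refine h1.congr_deriv ?_
  rw [contract, map_sum]
  refine Finset.sum_congr rfl fun i _ => ?_
  rw [map_smul, ← hO.gradient_q_eq (hGO (mem_G_of_le' h hs))]

section

variable (hc : c.Admissible) (hD : D.Smooth c) (hρ : D.IsRiemann c ρ₁ ρ₂)
  (hS : (D.problem c).IsSolution S)
include hc hD hρ hS

omit hD hρ hS in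
theorem blow₁_nonneg (l : ℝ) : 0 ≤ c.blow₁ l := hc.L₁_nonneg (hc.collapse_mem l)

omit hD hρ hS in
theorem blow₂_nonneg (l : ℝ) : 0 ≤ c.blow₂ l := hc.L₂_nonneg (hc.collapse_mem l)

omit hD hρ hS in
theorem countable_knots : ((fun r => c.knot r) '' Iic (c.N + 1) ∪
    (fun r => c.knot r + 1) '' Iic (c.N + 1)).Countable :=
  (((finite_Iic _).image _).union ((finite_Iic _).image _)).countable

/-- The kernel `U` is given by the values of the Riemann function on vertical lines. -/
theorem U_apply {α β : ℝ} (hβ : 0 ≤ β) (hβα : β ≤ α) (hα : α ≤ c.blowLen) (v : Euc n) :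
    S.U (α, β) v = contract v (ρ₁ (c.blow₁ α) (c.blow₂ β) (c.blow₂ α)) := by
  have hT := problem_regular hc hD
  have hG : (c.blow₁ α, c.blow₂ α) ∈ c.G := hc.blow_mem_G (z := (α, α)) le_rfl
  have hmem : MapsTo c.blow₂ (Icc 0 α) (Icc 0 (c.blow₂ α)) := fun b hb =>
    ⟨blow₂_nonneg hc b, hc.blow₂_mono hb.2⟩
  have hder := fun t ht => hρ.hasDerivWithinAt_contract₁ hD hG v (t := t) ht
  have hcont : ContinuousOn (fun b => contract v (ρ₁ (c.blow₁ α) (c.blow₂ b) (c.blow₂ α)))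
      (Icc 0 α) :=
    ContinuousOn.comp (g := fun t => contract v (ρ₁ (c.blow₁ α) t (c.blow₂ α)))
      (fun t ht => (hder t ht).continuousWithinAt) hc.continuous_blow₂.continuousOn hmem
  refine (hS.U_apply_eq hT (β := 0) (α := α) le_rfl hα (v := v) hcont ?_ β ⟨hβ, hβα⟩).symm
  intro b hb
  have hB : ContinuousOn (fun x => (D.problem c).B (α, x)) (Icc 0 α) :=
    hT.cont_B.comp (by fun_prop) fun x hx => ⟨hx.1, hx.2, hα⟩
  have hi : IntervalIntegrable (fun x => (D.problem c).ν₁ x • (D.problem c).B (α, x)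
      (contract v (ρ₁ (c.blow₁ α) (c.blow₂ x) (c.blow₂ α)))) volume b α :=
    intervalIntegrable_smul_of_continuousOn hT.meas₁ hT.bound₁ hb.2
      ((hB.clm_apply hcont).mono (Icc_subset_Icc_left hb.1))
  -- The derivative of `blow₂` is `ν₁` off the knots. These are finitely many and are ignored by
  -- this form of the fundamental theorem, so the Riemann solution, read along the stretched curve,
  -- satisfies the integral equation of `U`.
  have := integral_eq_of_hasDerivAt_off_countable_of_le _ _ hb.2 (countable_knots hc)
    (hcont.mono (Icc_subset_Icc_left hb.1)) (fun x hx => ?_) hi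
  · rw [this, show ρ₁ (c.blow₁ α) (c.blow₂ α) (c.blow₂ α) = fun i => EuclideanSpace.single i 1
      from funext (hρ.init₁ _ _ hG), contract_single, sub_sub_cancel]
  · have hx0 : x ∈ Ioo 0 α := ⟨hb.1.trans_lt hx.1.1, hx.1.2⟩
    have hblow : HasDerivAt c.blow₂ ((D.problem c).ν₁ x) x := by
      rcases hc.mem_blowArc_or_mem_blowNode (l := x) ⟨hx0.1.le, hx0.2.le.trans hα⟩
        (fun r hr => ⟨fun h => hx.2 (Or.inl ⟨r, hr, h.symm⟩),
          fun h => hx.2 (Or.inr ⟨r, hr, h.symm⟩)⟩) with ⟨j, hj, h⟩ | ⟨r, hr, h⟩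
      · exact hc.hasDerivAt_blow₂ hj h
      · exact hc.hasDerivAt_blow₂_node hr h
    have h1 := HasDerivWithinAt.scomp x (hder _ (hmem (Ioo_subset_Icc_self hx0)))
      (hblow.hasDerivWithinAt (s := Icc 0 α)) hmem
    exact h1.hasDerivAt (Icc_mem_nhds hx0.1 hx0.2)

/-- The kernel `U'` is given by the values of the Riemann function on horizontal lines. -/
theorem U'_apply {α β : ℝ} (hβ : 0 ≤ β) (hβα : β ≤ α) (hα : α ≤ c.blowLen) (v : Euc n) :
    S.U' (α, β) v = contract v (ρ₂ (c.blow₁ α) (c.blow₂ β) (c.blow₁ β)) := by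
  have hT := problem_regular hc hD
  have hG : (c.blow₁ β, c.blow₂ β) ∈ c.G := hc.blow_mem_G (z := (β, β)) le_rfl
  have hmem : MapsTo c.blow₁ (Icc β c.blowLen) (Icc 0 (c.blow₁ β)) := fun b hb =>
    ⟨blow₁_nonneg hc b, hc.blow₁_anti hb.1⟩
  have hder := fun t ht => hρ.hasDerivWithinAt_contract₂ hD hG v (s := t) ht
  have hcont : ContinuousOn (fun a => contract v (ρ₂ (c.blow₁ a) (c.blow₂ β) (c.blow₁ β)))
      (Icc β c.blowLen) :=
    ContinuousOn.comp (g := fun t => contract v (ρ₂ t (c.blow₂ β) (c.blow₁ β)))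
      (fun t ht => (hder t ht).continuousWithinAt) hc.continuous_blow₁.continuousOn hmem
  refine (hS.U'_apply_eq hT (β := β) (α := c.blowLen) hβ le_rfl (v := v) hcont ?_ α ⟨hβα, hα⟩).symm
  intro a ha
  have hC : ContinuousOn (fun x => (D.problem c).C (x, β)) (Icc β c.blowLen) :=
    hT.cont_C.comp (by fun_prop) fun x hx => ⟨hβ, hx.1, hx.2⟩
  have hi : IntervalIntegrable (fun x => (D.problem c).ν₂ x • (D.problem c).C (x, β)
      (contract v (ρ₂ (c.blow₁ x) (c.blow₂ β) (c.blow₁ β)))) volume β a :=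
    intervalIntegrable_smul_of_continuousOn hT.meas₂ hT.bound₂ ha.1
      ((hC.clm_apply hcont).mono (Icc_subset_Icc_right ha.2))
  have := integral_eq_of_hasDerivAt_off_countable_of_le _ _ ha.1 (countable_knots hc)
    (hcont.mono (Icc_subset_Icc_right ha.2)).neg (fun x hx => ?_) hi
  · rw [this, Pi.neg_apply, Pi.neg_apply, show ρ₂ (c.blow₁ β) (c.blow₂ β) (c.blow₁ β)
      = fun i => EuclideanSpace.single i 1 from funext (hρ.init₂ _ _ hG), contract_single]
    abel
  · have hx0 : x ∈ Ioo β c.blowLen := ⟨hx.1.1, hx.1.2.trans_le ha.2⟩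
    have hblow : HasDerivAt c.blow₁ (-(D.problem c).ν₂ x) x := by
      rcases hc.mem_blowArc_or_mem_blowNode (l := x) ⟨hβ.trans hx0.1.le, hx0.2.le⟩
        (fun r hr => ⟨fun h => hx.2 (Or.inl ⟨r, hr, h.symm⟩),
          fun h => hx.2 (Or.inr ⟨r, hr, h.symm⟩)⟩) with ⟨j, hj, h⟩ | ⟨r, hr, h⟩
      · exact hc.hasDerivAt_blow₁ hj h
      · exact hc.hasDerivAt_blow₁_node hr h
    have h1 := HasDerivWithinAt.scomp x (hder _ (hmem (Ioo_subset_Icc_self hx0)))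
      (hblow.hasDerivWithinAt (s := Icc β c.blowLen)) hmem
    have h2 := (h1.hasDerivAt (Icc_mem_nhds hx0.1 hx0.2)).neg
    rw [neg_smul, neg_neg] at h2
    exact h2

/-! ### The increments of the solution over stretches parallel to an axis -/

/-- Between the ends of the vertex intervals of `k` and of the last vertex `k'` on its vertical line
lie exactly the vertical arcs and the vertices above `k`. Across this strip `Ψ` increases by `∫ U
F`, where `U` acts as `ρ₁`. -/
theorem Ψ_sub_above {k k' : ℕ} (hkk : k ≤ k') (hk' : k' ≤ c.N + 1) (h : c.vs k' = c.vs k)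
    (hlast : ∀ r ≤ c.N + 1, k' < r → c.vs r ≠ c.vs k) {β : ℝ} (hβ : 0 ≤ β)
    (hβk : β ≤ c.knot k + 1) :
    S.Ψ (c.knot k' + 1, β) - S.Ψ (c.knot k + 1, β) = D.aboveTerm c ρ₁ k (c.blow₂ β) := by
  have hT := problem_regular hc hD
  have e1 := hc.knot_le hkk hk'
  have e2 := hc.knot_add_one_le_blowLen hk'
  have hsub : Icc (c.knot k + 1) (c.knot k' + 1) ⊆ Icc (c.knot k) (c.knot k' + 1) :=
    Icc_subset_Icc_left (by linarith)
  obtain ⟨M, hM⟩ := hT.boundF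
  have hI : IntervalIntegrable (fun a => S.U (a, β) ((D.problem c).F a)) volume (c.knot k + 1)
      (c.knot k' + 1) :=
    intervalIntegrable_clm_of_continuousOn hT.measF hM (by linarith)
      (hS.contU.comp (by fun_prop) fun a ha => ⟨hβ, hβk.trans ha.1, ha.2.trans e2⟩)
  rw [hS.Ψ_sub_left hT hβ hβk (by linarith) e2
    fun a ha => hc.glue_n₂_eq_zero hkk hk' h (hsub ha)]
  have key : ∀ l, c.knot k + 1 ≤ l → l ≤ c.knot k' + 1 → ∀ v, S.U (l, β) v
      = contract v (ρ₁ (c.vs k) (c.blow₂ β) (c.blow₂ l)) := fun l h1 h2 v => by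
    rw [U_apply hc hD hρ hS hβ (hβk.trans h1) (h2.trans e2),
      hc.blow₁_eq_vs hkk hk' h (hsub ⟨h1, h2⟩)]
  have hI' := (hc.integral_blow_Ioc hkk hk' hI
    (h := fun μ => contract (D.F₁ c μ) (ρ₁ (c.vs k) (c.blow₂ β) (c.L₂ μ)))
    (v := fun r => contract (D.F₀ c r) (ρ₁ (c.vs k) (c.blow₂ β) (c.vt r)))
    (fun j h1 h2 l hl => ?_) (fun r h1 h2 l hl => ?_)).2
  · rw [hI', aboveTerm, hc.Lt_eq hkk hk' h hlast, hc.Tset_eq hk' h hlast,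
      intervalIntegral.integral_of_le (hc.node_le_node hkk hk')]
  · have g1 := hc.knot_le h1 (by lia)
    have g2 := hc.knot_le (Nat.succ_le_of_lt h2) hk'
    rw [key l (by linarith [hl.1]) (by linarith [hl.2]), problem_F hc (by lia) hl, VertexCurve.blow₂,
      VertexCurve.blow₂, hc.collapse_arc (j := j) (by lia) (Ioo_subset_Icc_self hl)]
  · have g1 := hc.knot_add_one_le h1 (by lia)
    have g2 := hc.knot_le h2 hk'
    rw [key l (by linarith [hl.1]) (by linarith [hl.2]),
      hc.blow₂_node (r := r) (by lia) (Ioo_subset_Icc_self hl)]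
    exact congrArg (fun v => contract v _) (hc.glue_node (by lia) hl)

/-- The same over the strip from the first vertex interval on the horizontal line to the beginning
of that of `k`, with `U'` acting as `ρ₂`. -/
theorem Ψ_sub_right {k k' : ℕ} (hkk : k' ≤ k) (hk : k ≤ c.N + 1) (h : c.vt k' = c.vt k)
    (hfirst : ∀ r < k', c.vt r ≠ c.vt k) {α : ℝ} (hα : α ≤ c.blowLen) (hkα : c.knot k ≤ α) :
    S.Ψ (α, c.knot k') - S.Ψ (α, c.knot k) = D.rightTerm c ρ₂ k (c.blow₁ α) := by
  have hT := problem_regular hc hD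
  have e1 := hc.knot_le hkk hk
  have e2 := hc.knot_nonneg (j := k') (by lia)
  have hsub : Icc (c.knot k') (c.knot k) ⊆ Icc (c.knot k') (c.knot k + 1) :=
    Icc_subset_Icc_right (by linarith)
  obtain ⟨M, hM⟩ := hT.boundF
  have hI : IntervalIntegrable (fun b => S.U' (α, b) ((D.problem c).F b)) volume (c.knot k')
      (c.knot k) :=
    intervalIntegrable_clm_of_continuousOn hT.measF hM e1
      (hS.contU'.comp (by fun_prop) fun a ha => ⟨e2.trans ha.1, ha.2.trans hkα, hα⟩)
  rw [hS.Ψ_sub_right hT e2 e1 hkα hα fun a ha => hc.glue_n₁_eq_zero hkk hk h.symm (hsub ha)]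
  have key : ∀ l, c.knot k' ≤ l → l ≤ c.knot k → ∀ v, S.U' (α, l) v
      = contract v (ρ₂ (c.blow₁ α) (c.vt k) (c.blow₁ l)) := fun l h1 h2 v => by
    rw [U'_apply hc hD hρ hS (e2.trans h1) (h2.trans hkα) hα,
      hc.blow₂_eq_vt hkk hk h.symm (hsub ⟨h1, h2⟩), h]
  have hI' := (hc.integral_blow_Ico hkk hk hI
    (h := fun μ => contract (D.F₁ c μ) (ρ₂ (c.blow₁ α) (c.vt k) (c.L₁ μ)))
    (v := fun r => contract (D.F₀ c r) (ρ₂ (c.blow₁ α) (c.vt k) (c.vs r)))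
    (fun j h1 h2 l hl => ?_) (fun r h1 h2 l hl => ?_)).2
  · rw [hI', rightTerm, hc.Ls_eq hkk hk h hfirst, hc.Sset_eq hk h hfirst,
      intervalIntegral.integral_of_le (hc.node_le_node hkk hk), integral_Ioc_eq_integral_Ioo,
      integral_Ico_eq_integral_Ioo]
  · have g1 := hc.knot_le h1 (by lia)
    have g2 := hc.knot_le (Nat.succ_le_of_lt h2) hk
    rw [key l (by linarith [hl.1]) (by linarith [hl.2]), problem_F hc (by lia) hl]
    rw [show c.blow₁ l = c.L₁ (l - (j + 1)) by
      rw [VertexCurve.blow₁, hc.collapse_arc (j := j) (by lia) (Ioo_subset_Icc_self hl)]]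
  · have g1 := hc.knot_le h1 (by lia)
    have g2 := hc.knot_add_one_le h2 hk
    rw [key l (by linarith [hl.1]) (by linarith [hl.2]),
      hc.blow₁_node (r := r) (by lia) (Ioo_subset_Icc_self hl)]
    exact congrArg (fun v => contract v _) (hc.glue_node (by lia) hl)

/-- The contribution of the vertex itself, which `aboveTerm` leaves out and which appears separately
in the jump conditions. -/
theorem Ψ_sub_node_left {k : ℕ} (hk : k ≤ c.N + 1) {β : ℝ} (hβ : 0 ≤ β) (hβk : β ≤ c.knot k) :
    S.Ψ (c.knot k + 1, β) - S.Ψ (c.knot k, β)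
      = contract (D.F₀ c k) (ρ₁ (c.vs k) (c.blow₂ β) (c.vt k)) := by
  have hT := problem_regular hc hD
  have e2 := hc.knot_add_one_le_blowLen hk
  rw [hS.Ψ_sub_left hT hβ hβk (by linarith) e2
    fun a ha => hc.glue_n₂_eq_zero le_rfl hk rfl ha]
  refine VertexCurve.Admissible.integral_blowNode fun l hl => ?_
  have hl' := Ioo_subset_Icc_self hl
  rw [U_apply hc hD hρ hS hβ (hβk.trans hl.1.le) (hl.2.le.trans e2), hc.blow₁_node hk hl',
    hc.blow₂_node hk hl']
  exact congrArg (fun v => contract v _) (hc.glue_node hk hl)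

theorem Ψ_sub_node_right {k : ℕ} (hk : k ≤ c.N + 1) {α : ℝ} (hα : α ≤ c.blowLen)
    (hkα : c.knot k + 1 ≤ α) :
    S.Ψ (α, c.knot k) - S.Ψ (α, c.knot k + 1)
      = contract (D.F₀ c k) (ρ₂ (c.blow₁ α) (c.vt k) (c.vs k)) := by
  have hT := problem_regular hc hD
  have e2 := hc.knot_nonneg hk
  rw [hS.Ψ_sub_right hT e2 (by linarith) hkα hα
    fun a ha => hc.glue_n₁_eq_zero le_rfl hk rfl ha]
  refine VertexCurve.Admissible.integral_blowNode fun l hl => ?_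
  have hl' := Ioo_subset_Icc_self hl
  rw [U'_apply hc hD hρ hS (e2.trans hl.1.le) (hl.2.le.trans hkα) hα, hc.blow₁_node hk hl',
    hc.blow₂_node hk hl']
  exact congrArg (fun v => contract v _) (hc.glue_node hk hl)

end

end ControlData

/-! ### Limits of the stretched parameters at lines and at points of the curve -/

namespace VertexCurve.Admissible

variable {c : VertexCurve} (hc : c.Admissible)
include hc

/-- Near a point the domain meets only those lines that pass through the point. -/
theorem eventually_mem_intGR (p : ℝ × ℝ) : ∀ᶠ z in 𝓝 p, z ∈ interior c.G →
    (z.1 = p.1 → ∀ r ≤ c.N + 1, p.1 ≠ c.vs r) → (z.2 = p.2 → ∀ r ≤ c.N + 1, p.2 ≠ c.vt r) →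
    z ∈ c.intGR := by
  have h1 : ∀ᶠ z in 𝓝 p, ∀ r ∈ Iic (c.N + 1), c.vs r ≠ p.1 → z.1 ≠ c.vs r := by
    rw [(finite_Iic _).eventually_all]
    intro r _
    by_cases h : c.vs r = p.1
    · exact Eventually.of_forall fun z hz => absurd h hz
    · filter_upwards [continuousAt_fst.eventually_ne (Ne.symm h)] with z hz _ using hz
  have h2 : ∀ᶠ z in 𝓝 p, ∀ r ∈ Iic (c.N + 1), c.vt r ≠ p.2 → z.2 ≠ c.vt r := by
    rw [(finite_Iic _).eventually_all]
    intro r _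
    by_cases h : c.vt r = p.2
    · exact Eventually.of_forall fun z hz => absurd h hz
    · filter_upwards [continuousAt_snd.eventually_ne (Ne.symm h)] with z hz _ using hz
  filter_upwards [h1, h2] with z h1 h2 hz hs ht
  refine ⟨hz, interior_subset hz, fun r hr => ⟨?_, ?_⟩⟩
  · by_cases h : c.vs r = p.1
    · intro h'
      exact hs (h'.trans h) r hr h.symm
    · exact h1 r hr h
  · by_cases h : c.vt r = p.2
    · intro h'
      exact ht (h'.trans h) r hr h.symm
    · exact h2 r hr h

theorem pos_of_mem_interior {z : ℝ × ℝ} (hz : z ∈ interior c.G) :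
    0 < z.1 ∧ 0 < z.2 ∧ z.1 < c.vs 0 ∧ z.2 < c.vt (c.N + 1) := by
  obtain ⟨h1, h2, μ, hμ, h3, h4⟩ := hc.mem_interior_iff.1 hz
  refine ⟨h1, h2, h3.trans_le ?_, h4.trans_le ?_⟩
  · rw [vs, hc.node_zero]
    exact hc.antitone₁ ⟨le_rfl, hc.len_pos.le⟩ hμ hμ.1
  · exact hc.monotone₂ hμ ⟨hc.len_pos.le, le_rfl⟩ hμ.2

theorem vs_last : c.vs (c.N + 1) = 0 := hc.finish

theorem vt_zero : c.vt 0 = 0 := by rw [vt, hc.node_zero, hc.start]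

/-- The last vertex on a vertical line. -/
theorem exists_last_vs {k : ℕ} (hk : k ≤ c.N + 1) (h0 : 0 < c.vs k) : ∃ r, k ≤ r ∧ r ≤ c.N ∧
    c.vs r = c.vs k ∧ (∀ i ≤ c.N + 1, r < i → c.vs i ≠ c.vs k) ∧ ¬c.IsVertical r := by
  obtain ⟨r, h1, h2, h3, h4⟩ := exists_last_index (P := fun r => c.vs r = c.vs k) hk rfl
  have hr : r ≤ c.N := by
    by_contra! h
    have : r = c.N + 1 := by lia
    rw [this, hc.vs_last] at h3
    exact h0.ne h3
  exact ⟨r, h1, hr, h3, h4, fun hv =>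
    h4 (r + 1) (by lia) (by lia) (((hc.vertical_iff hr).1 hv).trans h3)⟩

/-- The first vertex on a horizontal line. -/
theorem exists_first_vt {k : ℕ} (hk : k ≤ c.N + 1) (h0 : 0 < c.vt k) : ∃ i, i + 1 ≤ k ∧
    c.vt (i + 1) = c.vt k ∧ (∀ r < i + 1, c.vt r ≠ c.vt k) ∧ ¬c.IsHorizontal i := by
  obtain ⟨r, h1, h3, h4⟩ := exists_first_index (P := fun r => c.vt r = c.vt k) (i := k) rfl
  obtain ⟨i, rfl⟩ : ∃ i, r = i + 1 := by
    refine Nat.exists_eq_succ_of_ne_zero ?_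
    rintro rfl
    rw [hc.vt_zero] at h3
    exact h0.ne h3
  exact ⟨i, h1, h3, h4, fun hv =>
    h4 i (by lia) (((hc.horizontal_iff (by lia)).1 hv).symm.trans h3)⟩

/-- The last vertex on a horizontal line. -/
theorem exists_last_vt {k : ℕ} (hk : k ≤ c.N + 1) (h0 : c.vt k < c.vt (c.N + 1)) : ∃ r, k ≤ r ∧
    r ≤ c.N ∧ c.vt r = c.vt k ∧ ¬c.IsHorizontal r := by
  obtain ⟨r, h1, h2, h3, h4⟩ := exists_last_index (P := fun r => c.vt r = c.vt k) hk rfl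
  have hr : r ≤ c.N := by
    by_contra! h
    have : r = c.N + 1 := by lia
    rw [this] at h3
    exact h0.ne h3.symm
  exact ⟨r, h1, hr, h3, fun hv =>
    h4 (r + 1) (by lia) (by lia) (((hc.horizontal_iff hr).1 hv).trans h3)⟩

/-- The first vertex on a vertical line. -/
theorem exists_first_vs {k : ℕ} (hk : k ≤ c.N + 1) (h0 : c.vs k < c.vs 0) : ∃ i, i + 1 ≤ k ∧
    c.vs (i + 1) = c.vs k ∧ ¬c.IsVertical i := by
  obtain ⟨r, h1, h3, h4⟩ := exists_first_index (P := fun r => c.vs r = c.vs k) (i := k) rfl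
  obtain ⟨i, rfl⟩ : ∃ i, r = i + 1 := by
    refine Nat.exists_eq_succ_of_ne_zero ?_
    rintro rfl
    exact h0.ne h3.symm
  exact ⟨i, h1, h3, fun hv =>
    h4 i (by lia) (((hc.vertical_iff (by lia)).1 hv).symm.trans h3)⟩

theorem tendsto_lift {l : Filter (ℝ × ℝ)} (hl : ∀ᶠ z in l, z ∈ c.intGR) {a b : ℝ}
    (ha : Tendsto (fun z : ℝ × ℝ => c.lift₁ z.1) l (𝓝 a))
    (hb : Tendsto (fun z : ℝ × ℝ => c.lift₂ z.2) l (𝓝 b)) :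
    Tendsto (fun z : ℝ × ℝ => (c.lift₁ z.1, c.lift₂ z.2)) l (𝓝[triangle c.blowLen] (a, b)) :=
  tendsto_nhdsWithin_iff.2 ⟨ha.prodMk_nhds hb, hl.mono fun _ hz => hc.lift_mem_triangle hz⟩

theorem mem_triangle_of_tendsto_lift {l : Filter (ℝ × ℝ)} [l.NeBot]
    (hl : ∀ᶠ z in l, z ∈ c.intGR) {a b : ℝ}
    (ha : Tendsto (fun z : ℝ × ℝ => c.lift₁ z.1) l (𝓝 a))
    (hb : Tendsto (fun z : ℝ × ℝ => c.lift₂ z.2) l (𝓝 b)) : (a, b) ∈ triangle c.blowLen :=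
  (isCompact_triangle _).isClosed.mem_of_tendsto (ha.prodMk_nhds hb)
    (hl.mono fun _ hz => hc.lift_mem_triangle hz)

theorem tendsto_lift₁_point {j : ℕ} (hj : j ≤ c.N) (hnj : ¬c.IsVertical j) {μ : ℝ}
    (hμ : μ ∈ c.arc j) {s : Set (ℝ × ℝ)} :
    Tendsto (fun z : ℝ × ℝ => c.lift₁ z.1) (𝓝[s] (c.point μ)) (𝓝 (μ + (j + 1))) := by
  have h1 := (hc.hasDerivAt_lift₁ hj hnj hμ).continuousAt.tendsto
  rw [hc.lift₁_eq hj hnj hμ] at h1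
  exact h1.comp ((continuous_fst.tendsto (c.point μ)).mono_left nhdsWithin_le_nhds)

theorem tendsto_lift₂_point {j : ℕ} (hj : j ≤ c.N) (hnj : ¬c.IsHorizontal j) {μ : ℝ}
    (hμ : μ ∈ c.arc j) {s : Set (ℝ × ℝ)} :
    Tendsto (fun z : ℝ × ℝ => c.lift₂ z.2) (𝓝[s] (c.point μ)) (𝓝 (μ + (j + 1))) := by
  have h1 := (hc.hasDerivAt_lift₂ hj hnj hμ).continuousAt.tendsto
  rw [hc.lift₂_eq hj hnj hμ] at h1
  exact h1.comp ((continuous_snd.tendsto (c.point μ)).mono_left nhdsWithin_le_nhds)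

/-- Near a point of a horizontal arc the domain lies below the arc. -/
theorem tendsto_snd_horizontal {j : ℕ} (hj : j ≤ c.N) (hh : c.IsHorizontal j) {μ : ℝ}
    (hμ : μ ∈ c.arc j) : Tendsto Prod.snd (𝓝[c.intGR] (c.point μ)) (𝓝[<] (c.vt j)) := by
  have hnv := hc.not_vertical_of_horizontal hj hh
  have hm := c.add_mem_blowArc_iff.2 hμ
  refine tendsto_nhdsWithin_iff.2 ⟨?_, ?_⟩
  · rw [← show (c.point μ).2 = c.vt j from hh μ (Ioo_subset_Icc_self hμ)]
    exact (continuous_snd.tendsto _).mono_left nhdsWithin_le_nhds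
  · filter_upwards [(hc.tendsto_lift₁_point hj hnv hμ).eventually (Ioo_mem_nhds hm.1 hm.2),
      self_mem_nhdsWithin] with z hz hzG
    obtain ⟨i, hi, k, hk, hzc⟩ := hc.exists_cell hzG
    obtain ⟨hni, -, hik, -, -, -, -, -, -, -, -, b1, -⟩ := hc.lift_of_mem_cell hi hk hzc
    obtain rfl := hc.eq_of_mem_blowArc hk hj b1 hz
    have hlt : i < k := lt_of_le_of_ne hik (by rintro rfl; exact hni hh)
    exact hzc.2.2.2.trans_le (hc.vt_mono (by lia) (by lia))

/-- Near a point of a vertical arc the domain lies to the left of the arc. -/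
theorem tendsto_fst_vertical {j : ℕ} (hj : j ≤ c.N) (hv : c.IsVertical j) {μ : ℝ}
    (hμ : μ ∈ c.arc j) : Tendsto Prod.fst (𝓝[c.intGR] (c.point μ)) (𝓝[<] (c.vs j)) := by
  have hnh : ¬c.IsHorizontal j := fun hh => hc.not_vertical_of_horizontal hj hh hv
  have hm := c.add_mem_blowArc_iff.2 hμ
  refine tendsto_nhdsWithin_iff.2 ⟨?_, ?_⟩
  · rw [← show (c.point μ).1 = c.vs j from hv μ (Ioo_subset_Icc_self hμ)]
    exact (continuous_fst.tendsto _).mono_left nhdsWithin_le_nhds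
  · filter_upwards [(hc.tendsto_lift₂_point hj hnh hμ).eventually (Ioo_mem_nhds hm.1 hm.2),
      self_mem_nhdsWithin] with z hz hzG
    obtain ⟨i, hi, k, hk, hzc⟩ := hc.exists_cell hzG
    obtain ⟨-, hnk, hik, -, -, -, -, -, -, -, -, -, b2, -⟩ := hc.lift_of_mem_cell hi hk hzc
    obtain rfl := hc.eq_of_mem_blowArc hi hj b2 hz
    have hlt : i < k := lt_of_le_of_ne hik (by rintro rfl; exact hnk hv)
    exact hzc.2.1.2.trans_le (hc.vs_anti (by lia) (by lia))

end VertexCurve.Admissible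

/-! ### Side conditions of the constructed co-state on the arcs -/

namespace ControlData

variable {n m : ℕ} {D : ControlData n m} {c : VertexCurve}
  {ρ₁ ρ₂ : ℝ → ℝ → ℝ → Fin n → Euc n} {S : TriangleProblem.Ansatz (Euc n)}

variable (hc : c.Admissible) (hD : D.Smooth c) (hS : (D.problem c).IsSolution S)
include hc hD hS

theorem tendsto_costate {l : Filter (ℝ × ℝ)} (hl : ∀ᶠ z in l, z ∈ c.intGR) {a b : ℝ}
    (ha : Tendsto (fun z : ℝ × ℝ => c.lift₁ z.1) l (𝓝 a))
    (hb : Tendsto (fun z : ℝ × ℝ => c.lift₂ z.2) l (𝓝 b)) :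
    Tendsto (costate c S) l (𝓝 (S.Ψ (a, b))) := by
  rcases l.eq_or_neBot with rfl | hne
  · exact tendsto_bot
  · exact (hS.contΨ _ (hc.mem_triangle_of_tendsto_lift hl ha hb)).tendsto.comp
      (hc.tendsto_lift hl ha hb)

theorem dS_costate {z : ℝ × ℝ} (hz : z ∈ c.intGR) : dS (costate c S) z
    = (-(D.problem c).ν₂ (c.lift₁ z.1))⁻¹ • (D.problem c).X S (c.lift₁ z.1, c.lift₂ z.2) := by
  obtain ⟨j, hj, k, hk, hzc⟩ := hc.exists_cell hz
  obtain ⟨-, -, -, α, hα, -, -, hαz, -, ea, -, b1, -⟩ := hc.lift_of_mem_cell hj hk hzc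
  rw [dS, (hasDerivAt_costate_left hc hD hS hj hk hzc hα hαz).deriv, problem_ν₂ hc hk b1, ea,
    add_sub_cancel_right]

theorem dT_costate {z : ℝ × ℝ} (hz : z ∈ c.intGR) : dT (costate c S) z
    = ((D.problem c).ν₁ (c.lift₂ z.2))⁻¹ • (D.problem c).Y S (c.lift₁ z.1, c.lift₂ z.2) := by
  obtain ⟨j, hj, k, hk, hzc⟩ := hc.exists_cell hz
  obtain ⟨-, -, -, -, -, β, hβ, -, hβz, -, eb, -, b2, -⟩ := hc.lift_of_mem_cell hj hk hzc
  rw [dT, (hasDerivAt_costate_right hc hD hS hj hk hzc hβ hβz).deriv, problem_ν₁ hc hj b2, eb,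
    add_sub_cancel_right]

/-- Near a point of an oblique arc both stretched parameters tend to the same value, so the image
point tends to the diagonal, where `Ψ = 0`, `X = F₁` and `Y = -F₁`. At that parameter `ν₁`, `ν₂` are
continuous and nonzero and may be divided out. -/
theorem costate_oblique {j : ℕ} (hj : j ≤ c.N) (hob : c.IsOblique j) {μ : ℝ} (hμ : μ ∈ c.arc j) :
    Tendsto (costate c S) (𝓝[c.intGR] (c.point μ)) (𝓝 0) ∧
    Tendsto (fun z => c.n₂ μ • dS (costate c S) z) (𝓝[c.intGR] (c.point μ)) (𝓝 (-D.F₁ c μ)) ∧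
    Tendsto (fun z => c.n₁ μ • dT (costate c S) z) (𝓝[c.intGR] (c.point μ)) (𝓝 (-D.F₁ c μ)) := by
  obtain ⟨hnv, hnh⟩ := (hc.oblique_iff hj).1 hob
  have hl : ∀ᶠ z in 𝓝[c.intGR] (c.point μ), z ∈ c.intGR := self_mem_nhdsWithin
  have h1 := hc.tendsto_lift₁_point hj hnv hμ (s := c.intGR)
  have h2 := hc.tendsto_lift₂_point hj hnh hμ (s := c.intGR)
  have hm := c.add_mem_blowArc_iff.2 hμ
  have hd : μ + (j + 1) ∈ Icc 0 (D.problem c).Λ := Ioo_subset_Icc_self (hc.blowArc_subset hj hm)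
  have hd' : (μ + (j + 1), μ + (j + 1)) ∈ triangle (D.problem c).Λ := ⟨hd.1, le_rfl, hd.2⟩
  have hF := continuousAt_problem_F hc hD hj hm
  have hν₁ := continuousAt_problem_ν₁ (D := D) hc hj hm
  have hν₂ := continuousAt_problem_ν₂ (D := D) hc hj hm
  have eF := problem_F (D := D) hc hj hm
  have e1 := problem_ν₁ (D := D) hc hj hm
  have e2 := problem_ν₂ (D := D) hc hj hm
  rw [add_sub_cancel_right] at eF e1 e2
  have hlift := hc.tendsto_lift hl h1 h2
  refine ⟨?_, ?_, ?_⟩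
  · have := tendsto_costate hc hD hS hl h1 h2
    rwa [hS.Ψ_diag hd] at this
  · have hX := (hS.continuousWithinAt_X hd' hF hν₂).tendsto.comp hlift
    rw [hS.X_diag hd, eF] at hX
    have hn := (hob μ hμ).2.ne'
    have hν := (hν₂.tendsto.comp h1).neg.inv₀ (by rw [e2]; exact neg_ne_zero.2 hn)
    rw [e2] at hν
    have := (hν.smul hX).const_smul (c.n₂ μ)
    rw [inv_neg, neg_smul, smul_neg, smul_inv_smul₀ hn] at this
    refine this.congr' (hl.mono fun z hz => ?_)
    change _ = c.n₂ μ • dS (costate c S) z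
    rw [dS_costate hc hD hS hz]
    rfl
  · have hX := (hS.continuousWithinAt_Y hd' hF hν₁).tendsto.comp hlift
    rw [hS.Y_diag hd, eF] at hX
    have hn := (hob μ hμ).1.ne'
    have hν := (hν₁.tendsto.comp h2).inv₀ (by rw [e1]; exact hn)
    rw [e1] at hν
    have := (hν.smul hX).const_smul (c.n₁ μ)
    rw [smul_inv_smul₀ hn] at this
    refine this.congr' (hl.mono fun z hz => ?_)
    change _ = c.n₁ μ • dT (costate c S) z
    rw [dT_costate hc hD hS hz]
    rfl

/-- Just below a horizontal arc the second stretched parameter is close to `knot (i + 1)`, where `i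
+ 1` is the first vertex on the line. The boundary values are thus those of `Ψ` on a horizontal line
in the triangle, and their derivative `X` is given by `X_eq_of_ν₁_eq_zero`. -/
theorem costate_horizontal {j : ℕ} (hj : j ≤ c.N) (hh : c.IsHorizontal j) :
    ∃ w : ℝ → Euc n, ∀ μ ∈ c.arc j,
    Tendsto (costate c S) (𝓝[c.intGR] (c.point μ)) (𝓝 (w μ)) ∧ DifferentiableAt ℝ w μ ∧
    (c.n₁ μ ^ 2 - c.n₂ μ ^ 2) • deriv w μ + c.n₁ μ • D.Hp (c.point μ) (w μ)
      + c.n₂ μ • D.Hq (c.point μ) (w μ) + D.Φ₁x c μ - deriv (D.Φ₁η c) μ = 0 := by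
  obtain ⟨O, hGO, hO⟩ := hD.smoothOn
  have hT := problem_regular hc hD
  have hnv := hc.not_vertical_of_horizontal hj hh
  have hvt := (hc.horizontal_iff hj).1 hh
  have hpos : 0 < c.vt j := by
    rw [← hvt]
    exact hc.L₂_pos ⟨(hc.node_nonneg (by lia)).trans_lt (hc.node_lt j hj),
      hc.node_le_len (by lia)⟩
  obtain ⟨i, hij, hi, -, hni⟩ := hc.exists_first_vt (by lia) hpos
  refine ⟨fun x => S.Ψ (x + (j + 1), c.knot (i + 1)), fun μ hμ => ?_⟩
  have hm := c.add_mem_blowArc_iff.2 hμ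
  have hb := hc.blowArc_subset hj hm
  have hl : ∀ᶠ z in 𝓝[c.intGR] (c.point μ), z ∈ c.intGR := self_mem_nhdsWithin
  have h1 := hc.tendsto_lift₁_point hj hnv hμ (s := c.intGR)
  have h2 : Tendsto (fun z : ℝ × ℝ => c.lift₂ z.2) (𝓝[c.intGR] (c.point μ))
      (𝓝 (c.knot (i + 1))) :=
    (hc.tendsto_lift₂_left (by lia) hni).comp (hi ▸ hc.tendsto_snd_horizontal hj hh hμ)
  have k0 := hc.knot_nonneg (j := i + 1) (by lia)
  have k1 : c.knot (i + 1) < μ + (j + 1) := by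
    linarith [hc.knot_le hij (by lia), hm.1]
  have hz : (μ + (j + 1), c.knot (i + 1)) ∈ triangle (D.problem c).Λ := ⟨k0, k1.le, hb.2.le⟩
  have hd := (hS.hasDerivAt_Ψ_left hT k0 k1 hb.2 (continuousAt_problem_F hc hD hj hm)
    (continuousAt_problem_ν₂ hc hj hm)).comp_add_const μ (j + 1 : ℝ)
  obtain ⟨n1, n2⟩ := hc.n_of_horizontal hj hh hμ
  have hsub : Icc (c.knot (i + 1)) (μ + (j + 1)) ⊆ Icc (c.knot (i + 1)) (c.knot (j + 1) + 1) :=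
    Icc_subset_Icc_right (by linarith [hm.2])
  have hvt' : c.vt (j + 1) = c.vt (i + 1) := hvt.trans hi.symm
  have hX := hS.X_eq_of_ν₁_eq_zero hT hz (C₀ := D.coefC (c.point μ))
    (fun b hb => hc.glue_n₁_eq_zero (by lia) (by lia) hvt' (hsub hb)) (fun b hb => by
      change D.coefC (c.blow₁ (μ + (j + 1)), c.blow₂ b) = _
      rw [hc.blow₁_add hj (Ioo_subset_Icc_self hμ),
        hc.blow₂_eq_vt (by lia) (by lia) hvt' (hsub hb), VertexCurve.point,
        hh μ (Ioo_subset_Icc_self hμ), hi])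
  rw [problem_F hc hj hm, problem_ν₂ hc hj hm, add_sub_cancel_right, n2, one_smul] at hX
  refine ⟨tendsto_costate hc hD hS hl h1 h2, hd.differentiableAt, ?_⟩
  have hpO : c.point μ ∈ O := hGO (hc.point_mem_G (hc.closedArc_subset hj (Ioo_subset_Icc_self hμ)))
  rw [hd.deriv, hX, hO.Hq_eq hpO, F₁, n1, n2, show D.coefC (c.point μ) = -D.adjfq (c.point μ)
    from rfl, neg_apply]
  module

/-- Here the boundary values are read off on `α = knot r + 1`, where `r` is the last vertex on the
vertical line, and `Y_eq_of_ν₂_eq_zero` gives their derivative. -/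
theorem costate_vertical {j : ℕ} (hj : j ≤ c.N) (hv : c.IsVertical j) :
    ∃ w : ℝ → Euc n, ∀ μ ∈ c.arc j,
    Tendsto (costate c S) (𝓝[c.intGR] (c.point μ)) (𝓝 (w μ)) ∧ DifferentiableAt ℝ w μ ∧
    (c.n₁ μ ^ 2 - c.n₂ μ ^ 2) • deriv w μ + c.n₁ μ • D.Hp (c.point μ) (w μ)
      + c.n₂ μ • D.Hq (c.point μ) (w μ) + D.Φ₁x c μ - deriv (D.Φ₁η c) μ = 0 := by
  obtain ⟨O, hGO, hO⟩ := hD.smoothOn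
  have hT := problem_regular hc hD
  have hnh : ¬c.IsHorizontal j := fun hh => hc.not_vertical_of_horizontal hj hh hv
  have hvs := (hc.vertical_iff hj).1 hv
  have hpos : 0 < c.vs j :=
    hc.L₁_pos ⟨hc.node_nonneg (by lia), (hc.node_lt j hj).trans_le (hc.node_le_len (by lia))⟩
  obtain ⟨r, hjr, hr, hrj, hlast, hnr⟩ := hc.exists_last_vs (by lia) hpos
  have hjr : j < r := lt_of_le_of_ne hjr (by rintro rfl; exact hnr hv)
  refine ⟨fun x => S.Ψ (c.knot r + 1, x + (j + 1)), fun μ hμ => ?_⟩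
  have hm := c.add_mem_blowArc_iff.2 hμ
  have hb := hc.blowArc_subset hj hm
  have hl : ∀ᶠ z in 𝓝[c.intGR] (c.point μ), z ∈ c.intGR := self_mem_nhdsWithin
  have h2 := hc.tendsto_lift₂_point hj hnh hμ (s := c.intGR)
  have h1 : Tendsto (fun z : ℝ × ℝ => c.lift₁ z.1) (𝓝[c.intGR] (c.point μ))
      (𝓝 (c.knot r + 1)) :=
    (hc.tendsto_lift₁_left hr hnr).comp (hrj ▸ hc.tendsto_fst_vertical hj hv hμ)
  have k0 := hc.knot_add_one_le_blowLen (j := r) (by lia)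
  have k1 : μ + (j + 1) < c.knot r + 1 := by
    linarith [hc.knot_le (Nat.succ_le_of_lt hjr) (by lia), hm.2]
  have hz : (c.knot r + 1, μ + (j + 1)) ∈ triangle (D.problem c).Λ := ⟨hb.1.le, k1.le, k0⟩
  have hd := (hS.hasDerivAt_Ψ_right hT hb.1 k1 k0 (continuousAt_problem_F hc hD hj hm)
    (continuousAt_problem_ν₁ hc hj hm)).comp_add_const μ (j + 1 : ℝ)
  obtain ⟨n1, n2⟩ := hc.n_of_vertical hj hv hμ
  have hsub : Icc (μ + (j + 1)) (c.knot r + 1) ⊆ Icc (c.knot j) (c.knot r + 1) :=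
    Icc_subset_Icc_left (by linarith [hm.1])
  have hX := hS.Y_eq_of_ν₂_eq_zero hT hz (B₀ := D.coefB (c.point μ))
    (fun b hb => hc.glue_n₂_eq_zero hjr.le (by lia) hrj (hsub hb)) (fun b hb => by
      change D.coefB (c.blow₁ b, c.blow₂ (μ + (j + 1))) = _
      rw [hc.blow₂_add hj (Ioo_subset_Icc_self hμ),
        hc.blow₁_eq_vs hjr.le (by lia) hrj (hsub hb), VertexCurve.point,
        hv μ (Ioo_subset_Icc_self hμ)])
  rw [problem_F hc hj hm, problem_ν₁ hc hj hm, add_sub_cancel_right, n1, one_smul] at hX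
  refine ⟨tendsto_costate hc hD hS hl h1 h2, hd.differentiableAt, ?_⟩
  have hpO : c.point μ ∈ O := hGO (hc.point_mem_G (hc.closedArc_subset hj (Ioo_subset_Icc_self hμ)))
  rw [hd.deriv, hX, hO.Hp_eq hpO, F₁, n1, n2, show D.coefB (c.point μ) = -D.adjfp (c.point μ)
    from rfl, neg_apply]
  module

/-! ### The vertices -/

omit hD hS in
theorem eventually_mem_intGR_of_ne {W : Set (ℝ × ℝ)} {p : ℝ × ℝ}
    (hW : ∀ z ∈ W, z ∈ interior c.G ∧ z.1 ≠ p.1 ∧ z.2 ≠ p.2) : ∀ᶠ z in 𝓝[W] p, z ∈ c.intGR := by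
  filter_upwards [nhdsWithin_le_nhds (hc.eventually_mem_intGR p), self_mem_nhdsWithin] with z hz hzW
  obtain ⟨h1, h2, h3⟩ := hW z hzW
  exact hz h1 (fun h => absurd h h2) (fun h => absurd h h3)

omit hD hS hc in
theorem tendsto_fst_nhdsWithin {W : Set (ℝ × ℝ)} {p : ℝ × ℝ} {s : Set ℝ} (h : ∀ z ∈ W, z.1 ∈ s) :
    Tendsto Prod.fst (𝓝[W] p) (𝓝[s] p.1) :=
  tendsto_nhdsWithin_iff.2 ⟨(continuous_fst.tendsto p).mono_left nhdsWithin_le_nhds,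
    eventually_mem_nhdsWithin.mono h⟩

omit hD hS hc in
theorem tendsto_snd_nhdsWithin {W : Set (ℝ × ℝ)} {p : ℝ × ℝ} {s : Set ℝ} (h : ∀ z ∈ W, z.2 ∈ s) :
    Tendsto Prod.snd (𝓝[W] p) (𝓝[s] p.2) :=
  tendsto_nhdsWithin_iff.2 ⟨(continuous_snd.tendsto p).mono_left nhdsWithin_le_nhds,
    eventually_mem_nhdsWithin.mono h⟩

variable (hρ : D.IsRiemann c ρ₁ ρ₂)
include hρ

/-- From below and from the left the stretched parameters tend to the far ends `knot r + 1` and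
`knot (i + 1)` of the two strips that meet in vertex `k`. -/
theorem costate_vertex₃ {k : ℕ} (hk : k ≤ c.N + 1) : Tendsto (costate c S) (𝓝[c.W3 k] (c.vertex k))
    (𝓝 (D.rightTerm c ρ₂ k (c.vs k) + D.aboveTerm c ρ₁ k (c.vt k) + D.F₀ c k)) := by
  have hT := problem_regular hc hD
  rcases (c.W3 k).eq_empty_or_nonempty with he | ⟨z₀, hz₀⟩
  · rw [he, nhdsWithin_empty]; exact tendsto_bot
  obtain ⟨p1, p2, -, -⟩ := hc.pos_of_mem_interior hz₀.1
  obtain ⟨r, hkr, hr, hrk, hlast, hnr⟩ := hc.exists_last_vs hk (p1.trans hz₀.2.1)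
  obtain ⟨i, hik, hi, hfirst, hni⟩ := hc.exists_first_vt hk (p2.trans hz₀.2.2)
  have h1 : Tendsto (fun z : ℝ × ℝ => c.lift₁ z.1) (𝓝[c.W3 k] (c.vertex k))
      (𝓝 (c.knot r + 1)) := by
    refine (hc.tendsto_lift₁_left hr hnr).comp ?_
    rw [hrk]
    exact tendsto_fst_nhdsWithin fun z hz => hz.2.1
  have h2 : Tendsto (fun z : ℝ × ℝ => c.lift₂ z.2) (𝓝[c.W3 k] (c.vertex k))
      (𝓝 (c.knot (i + 1))) := by
    refine (hc.tendsto_lift₂_left (by lia) hni).comp ?_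
    rw [hi]
    exact tendsto_snd_nhdsWithin fun z hz => hz.2.2
  have hlim := tendsto_costate hc hD hS (eventually_mem_intGR_of_ne hc
    fun z hz => ⟨hz.1, hz.2.1.ne, hz.2.2.ne⟩) h1 h2
  have i1 := hc.knot_le hik hk
  have i2 := hc.knot_le hkr (by lia)
  have i3 := hc.knot_nonneg hk
  have i4 := hc.knot_add_one_le_blowLen hk
  -- The diagonal interval from `f₀` to `f₁` is the vertex interval of `k`, over which `F`
  -- integrates to `F₀`. The other two terms are increments from the diagonal, where `Ψ = 0`: the
  -- preceding horizontal segment and the subsequent vertical one.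
  have hcor := hS.Ψ_corner hT (e₀ := c.knot (i + 1)) (f₀ := c.knot k) (f₁ := c.knot k + 1)
    (e₁ := c.knot r + 1) (hc.knot_nonneg (by lia)) i1 (by linarith) (by linarith)
    (hc.knot_add_one_le_blowLen (by lia)) (fun b hb => hc.glue_n₁_eq_zero hik hk hi.symm hb)
    (fun a ha => hc.glue_n₂_eq_zero hkr (by lia) hrk ha)
  have ha := Ψ_sub_above hc hD hρ hS hkr (by lia) hrk hlast (β := c.knot k + 1) (by linarith) le_rfl
  rw [hS.Ψ_diag ⟨by linarith, i4⟩, sub_zero, hc.blow₂_node hk ⟨by linarith, le_rfl⟩] at ha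
  have hb := Ψ_sub_right hc hD hρ hS hik hk hi hfirst (α := c.knot k) (by linarith) le_rfl
  rw [hS.Ψ_diag ⟨i3, by linarith [show (D.problem c).Λ = c.blowLen from rfl]⟩, sub_zero,
    hc.blow₁_node hk ⟨le_rfl, by linarith⟩] at hb
  have hF : ∫ a in c.knot k..c.knot k + 1, (D.problem c).F a = D.F₀ c k :=
    VertexCurve.Admissible.integral_blowNode fun l hl => hc.glue_node hk hl
  rw [hcor, ha, hb, hF, add_right_comm] at hlim
  exact hlim

/-- The first stretched parameter tends to the end of the vertical strip, the second to the end of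
the vertex interval of `k` itself. The limit is the increment of `Ψ` from the diagonal across the
part of the strip above `k`. -/
theorem costate_vertex₂ {k : ℕ} (hk : k ≤ c.N + 1) : Tendsto (costate c S) (𝓝[c.W2 k] (c.vertex k))
    (𝓝 (D.aboveTerm c ρ₁ k (c.vt k))) := by
  rcases (𝓝[c.W2 k] (c.vertex k)).eq_or_neBot with he | hne
  · rw [he]; exact tendsto_bot
  obtain ⟨z₀, hz₀⟩ : (c.W2 k).Nonempty :=
    closure_nonempty_iff.1 ⟨_, mem_closure_iff_nhdsWithin_neBot.2 hne⟩
  obtain ⟨p1, -, -, p4⟩ := hc.pos_of_mem_interior hz₀.1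
  obtain ⟨r, hkr, hr, hrk, hlast, hnr⟩ := hc.exists_last_vs hk (p1.trans hz₀.2.1)
  obtain ⟨i, hki, hi, hik, hni⟩ := hc.exists_last_vt hk (hz₀.2.2.trans p4)
  have h1 : Tendsto (fun z : ℝ × ℝ => c.lift₁ z.1) (𝓝[c.W2 k] (c.vertex k))
      (𝓝 (c.knot r + 1)) := by
    refine (hc.tendsto_lift₁_left hr hnr).comp ?_
    rw [hrk]
    exact tendsto_fst_nhdsWithin fun z hz => hz.2.1
  have h2 : Tendsto (fun z : ℝ × ℝ => c.lift₂ z.2) (𝓝[c.W2 k] (c.vertex k))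
      (𝓝 (c.knot i + 1)) := by
    refine (hc.tendsto_lift₂_right hi hni).comp ?_
    rw [hik]
    exact tendsto_snd_nhdsWithin fun z hz => hz.2.2
  have hl := eventually_mem_intGR_of_ne (W := c.W2 k) (p := c.vertex k) hc
    fun z hz => ⟨hz.1, hz.2.1.ne, hz.2.2.ne'⟩
  have hlim := tendsto_costate hc hD hS hl h1 h2
  have htri := hc.mem_triangle_of_tendsto_lift hl h1 h2
  have hir : i ≤ r := hc.le_of_knot_le (by lia) (by linarith [htri.2.1])
  -- If the horizontal line carried later vertices, arc `k` would be horizontal. The limit point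
  -- lies in the closed triangle, so `i ≤ r`, and arc `k` would be vertical as well.
  obtain rfl : k = i := by
    by_contra hne
    have hlt : k < i := lt_of_le_of_ne hki hne
    exact hc.not_vertical_of_horizontal (by lia) (hc.isHorizontal_of_vt_eq (by lia) hik le_rfl hlt)
      (hc.isVertical_of_vs_eq (by lia) hrk le_rfl (by lia))
  have i3 := hc.knot_nonneg hk
  have ha := Ψ_sub_above hc hD hρ hS hkr (by lia) hrk hlast (β := c.knot k + 1) (by linarith) le_rfl
  rw [hS.Ψ_diag ⟨by linarith, hc.knot_add_one_le_blowLen hk⟩, sub_zero,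
    hc.blow₂_node hk ⟨by linarith, le_rfl⟩] at ha
  rw [ha] at hlim
  exact hlim

theorem costate_vertex₄ {k : ℕ} (hk : k ≤ c.N + 1) : Tendsto (costate c S) (𝓝[c.W4 k] (c.vertex k))
    (𝓝 (D.rightTerm c ρ₂ k (c.vs k))) := by
  rcases (𝓝[c.W4 k] (c.vertex k)).eq_or_neBot with he | hne
  · rw [he]; exact tendsto_bot
  obtain ⟨z₀, hz₀⟩ : (c.W4 k).Nonempty :=
    closure_nonempty_iff.1 ⟨_, mem_closure_iff_nhdsWithin_neBot.2 hne⟩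
  obtain ⟨-, p2, p3, -⟩ := hc.pos_of_mem_interior hz₀.1
  obtain ⟨r, hrk, hr, hnr⟩ := hc.exists_first_vs hk (hz₀.2.1.trans p3)
  obtain ⟨i, hik, hi, hfirst, hni⟩ := hc.exists_first_vt hk (p2.trans hz₀.2.2)
  have h1 : Tendsto (fun z : ℝ × ℝ => c.lift₁ z.1) (𝓝[c.W4 k] (c.vertex k))
      (𝓝 (c.knot (r + 1))) := by
    refine (hc.tendsto_lift₁_right (by lia) hnr).comp ?_
    rw [hr]
    exact tendsto_fst_nhdsWithin fun z hz => hz.2.1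
  have h2 : Tendsto (fun z : ℝ × ℝ => c.lift₂ z.2) (𝓝[c.W4 k] (c.vertex k))
      (𝓝 (c.knot (i + 1))) := by
    refine (hc.tendsto_lift₂_left (by lia) hni).comp ?_
    rw [hi]
    exact tendsto_snd_nhdsWithin fun z hz => hz.2.2
  have hl := eventually_mem_intGR_of_ne (W := c.W4 k) (p := c.vertex k) hc
    fun z hz => ⟨hz.1, hz.2.1.ne', hz.2.2.ne⟩
  have hlim := tendsto_costate hc hD hS hl h1 h2
  have htri := hc.mem_triangle_of_tendsto_lift hl h1 h2
  have hir : i + 1 ≤ r + 1 := hc.le_of_knot_le (by lia) htri.2.1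
  -- Otherwise arc `k - 1` would lie both on the vertical and on the horizontal line through vertex
  -- `k`. So `k` is the first vertex on its vertical line.
  have hrk' : r + 1 = k := by
    by_contra hne
    exact hc.not_vertical_of_horizontal (k := k - 1) (by lia)
      (hc.isHorizontal_of_vt_eq (i := i + 1) hk hi.symm (by lia) (by lia))
      (hc.isVertical_of_vs_eq (i := r + 1) hk hr.symm (by lia) (by lia))
  have i3 := hc.knot_nonneg hk
  have i4 := hc.knot_add_one_le_blowLen hk
  have hb := Ψ_sub_right hc hD hρ hS hik hk hi hfirst (α := c.knot k) (by linarith) le_rfl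
  rw [hS.Ψ_diag ⟨i3, by linarith [show (D.problem c).Λ = c.blowLen from rfl]⟩, sub_zero,
    hc.blow₁_node hk ⟨le_rfl, by linarith⟩] at hb
  rw [hrk', hb] at hlim
  exact hlim

/-! ### The jumps across the lines through the vertices -/

/-- For fixed `s` the first stretched parameter is fixed. Across the line the second one jumps from
`knot (i + 1)`, the beginning of the first vertex interval, to `knot r + 1`, the end of the last.
The increment of `Ψ` splits into the stretch before vertex `r`, which gives `rightTerm`, and the
vertex interval of `r`. -/
theorem costate_jumpS {r : ℕ} (hr : r ≤ c.N + 1) {s : ℝ}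
    (hlast : ∀ k ≤ c.N + 1, r < k → c.vt k ≠ c.vt r) (hs : (s, c.vt r) ∈ interior c.G)
    (hne : ∀ k ≤ c.N + 1, s ≠ c.vs k) : ∃ ψm ψp : Euc n,
      Tendsto (fun t => costate c S (s, t)) (𝓝[<] (c.vt r)) (𝓝 ψm) ∧
      Tendsto (fun t => costate c S (s, t)) (𝓝[>] (c.vt r)) (𝓝 ψp) ∧
      ψm - ψp = D.rightTerm c ρ₂ r s + contract (D.F₀ c r) (ρ₂ s (c.vt r) (c.vs r)) := by
  obtain ⟨p1, p2, -, p4⟩ := hc.pos_of_mem_interior hs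
  obtain ⟨-, -, μ, hμ, hsμ, -⟩ := hc.mem_interior_iff.1 hs
  obtain ⟨k, hk, hsk⟩ := hc.exists_vs_between p1 hμ hsμ hne
  have hnk : ¬c.IsVertical k := fun hv => (hsk.1.trans hsk.2).ne ((hc.vertical_iff hk).1 hv)
  obtain ⟨α, hα, rfl⟩ := hc.exists_L₁_eq hk hsk
  have hrN : r ≤ c.N := by
    by_contra! h
    obtain rfl : r = c.N + 1 := by lia
    exact p4.ne rfl
  have hnr : ¬c.IsHorizontal r := fun hh =>
    hlast (r + 1) (by lia) (by lia) ((hc.horizontal_iff hrN).1 hh)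
  obtain ⟨i, hir, hi, hfirst, hni⟩ := hc.exists_first_vt hr p2
  have hev : ∀ᶠ t in 𝓝 (c.vt r), t ≠ c.vt r → (c.L₁ α, t) ∈ c.intGR := by
    have h1 : Tendsto (fun t => (c.L₁ α, t)) (𝓝 (c.vt r)) (𝓝 (c.L₁ α, c.vt r)) :=
      (Continuous.prodMk_right (c.L₁ α)).tendsto _
    filter_upwards [h1.eventually (hc.eventually_mem_intGR _),
      h1.eventually (isOpen_interior.mem_nhds hs)] with t h2 h3 h4
    exact h2 h3 (fun _ => hne) fun h => absurd h h4
  have hl₁ : ∀ l : Filter ℝ, Tendsto (fun z : ℝ × ℝ => c.lift₁ z.1)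
      (l.map fun t => (c.L₁ α, t)) (𝓝 (α + (k + 1))) := fun l => by
    rw [tendsto_map'_iff]
    refine tendsto_const_nhds.congr fun t => ?_
    exact (hc.lift₁_eq hk hnk hα).symm
  have hlm : ∀ᶠ z in (𝓝[<] (c.vt r)).map fun t => (c.L₁ α, t), z ∈ c.intGR := by
    rw [eventually_map]
    filter_upwards [nhdsWithin_le_nhds hev, self_mem_nhdsWithin] with t h1 h2 using h1 (ne_of_lt h2)
  have hlp : ∀ᶠ z in (𝓝[>] (c.vt r)).map fun t => (c.L₁ α, t), z ∈ c.intGR := by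
    rw [eventually_map]
    filter_upwards [nhdsWithin_le_nhds hev, self_mem_nhdsWithin] with t h1 h2 using h1 (ne_of_gt h2)
  have hbm : Tendsto (fun z : ℝ × ℝ => c.lift₂ z.2) ((𝓝[<] (c.vt r)).map fun t => (c.L₁ α, t))
      (𝓝 (c.knot (i + 1))) := by
    rw [tendsto_map'_iff, ← hi]
    exact hc.tendsto_lift₂_left (by lia) hni
  have hbp : Tendsto (fun z : ℝ × ℝ => c.lift₂ z.2) ((𝓝[>] (c.vt r)).map fun t => (c.L₁ α, t))
      (𝓝 (c.knot r + 1)) := by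
    rw [tendsto_map'_iff]
    exact hc.tendsto_lift₂_right hrN hnr
  have htri := hc.mem_triangle_of_tendsto_lift hlp (hl₁ _) hbp
  refine ⟨S.Ψ (α + (k + 1), c.knot (i + 1)), S.Ψ (α + (k + 1), c.knot r + 1),
    tendsto_map'_iff.1 (tendsto_costate hc hD hS hlm (hl₁ _) hbm),
    tendsto_map'_iff.1 (tendsto_costate hc hD hS hlp (hl₁ _) hbp), ?_⟩
  have hle : c.knot r ≤ α + (k + 1) := by linarith [htri.2.1]
  have e1 := Ψ_sub_right hc hD hρ hS hir hr hi hfirst (α := α + (k + 1)) htri.2.2 hle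
  have e2 := Ψ_sub_node_right hc hD hρ hS hr (α := α + (k + 1)) htri.2.2 htri.2.1
  rw [hc.blow₁_add hk (Ioo_subset_Icc_self hα)] at e1 e2
  rw [← e1, ← e2, sub_add_sub_cancel]

/-- Now the second parameter is fixed and the first runs from `knot r` on the right of the line to
the end of the last vertex interval on the left. The vertex interval of `r` comes first; the
remainder of the strip gives `aboveTerm`. -/
theorem costate_jumpT {r : ℕ} (hr : r ≤ c.N + 1) {t : ℝ} (hfirst : ∀ k < r, c.vs k ≠ c.vs r)
    (ht : (c.vs r, t) ∈ interior c.G) (hne : ∀ k ≤ c.N + 1, t ≠ c.vt k) : ∃ ψm ψp : Euc n,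
      Tendsto (fun s => costate c S (s, t)) (𝓝[<] (c.vs r)) (𝓝 ψm) ∧
      Tendsto (fun s => costate c S (s, t)) (𝓝[>] (c.vs r)) (𝓝 ψp) ∧
      ψm - ψp = D.aboveTerm c ρ₁ r t + contract (D.F₀ c r) (ρ₁ (c.vs r) t (c.vt r)) := by
  obtain ⟨p1, p2, p3, -⟩ := hc.pos_of_mem_interior ht
  obtain ⟨-, -, μ, hμ, -, htμ⟩ := hc.mem_interior_iff.1 ht
  obtain ⟨j, hj, htj⟩ := hc.exists_vt_between p2 hμ htμ hne
  have hnj : ¬c.IsHorizontal j := fun hh => (htj.1.trans htj.2).ne' ((hc.horizontal_iff hj).1 hh)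
  obtain ⟨β, hβ, rfl⟩ := hc.exists_L₂_eq hj htj
  obtain ⟨i, rfl⟩ : ∃ i, r = i + 1 := by
    refine Nat.exists_eq_succ_of_ne_zero ?_
    rintro rfl
    exact p3.ne rfl
  have hni : ¬c.IsVertical i := fun hh =>
    hfirst i (by lia) ((hc.vertical_iff (by lia)).1 hh).symm
  obtain ⟨k, hrk, hk, hkr, hlast, hnk⟩ := hc.exists_last_vs hr p1
  have hev : ∀ᶠ s in 𝓝 (c.vs (i + 1)), s ≠ c.vs (i + 1) → (s, c.L₂ β) ∈ c.intGR := by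
    have h1 : Tendsto (fun s => (s, c.L₂ β)) (𝓝 (c.vs (i + 1))) (𝓝 (c.vs (i + 1), c.L₂ β)) :=
      (Continuous.prodMk_left (c.L₂ β)).tendsto _
    filter_upwards [h1.eventually (hc.eventually_mem_intGR _),
      h1.eventually (isOpen_interior.mem_nhds ht)] with t h2 h3 h4
    exact h2 h3 (fun h => absurd h h4) fun _ => hne
  have hl₂ : ∀ l : Filter ℝ, Tendsto (fun z : ℝ × ℝ => c.lift₂ z.2)
      (l.map fun s => (s, c.L₂ β)) (𝓝 (β + (j + 1))) := fun l => by
    rw [tendsto_map'_iff]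
    refine tendsto_const_nhds.congr fun t => ?_
    exact (hc.lift₂_eq hj hnj hβ).symm
  have hlm : ∀ᶠ z in (𝓝[<] (c.vs (i + 1))).map fun s => (s, c.L₂ β), z ∈ c.intGR := by
    rw [eventually_map]
    filter_upwards [nhdsWithin_le_nhds hev, self_mem_nhdsWithin] with t h1 h2 using h1 (ne_of_lt h2)
  have hlp : ∀ᶠ z in (𝓝[>] (c.vs (i + 1))).map fun s => (s, c.L₂ β), z ∈ c.intGR := by
    rw [eventually_map]
    filter_upwards [nhdsWithin_le_nhds hev, self_mem_nhdsWithin] with t h1 h2 using h1 (ne_of_gt h2)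
  have hbm : Tendsto (fun z : ℝ × ℝ => c.lift₁ z.1)
      ((𝓝[<] (c.vs (i + 1))).map fun s => (s, c.L₂ β)) (𝓝 (c.knot k + 1)) := by
    rw [tendsto_map'_iff, ← hkr]
    exact hc.tendsto_lift₁_left hk hnk
  have hbp : Tendsto (fun z : ℝ × ℝ => c.lift₁ z.1)
      ((𝓝[>] (c.vs (i + 1))).map fun s => (s, c.L₂ β)) (𝓝 (c.knot (i + 1))) := by
    rw [tendsto_map'_iff]
    exact hc.tendsto_lift₁_right (by lia) hni
  have htri := hc.mem_triangle_of_tendsto_lift hlp hbp (hl₂ _)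
  refine ⟨S.Ψ (c.knot k + 1, β + (j + 1)), S.Ψ (c.knot (i + 1), β + (j + 1)),
    tendsto_map'_iff.1 (tendsto_costate hc hD hS hlm hbm (hl₂ _)),
    tendsto_map'_iff.1 (tendsto_costate hc hD hS hlp hbp (hl₂ _)), ?_⟩
  have hle : β + (j + 1) ≤ c.knot (i + 1) + 1 := by linarith [htri.2.1]
  have e1 := Ψ_sub_above hc hD hρ hS hrk (by lia) hkr hlast htri.1 hle
  have e2 := Ψ_sub_node_left hc hD hρ hS hr htri.1 htri.2.1
  rw [hc.blow₂_add hj (Ioo_subset_Icc_self hβ)] at e1 e2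
  rw [← e1, ← e2, sub_add_sub_cancel]

theorem isCostate_costate : D.IsCostate c ρ₁ ρ₂ (costate c S) where
  regular _ hj _ hk := costate_regularOnCell hc hD hS hj hk
  hamilton _ hz := costate_hamilton hc hD hS hz
  flat _ hj hflat := hflat.elim (costate_horizontal hc hD hS hj) (costate_vertical hc hD hS hj)
  oblique _ hj hob _ hμ := costate_oblique hc hD hS hj hob hμ
  vertex₃ _ hk := costate_vertex₃ hc hD hS hρ hk
  vertex₂ _ hk := costate_vertex₂ hc hD hS hρ hk
  vertex₄ _ hk := costate_vertex₄ hc hD hS hρ hk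
  jumpS _ hr hlast _ hs hne := costate_jumpS hc hD hS hρ hr hlast hs hne
  jumpT _ hr hfirst _ ht hne := costate_jumpT hc hD hS hρ hr hfirst ht hne

end ControlData

end

/-! ### Existence and uniqueness -/

theorem theorem4p4 {n m : ℕ} (c : VertexCurve) (hc : c.Admissible) (D : ControlData n m)
    (hD : D.Smooth c) (hx : D.IsState c) (hLip : D.RhsLipschitz c) :
    (∃ ρ₁ ρ₂ : ℝ → ℝ → ℝ → Fin n → Euc n, D.IsRiemann c ρ₁ ρ₂) ∧
    ∀ ρ₁ ρ₂ : ℝ → ℝ → ℝ → Fin n → Euc n, D.IsRiemann c ρ₁ ρ₂ →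
      (∃ ψ : ℝ × ℝ → Euc n, D.IsCostate c ρ₁ ρ₂ ψ) ∧
      ∀ ψ ψ' : ℝ × ℝ → Euc n, D.IsCostate c ρ₁ ρ₂ ψ → D.IsCostate c ρ₁ ρ₂ ψ' →
        Set.EqOn ψ ψ' c.intGR := by
  refine ⟨ControlData.exists_isRiemann hD, fun ρ₁ ρ₂ hρ => ⟨?_, fun ψ ψ' h h' =>
    ControlData.costate_unique hc hD hLip h h'⟩⟩
  obtain ⟨S, hS⟩ := (ControlData.problem_regular hc hD).exists_solution
  exact ⟨ControlData.costate c S, ControlData.isCostate_costate hc hD hS hρ⟩
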